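/- **Theorem 2.1.** Let $d\ge 2$ and let $\mathcal O\subset\mathbb R^d$ be a Lipschitz domain (nonempty, bounded, open, connected, with a boundary that is locally the graph of a Lipschitz function). Let $\alpha\in L^\infty(\mathcal O,\mathbb R^{d\times d}_{\mathrm{sym}})$ and $\beta\in L^\infty(\mathcal O,\mathbb R)$ be uniformly positive, i.e. $\alpha(x)\ge\alpha_0 I$ and $\beta(x)\ge\beta_0$ for a.a. $x\in\mathcal O$ with constants $\alpha_0,\beta_0>0$. Let $\mathbb L^2_{\alpha,\beta}(\mathcal O)$ be the space $L^2(\mathcal O,\mathbb C^d)\oplus L^2(\mathcal O)$ of pairs $\Psi=\{\mathbf v,p\}$ with the norm $\|\Psi\|^2=\int_{\mathcal O}(\alpha\mathbf v|\mathbf v)_{\mathbb C^d}+\int_{\mathcal O}\beta|p|^2$. Let $\gamma_0:H^1(\mathcal O)\to H^{1/2}(\partial\mathcal O)$, $p\mapsto p|_{\partial\mathcal O}$, be the scalar trace and $\gamma_{\mathrm n}:\mathbb H(\mathrm{div},\mathcal O)\to H^{-1/2}(\partial\mathcal O)$, $\mathbf v\mapsto\mathbf n\cdot\mathbf v|_{\partial\mathcal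 O}$, the normal trace ($\mathbf n$ is the outward unit normal), understood through Green's formula $(\nabla p|\mathbf v)_{L^2(\mathcal O,\mathbb C^d)}+(p|\mathrm{div}\,\mathbf v)_{L^2(\mathcal O)}=\langle\gamma_0p|\gamma_{\mathrm n}\mathbf v\rangle$ for all $p\in H^1(\mathcal O)$. Here $L^2(\partial\mathcal O)$ is taken with respect to the surface measure $\sigma$; $H^{1/2}(\partial\mathcal O)$ is the Sobolev–Slobodeckij space of the $f\in L^2(\partial\mathcal O)$ with $\|f\|^2_{L^2(\partial\mathcal O)}+\iint_{\partial\mathcal O\times\partial\mathcal O}|f(x)-f(y)|^2|x-y|^{-d}\,d\sigma(x)\,d\sigma(y)<\infty$; $H^{-1/2}(\partial\mathcal O)$ is its dual with respect to the pivot space $L^2(\partial\mathcal O)$; and $\langle\cdot|\cdot\rangle$ is the sesquilinear $L^2(\partial\mathcal O)$-pairing of the two spaces. Let $\mathcal A$ be the symmetric operator $$\mathcal A\{\mathbf v,p\}=\tfrac1{\mathrm i}\{\alpha^{-1}\nabla p,\ \beta^{-1}\nabla\cdot\mathbf v\},\qquad \mathrm{dom}\,\mathcal A=\{\mathbf v\in\mathbb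 H(\mathrm{div},\mathcal O):\gamma_{\mathrm n}\mathbf v=0\}\times H^1_0(\mathcal O),$$ in $\mathbb L^2_{\alpha,\beta}(\mathcal O)$. An operator $T$ in a Hilbert space is called m-dissipative if every $z\in\mathbb C$ with $\mathrm{Im}\,z>0$ is in its resolvent set and $\|(T-z)^{-1}\|\le(\mathrm{Im}\,z)^{-1}$. A contraction is a bounded operator of norm at most $1$. Fix linear homeomorphisms $V:L^2(\partial\mathcal O)\to H^{1/2}(\partial\mathcal O)$ and $V^\natural:H^{-1/2}(\partial\mathcal O)\to L^2(\partial\mathcal O)$ that are mutually adjoint with respect to the pairing: $\langle Vf|g\rangle=(f|V^\natural g)_{L^2(\partial\mathcal O)}$ for all $f\in L^2(\partial\mathcal O)$ and $g\in H^{-1/2}(\partial\mathcal O)$. For a bounded operator $K$ in $L^2(\partial\mathcal O)$ let $\widehat{\mathcal A}_K$ be the restriction of the adjoint $\mathcal A^*$ to the set of all $\{\mathbf v,p\}\in\mathrm{dom}\,\mathcal A^*=\mathbb H(\mathrm{div},\mathcal O)\times H^1(\mathcal O)$ such that $$(K+I)V^{-1}\gamma_0(p)+(K-I)V^\natural\gamma_{\mathrm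 n}(\mathbf v)=0.$$ Then an operator $\widehat{\mathcal A}$ in $\mathbb L^2_{\alpha,\beta}(\mathcal O)$ is an m-dissipative extension of $\mathcal A$ if and only if $\widehat{\mathcal A}=\widehat{\mathcal A}_K$ for some contraction $K$ in $L^2(\partial\mathcal O)$. The map $K\mapsto\widehat{\mathcal A}_K$ is a bijection from the set of contractions in $L^2(\partial\mathcal O)$ onto the set of m-dissipative extensions of $\mathcal A$. Moreover, for a contraction $K$, $\widehat{\mathcal A}_K=\widehat{\mathcal A}_K^*$ if and only if $K$ is unitary. -/

import Mathlib

open MeasureTheory Filter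
open scoped ContDiff

noncomputable section

namespace Acoustic

/-! ### The domain, its surface measure, and the Lebesgue spaces -/

/-- The Euclidean space `ℝ^d`. -/
abbrev Space (d : ℕ) : Type := EuclideanSpace ℝ (Fin d)

/-- A Lipschitz domain: a nonempty bounded open connected set which, near each of its boundary
points, is the strict hypograph of a Lipschitz function over a hyperplane `eᗮ`, the height being
measured in the direction of the unit vector `e`. -/
structure IsLipschitzDomain {d : ℕ} (O : Set (Space d)) : Prop where
  isOpen : IsOpen O
  isConnected : IsConnected O
  isBounded : Bornology.IsBounded O
  lipschitz_boundary : ∀ x ∈ frontier O, ∃ e : Space d, ‖e‖ = 1 ∧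
    ∃ (L : NNReal) (f : (Submodule.span ℝ {e})ᗮ → ℝ), LipschitzWith L f ∧
      ∃ U ∈ nhds x, ∀ y ∈ U,
        (y ∈ O ↔ inner ℝ e y < f ((Submodule.span ℝ {e})ᗮ.orthogonalProjectionOnto y))

variable {d : ℕ}

/-- The surface measure of `∂O`: the `(d-1)`-dimensional Hausdorff measure, normalised so as to
agree with Lebesgue measure on hyperplanes, restricted to the boundary. -/
def surfaceMeasure (O : Set (Space d)) : Measure (Space d) :=
  (Measure.euclideanHausdorffMeasure (d - 1)).restrict (frontier O)

/-- `L²(O)`. -/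
abbrev L2 (O : Set (Space d)) : Type := Lp ℂ 2 (volume.restrict O)

/-- `L²(O, ℂ^d)`. -/
abbrev L2Vec (O : Set (Space d)) : Type := Lp (EuclideanSpace ℂ (Fin d)) 2 (volume.restrict O)

/-- `L²(∂O)`. -/
abbrev L2Bdry (O : Set (Space d)) : Type := Lp ℂ 2 (surfaceMeasure O)

/-! ### The boundary spaces `H^{1/2}(∂O)` and `H^{-1/2}(∂O)` -/

/-- The Sobolev–Slobodeckij space `H^{1/2}(∂O)`: an `f ∈ L²(∂O)` belongs to it when
`(x, y) ↦ (f x - f y) / |x - y|^{d/2}` is in `L²(∂O × ∂O)` (note `d = (d - 1) + 2 · (1/2)`).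
The space is realised as the set of pairs of `f` and this difference quotient, so that its norm is
`‖f‖² = ∫ |f|² + ∫∫ |f x - f y|² / |x - y|^d`. -/
def sobolevHalf (O : Set (Space d)) : Submodule ℂ
    (WithLp 2 (L2Bdry O × Lp ℂ 2 ((surfaceMeasure O).prod (surfaceMeasure O)))) where
  carrier := {w | w.snd =ᵐ[(surfaceMeasure O).prod (surfaceMeasure O)]
    fun z => (w.fst z.1 - w.fst z.2) / ((‖z.1 - z.2‖ ^ ((d : ℝ) / 2) : ℝ) : ℂ)}
  zero_mem' := by
    rw [Set.mem_ofPred_eq]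
    have h := Lp.coeFn_zero ℂ 2 (surfaceMeasure O)
    have h1 := Measure.quasiMeasurePreserving_fst (μ := surfaceMeasure O)
      (ν := surfaceMeasure O) |>.ae h
    have h2 := Measure.quasiMeasurePreserving_snd (μ := surfaceMeasure O)
      (ν := surfaceMeasure O) |>.ae h
    filter_upwards [h1, h2, Lp.coeFn_zero ℂ 2 ((surfaceMeasure O).prod (surfaceMeasure O))]
      with z a b c
    simp only [WithLp.zero_fst, WithLp.zero_snd]
    rw [a, b, c]; simp
  add_mem' := by
    intro u w hu hw
    rw [Set.mem_ofPred_eq] at hu hw ⊢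
    have h := Lp.coeFn_add u.fst w.fst
    have h1 := Measure.quasiMeasurePreserving_fst (μ := surfaceMeasure O)
      (ν := surfaceMeasure O) |>.ae h
    have h2 := Measure.quasiMeasurePreserving_snd (μ := surfaceMeasure O)
      (ν := surfaceMeasure O) |>.ae h
    filter_upwards [h1, h2, Lp.coeFn_add u.snd w.snd, hu, hw] with z a b c hu hw
    simp only [WithLp.add_fst, WithLp.add_snd]
    rw [a, b, c, Pi.add_apply, Pi.add_apply, Pi.add_apply, hu, hw]; ring
  smul_mem' := by
    intro k u hu
    rw [Set.mem_ofPred_eq] at hu ⊢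
    have h := Lp.coeFn_smul k u.fst
    have h1 := Measure.quasiMeasurePreserving_fst (μ := surfaceMeasure O)
      (ν := surfaceMeasure O) |>.ae h
    have h2 := Measure.quasiMeasurePreserving_snd (μ := surfaceMeasure O)
      (ν := surfaceMeasure O) |>.ae h
    filter_upwards [h1, h2, Lp.coeFn_smul k u.snd, hu] with z a b c hu
    simp only [WithLp.smul_fst, WithLp.smul_snd]
    rw [a, b, c, Pi.smul_apply, Pi.smul_apply, Pi.smul_apply, hu]
    simp only [smul_eq_mul]; ring

/-- `H^{1/2}(∂O)` as a Hilbert space. -/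
abbrev HHalf (O : Set (Space d)) : Type := sobolevHalf O

/-- The embedding `H^{1/2}(∂O) → L²(∂O)`. -/
def HHalf.toL2 {O : Set (Space d)} (h : HHalf O) : L2Bdry O :=
  (h : WithLp 2 (L2Bdry O × Lp ℂ 2 ((surfaceMeasure O).prod (surfaceMeasure O)))).fst

/-- `H^{-1/2}(∂O)`, the dual of `H^{1/2}(∂O)` with respect to the pivot space `L²(∂O)`: the bounded
antilinear functionals on `H^{1/2}(∂O)`. The sesquilinear `L²(∂O)`-pairing (linear in the first
argument) is `⟨g | h⟩ = g h`, `⟨h | g⟩ = conj (g h)`; it extends `⟨g | h⟩ = ∫ g * conj h` for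
`g ∈ L²(∂O)`. -/
abbrev HMinusHalf (O : Set (Space d)) : Type := HHalf O →L⋆[ℂ] ℂ

/-- The bounded operators `V : L²(∂O) → H^{1/2}(∂O)` and `W : H^{-1/2}(∂O) → L²(∂O)` are mutually
adjoint with respect to the `L²(∂O)`-pairing: `⟨g | V f⟩ = (W g | f)`. (Mathlib's `inner ℂ f u`
is `(u | f) = ∫ u * conj f`.) -/
def IsNaturalAdjoint {O : Set (Space d)} (V : L2Bdry O →L[ℂ] HHalf O)
    (W : HMinusHalf O →L[ℂ] L2Bdry O) : Prop :=
  ∀ (f : L2Bdry O) (g : HMinusHalf O), g (V f) = inner ℂ f (W g)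

/-! ### Weak derivatives and traces -/

/-- The partial derivative `∂_i φ`. -/
def pderiv (i : Fin d) (φ : Space d → ℂ) (x : Space d) : ℂ :=
  fderiv ℝ φ x (EuclideanSpace.single i 1)

/-- The gradient of a differentiable function. -/
def grad (φ : Space d → ℂ) (x : Space d) : EuclideanSpace ℂ (Fin d) :=
  WithLp.toLp 2 fun i => pderiv i φ x

/-- `φ` is a test function: `φ ∈ C_c^∞(O)`. -/
structure IsTest (O : Set (Space d)) (φ : Space d → ℂ) : Prop where
  smooth : ContDiff ℝ ∞ φ
  compact : HasCompactSupport φ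
  supp : tsupport φ ⊆ O

lemma pderiv_add {φ ψ : Space d → ℂ} (hφ : ContDiff ℝ ∞ φ) (hψ : ContDiff ℝ ∞ ψ) (i : Fin d) :
    pderiv i (φ + ψ) = pderiv i φ + pderiv i ψ := by
  funext x
  simp only [pderiv, Pi.add_apply]
  rw [fderiv_add (hφ.differentiable (by simp) x) (hψ.differentiable (by simp) x)]; rfl

lemma pderiv_smul {φ : Space d → ℂ} (hφ : ContDiff ℝ ∞ φ) (c : ℂ) (i : Fin d) :
    pderiv i (c • φ) = c • pderiv i φ := by
  funext x
  simp only [pderiv, Pi.smul_apply]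
  rw [fderiv_const_smul (hφ.differentiable (by simp) x)]; rfl

lemma grad_add {φ ψ : Space d → ℂ} (hφ : ContDiff ℝ ∞ φ) (hψ : ContDiff ℝ ∞ ψ) :
    grad (φ + ψ) = grad φ + grad ψ := by
  funext x; ext i
  simp [grad, pderiv_add hφ hψ]

lemma grad_smul {φ : Space d → ℂ} (hφ : ContDiff ℝ ∞ φ) (c : ℂ) :
    grad (c • φ) = c • grad φ := by
  funext x; ext i
  simp [grad, pderiv_smul hφ]

lemma grad_zero : grad (0 : Space d → ℂ) = 0 := by
  funext x; ext i
  simp [grad, pderiv]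

lemma IsTest.memLp {O : Set (Space d)} {φ : Space d → ℂ} (h : IsTest O φ) :
    MemLp φ 2 (volume.restrict O) :=
  (h.smooth.continuous.memLp_of_hasCompactSupport h.compact).restrict O

lemma IsTest.memLp_pderiv {O : Set (Space d)} {φ : Space d → ℂ} (h : IsTest O φ) (i : Fin d) :
    MemLp (pderiv i φ) 2 (volume.restrict O) := by
  have h1 : Continuous (fderiv ℝ φ) := h.smooth.continuous_fderiv (by simp)
  have h2 : Continuous (pderiv i φ) := h1.clm_apply continuous_const
  have h3 : HasCompactSupport (pderiv i φ) := h.compact.fderiv_apply (𝕜 := ℝ) _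
  exact (h2.memLp_of_hasCompactSupport h3).restrict O

/-- `p ∈ H¹(O)` with weak gradient `F`. -/
def HasWeakGrad (O : Set (Space d)) (p : L2 O) (F : L2Vec O) : Prop :=
  ∀ φ, IsTest O φ → ∀ i, ∫ x in O, p x * pderiv i φ x = - ∫ x in O, F x i * φ x

/-- `v ∈ H(div, O)` with weak divergence `q`. -/
def HasWeakDiv (O : Set (Space d)) (v : L2Vec O) (q : L2 O) : Prop :=
  ∀ φ, IsTest O φ → ∑ i, ∫ x in O, v x i * pderiv i φ x = - ∫ x in O, q x * φ x

/-- The graph `{(φ, ∇φ) : φ ∈ C_c^∞(O)}` in `L²(O) × L²(O, ℂ^d)`. -/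
def testGraph (O : Set (Space d)) : Submodule ℂ (L2 O × L2Vec O) where
  carrier := {w | ∃ φ, IsTest O φ ∧
    w.1 =ᵐ[volume.restrict O] φ ∧ w.2 =ᵐ[volume.restrict O] grad φ}
  zero_mem' := by
    refine ⟨0, ⟨contDiff_const, HasCompactSupport.zero, by simp⟩, Lp.coeFn_zero _ _ _, ?_⟩
    rw [grad_zero]; exact Lp.coeFn_zero _ _ _
  add_mem' := by
    rintro u w ⟨φ, hφ, h1, h2⟩ ⟨ψ, hψ, h3, h4⟩
    refine ⟨φ + ψ, ⟨hφ.smooth.add hψ.smooth, hφ.compact.add hψ.compact,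
      (tsupport_add φ ψ).trans (Set.union_subset hφ.supp hψ.supp)⟩,
      (Lp.coeFn_add _ _).trans (h1.add h3), ?_⟩
    rw [grad_add hφ.smooth hψ.smooth]
    exact (Lp.coeFn_add _ _).trans (h2.add h4)
  smul_mem' := by
    rintro c u ⟨φ, hφ, h1, h2⟩
    refine ⟨c • φ, ⟨hφ.smooth.const_smul c, hφ.compact.smul_left (f := fun _ => c),
      (tsupport_smul_subset_right (fun _ => c) φ).trans hφ.supp⟩,
      (Lp.coeFn_smul _ _).trans (h1.const_smul c), ?_⟩
    rw [grad_smul hφ.smooth]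
    exact (Lp.coeFn_smul _ _).trans (h2.const_smul c)

/-- The graph `{(φ|_O, ∇φ|_O, φ|_{∂O}) : φ ∈ C^∞(ℝ^d)}` in `L²(O) × L²(O, ℂ^d) × L²(∂O)`. -/
def restrictionGraph (O : Set (Space d)) : Submodule ℂ (L2 O × L2Vec O × L2Bdry O) where
  carrier := {w | ∃ φ : Space d → ℂ, ContDiff ℝ ∞ φ ∧ w.1 =ᵐ[volume.restrict O] φ ∧
    w.2.1 =ᵐ[volume.restrict O] grad φ ∧ w.2.2 =ᵐ[surfaceMeasure O] φ}
  zero_mem' := by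
    refine ⟨0, contDiff_const, Lp.coeFn_zero _ _ _, ?_, Lp.coeFn_zero _ _ _⟩
    rw [grad_zero]; exact Lp.coeFn_zero _ _ _
  add_mem' := by
    rintro u w ⟨φ, hφ, h1, h2, h3⟩ ⟨ψ, hψ, k1, k2, k3⟩
    refine ⟨φ + ψ, hφ.add hψ, (Lp.coeFn_add _ _).trans (h1.add k1), ?_,
      (Lp.coeFn_add _ _).trans (h3.add k3)⟩
    rw [grad_add hφ hψ]
    exact (Lp.coeFn_add _ _).trans (h2.add k2)
  smul_mem' := by
    rintro c u ⟨φ, hφ, h1, h2, h3⟩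
    refine ⟨c • φ, hφ.const_smul c, (Lp.coeFn_smul _ _).trans (h1.const_smul c), ?_,
      (Lp.coeFn_smul _ _).trans (h3.const_smul c)⟩
    rw [grad_smul hφ]
    exact (Lp.coeFn_smul _ _).trans (h2.const_smul c)

/-- `p ∈ H¹₀(O)` with weak gradient `F`: `p` is in the closure of `C_c^∞(O)` in `H¹(O)`. -/
def HasWeakGradZero (O : Set (Space d)) (p : L2 O) (F : L2Vec O) : Prop :=
  HasWeakGrad O p F ∧ (p, F) ∈ (testGraph O).topologicalClosure

/-- `γ₀ p = h`: the scalar trace is the extension by continuity to `H¹(O)` of the restriction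
`φ ↦ φ|_{∂O}` of functions `φ ∈ C^∞(ℝ^d)`. -/
def IsTrace (O : Set (Space d)) (p : L2 O) (h : HHalf O) : Prop :=
  ∃ F, HasWeakGrad O p F ∧ (p, F, h.toL2) ∈ (restrictionGraph O).topologicalClosure

/-- `γₙ v = g`: the normal trace `n · v|_{∂O}` (`n` the outward unit normal) of `v ∈ H(div, O)` is
the functional `g ∈ H^{-1/2}(∂O)` with `⟨g | γ₀ p⟩ = ∫ v · conj (∇ p) + ∫ (div v) * conj p` for all
`p ∈ H¹(O)`. -/
def IsNormalTrace (O : Set (Space d)) (v : L2Vec O) (g : HMinusHalf O) : Prop :=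
  ∃ q, HasWeakDiv O v q ∧ ∀ (p : L2 O) (F : L2Vec O) (h : HHalf O),
    HasWeakGrad O p F → IsTrace O p h → g h = inner ℂ F v + inner ℂ p q

lemma L2Vec.memLp_apply {O : Set (Space d)} (F : L2Vec O) (i : Fin d) :
    MemLp (fun x => F x i) 2 (volume.restrict O) := memLp_piLp_iff.1 (Lp.memLp F) i

lemma integral_add_mul {O : Set (Space d)} {a b c f : Space d → ℂ}
    (ha : MemLp a 2 (volume.restrict O)) (hb : MemLp b 2 (volume.restrict O))
    (hf : MemLp f 2 (volume.restrict O)) (hc : c =ᵐ[volume.restrict O] a + b) :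
    ∫ x in O, c x * f x = (∫ x in O, a x * f x) + ∫ x in O, b x * f x := by
  have h1 : Integrable (fun x => a x * f x) (volume.restrict O) := ha.integrable_mul hf
  have h2 : Integrable (fun x => b x * f x) (volume.restrict O) := hb.integrable_mul hf
  rw [← integral_add h1 h2]
  refine integral_congr_ae ?_
  filter_upwards [hc] with x hx
  rw [hx, Pi.add_apply, add_mul]

lemma integral_smul_mul {O : Set (Space d)} {a c f : Space d → ℂ} {k : ℂ}
    (hc : c =ᵐ[volume.restrict O] k • a) :
    ∫ x in O, c x * f x = k * ∫ x in O, a x * f x := by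
  rw [← integral_const_mul]
  refine integral_congr_ae ?_
  filter_upwards [hc] with x hx
  rw [hx, Pi.smul_apply, smul_eq_mul, mul_assoc]

lemma coeFn_add_apply {O : Set (Space d)} (F G : L2Vec O) (i : Fin d) :
    (fun x => (F + G) x i) =ᵐ[volume.restrict O] (fun x => F x i) + fun x => G x i := by
  filter_upwards [Lp.coeFn_add F G] with x hx
  rw [hx]; rfl

lemma coeFn_smul_apply {O : Set (Space d)} (k : ℂ) (F : L2Vec O) (i : Fin d) :
    (fun x => (k • F) x i) =ᵐ[volume.restrict O] k • fun x => F x i := by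
  filter_upwards [Lp.coeFn_smul k F] with x hx
  rw [hx]; rfl

lemma HasWeakGrad.add {O : Set (Space d)} {p q : L2 O} {F G : L2Vec O} (h : HasWeakGrad O p F)
    (k : HasWeakGrad O q G) : HasWeakGrad O (p + q) (F + G) := by
  intro φ hφ i
  rw [integral_add_mul (Lp.memLp p) (Lp.memLp q) (hφ.memLp_pderiv i) (Lp.coeFn_add p q),
    integral_add_mul (c := fun x => (F + G) x i) (F.memLp_apply i) (G.memLp_apply i) hφ.memLp
      (coeFn_add_apply F G i), h φ hφ i, k φ hφ i]
  ring

lemma HasWeakGrad.smul {O : Set (Space d)} {p : L2 O} {F : L2Vec O} (c : ℂ)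
    (h : HasWeakGrad O p F) : HasWeakGrad O (c • p) (c • F) := by
  intro φ hφ i
  rw [integral_smul_mul (Lp.coeFn_smul c p),
    integral_smul_mul (c := fun x => (c • F) x i) (coeFn_smul_apply c F i), h φ hφ i]
  ring

lemma HasWeakGrad.zero {O : Set (Space d)} : HasWeakGrad O 0 0 := by
  intro φ hφ i
  have h1 := integral_smul_mul (k := 0) (a := 0) (f := pderiv i φ)
    (show ((0 : L2 O) : Space d → ℂ) =ᵐ[volume.restrict O] (0 : ℂ) • 0 by
      simpa using Lp.coeFn_zero ℂ 2 (volume.restrict O))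
  have h2 := integral_smul_mul (k := 0) (a := 0) (f := φ)
    (show (fun x => (0 : L2Vec O) x i) =ᵐ[volume.restrict O] (0 : ℂ) • 0 by
      filter_upwards [Lp.coeFn_zero (EuclideanSpace ℂ (Fin d)) 2 (volume.restrict O)] with x hx
      rw [hx]; simp)
  rw [h1, h2]; simp

lemma HasWeakDiv.add {O : Set (Space d)} {v w : L2Vec O} {q r : L2 O} (h : HasWeakDiv O v q)
    (k : HasWeakDiv O w r) : HasWeakDiv O (v + w) (q + r) := by
  intro φ hφ
  have e : ∀ i, ∫ x in O, (v + w) x i * pderiv i φ x =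
      (∫ x in O, v x i * pderiv i φ x) + ∫ x in O, w x i * pderiv i φ x := fun i =>
    integral_add_mul (c := fun x => (v + w) x i) (v.memLp_apply i) (w.memLp_apply i)
      (hφ.memLp_pderiv i) (coeFn_add_apply v w i)
  rw [Finset.sum_congr rfl fun i _ => e i, Finset.sum_add_distrib, h φ hφ, k φ hφ,
    integral_add_mul (Lp.memLp q) (Lp.memLp r) hφ.memLp (Lp.coeFn_add q r)]
  ring

lemma HasWeakDiv.smul {O : Set (Space d)} {v : L2Vec O} {q : L2 O} (c : ℂ)
    (h : HasWeakDiv O v q) : HasWeakDiv O (c • v) (c • q) := by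
  intro φ hφ
  have e : ∀ i, ∫ x in O, (c • v) x i * pderiv i φ x = c * ∫ x in O, v x i * pderiv i φ x :=
    fun i => integral_smul_mul (c := fun x => (c • v) x i) (coeFn_smul_apply c v i)
  rw [Finset.sum_congr rfl fun i _ => e i, ← Finset.mul_sum, h φ hφ,
    integral_smul_mul (Lp.coeFn_smul c q)]
  ring

lemma HasWeakDiv.zero {O : Set (Space d)} : HasWeakDiv O 0 0 := by
  intro φ hφ
  have h1 := integral_smul_mul (k := 0) (a := 0) (f := φ)
    (show ((0 : L2 O) : Space d → ℂ) =ᵐ[volume.restrict O] (0 : ℂ) • 0 by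
      simpa using Lp.coeFn_zero ℂ 2 (volume.restrict O))
  have h2 : ∀ i, ∫ x in O, (0 : L2Vec O) x i * pderiv i φ x = 0 := by
    intro i
    have := integral_smul_mul (k := 0) (a := 0) (f := pderiv i φ)
      (show (fun x => (0 : L2Vec O) x i) =ᵐ[volume.restrict O] (0 : ℂ) • 0 by
        filter_upwards [Lp.coeFn_zero (EuclideanSpace ℂ (Fin d)) 2 (volume.restrict O)] with x hx
        rw [hx]; simp)
    rw [this, zero_mul]
  rw [h1, Finset.sum_congr rfl fun i _ => h2 i]; simp

lemma HasWeakGradZero.add {O : Set (Space d)} {p q : L2 O} {F G : L2Vec O}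
    (h : HasWeakGradZero O p F) (k : HasWeakGradZero O q G) :
    HasWeakGradZero O (p + q) (F + G) :=
  ⟨h.1.add k.1, add_mem h.2 k.2⟩

lemma HasWeakGradZero.smul {O : Set (Space d)} {p : L2 O} {F : L2Vec O} (c : ℂ)
    (h : HasWeakGradZero O p F) : HasWeakGradZero O (c • p) (c • F) :=
  ⟨h.1.smul c, Submodule.smul_mem _ c h.2⟩

lemma HasWeakGradZero.zero {O : Set (Space d)} : HasWeakGradZero O 0 0 :=
  ⟨HasWeakGrad.zero, zero_mem _⟩

lemma IsTrace.add {O : Set (Space d)} {p q : L2 O} {h k : HHalf O} (hp : IsTrace O p h)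
    (hq : IsTrace O q k) : IsTrace O (p + q) (h + k) := by
  obtain ⟨F, h1, h2⟩ := hp
  obtain ⟨G, k1, k2⟩ := hq
  exact ⟨F + G, h1.add k1, add_mem h2 k2⟩

lemma IsTrace.smul {O : Set (Space d)} {p : L2 O} {h : HHalf O} (c : ℂ) (hp : IsTrace O p h) :
    IsTrace O (c • p) (c • h) := by
  obtain ⟨F, h1, h2⟩ := hp
  exact ⟨c • F, h1.smul c, Submodule.smul_mem _ c h2⟩

lemma IsTrace.zero {O : Set (Space d)} : IsTrace O 0 0 :=
  ⟨0, HasWeakGrad.zero, zero_mem _⟩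

lemma IsNormalTrace.add {O : Set (Space d)} {v w : L2Vec O} {g k : HMinusHalf O}
    (hv : IsNormalTrace O v g) (hw : IsNormalTrace O w k) : IsNormalTrace O (v + w) (g + k) := by
  obtain ⟨q, h1, h2⟩ := hv
  obtain ⟨r, k1, k2⟩ := hw
  refine ⟨q + r, h1.add k1, fun p F h hF hp => ?_⟩
  rw [add_apply, h2 p F h hF hp, k2 p F h hF hp, inner_add_right,
    inner_add_right]
  ring

lemma IsNormalTrace.smul {O : Set (Space d)} {v : L2Vec O} {g : HMinusHalf O} (c : ℂ)
    (hv : IsNormalTrace O v g) : IsNormalTrace O (c • v) (c • g) := by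
  obtain ⟨q, h1, h2⟩ := hv
  refine ⟨c • q, h1.smul c, fun p F h hF hp => ?_⟩
  rw [smul_apply, h2 p F h hF hp, inner_smul_right, inner_smul_right,
    smul_eq_mul]
  ring

lemma IsNormalTrace.zero {O : Set (Space d)} : IsNormalTrace O 0 0 :=
  ⟨0, HasWeakDiv.zero, fun p F h _ _ => by simp⟩

/-! ### The material parameters and the energy space -/

/-- Material parameters: `α ∈ L^∞(O, ℝ_sym^{d×d})` and `β ∈ L^∞(O, ℝ)`, uniformly positive. -/
structure Medium (O : Set (Space d)) where
  α : Space d → Matrix (Fin d) (Fin d) ℝ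
  β : Space d → ℝ
  α_meas : ∀ i j, AEMeasurable (fun x => α x i j) (volume.restrict O)
  β_meas : AEMeasurable β (volume.restrict O)
  α_bdd : ∃ C : ℝ, ∀ᵐ x ∂(volume.restrict O), ∀ i j, |α x i j| ≤ C
  β_bdd : ∃ C : ℝ, ∀ᵐ x ∂(volume.restrict O), |β x| ≤ C
  α_symm : ∀ᵐ x ∂(volume.restrict O), (α x).IsSymm
  α_pos : ∃ a > 0, ∀ᵐ x ∂(volume.restrict O), ∀ ξ : Fin d → ℝ,
    a * (ξ ⬝ᵥ ξ) ≤ ξ ⬝ᵥ (α x).mulVec ξ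
  β_pos : ∃ b > 0, ∀ᵐ x ∂(volume.restrict O), b ≤ β x

/-- The action of a real matrix on `ℂ^d`. -/
def matAct (A : Matrix (Fin d) (Fin d) ℝ) (ξ : EuclideanSpace ℂ (Fin d)) :
    EuclideanSpace ℂ (Fin d) :=
  WithLp.toLp 2 fun i => ∑ j, (A i j : ℂ) * ξ j

lemma matAct_add (A : Matrix (Fin d) (Fin d) ℝ) (ξ η : EuclideanSpace ℂ (Fin d)) :
    matAct A (ξ + η) = matAct A ξ + matAct A η := by
  ext i; simp [matAct, mul_add, Finset.sum_add_distrib]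

lemma matAct_smul (A : Matrix (Fin d) (Fin d) ℝ) (c : ℂ) (ξ : EuclideanSpace ℂ (Fin d)) :
    matAct A (c • ξ) = c • matAct A ξ := by
  ext i; simp [matAct, Finset.mul_sum, mul_left_comm]

lemma norm_matAct_le {A : Matrix (Fin d) (Fin d) ℝ} {C : ℝ} (hC : ∀ i j, |A i j| ≤ C)
    (ξ : EuclideanSpace ℂ (Fin d)) : ‖matAct A ξ‖ ≤ d * (d * |C|) * ‖ξ‖ := by
  have h1 : ∀ i, ‖matAct A ξ i‖ ≤ d * |C| * ‖ξ‖ := by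
    intro i
    calc ‖matAct A ξ i‖ = ‖∑ j, (A i j : ℂ) * ξ j‖ := rfl
      _ ≤ ∑ j, ‖(A i j : ℂ) * ξ j‖ := norm_sum_le _ _
      _ ≤ ∑ _j : Fin d, |C| * ‖ξ‖ := by
          refine Finset.sum_le_sum fun j _ => ?_
          rw [norm_mul, Complex.norm_real, Real.norm_eq_abs]
          exact mul_le_mul ((hC i j).trans (le_abs_self C)) (PiLp.norm_apply_le ξ j)
            (norm_nonneg _) (abs_nonneg _)
      _ = d * |C| * ‖ξ‖ := by simp [mul_assoc]
  have h2 : matAct A ξ = ∑ i, matAct A ξ i • EuclideanSpace.single i (1 : ℂ) := by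
    ext k; simp [Pi.single_apply]
  rw [h2]
  calc _ ≤ ∑ i, ‖matAct A ξ i • EuclideanSpace.single i (1 : ℂ)‖ := norm_sum_le _ _
    _ ≤ ∑ _i : Fin d, d * |C| * ‖ξ‖ := by
        refine Finset.sum_le_sum fun i _ => ?_
        rw [norm_smul]; simpa using h1 i
    _ = _ := by simp [mul_assoc]

lemma inner_matAct_symm {A : Matrix (Fin d) (Fin d) ℝ} (hA : A.IsSymm)
    (ξ η : EuclideanSpace ℂ (Fin d)) :
    inner ℂ (matAct A ξ) η = inner ℂ ξ (matAct A η) := by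
  simp only [PiLp.inner_apply, matAct, RCLike.inner_apply, map_sum, map_mul, Complex.conj_ofReal,
    Finset.mul_sum, Finset.sum_mul]
  rw [Finset.sum_comm]
  refine Finset.sum_congr rfl fun i _ => Finset.sum_congr rfl fun j _ => ?_
  rw [← hA.apply j i]; ring

lemma le_re_inner_matAct {A : Matrix (Fin d) (Fin d) ℝ} {a : ℝ}
    (ha : ∀ ξ : Fin d → ℝ, a * (ξ ⬝ᵥ ξ) ≤ ξ ⬝ᵥ A.mulVec ξ) (ξ : EuclideanSpace ℂ (Fin d)) :
    a * ‖ξ‖ ^ 2 ≤ (inner ℂ ξ (matAct A ξ)).re := by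
  have h1 := ha fun i => (ξ i).re
  have h2 := ha fun i => (ξ i).im
  have h3 : ‖ξ‖ ^ 2 = ((fun i => (ξ i).re) ⬝ᵥ fun i => (ξ i).re) +
      ((fun i => (ξ i).im) ⬝ᵥ fun i => (ξ i).im) := by
    rw [EuclideanSpace.norm_sq_eq, dotProduct, dotProduct, ← Finset.sum_add_distrib]
    refine Finset.sum_congr rfl fun i _ => ?_
    rw [Complex.sq_norm, Complex.normSq_apply]
  have h4 : (inner ℂ ξ (matAct A ξ)).re =
      ((fun i => (ξ i).re) ⬝ᵥ A.mulVec fun i => (ξ i).re) +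
      ((fun i => (ξ i).im) ⬝ᵥ A.mulVec fun i => (ξ i).im) := by
    simp only [PiLp.inner_apply, matAct, RCLike.inner_apply, dotProduct, Matrix.mulVec,
      Complex.re_sum, ← Finset.sum_add_distrib]
    refine Finset.sum_congr rfl fun i _ => ?_
    simp [Finset.sum_mul, Finset.mul_sum, ← Finset.sum_add_distrib, Complex.re_sum]
    refine Finset.sum_congr rfl fun j _ => ?_
    ring
  rw [h3, h4, mul_add]
  exact add_le_add h1 h2

variable {O : Set (Space d)}

lemma Medium.memLp_α (M : Medium O) (v : L2Vec O) :
    MemLp (fun x => matAct (M.α x) (v x)) 2 (volume.restrict O) := by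
  obtain ⟨C, hC⟩ := M.α_bdd
  rw [memLp_piLp_iff]
  intro i
  have : ∀ j, MemLp (fun x => (M.α x i j : ℂ) * v x j) 2 (volume.restrict O) := by
    intro j
    have hα : MemLp (fun x => (M.α x i j : ℂ)) ⊤ (volume.restrict O) := by
      refine memLp_top_of_bound (M.α_meas i j).complex_ofReal.aestronglyMeasurable C ?_
      filter_upwards [hC] with x hx
      rw [Complex.norm_real]; exact hx i j
    exact ((memLp_piLp_iff.1 (Lp.memLp v)) j).mul hα
  exact memLp_finsetSum Finset.univ fun j _ => this j

lemma Medium.memLp_β (M : Medium O) (p : L2 O) :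
    MemLp (fun x => (M.β x : ℂ) * p x) 2 (volume.restrict O) := by
  obtain ⟨C, hC⟩ := M.β_bdd
  have hβ : MemLp (fun x => (M.β x : ℂ)) ⊤ (volume.restrict O) := by
    refine memLp_top_of_bound M.β_meas.complex_ofReal.aestronglyMeasurable C ?_
    filter_upwards [hC] with x hx
    rw [Complex.norm_real]; exact hx
  exact (Lp.memLp p).mul hβ

/-- Multiplication by `α` on `L²(O, ℂ^d)`. -/
def Medium.mulα (M : Medium O) (v : L2Vec O) : L2Vec O := (M.memLp_α v).toLp

/-- Multiplication by `β` on `L²(O)`. -/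
def Medium.mulβ (M : Medium O) (p : L2 O) : L2 O := (M.memLp_β p).toLp

lemma Medium.mulα_symm (M : Medium O) (v w : L2Vec O) :
    inner ℂ (M.mulα v) w = inner ℂ v (M.mulα w) := by
  rw [L2.inner_def, L2.inner_def]
  refine integral_congr_ae ?_
  filter_upwards [(M.memLp_α v).coeFn_toLp, (M.memLp_α w).coeFn_toLp, M.α_symm] with x h1 h2 h3
  rw [Medium.mulα, Medium.mulα, h1, h2, inner_matAct_symm h3]

lemma Medium.mulβ_symm (M : Medium O) (p q : L2 O) :
    inner ℂ (M.mulβ p) q = inner ℂ p (M.mulβ q) := by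
  rw [L2.inner_def, L2.inner_def]
  refine integral_congr_ae ?_
  filter_upwards [(M.memLp_β p).coeFn_toLp, (M.memLp_β q).coeFn_toLp] with x h1 h2
  rw [Medium.mulβ, Medium.mulβ, h1, h2]
  simp only [RCLike.inner_apply, map_mul, Complex.conj_ofReal]
  ring

lemma Medium.le_inner_α (M : Medium O) :
    ∃ a > 0, ∀ v : L2Vec O, a * ‖v‖ ^ 2 ≤ (inner ℂ v (M.mulα v)).re := by
  obtain ⟨a, ha, h⟩ := M.α_pos
  refine ⟨a, ha, fun v => ?_⟩
  have e1 : ‖v‖ ^ 2 = ∫ x in O, ‖v x‖ ^ 2 := by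
    have := inner_self_eq_norm_sq (𝕜 := ℂ) v
    rw [← this, L2.inner_def, ← integral_re (L2.integrable_inner v v)]
    simp only [inner_self_eq_norm_sq]
  have e2 : Integrable (fun x => ‖v x‖ ^ 2) (volume.restrict O) := by
    have := (L2.integrable_inner (𝕜 := ℂ) v v).re
    simpa only [inner_self_eq_norm_sq] using this
  have e3 := (L2.integrable_inner (𝕜 := ℂ) v (M.mulα v))
  rw [e1, L2.inner_def, ← integral_const_mul]
  refine le_trans ?_ (integral_re e3).le
  refine integral_mono_ae (e2.const_mul a) e3.re ?_
  filter_upwards [(M.memLp_α v).coeFn_toLp, h] with x h1 h3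
  rw [Medium.mulα, h1]
  exact le_re_inner_matAct h3 _

lemma Medium.le_inner_β (M : Medium O) :
    ∃ b > 0, ∀ p : L2 O, b * ‖p‖ ^ 2 ≤ (inner ℂ p (M.mulβ p)).re := by
  obtain ⟨b, hb, h⟩ := M.β_pos
  refine ⟨b, hb, fun v => ?_⟩
  have e1 : ‖v‖ ^ 2 = ∫ x in O, ‖v x‖ ^ 2 := by
    have := inner_self_eq_norm_sq (𝕜 := ℂ) v
    rw [← this, L2.inner_def, ← integral_re (L2.integrable_inner v v)]
    simp only [inner_self_eq_norm_sq]
  have e2 : Integrable (fun x => ‖v x‖ ^ 2) (volume.restrict O) := by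
    have := (L2.integrable_inner (𝕜 := ℂ) v v).re
    simpa only [inner_self_eq_norm_sq] using this
  have e3 := (L2.integrable_inner (𝕜 := ℂ) v (M.mulβ v))
  rw [e1, L2.inner_def, ← integral_const_mul]
  refine le_trans ?_ (integral_re e3).le
  refine integral_mono_ae (e2.const_mul b) e3.re ?_
  filter_upwards [(M.memLp_β v).coeFn_toLp, h] with x h1 h3
  rw [Medium.mulβ, h1]
  have : (inner ℂ (v x) ((M.β x : ℂ) * v x)) = ((M.β x * ‖v x‖ ^ 2 : ℝ) : ℂ) := by
    rw [RCLike.inner_apply, mul_assoc, Complex.mul_conj, Complex.normSq_eq_norm_sq]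
    push_cast; rfl
  simp only [this]
  change b * ‖v x‖ ^ 2 ≤ ((M.β x * ‖v x‖ ^ 2 : ℝ) : ℂ).re
  rw [Complex.ofReal_re]
  exact mul_le_mul_of_nonneg_right h3 (sq_nonneg _)

lemma Medium.norm_mulα_le (M : Medium O) : ∃ C : ℝ, ∀ v : L2Vec O, ‖M.mulα v‖ ≤ C * ‖v‖ := by
  obtain ⟨C, hC⟩ := M.α_bdd
  refine ⟨d * (d * |C|), fun v => ?_⟩
  refine Lp.norm_le_mul_norm_of_ae_le_mul ?_
  filter_upwards [(M.memLp_α v).coeFn_toLp, hC] with x h1 h2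
  rw [Medium.mulα, h1]
  exact norm_matAct_le h2 _

lemma Medium.norm_mulβ_le (M : Medium O) : ∃ C : ℝ, ∀ p : L2 O, ‖M.mulβ p‖ ≤ C * ‖p‖ := by
  obtain ⟨C, hC⟩ := M.β_bdd
  refine ⟨C, fun p => ?_⟩
  refine Lp.norm_le_mul_norm_of_ae_le_mul ?_
  filter_upwards [(M.memLp_β p).coeFn_toLp, hC] with x h1 h2
  rw [Medium.mulβ, h1, norm_mul, Complex.norm_real]
  exact mul_le_mul_of_nonneg_right h2 (norm_nonneg _)

/-- The energy space `𝕃²_{α,β}(O)`: as a linear space it is `L²(O, ℂ^d) × L²(O)`. Its elements are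
the pairs `Ψ = (v, p)`. -/
def Energy (_M : Medium O) : Type := L2Vec O × L2 O

namespace Energy

variable {M : Medium O}

instance : AddCommGroup (Energy M) := inferInstanceAs (AddCommGroup (L2Vec O × L2 O))

instance : Module ℂ (Energy M) := inferInstanceAs (Module ℂ (L2Vec O × L2 O))

/-- The velocity component of `Ψ = (v, p)`. -/
def vel (Ψ : Energy M) : L2Vec O := Prod.fst Ψ

/-- The pressure component of `Ψ = (v, p)`. -/
def prs (Ψ : Energy M) : L2 O := Prod.snd Ψ

@[simp] lemma vel_add (x y : Energy M) : (x + y).vel = x.vel + y.vel := rfl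
@[simp] lemma prs_add (x y : Energy M) : (x + y).prs = x.prs + y.prs := rfl
@[simp] lemma vel_smul (c : ℂ) (x : Energy M) : (c • x).vel = c • x.vel := rfl
@[simp] lemma prs_smul (c : ℂ) (x : Energy M) : (c • x).prs = c • x.prs := rfl
@[simp] lemma vel_zero : (0 : Energy M).vel = 0 := rfl
@[simp] lemma prs_zero : (0 : Energy M).prs = 0 := rfl

/-- The inner product of `𝕃²_{α,β}(O)`, whose square norm is
`‖(v, p)‖² = (α v | v)_{L²(O, ℂ^d)} + (β p | p)_{L²(O)}`. -/
@[reducible] def core (M : Medium O) : InnerProductSpace.Core ℂ (Energy M) where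
  inner x y := inner ℂ x.vel (M.mulα y.vel) + inner ℂ x.prs (M.mulβ y.prs)
  conj_inner_symm x y := by
    rw [map_add, inner_conj_symm, inner_conj_symm, M.mulα_symm, M.mulβ_symm]
  re_inner_nonneg x := by
    obtain ⟨a, ha, h1⟩ := M.le_inner_α
    obtain ⟨b, hb, h2⟩ := M.le_inner_β
    have := h1 x.vel
    have := h2 x.prs
    change 0 ≤ (_ + _ : ℂ).re
    rw [Complex.add_re]
    have : 0 ≤ a * ‖x.vel‖ ^ 2 := by positivity
    have : 0 ≤ b * ‖x.prs‖ ^ 2 := by positivity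
    linarith
  add_left x y z := by
    simp only [vel_add, prs_add, inner_add_left]; ring
  smul_left x y r := by
    simp only [vel_smul, prs_smul, inner_smul_left]; ring
  definite x hx := by
    obtain ⟨a, ha, h1⟩ := M.le_inner_α
    obtain ⟨b, hb, h2⟩ := M.le_inner_β
    have h3 := h1 x.vel
    have h4 := h2 x.prs
    have h5 := congrArg Complex.re hx
    rw [Complex.add_re, Complex.zero_re] at h5
    have h6 : 0 ≤ a * ‖x.vel‖ ^ 2 := by positivity
    have h7 : 0 ≤ b * ‖x.prs‖ ^ 2 := by positivity
    have h8 : a * ‖x.vel‖ ^ 2 = 0 := by linarith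
    have h9 : b * ‖x.prs‖ ^ 2 = 0 := by linarith
    have h10 : x.vel = 0 := by simpa [ha.ne'] using h8
    have h11 : x.prs = 0 := by simpa [hb.ne'] using h9
    exact Prod.ext h10 h11

instance : NormedAddCommGroup (Energy M) := (core M).toNormedAddCommGroup

instance : InnerProductSpace ℂ (Energy M) := InnerProductSpace.ofCore (core M).toCore

lemma inner_def (x y : Energy M) :
    inner ℂ x y = inner ℂ x.vel (M.mulα y.vel) + inner ℂ x.prs (M.mulβ y.prs) := rfl

instance : CompleteSpace (Energy M) := by
  obtain ⟨a, ha, h1⟩ := M.le_inner_α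
  obtain ⟨b, hb, h2⟩ := M.le_inner_β
  obtain ⟨C, hC⟩ := M.norm_mulα_le
  obtain ⟨D, hD⟩ := M.norm_mulβ_le
  let e : Energy M ≃ₗ[ℂ] (L2Vec O × L2 O) := LinearEquiv.refl ℂ (L2Vec O × L2 O)
  have hn : ∀ x : Energy M, ‖x‖ ^ 2 =
      (inner ℂ x.vel (M.mulα x.vel)).re + (inner ℂ x.prs (M.mulβ x.prs)).re := by
    intro x
    rw [← inner_self_eq_norm_sq (𝕜 := ℂ) x, inner_def]; rfl
  have hlow : ∀ x : Energy M, ‖e x‖ ≤ √(1 / a + 1 / b) * ‖x‖ := by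
    intro x
    rw [← Real.sqrt_sq (norm_nonneg x), ← Real.sqrt_mul (by positivity)]
    refine Real.le_sqrt_of_sq_le ?_
    have h3 := h1 x.vel
    have h4 := h2 x.prs
    have h5 := hn x
    have h6 : 0 ≤ a * ‖x.vel‖ ^ 2 := by positivity
    have h7 : 0 ≤ b * ‖x.prs‖ ^ 2 := by positivity
    have h8 : ‖x.vel‖ ^ 2 ≤ 1 / a * ‖x‖ ^ 2 := by
      rw [one_div, ← div_eq_inv_mul, le_div_iff₀ ha]; linarith
    have h9 : ‖x.prs‖ ^ 2 ≤ 1 / b * ‖x‖ ^ 2 := by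
      rw [one_div, ← div_eq_inv_mul, le_div_iff₀ hb]; linarith
    have h10 : 0 ≤ ‖x.vel‖ ^ 2 := by positivity
    have h11 : 0 ≤ ‖x.prs‖ ^ 2 := by positivity
    have h12 : ‖e x‖ = max ‖x.vel‖ ‖x.prs‖ := rfl
    rw [h12, add_mul]
    rcases max_cases ‖x.vel‖ ‖x.prs‖ with h | h <;> rw [h.1] <;> linarith
  have hup : ∀ y : L2Vec O × L2 O, ‖e.symm y‖ ≤ √(|C| + |D|) * ‖y‖ := by
    intro y
    rw [← Real.sqrt_sq (norm_nonneg y), ← Real.sqrt_mul (by positivity)]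
    refine Real.le_sqrt_of_sq_le ?_
    rw [hn, add_mul]
    refine add_le_add ?_ ?_
    · change (inner ℂ y.1 (M.mulα y.1)).re ≤ _
      have k1 : (inner ℂ y.1 (M.mulα y.1)).re ≤ ‖y.1‖ * ‖M.mulα y.1‖ :=
        re_inner_le_norm (𝕜 := ℂ) y.1 _
      have k2 : ‖M.mulα y.1‖ ≤ |C| * ‖y.1‖ :=
        (hC _).trans (mul_le_mul_of_nonneg_right (le_abs_self C) (norm_nonneg _))
      have k3 : ‖y.1‖ ≤ ‖y‖ := norm_fst_le y
      calc _ ≤ ‖y.1‖ * (|C| * ‖y.1‖) :=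
            k1.trans (mul_le_mul_of_nonneg_left k2 (norm_nonneg _))
        _ = |C| * ‖y.1‖ ^ 2 := by ring
        _ ≤ _ := by gcongr
    · change (inner ℂ y.2 (M.mulβ y.2)).re ≤ _
      have k1 : (inner ℂ y.2 (M.mulβ y.2)).re ≤ ‖y.2‖ * ‖M.mulβ y.2‖ :=
        re_inner_le_norm (𝕜 := ℂ) y.2 _
      have k2 : ‖M.mulβ y.2‖ ≤ |D| * ‖y.2‖ :=
        (hD _).trans (mul_le_mul_of_nonneg_right (le_abs_self D) (norm_nonneg _))
      have k3 : ‖y.2‖ ≤ ‖y‖ := norm_snd_le y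
      calc _ ≤ ‖y.2‖ * (|D| * ‖y.2‖) :=
            k1.trans (mul_le_mul_of_nonneg_left k2 (norm_nonneg _))
        _ = |D| * ‖y.2‖ ^ 2 := by ring
        _ ≤ _ := by gcongr
  let E := e.toContinuousLinearEquivOfBounds _ _ hlow hup
  exact (completeSpace_congr (e := E.toEquiv) E.isUniformEmbedding).2 inferInstance

end Energy

/-! ### The acoustic operators -/

/-- The graph of the symmetric acoustic operator
`𝒜 (v, p) = (1/i) (α⁻¹ ∇p, β⁻¹ div v)` with domain `H₀(div, O) × H¹₀(O)`, where
`H₀(div, O) = {v ∈ H(div, O) : γₙ v = 0}`. -/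
def acousticGraph (M : Medium O) : Submodule ℂ (Energy M × Energy M) where
  carrier := {X | ∃ (F : L2Vec O) (q : L2 O),
    HasWeakGradZero O X.1.prs F ∧ HasWeakDiv O X.1.vel q ∧ IsNormalTrace O X.1.vel 0 ∧
    X.2.vel =ᵐ[volume.restrict O] (fun x => (1 / Complex.I) • matAct (M.α x)⁻¹ (F x)) ∧
    X.2.prs =ᵐ[volume.restrict O] (fun x => (1 / Complex.I) • (((M.β x)⁻¹ : ℝ) : ℂ) • q x)}
  zero_mem' := by
    refine ⟨0, 0, HasWeakGradZero.zero, HasWeakDiv.zero, IsNormalTrace.zero, ?_, ?_⟩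
    · filter_upwards [Lp.coeFn_zero (EuclideanSpace ℂ (Fin d)) 2 (volume.restrict O)] with x hx
      change (0 : L2Vec O) x = _
      rw [hx, Pi.zero_apply]
      have := matAct_smul (M.α x)⁻¹ 0 0
      rw [zero_smul, zero_smul] at this
      rw [this, smul_zero]
    · filter_upwards [Lp.coeFn_zero ℂ 2 (volume.restrict O)] with x hx
      change (0 : L2 O) x = _
      rw [hx, Pi.zero_apply]; simp
  add_mem' := by
    rintro X Y ⟨F, q, h1, h2, h3, h4, h5⟩ ⟨G, r, k1, k2, k3, k4, k5⟩
    refine ⟨F + G, q + r, h1.add k1, h2.add k2, ?_, ?_, ?_⟩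
    · have := h3.add k3
      rwa [add_zero] at this
    · filter_upwards [h4, k4, Lp.coeFn_add X.2.vel Y.2.vel, Lp.coeFn_add F G] with x a b c e
      change (X.2.vel + Y.2.vel : L2Vec O) x = _
      rw [c, e, Pi.add_apply, Pi.add_apply, a, b, matAct_add, smul_add]
    · filter_upwards [h5, k5, Lp.coeFn_add X.2.prs Y.2.prs, Lp.coeFn_add q r] with x a b c e
      change (X.2.prs + Y.2.prs : L2 O) x = _
      rw [c, e, Pi.add_apply, Pi.add_apply, a, b, smul_add, smul_add]
  smul_mem' := by
    rintro c X ⟨F, q, h1, h2, h3, h4, h5⟩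
    refine ⟨c • F, c • q, h1.smul c, h2.smul c, ?_, ?_, ?_⟩
    · have := h3.smul c
      have h0 : c • (0 : HMinusHalf O) = 0 := by ext; simp
      rwa [h0] at this
    · filter_upwards [h4, Lp.coeFn_smul c X.2.vel, Lp.coeFn_smul c F] with x a b e
      change (c • X.2.vel : L2Vec O) x = _
      rw [b, e, Pi.smul_apply, Pi.smul_apply, a, matAct_smul, smul_comm]
    · filter_upwards [h5, Lp.coeFn_smul c X.2.prs, Lp.coeFn_smul c q] with x a b e
      change (c • X.2.prs : L2 O) x = _
      rw [b, e, Pi.smul_apply, Pi.smul_apply, a]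
      simp only [smul_eq_mul]; ring

/-- A real-valued test function, seen as a complex-valued one. -/
lemma isTest_ofReal {g : Space d → ℝ} (h1 : ContDiff ℝ ∞ g) (h2 : HasCompactSupport g)
    (h3 : tsupport g ⊆ O) : IsTest O fun x => (g x : ℂ) where
  smooth := Complex.ofRealCLM.contDiff.comp h1
  compact := h2.comp_left (g := Complex.ofReal) Complex.ofReal_zero
  supp := (tsupport_comp_subset (g := Complex.ofReal) Complex.ofReal_zero g).trans h3

lemma ae_eq_zero_of_test (hO : IsOpen O) {f : Space d → ℂ} (hf : MemLp f 2 (volume.restrict O))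
    (h : ∀ φ, IsTest O φ → ∫ x in O, f x * φ x = 0) : f =ᵐ[volume.restrict O] 0 := by
  have hloc : LocallyIntegrableOn f O volume := by
    have := hf.locallyIntegrable (by norm_num)
    exact locallyIntegrableOn_of_locallyIntegrable_restrict this
  have := hO.ae_eq_zero_of_integral_contDiff_smul_eq_zero hloc fun g g1 g2 g3 => by
    have h4 := h _ (isTest_ofReal g1 g2 g3)
    rw [← setIntegral_eq_integral_of_forall_compl_eq_zero (s := O)]
    · rw [← h4]
      refine integral_congr_ae (Eventually.of_forall fun x => ?_)
      simp [mul_comm]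
    · intro x hx
      have : g x = 0 := by
        by_contra hne
        exact hx (g3 (subset_tsupport g hne))
      simp [this]
  exact (ae_restrict_iff' hO.measurableSet).2 this

lemma HasWeakGrad.unique (hO : IsOpen O) {F : L2Vec O} (h : HasWeakGrad O 0 F) : F = 0 := by
  have h1 : ∀ i, (fun x => F x i) =ᵐ[volume.restrict O] 0 := fun i =>
    ae_eq_zero_of_test hO (F.memLp_apply i) fun φ hφ => by
      have := h φ hφ i
      rw [HasWeakGrad.zero φ hφ i, neg_inj] at this
      rw [← this]
      refine integral_eq_zero_of_ae ?_
      filter_upwards [Lp.coeFn_zero (EuclideanSpace ℂ (Fin d)) 2 (volume.restrict O)] with x hx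
      rw [hx]; simp
  refine Lp.ext ?_
  filter_upwards [ae_all_iff.2 h1,
    Lp.coeFn_zero (EuclideanSpace ℂ (Fin d)) 2 (volume.restrict O)] with x hx h0
  rw [h0]
  ext i
  exact hx i

lemma HasWeakDiv.unique (hO : IsOpen O) {q : L2 O} (h : HasWeakDiv O 0 q) : q = 0 := by
  refine Lp.ext ((ae_eq_zero_of_test hO (Lp.memLp q) fun φ hφ => ?_).trans
    (Lp.coeFn_zero _ _ _).symm)
  have := h φ hφ
  rw [HasWeakDiv.zero φ hφ, neg_inj] at this
  rw [← this]
  refine integral_eq_zero_of_ae ?_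
  filter_upwards [Lp.coeFn_zero ℂ 2 (volume.restrict O)] with x hx
  rw [hx]; simp

/-- `acousticGraph M` is the graph of an operator. -/
lemma acousticGraph_functional (hO : IsOpen O) (M : Medium O) (X : Energy M × Energy M)
    (hX : X ∈ acousticGraph M) (h0 : X.1 = 0) : X.2 = 0 := by
  obtain ⟨F, q, h1, h2, -, h4, h5⟩ := hX
  rw [h0] at h1 h2
  have hF : F = 0 := HasWeakGrad.unique hO h1.1
  have hq : q = 0 := HasWeakDiv.unique hO h2
  refine Prod.ext (Lp.ext ?_) (Lp.ext ?_)
  · refine h4.trans ?_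
    subst hF
    filter_upwards [Lp.coeFn_zero (EuclideanSpace ℂ (Fin d)) 2 (volume.restrict O)] with x hx
    change _ = (0 : L2Vec O) x
    rw [hx, Pi.zero_apply]
    have := matAct_smul (M.α x)⁻¹ 0 0
    rw [zero_smul, zero_smul] at this
    rw [this, smul_zero]
  · refine h5.trans ?_
    subst hq
    filter_upwards [Lp.coeFn_zero ℂ 2 (volume.restrict O)] with x hx
    change _ = (0 : L2 O) x
    rw [hx, Pi.zero_apply]; simp

/-- The symmetric acoustic operator `𝒜` in `𝕃²_{α,β}(O)`. -/
def acousticMin (M : Medium O) : Energy M →ₗ.[ℂ] Energy M := (acousticGraph M).toLinearPMap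

/-- The graph of `𝒜` is as prescribed. -/
lemma acousticMin_graph (hO : IsOpen O) (M : Medium O) :
    (acousticMin M).graph = acousticGraph M :=
  Submodule.toLinearPMap_graph_eq _ (acousticGraph_functional hO M)

/-- The `Ψ = (v, p)` with `v ∈ H(div, O)` and `p ∈ H¹(O)` that satisfy the boundary condition
`(K + I) V⁻¹ γ₀ p + (K - I) V^♮ γₙ v = 0`. -/
def boundaryCondition (M : Medium O) (V : L2Bdry O ≃L[ℂ] HHalf O)
    (Vn : HMinusHalf O ≃L[ℂ] L2Bdry O) (K : L2Bdry O →L[ℂ] L2Bdry O) :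
    Submodule ℂ (Energy M) where
  carrier := {Ψ | ∃ (h : HHalf O) (g : HMinusHalf O), IsTrace O Ψ.prs h ∧
    IsNormalTrace O Ψ.vel g ∧ (K + 1) (V.symm h) + (K - 1) (Vn g) = 0}
  zero_mem' := ⟨0, 0, IsTrace.zero, IsNormalTrace.zero, by simp⟩
  add_mem' := by
    rintro x y ⟨h, g, h1, h2, h3⟩ ⟨h', g', k1, k2, k3⟩
    refine ⟨h + h', g + g', h1.add k1, h2.add k2, ?_⟩
    rw [map_add, map_add, map_add, map_add, add_add_add_comm, h3, k3, add_zero]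
  smul_mem' := by
    rintro c x ⟨h, g, h1, h2, h3⟩
    refine ⟨c • h, c • g, h1.smul c, h2.smul c, ?_⟩
    rw [map_smul, map_smul, map_smul, map_smul, ← smul_add, h3, smul_zero]

/-- The acoustic operator associated with the boundary condition
`(K + I) V⁻¹ γ₀ p + (K - I) V^♮ γₙ v = 0`: the restriction of `𝒜*` to the elements of its domain
that satisfy this condition. -/
def acousticOp (M : Medium O) (V : L2Bdry O ≃L[ℂ] HHalf O)
    (Vn : HMinusHalf O ≃L[ℂ] L2Bdry O) (K : L2Bdry O →L[ℂ] L2Bdry O) :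
    Energy M →ₗ.[ℂ] Energy M :=
  (acousticMin M).adjoint.domRestrict (boundaryCondition M V Vn K)

/-- An operator `T` in a Hilbert space is m-dissipative: every `z` with `Im z > 0` is in its
resolvent set, and `‖(T - z)⁻¹‖ ≤ (Im z)⁻¹`. -/
def IsMDissipative {H : Type*} [NormedAddCommGroup H] [InnerProductSpace ℂ H]
    (T : H →ₗ.[ℂ] H) : Prop :=
  ∀ z : ℂ, 0 < z.im → ∃ R : H →L[ℂ] H, ‖R‖ ≤ z.im⁻¹ ∧
    (∀ x : T.domain, R (T x - z • (x : H)) = x) ∧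
    ∀ y : H, ∃ x : T.domain, (x : H) = R y ∧ T x - z • (x : H) = y

end Acoustic

end

open Acoustic

noncomputable section

namespace Acoustic

/-! ### Boundary triples and m-dissipative extensions -/

/-! Green's formula turns the question into linear algebra on the boundary. For {v, p} in dom 𝒜* put
f = V⁻¹γ₀p and g = V^♮γₙv. As V and V^♮ are mutually adjoint, the boundary form of 𝒜* is i(⟨f, g'⟩ +
⟨g, f'⟩) in L²(∂O). With a = f + g and b = g - f it becomes (i/2)(⟨a, a'⟩ - ⟨b, b'⟩); this is the
content of `exists_boundaryTriple`. Hence Im⟨x, 𝒜*x⟩ = (‖b‖² - ‖a‖²)/4, and a restriction of 𝒜* is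
dissipative exactly when ‖b‖ ≤ ‖a‖ on its domain. The boundary condition with parameter K says b =
Ka.

For a contraction K the restriction to b = Ka is closed and dissipative, and its adjoint is the
restriction to a = K*b, for which the sign is reversed; so T - z is onto for Im z > 0
(`restr_surjective`). Conversely, a dissipative extension of 𝒜 is a restriction of 𝒜*
(`le_adjoint_of_dissipative`), its boundary values form the graph of a contraction on a subspace,
this contraction extends to all of L²(∂O) (`exists_contraction`), and maximality of m-dissipative
operators gives equality (`exists_eq_restr`). Since (a, b) is onto, K can be read off from the
operator, and self-adjointness means that b = Ka and a = K*b are the same relation, i.e. that K is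
unitary.

What remains is analysis on a Lipschitz domain: the scalar trace maps H¹(O) boundedly to H^{1/2}(∂O)
(`exists_trace`), has a bounded right inverse (`exists_extension`), and has kernel H¹₀(O)
(`hasWeakGradZero_of_isTrace_zero`). The normal trace then exists by duality
(`exists_isNormalTrace`) and is onto by Riesz representation in H¹(O) (`exists_normalTrace_eq`);
testing with smooth functions identifies dom 𝒜* (`mem_adjoint_graph`).

The boundary is never flattened. A `Chart` only records a cone of inward directions, comparison of
volume integrals with integrals along rays from the boundary, and Ahlfors regularity of the surface
measure. Boundedness of the trace comes from Hardy's inequality along rays and an average over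
overlapping cones (`Chart.lintegral_slobodeckij_le`). For the kernel, a function with zero trace has
mean square o(ε²) in the ε-layer, which absorbs the gradient of a cut-off. The right inverse
averages boundary values with the weight |x - y|^{-2d} (`lift`). -/

/-- Boundary data for a densely defined symmetric operator `A`: linear maps `a` and `b` from the
domain of `A*` to a Hilbert space that are jointly surjective, vanish on the domain of `A`, and
satisfy the abstract Green identity. -/
structure BoundaryTriple {H : Type*} [NormedAddCommGroup H] [InnerProductSpace ℂ H]
    [CompleteSpace H] (A : H →ₗ.[ℂ] H) (B : Type*) [NormedAddCommGroup B]
    [InnerProductSpace ℂ B] where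
  dense : Dense (A.domain : Set H)
  symm : A ≤ A.adjoint
  a : A.adjoint.domain →ₗ[ℂ] B
  b : A.adjoint.domain →ₗ[ℂ] B
  vanish : ∀ x : A.adjoint.domain, (x : H) ∈ A.domain → a x = 0 ∧ b x = 0
  surj : ∀ u v : B, ∃ x, a x = u ∧ b x = v
  green : ∀ x y : A.adjoint.domain, inner ℂ (A.adjoint x) (y : H) - inner ℂ (x : H) (A.adjoint y) =
    (Complex.I / 2) * (inner ℂ (a x) (a y) - inner ℂ (b x) (b y))

namespace BoundaryTriple

variable {H : Type*} [NormedAddCommGroup H] [InnerProductSpace ℂ H] [CompleteSpace H]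
  {A : H →ₗ.[ℂ] H} {B : Type*} [NormedAddCommGroup B] [InnerProductSpace ℂ B]

lemma green_im (Γ : BoundaryTriple A B) (x : A.adjoint.domain) :
    (inner ℂ (x : H) (A.adjoint x)).im = (‖Γ.b x‖ ^ 2 - ‖Γ.a x‖ ^ 2) / 4 := by
  have h := Γ.green x x
  rw [inner_self_eq_norm_sq_to_K, inner_self_eq_norm_sq_to_K] at h
  have h2 := congrArg Complex.im h
  have h3 : (inner ℂ (A.adjoint x) (x : H)).im = -(inner ℂ (x : H) (A.adjoint x)).im := by
    rw [← inner_conj_symm, Complex.conj_im]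
  have h4 : ∀ r s : ℝ, (Complex.I / 2 * ((r : ℂ) ^ 2 - (s : ℂ) ^ 2)).im = (r ^ 2 - s ^ 2) / 2 := by
    intro r s
    rw [show Complex.I / 2 * ((r : ℂ) ^ 2 - (s : ℂ) ^ 2) = (((r ^ 2 - s ^ 2) / 2 : ℝ) : ℂ) * Complex.I by
      push_cast; ring, Complex.im_ofReal_mul, Complex.I_im, mul_one]
  rw [Complex.sub_im, h3] at h2
  have h5 := h2.trans (h4 ‖Γ.a x‖ ‖Γ.b x‖)
  linarith

/-- Restriction of the adjoint to those elements whose boundary data are in a subspace. -/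
def restr (Γ : BoundaryTriple A B) (Θ : Submodule ℂ (B × B)) : H →ₗ.[ℂ] H :=
  A.adjoint.domRestrict ((Θ.comap (Γ.a.prod Γ.b)).map A.adjoint.domain.subtype)

lemma restr_le (Γ : BoundaryTriple A B) (Θ : Submodule ℂ (B × B)) : Γ.restr Θ ≤ A.adjoint :=
  LinearPMap.domRestrict_le

lemma mem_restr (Γ : BoundaryTriple A B) (Θ : Submodule ℂ (B × B)) (x : A.adjoint.domain) :
    (x : H) ∈ (Γ.restr Θ).domain ↔ (Γ.a x, Γ.b x) ∈ Θ := by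
  change (x : H) ∈ _ ⊓ _ ↔ _
  rw [Submodule.mem_inf]
  constructor
  · rintro ⟨⟨y, hy, hyx⟩, -⟩
    have : y = x := Subtype.ext hyx
    subst this
    exact hy
  · intro h
    exact ⟨⟨x, h, rfl⟩, x.2⟩

lemma le_restr (Γ : BoundaryTriple A B) (Θ : Submodule ℂ (B × B)) : A ≤ Γ.restr Θ := by
  have h1 : A.domain ≤ (Γ.restr Θ).domain := by
    intro x hx
    have := Γ.vanish ⟨x, Γ.symm.1 hx⟩ hx
    refine (Γ.mem_restr Θ ⟨x, Γ.symm.1 hx⟩).2 ?_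
    rw [this.1, this.2]
    exact Θ.zero_mem
  refine ⟨h1, fun x y hxy => ?_⟩
  rw [Γ.symm.2 (x := x) (y := ⟨y, (Γ.restr_le Θ).1 y.2⟩) hxy,
    (Γ.restr_le Θ).2 (x := y) (y := ⟨y, (Γ.restr_le Θ).1 y.2⟩) rfl]

/-- Two restrictions of the adjoint with the same domain coincide. -/
lemma eq_of_domain_eq {S T U : H →ₗ.[ℂ] H} (hS : S ≤ U) (hT : T ≤ U) (h : S.domain = T.domain) :
    S = T := by
  refine LinearPMap.ext h fun x hx hx' => ?_
  rw [hS.2 (x := ⟨x, hx⟩) (y := ⟨x, hS.1 hx⟩) rfl, hT.2 (x := ⟨x, hx'⟩) (y := ⟨x, hS.1 hx⟩) rfl]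

lemma le_of_domain_le {S T U : H →ₗ.[ℂ] H} (hS : S ≤ U) (hT : T ≤ U) (h : S.domain ≤ T.domain) :
    S ≤ T := by
  refine ⟨h, fun x y hxy => ?_⟩
  rw [hS.2 (x := x) (y := ⟨x, hS.1 x.2⟩) rfl, hT.2 (x := y) (y := ⟨x, hS.1 x.2⟩) hxy.symm]

/-- The adjoint of a restriction of `A*` that extends `A`. -/
lemma adjoint_le {T : H →ₗ.[ℂ] H} (hd : Dense (A.domain : Set H)) (hT : A ≤ T) :
    T.adjoint ≤ A.adjoint := by
  have hTd : Dense (T.domain : Set H) := hd.mono hT.1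
  refine LinearPMap.IsFormalAdjoint.le_adjoint hd fun x y => ?_
  have := (LinearPMap.adjoint_isFormalAdjoint hTd).symm ⟨x, hT.1 x.2⟩ y
  rw [← this, hT.2 (x := x) (y := ⟨x, hT.1 x.2⟩) rfl]

/-- The adjoint of T is again a restriction of A*, so for y in dom A* the only obstruction to lying
in its domain is the boundary term of Green's identity against dom T. -/
lemma mem_adjoint_domain (Γ : BoundaryTriple A B) {T : H →ₗ.[ℂ] H} (h1 : A ≤ T)
    (h2 : T ≤ A.adjoint) (y : A.adjoint.domain) :
    (y : H) ∈ T.adjoint.domain ↔ ∀ x : A.adjoint.domain, (x : H) ∈ T.domain →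
      inner ℂ (Γ.a x) (Γ.a y) = inner ℂ (Γ.b x) (Γ.b y) := by
  have hTd : Dense (T.domain : Set H) := Γ.dense.mono h1.1
  constructor
  · intro hy x hx
    have e1 := (LinearPMap.adjoint_isFormalAdjoint hTd).symm ⟨x, hx⟩ ⟨y, hy⟩
    rw [h2.2 (x := ⟨x, hx⟩) (y := x) rfl,
      (adjoint_le Γ.dense h1).2 (x := ⟨y, hy⟩) (y := y) rfl] at e1
    have e2 := Γ.green x y
    change inner ℂ (A.adjoint x) (y : H) = inner ℂ (x : H) (A.adjoint y) at e1
    rw [e1, sub_self, eq_comm, mul_eq_zero] at e2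
    rcases e2 with e2 | e2
    · simp at e2
    · exact sub_eq_zero.1 e2
  · intro h
    refine LinearPMap.mem_adjoint_domain_of_exists _ ⟨A.adjoint y, fun x => ?_⟩
    have e2 := Γ.green ⟨x, h2.1 x.2⟩ y
    rw [h ⟨x, h2.1 x.2⟩ x.2, sub_self, mul_zero, sub_eq_zero] at e2
    rw [h2.2 (x := x) (y := ⟨x, h2.1 x.2⟩) rfl, ← inner_conj_symm, ← inner_conj_symm (y : H), e2]

variable [CompleteSpace B]

/-- The relation `{(u, K u)}`. -/
abbrev contrGraph (K : B →L[ℂ] B) : Submodule ℂ (B × B) := (K : B →ₗ[ℂ] B).graph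

/-- The relation `{(K* v, v)}`. -/
abbrev adjGraph (K : B →L[ℂ] B) : Submodule ℂ (B × B) :=
  ((ContinuousLinearMap.adjoint K : B →L[ℂ] B) : B →ₗ[ℂ] B).graph.comap
    (LinearEquiv.prodComm ℂ B B).toLinearMap

lemma mem_contrGraph (Γ : BoundaryTriple A B) (K : B →L[ℂ] B) (x : A.adjoint.domain) :
    (x : H) ∈ (Γ.restr (contrGraph K)).domain ↔ Γ.b x = K (Γ.a x) := by
  rw [mem_restr, LinearMap.mem_graph_iff]; rfl

lemma mem_adjGraph (Γ : BoundaryTriple A B) (K : B →L[ℂ] B) (x : A.adjoint.domain) :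
    (x : H) ∈ (Γ.restr (adjGraph K)).domain ↔
      Γ.a x = ContinuousLinearMap.adjoint K (Γ.b x) := by
  rw [mem_restr, Submodule.mem_comap, LinearMap.mem_graph_iff]; rfl

/-- Orthogonality for the indefinite form ⟨a, a'⟩ - ⟨b, b'⟩ to all pairs (u, Ku) says ⟨u, a'⟩ = ⟨Ku,
b'⟩, that is a' = K*b'. Joint surjectivity of the boundary maps makes every u available. -/
lemma adjoint_restr_contrGraph (Γ : BoundaryTriple A B) (K : B →L[ℂ] B) :
    (Γ.restr (contrGraph K)).adjoint = Γ.restr (adjGraph K) := by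
  have hle := adjoint_le Γ.dense (Γ.le_restr (contrGraph K))
  refine eq_of_domain_eq hle (Γ.restr_le _) (Submodule.ext fun y => ?_)
  by_cases hy : y ∈ A.adjoint.domain
  · rw [Γ.mem_adjoint_domain (Γ.le_restr _) (Γ.restr_le _) ⟨y, hy⟩, Γ.mem_adjGraph K ⟨y, hy⟩]
    constructor
    · intro h
      refine ext_inner_left ℂ fun u => ?_
      obtain ⟨x, h1, h2⟩ := Γ.surj u (K u)
      have := h x ((Γ.mem_contrGraph K x).2 (by rw [h1, h2]))
      rw [h1, h2] at this
      rw [this, ContinuousLinearMap.adjoint_inner_right]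
    · intro h x hx
      rw [(Γ.mem_contrGraph K x).1 hx, h, ContinuousLinearMap.adjoint_inner_right]
  · exact ⟨fun h => (hy (hle.1 h)).elim, fun h => (hy ((Γ.restr_le _).1 h)).elim⟩

/-- Together with the preceding lemma this exhibits the restriction to b = Ka as an adjoint. It is
therefore closed, although no continuity of the boundary maps has been assumed. -/
lemma adjoint_restr_adjGraph (Γ : BoundaryTriple A B) (K : B →L[ℂ] B) :
    (Γ.restr (adjGraph K)).adjoint = Γ.restr (contrGraph K) := by
  have hle := adjoint_le Γ.dense (Γ.le_restr (adjGraph K))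
  refine eq_of_domain_eq hle (Γ.restr_le _) (Submodule.ext fun y => ?_)
  by_cases hy : y ∈ A.adjoint.domain
  · rw [Γ.mem_adjoint_domain (Γ.le_restr _) (Γ.restr_le _) ⟨y, hy⟩, Γ.mem_contrGraph K ⟨y, hy⟩]
    constructor
    · intro h
      refine ext_inner_left ℂ fun u => ?_
      obtain ⟨x, h1, h2⟩ := Γ.surj (ContinuousLinearMap.adjoint K u) u
      have := h x ((Γ.mem_adjGraph K x).2 (by rw [h1, h2]))
      rw [h1, h2] at this
      rw [← this, ContinuousLinearMap.adjoint_inner_left]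
    · intro h x hx
      rw [(Γ.mem_adjGraph K x).1 hx, h, ContinuousLinearMap.adjoint_inner_left]
  · exact ⟨fun h => (hy (hle.1 h)).elim, fun h => (hy ((Γ.restr_le _).1 h)).elim⟩

end BoundaryTriple

/-- The basic estimate for dissipative operators. -/
lemma im_mul_norm_le {H : Type*} [NormedAddCommGroup H] [InnerProductSpace ℂ H] {x y : H}
    (h : (inner ℂ x y).im ≤ 0) (z : ℂ) : z.im * ‖x‖ ≤ ‖y - z • x‖ := by
  rcases eq_or_ne x 0 with rfl | hx
  · simp
  have hx0 : 0 < ‖x‖ := norm_pos_iff.2 hx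
  have h1 : (inner ℂ x (y - z • x)).im = (inner ℂ x y).im - z.im * ‖x‖ ^ 2 := by
    rw [inner_sub_right, inner_smul_right, inner_self_eq_norm_sq_to_K]
    simp [← Complex.ofReal_pow]
  have h2 : -(inner ℂ x (y - z • x)).im ≤ ‖x‖ * ‖y - z • x‖ :=
    (neg_le_abs _).trans ((Complex.abs_im_le_norm _).trans (norm_inner_le_norm _ _))
  nlinarith

/-- A dissipative operator for which every `T - z`, `Im z > 0`, is onto is m-dissipative. -/
lemma isMDissipative_of_surjective {H : Type*} [NormedAddCommGroup H] [InnerProductSpace ℂ H]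
    {T : H →ₗ.[ℂ] H} (h : ∀ x : T.domain, (inner ℂ (x : H) (T x)).im ≤ 0)
    (hs : ∀ z : ℂ, 0 < z.im → ∀ y, ∃ x : T.domain, T x - z • (x : H) = y) :
    IsMDissipative T := by
  intro z hz
  let L : T.domain →ₗ[ℂ] H := T.toFun - z • T.domain.subtype
  have hL : ∀ x : T.domain, L x = T x - z • (x : H) := fun x => rfl
  have hb : ∀ x : T.domain, z.im * ‖x‖ ≤ ‖L x‖ := fun x => im_mul_norm_le (h x) z
  have hinj : Function.Injective L := by
    refine (injective_iff_map_eq_zero L).2 fun x hx => ?_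
    have := hb x
    rw [hx, norm_zero] at this
    exact norm_le_zero_iff.1 (by nlinarith [norm_nonneg x])
  let E := LinearEquiv.ofBijective L ⟨hinj, hs z hz⟩
  have hEs : ∀ y, ‖T.domain.subtype (E.symm y)‖ ≤ z.im⁻¹ * ‖y‖ := by
    intro y
    have := hb (E.symm y)
    have e : L (E.symm y) = y := E.apply_symm_apply y
    rw [e] at this
    rw [inv_mul_eq_div, le_div_iff₀ hz, mul_comm]
    exact this
  refine ⟨(T.domain.subtype.comp E.symm.toLinearMap).mkContinuous z.im⁻¹ hEs,
    LinearMap.mkContinuous_norm_le _ (inv_nonneg.2 hz.le) _, fun x => ?_, fun y => ?_⟩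
  · rw [← hL]
    change ((E.symm (E x) : T.domain) : H) = x
    rw [E.symm_apply_apply]
  · exact ⟨E.symm y, rfl, E.apply_symm_apply y⟩

lemma IsMDissipative.surjective {H : Type*} [NormedAddCommGroup H] [InnerProductSpace ℂ H]
    {T : H →ₗ.[ℂ] H} (h : IsMDissipative T) {z : ℂ} (hz : 0 < z.im) (y : H) :
    ∃ x : T.domain, T x - z • (x : H) = y := by
  obtain ⟨R, -, -, h3⟩ := h z hz
  obtain ⟨x, -, hx⟩ := h3 y
  exact ⟨x, hx⟩

/-- The resolvent bound at z = it reads t²‖x‖² ≤ ‖Tx - itx‖². Expanding the square cancels t²‖x‖²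
and leaves 2t Im⟨x, Tx⟩ ≤ ‖Tx‖², which for large t forces the sign. -/
lemma IsMDissipative.im_nonpos {H : Type*} [NormedAddCommGroup H] [InnerProductSpace ℂ H]
    {T : H →ₗ.[ℂ] H} (h : IsMDissipative T) (x : T.domain) : (inner ℂ (x : H) (T x)).im ≤ 0 := by
  have key : ∀ t : ℝ, 0 < t → 2 * t * (inner ℂ (x : H) (T x)).im ≤ ‖T x‖ ^ 2 := by
    intro t ht
    obtain ⟨R, h1, h2, -⟩ := h (t * Complex.I) (by simpa using ht)
    have e1 : ‖(x : H)‖ ≤ t⁻¹ * ‖T x - (t * Complex.I) • (x : H)‖ := by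
      conv_lhs => rw [← h2 x]
      refine (R.le_opNorm _).trans (mul_le_mul_of_nonneg_right ?_ (norm_nonneg _))
      simpa using h1
    rw [inv_mul_eq_div, le_div_iff₀ ht] at e1
    have e2 : (‖(x : H)‖ * t) ^ 2 ≤ ‖T x - (t * Complex.I) • (x : H)‖ ^ 2 := by gcongr
    have e3 : (inner ℂ (T x) (x : H)).im = -(inner ℂ (x : H) (T x)).im := by
      rw [← inner_conj_symm, Complex.conj_im]
    rw [@norm_sub_sq ℂ, inner_smul_right, norm_smul] at e2
    simp at e2
    rw [e3, abs_of_pos ht] at e2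
    nlinarith
  by_contra hneg
  push Not at hneg
  -- This t makes the left side equal to ‖Tx‖² + 1, a contradiction.
  have := key ((‖T x‖ ^ 2 + 1) / (2 * (inner ℂ (x : H) (T x)).im)) (by positivity)
  rw [show 2 * ((‖T x‖ ^ 2 + 1) / (2 * (inner ℂ (x : H) (T x)).im)) * (inner ℂ (x : H) (T x)).im
    = ‖T x‖ ^ 2 + 1 by field_simp] at this
  linarith

/-- An m-dissipative operator has no proper dissipative extension. -/
lemma IsMDissipative.eq_of_le {H : Type*} [NormedAddCommGroup H] [InnerProductSpace ℂ H]
    {T S : H →ₗ.[ℂ] H} (h : IsMDissipative T) (hS : ∀ x : S.domain, (inner ℂ (x : H) (S x)).im ≤ 0)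
    (hle : T ≤ S) : T = S := by
  refine LinearPMap.eq_of_le_of_domain_eq hle (le_antisymm hle.1 fun x hx => ?_)
  -- Solve (T - i)y = (S - i)x. Then x - y is in the kernel of S - i, which is trivial because S is
  -- dissipative, so x = y is in dom T.
  obtain ⟨y, hy⟩ := h.surjective (z := Complex.I) (by simp) (S ⟨x, hx⟩ - Complex.I • x)
  let y' : S.domain := ⟨y, hle.1 y.2⟩
  have e1 : S (⟨x, hx⟩ - y') - Complex.I • ((⟨x, hx⟩ - y' : S.domain) : H) = 0 := by
    rw [LinearPMap.map_sub, ← hle.2 (x := y) (y := y') rfl, Submodule.coe_sub, smul_sub,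
      sub_sub_sub_comm, hy, sub_self]
  have e2 := im_mul_norm_le (hS (⟨x, hx⟩ - y')) Complex.I
  rw [e1, norm_zero, Complex.I_im, one_mul] at e2
  have e3 := norm_le_zero_iff.1 e2
  rw [Submodule.coe_sub, sub_eq_zero] at e3
  change x = y at e3
  rw [e3]; exact y.2

namespace BoundaryTriple

variable {H : Type*} [NormedAddCommGroup H] [InnerProductSpace ℂ H] [CompleteSpace H]
  {A : H →ₗ.[ℂ] H} {B : Type*} [NormedAddCommGroup B] [InnerProductSpace ℂ B] [CompleteSpace B]

lemma norm_adjoint_le {K : B →L[ℂ] B} (hK : ‖K‖ ≤ 1) (u : B) :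
    ‖ContinuousLinearMap.adjoint K u‖ ≤ ‖u‖ := by
  refine (ContinuousLinearMap.le_opNorm _ u).trans ?_
  rw [LinearIsometryEquiv.norm_map]
  exact mul_le_of_le_one_left (norm_nonneg _) hK

lemma restr_dissipative (Γ : BoundaryTriple A B) {K : B →L[ℂ] B} (hK : ‖K‖ ≤ 1)
    (x : (Γ.restr (contrGraph K)).domain) :
    (inner ℂ (x : H) (Γ.restr (contrGraph K) x)).im ≤ 0 := by
  let x' : A.adjoint.domain := ⟨x, (Γ.restr_le _).1 x.2⟩
  rw [(Γ.restr_le _).2 (x := x) (y := x') rfl]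
  have h1 := Γ.green_im x'
  have h2 := (Γ.mem_contrGraph K x').1 x.2
  have h3 : ‖Γ.b x'‖ ≤ ‖Γ.a x'‖ := by
    rw [h2]
    exact (K.le_opNorm _).trans (mul_le_of_le_one_left (norm_nonneg _) hK)
  change (inner ℂ (x' : H) (A.adjoint x')).im ≤ 0
  rw [h1]
  have : ‖Γ.b x'‖ ^ 2 ≤ ‖Γ.a x'‖ ^ 2 := by gcongr
  linarith

lemma restr_isClosed (Γ : BoundaryTriple A B) (K : B →L[ℂ] B) :
    (Γ.restr (contrGraph K)).IsClosed := by
  rw [← Γ.adjoint_restr_adjGraph K]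
  exact LinearPMap.adjoint_isClosed (Γ.dense.mono (Γ.le_restr _).1)

/-- The range of T - z is closed, since T is closed and T - z is bounded below by Im z. It is also
dense: a vector w orthogonal to it satisfies T*w = z̄w and has boundary data a = K*b, so Im⟨w, T*w⟩
= (‖b‖² - ‖a‖²)/4 ≥ 0, while this number is -Im z ‖w‖². -/
lemma restr_surjective (Γ : BoundaryTriple A B) {K : B →L[ℂ] B} (hK : ‖K‖ ≤ 1) {z : ℂ}
    (hz : 0 < z.im) (y : H) :
    ∃ x : (Γ.restr (contrGraph K)).domain, Γ.restr (contrGraph K) x - z • (x : H) = y := by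
  set T := Γ.restr (contrGraph K) with hT
  have hTd : Dense (T.domain : Set H) := Γ.dense.mono (Γ.le_restr _).1
  let L : T.domain →ₗ[ℂ] H := T.toFun - z • T.domain.subtype
  have hL : ∀ x : T.domain, L x = T x - z • (x : H) := fun x => rfl
  have hb : ∀ x : T.domain, z.im * ‖(x : H)‖ ≤ ‖L x‖ := fun x =>
    im_mul_norm_le (Γ.restr_dissipative hK x) z
  let W : Submodule ℂ H := LinearMap.range L
  -- If (T - z)xₙ converges, the lower bound makes xₙ Cauchy, hence Txₙ converges too and closedness
  -- of the graph applies.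
  have hclosed : IsClosed (W : Set H) := by
    refine isClosed_of_closure_subset fun w hw => ?_
    obtain ⟨u, hu, hlim⟩ := mem_closure_iff_seq_limit.1 hw
    choose x hx using hu
    have hc : CauchySeq fun n => (x n : H) := by
      have huc := hlim.cauchySeq
      rw [Metric.cauchySeq_iff] at huc ⊢
      intro ε hε
      obtain ⟨N, hN⟩ := huc (z.im * ε) (by positivity)
      refine ⟨N, fun m hm n hn => ?_⟩
      have h1 := hN m hm n hn
      rw [dist_eq_norm] at h1 ⊢
      rw [← hx m, ← hx n, ← map_sub] at h1
      have h2 := hb (x m - x n)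
      rw [Submodule.coe_sub] at h2
      exact lt_of_mul_lt_mul_left (h2.trans_lt h1) hz.le
    obtain ⟨x0, hx0⟩ := cauchySeq_tendsto_of_complete hc
    have hTx : Tendsto (fun n => T (x n)) atTop (nhds (w + z • x0)) := by
      have : (fun n => T (x n)) = fun n => u n + z • (x n : H) := by
        funext n
        rw [← hx n, hL]; abel
      rw [this]
      exact hlim.add (hx0.const_smul z)
    have hmem : (x0, w + z • x0) ∈ (T.graph : Set (H × H)) := by
      refine (Γ.restr_isClosed K).mem_of_tendsto (hx0.prodMk_nhds hTx)
        (Eventually.of_forall fun n => T.mem_graph (x n))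
    rw [SetLike.mem_coe, LinearPMap.mem_graph_iff] at hmem
    obtain ⟨x1, h1, h2⟩ := hmem
    refine ⟨x1, ?_⟩
    rw [hL, h2]
    change w + z • x0 - z • (x1 : H) = w
    rw [h1]; simp
  have : CompleteSpace W := hclosed.completeSpace_coe
  have htop : W = ⊤ := by
    rw [← Submodule.orthogonal_eq_bot_iff, Submodule.eq_bot_iff]
    intro w hw
    have h1 : ∀ x : T.domain, inner ℂ (starRingEnd ℂ z • w) (x : H) = inner ℂ w (T x) := by
      intro x
      have := (Submodule.mem_orthogonal' W w).1 hw (L x) ⟨x, rfl⟩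
      rw [hL, inner_sub_right, inner_smul_right, sub_eq_zero] at this
      rw [this, inner_smul_left, Complex.conj_conj]
    have hmem : w ∈ T.adjoint.domain := LinearPMap.mem_adjoint_domain_of_exists _ ⟨_, h1⟩
    have hval := LinearPMap.adjoint_apply_eq hTd ⟨w, hmem⟩ h1
    have hle := adjoint_le Γ.dense (Γ.le_restr (contrGraph K))
    let w' : A.adjoint.domain := ⟨w, hle.1 hmem⟩
    rw [hle.2 (x := ⟨w, hmem⟩) (y := w') rfl] at hval
    have hadj : Γ.a w' = ContinuousLinearMap.adjoint K (Γ.b w') := by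
      rw [← Γ.mem_adjGraph K w', ← Γ.adjoint_restr_contrGraph K]
      exact hmem
    have h3 := Γ.green_im w'
    rw [hval, inner_smul_right, inner_self_eq_norm_sq_to_K] at h3
    simp [← Complex.ofReal_pow] at h3
    have h4 : ‖Γ.a w'‖ ≤ ‖Γ.b w'‖ := by rw [hadj]; exact norm_adjoint_le hK _
    have h5 : ‖Γ.a w'‖ ^ 2 ≤ ‖Γ.b w'‖ ^ 2 := by gcongr
    have h6 : z.im * ‖w‖ ^ 2 ≤ 0 := by
      have : (w' : H) = w := rfl
      rw [this] at h3
      linarith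
    have h7 : ‖w‖ ^ 2 ≤ 0 := by
      by_contra h
      push Not at h
      nlinarith [mul_pos hz h]
    exact norm_eq_zero.1 (pow_eq_zero_iff (two_ne_zero) |>.1 (le_antisymm h7 (sq_nonneg _)))
  have : y ∈ W := by rw [htop]; trivial
  exact this

lemma restr_isMDissipative (Γ : BoundaryTriple A B) {K : B →L[ℂ] B} (hK : ‖K‖ ≤ 1) :
    IsMDissipative (Γ.restr (contrGraph K)) :=
  isMDissipative_of_surjective (Γ.restr_dissipative hK) fun _ hz y => Γ.restr_surjective hK hz y

/-- The value Ku is recovered from any element with boundary data (u, Ku), and such an element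
exists by surjectivity. -/
lemma restr_injective (Γ : BoundaryTriple A B) {K L : B →L[ℂ] B}
    (h : Γ.restr (contrGraph K) = Γ.restr (contrGraph L)) : K = L := by
  ext u
  obtain ⟨x, h1, h2⟩ := Γ.surj u (K u)
  have h3 := (Γ.mem_contrGraph K x).2 (by rw [h1, h2])
  rw [h, Γ.mem_contrGraph L x, h1, h2] at h3
  exact h3

/-- The relations b = Ka and a = K*b coincide exactly when K*K and KK* are the identity: insert the
pairs (u, Ku) and (K*u, u). -/
lemma adjoint_eq_iff (Γ : BoundaryTriple A B) (K : B →L[ℂ] B) :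
    (Γ.restr (contrGraph K)).adjoint = Γ.restr (contrGraph K) ↔ K ∈ unitary (B →L[ℂ] B) := by
  rw [adjoint_restr_contrGraph, Unitary.mem_iff]
  constructor
  · intro h
    constructor
    · ext u
      obtain ⟨x, h1, h2⟩ := Γ.surj u (K u)
      have h3 := (Γ.mem_contrGraph K x).2 (by rw [h1, h2])
      rw [← h, Γ.mem_adjGraph K x, h1, h2] at h3
      exact h3.symm
    · ext u
      obtain ⟨x, h1, h2⟩ := Γ.surj (ContinuousLinearMap.adjoint K u) u
      have h3 := (Γ.mem_adjGraph K x).2 (by rw [h1, h2])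
      rw [h, Γ.mem_contrGraph K x, h1, h2] at h3
      exact h3.symm
  · rintro ⟨h1, h2⟩
    have e1 : ∀ u, ContinuousLinearMap.adjoint K (K u) = u := fun u => DFunLike.congr_fun h1 u
    have e2 : ∀ u, K (ContinuousLinearMap.adjoint K u) = u := fun u => DFunLike.congr_fun h2 u
    refine eq_of_domain_eq (Γ.restr_le _) (Γ.restr_le _) (Submodule.ext fun y => ?_)
    by_cases hy : y ∈ A.adjoint.domain
    · rw [Γ.mem_adjGraph K ⟨y, hy⟩, Γ.mem_contrGraph K ⟨y, hy⟩]
      exact ⟨fun h => by rw [h, e2], fun h => by rw [h, e1]⟩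
    · exact ⟨fun h => (hy ((Γ.restr_le _).1 h)).elim, fun h => (hy ((Γ.restr_le _).1 h)).elim⟩

/-- A dissipative extension of a symmetric operator is a restriction of its adjoint. -/
lemma le_adjoint_of_dissipative (Γ : BoundaryTriple A B) {T : H →ₗ.[ℂ] H} (hA : A ≤ T)
    (hT : ∀ x : T.domain, (inner ℂ (x : H) (T x)).im ≤ 0) : T ≤ A.adjoint := by
  refine LinearPMap.IsFormalAdjoint.le_adjoint Γ.dense fun y x => ?_
  let y' : T.domain := ⟨y, hA.1 y.2⟩
  have ey : A y = T y' := hA.2 rfl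
  have hreal : (inner ℂ (y : H) (T y')).im = 0 := by
    rw [← ey]
    have h1 := (LinearPMap.adjoint_isFormalAdjoint Γ.dense) ⟨y, Γ.symm.1 y.2⟩ y
    rw [← Γ.symm.2 (x := y) rfl] at h1
    have h2 := inner_conj_symm (𝕜 := ℂ) (y : H) (A y)
    rw [h1] at h2
    exact Complex.conj_eq_iff_im.1 h2
  set w : ℂ := inner ℂ (T y') (x : H) - inner ℂ (y : H) (T x) with hw
  -- Apply dissipativity to x + cy. The quadratic term |c|²⟨y, Ty⟩ is real because A is symmetric,
  -- so the imaginary part is affine in c; being bounded above, it must be constant, and this forces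
  -- w = 0.
  have key : ∀ c : ℂ, (inner ℂ (x : H) (T x)).im + (starRingEnd ℂ c * -w).im ≤ 0 := by
    intro c
    have h := hT (x + c • y')
    rw [LinearPMap.map_add, LinearPMap.map_smul, Submodule.coe_add, Submodule.coe_smul] at h
    simp only [inner_add_left, inner_add_right, inner_smul_left, inner_smul_right] at h
    have e1 : (c * (starRingEnd ℂ c * inner ℂ (y' : H) (T y'))).im = 0 := by
      rw [← mul_assoc, Complex.mul_conj, Complex.im_ofReal_mul]
      change _ * (inner ℂ (y : H) (T y')).im = 0
      rw [hreal, mul_zero]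
    have e2 : (c * inner ℂ (x : H) (T y')).im =
        -(starRingEnd ℂ c * inner ℂ (T y') (x : H)).im := by
      rw [← inner_conj_symm (x : H) (T y'), ← Complex.conj_im, map_mul, Complex.conj_conj]
    have e3 : (y' : H) = y := rfl
    simp only [mul_add, Complex.add_im] at h
    rw [e1, e2, e3] at h
    rw [hw, neg_sub, mul_sub, Complex.sub_im]
    linarith
  have hz : w = 0 := by
    by_contra hne
    have hpos : 0 < Complex.normSq w := Complex.normSq_pos.2 hne
    set m := (inner ℂ (x : H) (T x)).im with hm
    -- With this c the affine part is |m| + 1, so that m + |m| + 1 ≤ 0, which is absurd.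
    have h1 := key (((-(|m| + 1) / Complex.normSq w : ℝ) : ℂ) * -Complex.I * w)
    have e : starRingEnd ℂ (((-(|m| + 1) / Complex.normSq w : ℝ) : ℂ) * -Complex.I * w) * -w =
        ((|m| + 1 : ℝ) : ℂ) * Complex.I := by
      have : starRingEnd ℂ w * w = Complex.normSq w := by rw [mul_comm, Complex.mul_conj]
      simp only [map_mul, map_neg, Complex.conj_ofReal, Complex.conj_I]
      rw [show ((-(|m| + 1) / Complex.normSq w : ℝ) : ℂ) * - -Complex.I * starRingEnd ℂ w * -w =
        -(((-(|m| + 1) / Complex.normSq w : ℝ) : ℂ) * Complex.I * (starRingEnd ℂ w * w)) by ring,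
        this]
      have hn : (Complex.normSq w : ℂ) ≠ 0 := by exact_mod_cast hpos.ne'
      push_cast
      field_simp
    rw [e, Complex.im_ofReal_mul, Complex.I_im] at h1
    linarith [neg_abs_le m]
  have := sub_eq_zero.1 (hw ▸ hz)
  rw [ey, this]

/-- A contraction that is defined on a subspace extends to a contraction. -/
lemma exists_contraction (Θ : Submodule ℂ (B × B)) (h : ∀ w ∈ Θ, ‖w.2‖ ≤ ‖w.1‖) :
    ∃ K : B →L[ℂ] B, ‖K‖ ≤ 1 ∧ ∀ w ∈ Θ, w.2 = K w.1 := by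
  let D : Submodule ℂ B := Θ.map (LinearMap.fst ℂ B B)
  have hfun : ∀ w ∈ Θ, w.1 = 0 → w.2 = 0 := fun w hw h0 => by
    have := h w hw
    rw [h0, norm_zero] at this
    exact norm_le_zero_iff.1 this
  let T := Θ.toLinearPMap
  have hg : T.graph = Θ := Submodule.toLinearPMap_graph_eq _ hfun
  have hTn : ∀ x : T.domain, ‖T.toFun x‖ ≤ 1 * ‖x‖ := by
    intro x
    have : ((x : B), T x) ∈ Θ := hg ▸ T.mem_graph x
    simpa using h _ this
  let C : T.domain →L[ℂ] B := T.toFun.mkContinuous 1 hTn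
  let D' := T.domain.topologicalClosure
  have : CompleteSpace D' := T.domain.isClosed_topologicalClosure.completeSpace_coe
  let ι : T.domain →L[ℂ] D' :=
    (Submodule.inclusion T.domain.le_topologicalClosure).mkContinuous 1 (fun x => by
      rw [one_mul]; rfl)
  have hιd : DenseRange ι := by
    intro x
    rw [closure_subtype]
    have : (Subtype.val '' Set.range ι : Set B) = T.domain := by
      ext y
      constructor
      · rintro ⟨-, ⟨x, rfl⟩, rfl⟩
        exact x.2
      · intro hy
        exact ⟨ι ⟨y, hy⟩, ⟨⟨y, hy⟩, rfl⟩, rfl⟩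
    rw [this]
    exact x.2
  have hιi : IsUniformInducing ι := by
    refine (Isometry.isUniformInducing ?_)
    exact AddMonoidHomClass.isometry_of_norm ι fun x => rfl
  let C' : D' →L[ℂ] B := C.extend ι
  have hC'n : ‖C'‖ ≤ 1 := by
    have := ContinuousLinearMap.opNorm_extend_le C (e := ι) (N := 1) hιd fun x => by
      simp only [NNReal.coe_one, one_mul]
      exact le_of_eq rfl
    refine this.trans ?_
    simp only [NNReal.coe_one, one_mul]
    exact LinearMap.mkContinuous_norm_le _ zero_le_one _
  -- After extension by continuity to the closure of the domain, composing with the orthogonal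
  -- projection (i.e. extending by zero on the complement) does not increase the norm.
  refine ⟨C'.comp D'.orthogonalProjectionOnto, ?_, fun w hw => ?_⟩
  · refine (ContinuousLinearMap.opNorm_comp_le _ _).trans ?_
    have := D'.orthogonalProjectionOnto_norm_le
    exact mul_le_one₀ hC'n (norm_nonneg _) this
  · rw [← hg, LinearPMap.mem_graph_iff] at hw
    obtain ⟨x, h1, h2⟩ := hw
    have e1 : D'.orthogonalProjectionOnto w.1 = ι x := by
      rw [← h1]
      exact Submodule.orthogonalProjectionOnto_mem_subspace_eq_self (ι x)
    rw [ContinuousLinearMap.comp_apply, e1, ContinuousLinearMap.extend_eq C hιd hιi, ← h2]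
    rfl

/-- By dissipativity the boundary values on dom T satisfy ‖b‖ ≤ ‖a‖, hence lie in the graph of a
globally defined contraction K. The restriction to b = Ka is then a dissipative extension of the
m-dissipative T, so the two agree. Maximality replaces a proof that the boundary values a exhaust
the whole space. -/
lemma exists_eq_restr (Γ : BoundaryTriple A B) {T : H →ₗ.[ℂ] H} (hA : A ≤ T)
    (hT : IsMDissipative T) :
    ∃ K : B →L[ℂ] B, ‖K‖ ≤ 1 ∧ T = Γ.restr (contrGraph K) := by
  have hle := Γ.le_adjoint_of_dissipative hA hT.im_nonpos
  let Θ : Submodule ℂ (B × B) :=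
    (T.domain.comap A.adjoint.domain.subtype).map (Γ.a.prod Γ.b)
  obtain ⟨K, hK, hΘ⟩ := exists_contraction Θ (by
    rintro - ⟨x, hx, rfl⟩
    have h1 := hT.im_nonpos ⟨x, hx⟩
    rw [hle.2 (x := ⟨x, hx⟩) (y := x) rfl] at h1
    have h2 := Γ.green_im x
    change ‖Γ.b x‖ ≤ ‖Γ.a x‖
    change (inner ℂ (x : H) (A.adjoint x)).im ≤ 0 at h1
    refine le_of_sq_le_sq ?_ (norm_nonneg _)
    linarith)
  refine ⟨K, hK, hT.eq_of_le (Γ.restr_dissipative hK)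
    (le_of_domain_le hle (Γ.restr_le _) fun x hx => ?_)⟩
  refine (Γ.mem_contrGraph K ⟨x, hle.1 hx⟩).2 ?_
  exact hΘ _ ⟨⟨x, hle.1 hx⟩, hx, rfl⟩

/-- The parametrisation of the m-dissipative extensions by contractions. -/
theorem mDissipative_extensions (Γ : BoundaryTriple A B) {op : (B →L[ℂ] B) → (H →ₗ.[ℂ] H)}
    (hop : ∀ K, op K ≤ A.adjoint)
    (hmem : ∀ K (x : A.adjoint.domain), (x : H) ∈ (op K).domain ↔ Γ.b x = K (Γ.a x)) :
    (∀ T : H →ₗ.[ℂ] H, (A ≤ T ∧ IsMDissipative T) ↔ ∃ K : B →L[ℂ] B, ‖K‖ ≤ 1 ∧ T = op K) ∧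
    Set.BijOn op {K | ‖K‖ ≤ 1} {T | A ≤ T ∧ IsMDissipative T} ∧
    ∀ K : B →L[ℂ] B, ‖K‖ ≤ 1 → ((op K).adjoint = op K ↔ K ∈ unitary (B →L[ℂ] B)) := by
  have heq : ∀ K, op K = Γ.restr (contrGraph K) := fun K => by
    refine eq_of_domain_eq (hop K) (Γ.restr_le _) (Submodule.ext fun y => ?_)
    by_cases hy : y ∈ A.adjoint.domain
    · rw [Γ.mem_contrGraph K ⟨y, hy⟩, hmem K ⟨y, hy⟩]
    · exact ⟨fun h => (hy ((hop K).1 h)).elim, fun h => (hy ((Γ.restr_le _).1 h)).elim⟩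
  have h1 : ∀ T : H →ₗ.[ℂ] H, (A ≤ T ∧ IsMDissipative T) ↔
      ∃ K : B →L[ℂ] B, ‖K‖ ≤ 1 ∧ T = op K := by
    intro T
    constructor
    · rintro ⟨hA, hT⟩
      obtain ⟨K, hK, e⟩ := Γ.exists_eq_restr hA hT
      exact ⟨K, hK, by rw [heq, e]⟩
    · rintro ⟨K, hK, rfl⟩
      rw [heq]
      exact ⟨Γ.le_restr _, Γ.restr_isMDissipative hK⟩
  refine ⟨h1, ⟨fun K hK => (h1 _).2 ⟨K, hK, rfl⟩, fun K _ L _ h => ?_, fun T hT => ?_⟩,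
    fun K _ => ?_⟩
  · rw [heq, heq] at h
    exact Γ.restr_injective h
  · obtain ⟨K, hK, e⟩ := (h1 T).1 hT
    exact ⟨K, hK, e.symm⟩
  · rw [heq]; exact Γ.adjoint_eq_iff K

end BoundaryTriple

end Acoustic

end


noncomputable section

namespace Acoustic

open Metric
open scoped ENNReal NNReal

/-! ### Measure-theoretic lemmas -/

/-- On the line, Lebesgue measure is one-dimensional Hausdorff measure, and preimages under a map
that contracts distances by at most the factor K have at most K times the measure. -/
lemma map_le_of_antilipschitz {H : ℝ → ℝ} {K : ℝ≥0} (hH : AntilipschitzWith K H)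
    (hm : Measurable H) : (volume : Measure ℝ).map H ≤ (K : ℝ≥0∞) • volume := by
  refine Measure.le_iff.2 fun s hs => ?_
  rw [Measure.map_apply hm hs, ← hausdorffMeasure_real, Measure.smul_apply, smul_eq_mul]
  simpa using hH.hausdorffMeasure_preimage_le zero_le_one s

lemma lintegral_comp_le_of_antilipschitz {H : ℝ → ℝ} {K : ℝ≥0} (hH : AntilipschitzWith K H)
    (hm : Measurable H) {g : ℝ → ℝ≥0∞} (hg : Measurable g) :
    ∫⁻ r, g (H r) ≤ K * ∫⁻ r, g r := by
  rw [← lintegral_map hg hm]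
  refine (lintegral_mono' (map_le_of_antilipschitz hH hm) le_rfl).trans ?_
  rw [lintegral_smul_measure, smul_eq_mul]

/-! ### Geometry and surface measure of a Lipschitz graph over a hyperplane -/

variable {d : ℕ}

/-- The hyperplane orthogonal to `e`. -/
abbrev Hyper (e : Space d) : Submodule ℝ (Space d) := (Submodule.span ℝ {e})ᗮ

/-- The orthogonal projection onto the hyperplane orthogonal to `e`. -/
abbrev hproj (e : Space d) : Space d →L[ℝ] Hyper e := (Hyper e).orthogonalProjectionOnto

/-- The parametrisation of the graph of `f`. -/
def graphMap (e : Space d) (f : Hyper e → ℝ) (y : Hyper e) : Space d := y + f y • e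

/-- The height of the graph of `f` above a point. -/
def depth (e : Space d) (f : Hyper e → ℝ) (x : Space d) : ℝ := f (hproj e x) - inner ℝ e x

section Hyperplane

variable {e : Space d}

lemma inner_hyper (y : Hyper e) : inner ℝ e (y : Space d) = 0 :=
  Submodule.mem_orthogonal_singleton_iff_inner_right.1 y.2

lemma hproj_self : hproj e e = 0 :=
  (Submodule.orthogonalProjectionOnto_eq_zero_iff).2
    (Submodule.le_orthogonal_orthogonal _ (Submodule.mem_span_singleton_self e))

lemma hproj_coe (y : Hyper e) : hproj e (y : Space d) = y :=
  Submodule.orthogonalProjectionOnto_mem_subspace_eq_self y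

lemma inner_self_unit (he : ‖e‖ = 1) : inner ℝ e e = (1 : ℝ) := by
  rw [real_inner_self_eq_norm_sq, he]; norm_num

lemma norm_hproj_le (x : Space d) : ‖hproj e x‖ ≤ ‖x‖ := by
  refine ((hproj e).le_opNorm x).trans ?_
  exact mul_le_of_le_one_left (norm_nonneg _) (Submodule.orthogonalProjectionOnto_norm_le _)

lemma hproj_add_inner_smul (he : ‖e‖ = 1) (x : Space d) :
    (hproj e x : Space d) + (inner ℝ e x : ℝ) • e = x := by
  have h := (Submodule.span ℝ {e}).starProjection_add_starProjection_orthogonal x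
  rw [Submodule.starProjection_unit_singleton ℝ he] at h
  rw [add_comm]
  exact h

lemma finrank_hyper (he : ‖e‖ = 1) : Module.finrank ℝ (Hyper e) = d - 1 := by
  have h := (Submodule.span ℝ {e}).finrank_add_finrank_orthogonal
  have hne : e ≠ 0 := by rintro rfl; simp at he
  rw [finrank_span_singleton hne, finrank_euclideanSpace_fin] at h
  change 1 + Module.finrank ℝ (Hyper e) = d at h
  omega

/-- Orthogonal coordinates preserve the volume. -/
lemma measurePreserving_coords (he : ‖e‖ = 1) :
    MeasurePreserving (fun q : Hyper e × ℝ => (q.1 : Space d) + q.2 • e)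
      ((volume : Measure (Hyper e)).prod volume) volume := by
  have h1 := ((Submodule.span ℝ {e}).measurePreserving_measurableEquivProd (0 : Space d)).symm
  rw [InnerProductSpace.euclideanHausdorffMeasure_eq_volume] at h1
  have h2 := (LinearIsometryEquiv.toSpanUnitSingleton (𝕜 := ℝ) e he).measurePreserving
  have h3 := h2.prod (MeasurePreserving.id (volume : Measure (Hyper e)))
  have h4 := h1.comp (h3.comp Measure.measurePreserving_swap)
  have h5 : (fun q : Hyper e × ℝ => (q.1 : Space d) + q.2 • e) =
      ((Submodule.span ℝ {e}).measurableEquivProd (0 : Space d)).symm ∘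
        Prod.map (LinearIsometryEquiv.toSpanUnitSingleton (𝕜 := ℝ) e he) id ∘ Prod.swap := by
    funext q
    simp [Submodule.measurableEquivProd_symm_apply, add_comm]
  rw [h5]
  exact h4

lemma lintegral_coords (he : ‖e‖ = 1) {g : Space d → ℝ≥0∞} (hg : Measurable g) :
    ∫⁻ y : Hyper e, ∫⁻ s : ℝ, g ((y : Space d) + s • e) = ∫⁻ x, g x := by
  rw [← (measurePreserving_coords he).lintegral_comp hg, lintegral_prod]
  exact (hg.comp (measurePreserving_coords he).measurable).aemeasurable

end Hyperplane

section Graph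

variable {e : Space d} {f : Hyper e → ℝ} {L : ℝ≥0}

lemma hproj_graphMap (y : Hyper e) : hproj e (graphMap e f y) = y := by
  rw [graphMap, map_add, map_smul, hproj_self, smul_zero, add_zero, hproj_coe]

lemma inner_graphMap (he : ‖e‖ = 1) (y : Hyper e) : inner ℝ e (graphMap e f y) = f y := by
  rw [graphMap, inner_add_right, inner_hyper, inner_smul_right, inner_self_unit he]; simp

lemma graphMap_sub_depth (he : ‖e‖ = 1) (x : Space d) :
    graphMap e f (hproj e x) - depth e f x • e = x := by
  conv_rhs => rw [← hproj_add_inner_smul he x]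
  rw [graphMap, depth, sub_smul]; abel

lemma graphMap_hproj (he : ‖e‖ = 1) {x : Space d} (hx : depth e f x = 0) :
    graphMap e f (hproj e x) = x := by
  have := graphMap_sub_depth (f := f) he x
  rwa [hx, zero_smul, sub_zero] at this

lemma depth_graphMap_sub (he : ‖e‖ = 1) (y : Hyper e) (s : ℝ) :
    depth e f (graphMap e f y - s • e) = s := by
  rw [depth, map_sub, map_smul, hproj_self, smul_zero, sub_zero, hproj_graphMap,
    inner_sub_right, inner_graphMap he, inner_smul_right, inner_self_unit he]; ring

lemma depth_graphMap (he : ‖e‖ = 1) (y : Hyper e) : depth e f (graphMap e f y) = 0 := by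
  simpa using depth_graphMap_sub (f := f) he y 0

lemma depth_add_smul (he : ‖e‖ = 1) (x : Space d) (s : ℝ) :
    depth e f (x + s • e) = depth e f x - s := by
  rw [depth, depth, map_add, map_smul, hproj_self, smul_zero, add_zero, inner_add_right,
    inner_smul_right, inner_self_unit he]; ring

lemma lipschitzWith_graphMap (he : ‖e‖ = 1) (hf : LipschitzWith L f) :
    LipschitzWith (1 + L) (graphMap e f) := by
  refine LipschitzWith.add (LipschitzWith.subtype_val _) (LipschitzWith.of_dist_le_mul
    fun x y => ?_)
  rw [dist_eq_norm, ← sub_smul, norm_smul, he, mul_one]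
  exact hf.dist_le_mul x y

lemma antilipschitzWith_graphMap : AntilipschitzWith 1 (graphMap e f) := by
  refine AntilipschitzWith.of_le_mul_dist fun x y => ?_
  rw [NNReal.coe_one, one_mul, dist_eq_norm, dist_eq_norm]
  conv_lhs => rw [← hproj_graphMap (f := f) x, ← hproj_graphMap (f := f) y, ← map_sub]
  exact norm_hproj_le _

lemma abs_depth_sub_le (he : ‖e‖ = 1) (hf : LipschitzWith L f) (x y : Space d) :
    |depth e f x - depth e f y| ≤ (1 + L) * ‖x - y‖ := by
  have h1 : |f (hproj e x) - f (hproj e y)| ≤ L * ‖x - y‖ := by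
    rw [← Real.dist_eq]
    refine (hf.dist_le_mul _ _).trans ?_
    rw [dist_eq_norm, ← map_sub]
    gcongr
    exact norm_hproj_le _
  have h2 : |inner ℝ e x - inner ℝ e y| ≤ ‖x - y‖ := by
    rw [← inner_sub_right]
    refine (abs_real_inner_le_norm _ _).trans ?_
    rw [he, one_mul]
  have h3 : depth e f x - depth e f y = (f (hproj e x) - f (hproj e y)) -
      (inner ℝ e x - inner ℝ e y) := by simp only [depth]; ring
  rw [h3]
  refine (abs_sub _ _).trans ?_
  linarith

lemma continuous_depth (hf : LipschitzWith L f) : Continuous (depth e f) :=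
  ((hf.continuous.comp (hproj e).continuous).sub (continuous_const.inner continuous_id))

/-- The opening of the inward cone at a Lipschitz graph. -/
def coneWidth (L : ℝ≥0) : ℝ := 1 / (2 * (1 + L))

lemma coneWidth_pos : 0 < coneWidth L := by unfold coneWidth; positivity

lemma coneWidth_mul : (1 + L) * coneWidth L = 1 / 2 := by
  unfold coneWidth
  have : (1 + L : ℝ) ≠ 0 := by positivity
  field_simp

lemma coneWidth_le : coneWidth L ≤ 1 / 2 := by
  have h := coneWidth_mul (L := L)
  nlinarith [coneWidth_pos (L := L), L.coe_nonneg]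

/-- The move by -re raises the depth by exactly r. The perturbation rz costs at most (1 + L)r‖z‖,
and `coneWidth` is chosen to make this at most r/2. -/
lemma depth_sub_smul_ge (he : ‖e‖ = 1) (hf : LipschitzWith L f) {z : Space d}
    (hz : ‖z‖ < coneWidth L) (x : Space d) {r : ℝ} (hr : 0 ≤ r) :
    depth e f x + r / 2 ≤ depth e f (x - r • (e + z)) := by
  have h1 := abs_depth_sub_le he hf (x - r • (e + z)) (x - r • e)
  have h2 : depth e f (x - r • e) = depth e f x + r := by
    have := depth_add_smul (f := f) he x (-r)
    rw [neg_smul, ← sub_eq_add_neg] at this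
    rw [this]; ring
  have h3 : ‖x - r • (e + z) - (x - r • e)‖ = r * ‖z‖ := by
    rw [smul_add, show x - (r • e + r • z) - (x - r • e) = -(r • z) by abel, norm_neg, norm_smul,
      Real.norm_of_nonneg hr]
  rw [h2, h3] at h1
  have h4 : (1 + L) * (r * ‖z‖) ≤ r / 2 := by
    have h5 : (1 + L) * ‖z‖ ≤ 1 / 2 := by
      rw [← coneWidth_mul (L := L)]
      gcongr
    nlinarith
  have := (abs_le.1 h1).1
  linarith

/-- Integration along the lines through a Lipschitz graph in a transversal direction. -/
lemma lintegral_sweep_le (he : ‖e‖ = 1) (hf : LipschitzWith L f) {z : Space d}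
    (hz : ‖z‖ < coneWidth L) {g : Space d → ℝ≥0∞} (hg : Measurable g) :
    ∫⁻ y : Hyper e, ∫⁻ r : ℝ, g (graphMap e f y - r • (e + z)) ≤ 2 * ∫⁻ x, g x := by
  have hΦ : Continuous (graphMap e f) := (lipschitzWith_graphMap he hf).continuous
  rw [lintegral_lintegral_swap (by fun_prop)]
  set w : Hyper e := hproj e (e + z) with hw
  set k : ℝ := inner ℝ e (e + z) with hk
  have hez : e + z = (w : Space d) + k • e := (hproj_add_inner_smul he _).symm
  have hfc := hf.continuous
  -- For fixed r, translate y by r times the horizontal part w of the direction. The foot point then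
  -- no longer depends on r and only the height f(y + rw) - rk moves, which reduces the claim to one
  -- dimension on each vertical line.
  have h1 : ∀ r : ℝ, ∫⁻ y : Hyper e, g (graphMap e f y - r • (e + z)) =
      ∫⁻ y : Hyper e, g ((y : Space d) + (f (y + r • w) - r * k) • e) := by
    intro r
    rw [← lintegral_add_right_eq_self _ (r • w)]
    refine lintegral_congr fun y => ?_
    congr 1
    rw [hez, graphMap, Submodule.coe_add, Submodule.coe_smul]
    module
  simp_rw [h1]
  rw [lintegral_lintegral_swap (by fun_prop), ← lintegral_coords he hg,
    ← lintegral_const_mul _ (by fun_prop)]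
  refine lintegral_mono fun y => ?_
  -- The height decreases at rate at least 1 - ‖z‖ from k and is disturbed at rate at most L‖z‖ by
  -- f; the net rate is at least 1 - (1 + L)‖z‖ ≥ 1/2.
  have hanti : AntilipschitzWith 2 fun r : ℝ => f (y + r • w) - r * k := by
    refine AntilipschitzWith.of_le_mul_dist fun r s => ?_
    rw [Real.dist_eq, Real.dist_eq]
    have e1 : |f (y + r • w) - f (y + s • w)| ≤ L * (|r - s| * ‖z‖) := by
      rw [← Real.dist_eq]
      refine (hf.dist_le_mul _ _).trans ?_
      rw [dist_add_left, dist_eq_norm, ← sub_smul, norm_smul, Real.norm_eq_abs]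
      have : ‖w‖ ≤ ‖z‖ := by
        rw [hw, map_add, hproj_self, zero_add]; exact norm_hproj_le z
      gcongr
    have e2 : 1 - ‖z‖ ≤ k := by
      rw [hk, inner_add_right, inner_self_unit he]
      have := abs_real_inner_le_norm e z
      rw [he, one_mul] at this
      linarith [(abs_le.1 this).1]
    have e3 : (1 + L) * ‖z‖ ≤ 1 / 2 := by
      rw [← coneWidth_mul (L := L)]
      gcongr
    have e4 : |(r - s) * k| ≤ |f (y + r • w) - r * k - (f (y + s • w) - s * k)| +
        |f (y + r • w) - f (y + s • w)| := by
      have : (r - s) * k = -(f (y + r • w) - r * k - (f (y + s • w) - s * k)) +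
        (f (y + r • w) - f (y + s • w)) := by ring
      rw [this]
      refine (abs_add_le _ _).trans ?_
      rw [abs_neg]
    have e5 : 0 ≤ |r - s| := abs_nonneg _
    rw [abs_mul] at e4
    have e6 : |r - s| * (1 - ‖z‖) ≤ |r - s| * |k| := by
      gcongr
      exact e2.trans (le_abs_self k)
    push_cast
    nlinarith
  have := lintegral_comp_le_of_antilipschitz hanti (by fun_prop)
    (g := fun s => g ((y : Space d) + s • e)) (by fun_prop)
  simpa using this

/-- Two-sided comparability of the surface measure with the measure of the hyperplane is enough
here, and no area formula is needed. The parametrisation is (1 + L)-Lipschitz, and its left inverse,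
the orthogonal projection, does not increase distances; the latter gives `map_le_surface`. -/
lemma surface_le_map (he : ‖e‖ = 1) (hf : LipschitzWith L f) :
    (Measure.euclideanHausdorffMeasure (d - 1) : Measure (Space d)).restrict
      (Set.range (graphMap e f)) ≤ ((1 + L) ^ (d - 1) : ℝ≥0) •
        (volume : Measure (Hyper e)).map (graphMap e f) := by
  have hΦ : Continuous (graphMap e f) := (lipschitzWith_graphMap he hf).continuous
  refine Measure.le_iff.2 fun s hs => ?_
  rw [Measure.restrict_apply hs, Measure.smul_apply, Measure.map_apply hΦ.measurable hs,
    ← Set.image_preimage_eq_inter_range, ← InnerProductSpace.euclideanHausdorffMeasure_eq_volume,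
    finrank_hyper he, Measure.euclideanHausdorffMeasure_def, Measure.euclideanHausdorffMeasure_def,
    Measure.smul_apply, Measure.smul_apply, smul_comm]
  simp only [ENNReal.smul_def, smul_eq_mul]
  gcongr
  have := (lipschitzWith_graphMap he hf).hausdorffMeasure_image_le (d := (d - 1 : ℕ))
    (by positivity) (graphMap e f ⁻¹' s)
  rw [ENNReal.rpow_natCast] at this
  refine this.trans (le_of_eq ?_)
  push_cast
  rfl

lemma map_le_surface (he : ‖e‖ = 1) (hf : LipschitzWith L f) :
    (volume : Measure (Hyper e)).map (graphMap e f) ≤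
      (Measure.euclideanHausdorffMeasure (d - 1) : Measure (Space d)).restrict
        (Set.range (graphMap e f)) := by
  have hΦ : Continuous (graphMap e f) := (lipschitzWith_graphMap he hf).continuous
  refine Measure.le_iff.2 fun s hs => ?_
  rw [Measure.restrict_apply hs, Measure.map_apply hΦ.measurable hs,
    ← Set.image_preimage_eq_inter_range, ← InnerProductSpace.euclideanHausdorffMeasure_eq_volume,
    finrank_hyper he, Measure.euclideanHausdorffMeasure_def, Measure.euclideanHausdorffMeasure_def,
    Measure.smul_apply, Measure.smul_apply]
  simp only [ENNReal.smul_def, smul_eq_mul]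
  gcongr
  have := (antilipschitzWith_graphMap (e := e) (f := f)).le_hausdorffMeasure_image (d := (d - 1 : ℕ))
    (by positivity) (graphMap e f ⁻¹' s)
  simpa using this

end Graph

end Acoustic

end


noncomputable section

namespace Acoustic

open Metric
open scoped ENNReal NNReal

variable {d : ℕ}

/-! ### Boundary charts -/

/-- Local description of a Lipschitz domain near a boundary point: a cone of inward directions
`-(e + z)`, `‖z‖ < c`, comparison of integrals over the domain with integrals along these
directions, and Ahlfors regularity of the surface measure. -/
structure Chart (O : Set (Space d)) (x₀ : Space d) where
  e : Space d
  norm_e : ‖e‖ = 1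
  c : ℝ
  c_pos : 0 < c
  c_le : c ≤ 1 / 2
  ρ : ℝ
  ρ_pos : 0 < ρ
  δ : ℝ
  δ_pos : 0 < δ
  C : ℝ≥0
  κ : ℝ
  κ_pos : 0 < κ
  inward : ∀ x ∈ closure O, x ∈ ball x₀ ρ → ∀ r ∈ Set.Ioo 0 ρ, ∀ z, ‖z‖ < c →
    x - r • (e + z) ∈ O
  sweep : ∀ z, ‖z‖ < c → ∀ g : Space d → ℝ≥0∞, Measurable g →
    ∫⁻ x in ball x₀ ρ, (∫⁻ r in Set.Ioo (0 : ℝ) ρ, g (x - r • (e + z))) ∂(surfaceMeasure O) ≤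
      C * ∫⁻ x in O, g x
  layer : ∀ ε ∈ Set.Ioo 0 δ, ∀ g : Space d → ℝ≥0∞, Measurable g →
    ∫⁻ x in O ∩ (ball x₀ δ ∩ {x | infDist x (frontier O) < ε}), g x ≤
      ∫⁻ x in ball x₀ ρ, (∫⁻ r in Set.Ioo (0 : ℝ) (C * ε), g (x - r • e)) ∂(surfaceMeasure O)
  layer_le : C * δ ≤ ρ
  upper : ∀ x ∈ ball x₀ ρ, ∀ r ∈ Set.Ioo 0 ρ,
    surfaceMeasure O (ball x r) ≤ ENNReal.ofReal (C * r ^ (d - 1))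
  lower : ∀ x ∈ frontier O, x ∈ ball x₀ ρ → ∀ r ∈ Set.Ioo 0 ρ,
    ENNReal.ofReal (κ * r ^ (d - 1)) ≤ surfaceMeasure O (ball x r)

section Construction

variable {O : Set (Space d)} {e x₀ : Space d} {f : Hyper e → ℝ} {L : ℝ≥0} {R : ℝ}

lemma frontier_iff_depth (hO : IsOpen O) (he : ‖e‖ = 1) (hf : LipschitzWith L f)
    (hR : ∀ x ∈ ball x₀ R, (x ∈ O ↔ 0 < depth e f x)) {x : Space d} (hx : x ∈ ball x₀ R) :
    x ∈ frontier O ↔ depth e f x = 0 := by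
  rw [hO.frontier_eq]
  constructor
  · rintro ⟨h1, h2⟩
    refine le_antisymm (not_lt.1 fun h => h2 ((hR x hx).2 h)) ?_
    have h3 : x ∈ closure (ball x₀ R ∩ O) := isOpen_ball.inter_closure ⟨hx, h1⟩
    have h4 : IsClosed {y | 0 ≤ depth e f y} := isClosed_le continuous_const (continuous_depth hf)
    exact closure_minimal (fun y hy => ((hR y hy.1).1 hy.2).le) h4 h3
  · intro h
    refine ⟨?_, fun h2 => ((hR x hx).1 h2).ne' h⟩
    have h3 : Tendsto (fun s : ℝ => x - s • e) (nhdsWithin 0 (Set.Ioi 0)) (nhds x) := by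
      have : Continuous fun s : ℝ => x - s • e := by fun_prop
      have h5 := this.tendsto 0
      simp only [zero_smul, sub_zero] at h5
      exact h5.mono_left nhdsWithin_le_nhds
    refine mem_closure_of_tendsto h3 ?_
    filter_upwards [h3 (isOpen_ball.mem_nhds hx), self_mem_nhdsWithin] with s hs hs0
    refine (hR _ hs).2 ?_
    have := depth_add_smul (f := f) he x (-s)
    rw [neg_smul, ← sub_eq_add_neg] at this
    rw [this, h]
    simpa using hs0

lemma depth_nonneg_of_closure (hf : LipschitzWith L f)
    (hR : ∀ x ∈ ball x₀ R, (x ∈ O ↔ 0 < depth e f x)) {x : Space d} (hx : x ∈ ball x₀ R)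
    (h : x ∈ closure O) : 0 ≤ depth e f x := by
  have h3 : x ∈ closure (ball x₀ R ∩ O) := isOpen_ball.inter_closure ⟨hx, h⟩
  have h4 : IsClosed {y | 0 ≤ depth e f y} := isClosed_le continuous_const (continuous_depth hf)
  exact closure_minimal (fun y hy => ((hR y hy.1).1 hy.2).le) h4 h3

lemma surface_restrict_ball (hO : IsOpen O) (he : ‖e‖ = 1) (hf : LipschitzWith L f)
    (hR : ∀ x ∈ ball x₀ R, (x ∈ O ↔ 0 < depth e f x)) :
    (surfaceMeasure O).restrict (ball x₀ R) =
      ((Measure.euclideanHausdorffMeasure (d - 1) : Measure (Space d)).restrict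
        (Set.range (graphMap e f))).restrict (ball x₀ R) := by
  rw [surfaceMeasure, Measure.restrict_restrict measurableSet_ball,
    Measure.restrict_restrict measurableSet_ball]
  congr 1
  ext x
  simp only [Set.mem_inter_iff, and_congr_right_iff]
  intro hx
  rw [frontier_iff_depth hO he hf hR hx]
  exact ⟨fun h => ⟨_, graphMap_hproj he h⟩, by rintro ⟨y, rfl⟩; exact depth_graphMap he y⟩

lemma surface_ball_le (hO : IsOpen O) (he : ‖e‖ = 1) (hf : LipschitzWith L f)
    (hR : ∀ x ∈ ball x₀ R, (x ∈ O ↔ 0 < depth e f x)) :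
    (surfaceMeasure O).restrict (ball x₀ R) ≤ ((1 + L) ^ (d - 1) : ℝ≥0) •
        (volume : Measure (Hyper e)).map (graphMap e f) := by
  rw [surface_restrict_ball hO he hf hR]
  exact Measure.restrict_le_self.trans (surface_le_map he hf)

lemma map_restrict_le (hO : IsOpen O) (he : ‖e‖ = 1) (hf : LipschitzWith L f)
    (hR : ∀ x ∈ ball x₀ R, (x ∈ O ↔ 0 < depth e f x)) :
    ((volume : Measure (Hyper e)).map (graphMap e f)).restrict (ball x₀ R) ≤
      (surfaceMeasure O).restrict (ball x₀ R) := by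
  rw [surface_restrict_ball hO he hf hR]
  exact Measure.restrict_mono le_rfl (map_le_surface he hf)

lemma volume_hyper_ball (he : ‖e‖ = 1) (y : Hyper e) {r : ℝ} (hr : 0 < r) :
    volume (ball y r) = ENNReal.ofReal (r ^ (d - 1)) * volume (ball (0 : Hyper e) 1) := by
  rw [Measure.addHaar_ball_of_pos _ _ hr, finrank_hyper he]

/-- The chart at a boundary point at which the domain is a Lipschitz hypograph in a ball of radius
`4 * ρ`. -/
lemma exists_chart_of_hypograph (hO : IsOpen O) (he : ‖e‖ = 1) (hf : LipschitzWith L f) {ρ : ℝ}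
    (hρ : 0 < ρ) (hx₀ : x₀ ∈ frontier O)
    (hR : ∀ x ∈ ball x₀ (4 * ρ), (x ∈ O ↔ 0 < depth e f x)) :
    Nonempty (Chart O x₀) := by
  set μ := (volume : Measure (Hyper e)).map (graphMap e f) with hμ
  have hΦ : Measurable (graphMap e f) := (lipschitzWith_graphMap he hf).continuous.measurable
  set C₀ : ℝ≥0 := (1 + L) ^ (d - 1) with hC₀
  have hΛ : (1 : ℝ) ≤ 1 + L := by simp
  set v : ℝ := (volume (ball (0 : Hyper e) 1)).toReal with hv
  have hvtop : volume (ball (0 : Hyper e) 1) ≠ ⊤ := measure_ball_lt_top.ne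
  have hv0 : 0 < v := ENNReal.toReal_pos (measure_ball_pos _ _ one_pos).ne' hvtop
  have hve : volume (ball (0 : Hyper e) 1) = ENNReal.ofReal v := (ENNReal.ofReal_toReal hvtop).symm
  have hup : (surfaceMeasure O).restrict (ball x₀ (4 * ρ)) ≤ (C₀ : ℝ≥0∞) • μ :=
    surface_ball_le hO he hf hR
  have hlow : μ.restrict (ball x₀ (4 * ρ)) ≤ (surfaceMeasure O).restrict (ball x₀ (4 * ρ)) :=
    map_restrict_le hO he hf hR
  have hsub : ball x₀ ρ ⊆ ball x₀ (4 * ρ) := ball_subset_ball (by linarith)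
  have hinball : ∀ x ∈ ball x₀ ρ, ∀ r ∈ Set.Ioo (0 : ℝ) ρ, ∀ z, ‖z‖ < coneWidth L →
      x - r • (e + z) ∈ ball x₀ (4 * ρ) := by
    intro x hx r hr z hz
    rw [mem_ball, dist_eq_norm] at hx ⊢
    have h1 : ‖e + z‖ ≤ 2 := by
      have := norm_add_le e z
      have := coneWidth_le (L := L)
      linarith
    calc ‖x - r • (e + z) - x₀‖ = ‖(x - x₀) - r • (e + z)‖ := by congr 1; abel
      _ ≤ ‖x - x₀‖ + ‖r • (e + z)‖ := norm_sub_le _ _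
      _ = ‖x - x₀‖ + r * ‖e + z‖ := by rw [norm_smul, Real.norm_of_nonneg hr.1.le]
      _ < 4 * ρ := by nlinarith [hr.1, hr.2]
  have hinward : ∀ x ∈ closure O, x ∈ ball x₀ ρ → ∀ r ∈ Set.Ioo (0 : ℝ) ρ, ∀ z,
      ‖z‖ < coneWidth L → x - r • (e + z) ∈ O := by
    intro x hx hxb r hr z hz
    rw [hR _ (hinball x hxb r hr z hz)]
    have h1 := depth_nonneg_of_closure hf hR (hsub hxb) hx
    have h2 := depth_sub_smul_ge he hf hz x hr.1.le
    linarith [hr.1]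
  have hfr : ∀ x ∈ ball x₀ (4 * ρ), (x ∈ frontier O ↔ depth e f x = 0) :=
    fun x hx => frontier_iff_depth hO he hf hR hx
  -- One constant for three fields: 2C₀ serves `sweep`, 1 + L serves `layer`, and C₀v serves
  -- `upper`.
  set K : ℝ≥0 := 2 * C₀ + (1 + L) + C₀ * ⟨v, hv0.le⟩ with hK
  have hKr : (K : ℝ) = 2 * C₀ + (1 + L) + C₀ * v := by rw [hK]; push_cast; rfl
  have hKL : (1 + L : ℝ) ≤ K := by
    rw [hKr]
    have : (0 : ℝ) ≤ 2 * C₀ := by positivity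
    have : (0 : ℝ) ≤ C₀ * v := by positivity
    linarith
  have hK1 : (1 : ℝ) ≤ K := hΛ.trans hKL
  -- Small enough that the layer of width δ, and the vertical projection of its points to the graph,
  -- remain in the ball where the hypograph description is valid.
  set δ : ℝ := ρ / (4 * K) with hδdef
  have hδpos : 0 < δ := by positivity
  have hKδ : K * δ = ρ / 4 := by
    rw [hδdef]
    have : (K : ℝ) ≠ 0 := by positivity
    field_simp
  have hδ' : δ ≤ ρ / 4 := by
    rw [← hKδ]
    exact le_mul_of_one_le_left hδpos.le hK1
  refine ⟨⟨e, he, coneWidth L, coneWidth_pos, coneWidth_le, ρ, hρ, δ, by positivity,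
    K, v / (1 + L) ^ (d - 1), by positivity, hinward, ?_, ?_,
    ?_, ?_, ?_⟩⟩
  · intro z hz g hg
    -- Rays of length ρ from the boundary stay in O, so cutting g off outside O changes nothing on
    -- them; after that they may be prolonged to full lines and `lintegral_sweep_le` applies.
    set g' := O.indicator g with hg'
    have hg'm : Measurable g' := hg.indicator hO.measurableSet
    set G : Space d → ℝ≥0∞ := fun x => ∫⁻ r : ℝ, g' (x - r • (e + z)) with hG
    have hGm : Measurable G := by
      refine Measurable.lintegral_prod_right' (f := fun q : Space d × ℝ => g' (q.1 - q.2 • (e + z))) ?_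
      exact hg'm.comp (by fun_prop)
    calc ∫⁻ x in ball x₀ ρ, (∫⁻ r in Set.Ioo (0 : ℝ) ρ, g (x - r • (e + z))) ∂(surfaceMeasure O)
        ≤ ∫⁻ x in ball x₀ ρ, G x ∂(surfaceMeasure O) := by
          refine lintegral_mono_ae ?_
          have h1 : ∀ᵐ x ∂(surfaceMeasure O), x ∈ frontier O :=
            ae_restrict_mem isClosed_frontier.measurableSet
          filter_upwards [ae_restrict_mem measurableSet_ball, ae_restrict_of_ae h1] with x hx hxf
          refine le_trans ?_ (setLIntegral_le_lintegral (Set.Ioo (0 : ℝ) ρ) _)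
          refine setLIntegral_mono' measurableSet_Ioo fun r hr => ?_
          rw [hg', Set.indicator_of_mem (hinward x (frontier_subset_closure hxf) hx r hr z hz)]
      _ ≤ ∫⁻ x in ball x₀ (4 * ρ), G x ∂(surfaceMeasure O) := lintegral_mono_set hsub
      _ ≤ ∫⁻ x, G x ∂((C₀ : ℝ≥0∞) • μ) := lintegral_mono' hup le_rfl
      _ = C₀ * ∫⁻ y : Hyper e, G (graphMap e f y) := by
          rw [lintegral_smul_measure, hμ, lintegral_map hGm hΦ, smul_eq_mul]
      _ ≤ C₀ * (2 * ∫⁻ x, g' x) := by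
          gcongr
          exact lintegral_sweep_le he hf hz hg'm
      _ = (2 * C₀ : ℝ≥0) * ∫⁻ x in O, g x := by
          rw [hg', lintegral_indicator hO.measurableSet]
          push_cast; ring
      _ ≤ _ := by
          gcongr
          rw [hK, add_assoc]
          exact le_self_add
  · intro ε hε g hg
    set A : Set (Space d) := O ∩ (ball x₀ (δ) ∩ {x | infDist x (frontier O) < ε})
      with hA
    have hAm : MeasurableSet A := hO.measurableSet.inter (measurableSet_ball.inter
      (measurableSet_lt (continuous_infDist_pt _).measurable measurable_const))
    have hΛε : (1 + L) * ε < ρ / 4 := by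
      rw [← hKδ]
      exact mul_lt_mul' hKL hε.2 hε.1.le (by positivity)
    -- A point of the layer is ε-close to a boundary point, where the depth vanishes. As the depth
    -- is (1 + L)-Lipschitz, the point lies on a vertical segment of length below (1 + L)ε issuing
    -- from the graph.
    have hkey : ∀ x ∈ A, 0 < depth e f x ∧ depth e f x < (1 + L) * ε ∧
        graphMap e f (hproj e x) ∈ ball x₀ ρ := by
      rintro x ⟨hxO, hxb, hxd⟩
      have hxb' : x ∈ ball x₀ (4 * ρ) := ball_subset_ball (by linarith) hxb
      have h0 : 0 < depth e f x := (hR x hxb').1 hxO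
      obtain ⟨y, hy, hxy⟩ := (infDist_lt_iff ⟨x₀, hx₀⟩).1 hxd
      have hyb : y ∈ ball x₀ (4 * ρ) := by
        rw [mem_ball] at hxb ⊢
        have := dist_triangle_left y x₀ x
        have := hε.2
        linarith
      have hy0 : depth e f y = 0 := (hfr y hyb).1 hy
      have h1 := abs_depth_sub_le he hf x y
      rw [hy0, sub_zero, ← dist_eq_norm, abs_of_pos h0] at h1
      have h2 : depth e f x < (1 + L) * ε :=
        h1.trans_lt (mul_lt_mul_of_pos_left hxy (by positivity))
      refine ⟨h0, h2, ?_⟩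
      have h3 : graphMap e f (hproj e x) = x + depth e f x • e := by
        conv_rhs => rw [← graphMap_sub_depth (f := f) he x]
        rw [depth_graphMap_sub he, sub_add_cancel]
      rw [h3, mem_ball, dist_eq_norm]
      rw [mem_ball, dist_eq_norm] at hxb
      calc ‖x + depth e f x • e - x₀‖ = ‖(x - x₀) + depth e f x • e‖ := by congr 1; abel
        _ ≤ ‖x - x₀‖ + ‖depth e f x • e‖ := norm_add_le _ _
        _ = ‖x - x₀‖ + depth e f x := by
          rw [norm_smul, he, mul_one, Real.norm_of_nonneg h0.le]
        _ < ρ := by linarith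
    set T : ℝ := (K : ℝ) * ε with hT
    have hT' : (1 + L) * ε ≤ T := by
      rw [hT]
      exact mul_le_mul_of_nonneg_right hKL hε.1.le
    set G : Space d → ℝ≥0∞ := fun x => ∫⁻ r in Set.Ioo (0 : ℝ) T, g (x - r • e) with hG
    have hGm : Measurable G := by
      refine Measurable.lintegral_prod_right' (f := fun q : Space d × ℝ => g (q.1 - q.2 • e)) ?_
      exact hg.comp (by fun_prop)
    calc ∫⁻ x in A, g x = ∫⁻ x, A.indicator g x := (lintegral_indicator hAm _).symm
      _ = ∫⁻ y : Hyper e, ∫⁻ s : ℝ, A.indicator g ((y : Space d) + s • e) :=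
          (lintegral_coords he (hg.indicator hAm)).symm
      _ = ∫⁻ y : Hyper e, ∫⁻ s : ℝ, A.indicator g (graphMap e f y - s • e) := by
          refine lintegral_congr fun y => ?_
          rw [← lintegral_sub_left_eq_self _ (f y)]
          refine lintegral_congr fun s => ?_
          rw [graphMap, sub_smul, add_sub_assoc]
      _ ≤ ∫⁻ y : Hyper e, (ball x₀ ρ).indicator G (graphMap e f y) := by
          refine lintegral_mono fun y => ?_
          by_cases hy : graphMap e f y ∈ ball x₀ ρ
          · rw [Set.indicator_of_mem hy, hG]
            change _ ≤ ∫⁻ r in Set.Ioo (0 : ℝ) T, g (graphMap e f y - r • e)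
            rw [← lintegral_indicator measurableSet_Ioo]
            refine lintegral_mono fun s => ?_
            by_cases hs : graphMap e f y - s • e ∈ A
            · have h1 := hkey _ hs
              rw [depth_graphMap_sub he] at h1
              rw [Set.indicator_of_mem hs, Set.indicator_of_mem
                (show s ∈ Set.Ioo (0 : ℝ) T from ⟨h1.1, h1.2.1.trans_le hT'⟩)]
            · rw [Set.indicator_of_notMem hs]
              exact zero_le
          · rw [Set.indicator_of_notMem hy]
            refine (lintegral_eq_zero_of_ae_eq_zero (Eventually.of_forall fun s => ?_)).le
            refine Set.indicator_of_notMem (fun hs => hy ?_) _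
            have := (hkey _ hs).2.2
            rwa [map_sub, map_smul, hproj_self, smul_zero, sub_zero, hproj_graphMap] at this
      _ = ∫⁻ x in ball x₀ ρ, G x ∂μ := by
          rw [hμ, ← lintegral_indicator measurableSet_ball,
            lintegral_map (hGm.indicator measurableSet_ball) hΦ]
      _ = ∫⁻ x in ball x₀ ρ, G x ∂(μ.restrict (ball x₀ (4 * ρ))) := by
          rw [Measure.restrict_restrict measurableSet_ball, Set.inter_eq_left.2 hsub]
      _ ≤ ∫⁻ x in ball x₀ ρ, G x ∂((surfaceMeasure O).restrict (ball x₀ (4 * ρ))) :=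
          lintegral_mono' (Measure.restrict_mono le_rfl hlow) le_rfl
      _ = ∫⁻ x in ball x₀ ρ, G x ∂(surfaceMeasure O) := by
          rw [Measure.restrict_restrict measurableSet_ball, Set.inter_eq_left.2 hsub]
  · linarith
  · intro x hx r hr
    have hxr : ball x r ⊆ ball x₀ (4 * ρ) := by
      refine ball_subset_ball' ?_
      have := hr.2
      rw [mem_ball] at hx
      linarith
    calc surfaceMeasure O (ball x r) = (surfaceMeasure O).restrict (ball x₀ (4 * ρ)) (ball x r) := by
          rw [Measure.restrict_apply measurableSet_ball, Set.inter_eq_left.2 hxr]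
      _ ≤ ((C₀ : ℝ≥0∞) • μ) (ball x r) := hup _
      _ = C₀ * volume (graphMap e f ⁻¹' ball x r) := by
          rw [Measure.smul_apply, hμ, Measure.map_apply hΦ measurableSet_ball, smul_eq_mul]
      _ ≤ C₀ * volume (ball (hproj e x) r) := by
          gcongr
          intro y hy
          rw [Set.mem_preimage, mem_ball, dist_eq_norm] at hy
          rw [mem_ball, dist_eq_norm]
          refine lt_of_le_of_lt ?_ hy
          conv_lhs => rw [← hproj_graphMap (f := f) y, ← map_sub]
          exact norm_hproj_le _
      _ = ENNReal.ofReal (C₀ * v * r ^ (d - 1)) := by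
          rw [volume_hyper_ball he _ hr.1, hve, mul_assoc, ENNReal.ofReal_mul (by positivity),
            mul_comm v, ENNReal.ofReal_mul (pow_nonneg hr.1.le _), ENNReal.ofReal_coe_nnreal]
      _ ≤ _ := by
          refine ENNReal.ofReal_le_ofReal (mul_le_mul_of_nonneg_right ?_ (pow_nonneg hr.1.le _))
          rw [hKr]
          have : (0 : ℝ) ≤ 2 * C₀ := by positivity
          have : (0 : ℝ) ≤ L := L.2
          linarith
  · intro x hxf hx r hr
    have hxr : ball x r ⊆ ball x₀ (4 * ρ) := by
      refine ball_subset_ball' ?_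
      have := hr.2
      rw [mem_ball] at hx
      linarith
    have hx0 : graphMap e f (hproj e x) = x := graphMap_hproj he ((hfr x (hsub hx)).1 hxf)
    calc ENNReal.ofReal (v / (1 + L) ^ (d - 1) * r ^ (d - 1))
        = volume (ball (hproj e x) (r / (1 + L))) := by
          have := hr.1
          rw [volume_hyper_ball he _ (by positivity), hve, ← ENNReal.ofReal_mul (by positivity),
            div_pow]
          congr 1; ring
      _ ≤ volume (graphMap e f ⁻¹' ball x r) := by
          gcongr
          intro y hy
          rw [Set.mem_preimage, mem_ball]
          rw [mem_ball, lt_div_iff₀ (by positivity)] at hy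
          conv_lhs => rw [← hx0]
          refine ((lipschitzWith_graphMap he hf).dist_le_mul _ _).trans_lt ?_
          push_cast
          linarith
      _ = μ (ball x r) := by rw [hμ, Measure.map_apply hΦ measurableSet_ball]
      _ = μ.restrict (ball x₀ (4 * ρ)) (ball x r) := by
          rw [Measure.restrict_apply measurableSet_ball, Set.inter_eq_left.2 hxr]
      _ ≤ (surfaceMeasure O).restrict (ball x₀ (4 * ρ)) (ball x r) := hlow _
      _ = _ := by rw [Measure.restrict_apply measurableSet_ball, Set.inter_eq_left.2 hxr]

end Construction

lemma IsLipschitzDomain.exists_chart {O : Set (Space d)} (hO : IsLipschitzDomain O) {x₀ : Space d}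
    (hx₀ : x₀ ∈ frontier O) : Nonempty (Chart O x₀) := by
  obtain ⟨e, he, L, f, hf, U, hU, hy⟩ := hO.lipschitz_boundary x₀ hx₀
  obtain ⟨r, hr, hrU⟩ := Metric.mem_nhds_iff.1 hU
  refine exists_chart_of_hypograph hO.isOpen he hf (ρ := r / 4) (by positivity) hx₀ fun x hx => ?_
  rw [hy x (hrU (by rwa [mul_div_cancel₀ _ (by norm_num)] at hx)), depth, sub_pos]

end Acoustic

end


noncomputable section

namespace Acoustic

open Metric
open scoped ENNReal NNReal Topology

variable {d : ℕ}

/-! ### Surface measure of the whole boundary -/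

section Surface

variable {O : Set (Space d)}

lemma IsLipschitzDomain.isCompact_frontier (hO : IsLipschitzDomain O) : IsCompact (frontier O) :=
  Metric.isCompact_of_isClosed_isBounded isClosed_frontier
    (hO.isBounded.closure.subset frontier_subset_closure)

lemma surfaceMeasure_univ_lt_top (hO : IsLipschitzDomain O) :
    surfaceMeasure O Set.univ < ⊤ := by
  have h1 : surfaceMeasure O (frontier O) < ⊤ := by
    refine hO.isCompact_frontier.measure_lt_top_of_nhdsWithin fun x hx => ?_
    obtain ⟨Γ⟩ := hO.exists_chart hx
    have hρ := Γ.ρ_pos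
    refine ⟨ball x (Γ.ρ / 2), mem_nhdsWithin_of_mem_nhds (ball_mem_nhds x (by positivity)), ?_⟩
    exact (Γ.upper x (mem_ball_self hρ) (Γ.ρ / 2) ⟨by positivity, by linarith⟩).trans_lt
      ENNReal.ofReal_lt_top
  rw [surfaceMeasure, Measure.restrict_apply MeasurableSet.univ, Set.univ_inter]
  rwa [surfaceMeasure, Measure.restrict_apply isClosed_frontier.measurableSet, Set.inter_self] at h1

lemma isFiniteMeasure_surface (hO : IsLipschitzDomain O) : IsFiniteMeasure (surfaceMeasure O) :=
  ⟨surfaceMeasure_univ_lt_top hO⟩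

/-- The compact boundary is covered by finitely many charts. -/
lemma exists_chart_cover (hO : IsLipschitzDomain O) (r : ∀ x, Chart O x → ℝ)
    (hr : ∀ x Γ, 0 < r x Γ) :
    ∃ (s : Finset (frontier O)) (Γ : ∀ x : frontier O, Chart O x),
      frontier O ⊆ ⋃ x ∈ s, ball (x : Space d) (r x (Γ x)) := by
  let Γ : ∀ x : frontier O, Chart O x := fun x => (hO.exists_chart x.2).some
  obtain ⟨s, hs⟩ := hO.isCompact_frontier.elim_finite_subcover
    (fun x : frontier O => ball (x : Space d) (r x (Γ x))) (fun _ => isOpen_ball)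
    (fun x hx => Set.mem_iUnion.2 ⟨⟨x, hx⟩, mem_ball_self (hr _ _)⟩)
  exact ⟨s, Γ, hs⟩

lemma exists_pos_le {ι : Type*} (s : Finset ι) (f : ι → ℝ) (hf : ∀ i, 0 < f i) :
    ∃ m > 0, ∀ i ∈ s, m ≤ f i := by
  classical
  induction s using Finset.induction with
  | empty => exact ⟨1, one_pos, by simp⟩
  | insert a s _ ih =>
    obtain ⟨m, hm, h⟩ := ih
    refine ⟨min m (f a), lt_min hm (hf a), fun i hi => ?_⟩
    rcases Finset.mem_insert.1 hi with rfl | hi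
    · exact min_le_right _ _
    · exact (min_le_left _ _).trans (h i hi)

/-- Lower Ahlfors regularity of the boundary. -/
lemma exists_surface_lower (hO : IsLipschitzDomain O) {D : ℝ} (hD : 0 < D) :
    ∃ κ > 0, ∀ x ∈ frontier O, ∀ r, 0 < r → r ≤ D →
      ENNReal.ofReal (κ * r ^ (d - 1)) ≤ surfaceMeasure O (ball x r) := by
  obtain ⟨s, Γ, hs⟩ := exists_chart_cover hO (fun _ Γ => Γ.ρ) (fun _ Γ => Γ.ρ_pos)
  obtain ⟨ρ, hρ, hρs⟩ := exists_pos_le s (fun x => (Γ x).ρ) (fun x => (Γ x).ρ_pos)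
  obtain ⟨κ, hκ, hκs⟩ := exists_pos_le s (fun x => (Γ x).κ) (fun x => (Γ x).κ_pos)
  -- The charts only control radii below ρ. Shrinking r by the factor ρ/(ρ + D) brings every r ≤ D
  -- into that range at the price of a constant.
  refine ⟨κ * (ρ / (ρ + D)) ^ (d - 1), by positivity, fun x hx r hr hrD => ?_⟩
  obtain ⟨y, hy, hxy⟩ := Set.mem_iUnion₂.1 (hs hx)
  have h0 : ρ / (ρ + D) * r < ρ := by
    rw [div_mul_eq_mul_div, div_lt_iff₀ (by positivity)]
    nlinarith
  have h1 : ρ / (ρ + D) * r ≤ r := by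
    refine mul_le_of_le_one_left hr.le ?_
    rw [div_le_one (by positivity)]
    linarith
  calc ENNReal.ofReal (κ * (ρ / (ρ + D)) ^ (d - 1) * r ^ (d - 1))
      ≤ ENNReal.ofReal ((Γ y).κ * (ρ / (ρ + D) * r) ^ (d - 1)) := by
        refine ENNReal.ofReal_le_ofReal ?_
        rw [mul_pow, ← mul_assoc]
        gcongr
        exact hκs y hy
    _ ≤ surfaceMeasure O (ball x (ρ / (ρ + D) * r)) :=
        (Γ y).lower x hx hxy _ ⟨by positivity, h0.trans_le (hρs y hy)⟩
    _ ≤ _ := measure_mono (ball_subset_ball h1)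

lemma ae_surface_mem : ∀ᵐ x ∂(surfaceMeasure O), x ∈ frontier O :=
  ae_restrict_mem isClosed_frontier.measurableSet

end Surface

/-! ### Mollification -/

/-- A weighted Cauchy-Schwarz inequality. -/
lemma sq_lintegral_mul_le {α : Type*} [MeasurableSpace α] {μ : Measure α} {w f : α → ℝ≥0∞}
    (hw : AEMeasurable w μ) (hf : AEMeasurable f μ) :
    (∫⁻ x, w x * f x ∂μ) ^ 2 ≤ (∫⁻ x, w x ∂μ) * ∫⁻ x, w x * f x ^ 2 ∂μ := by
  have h1 := ENNReal.lintegral_mul_le_Lp_mul_Lq μ Real.HolderConjugate.two_two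
    (f := fun x => w x ^ (2⁻¹ : ℝ)) (g := fun x => w x ^ (2⁻¹ : ℝ) * f x)
    (hw.pow_const _) ((hw.pow_const _).mul hf)
  have h2 : ∀ x, w x ^ (2⁻¹ : ℝ) * w x ^ (2⁻¹ : ℝ) = w x := fun x => by
    rw [← ENNReal.rpow_add_of_nonneg _ _ (by norm_num) (by norm_num)]
    norm_num
  have h3 : ∀ x, (w x ^ (2⁻¹ : ℝ)) ^ (2 : ℝ) = w x := fun x => by
    rw [← ENNReal.rpow_mul]; norm_num
  have h4 : ∀ x, (w x ^ (2⁻¹ : ℝ) * f x) ^ (2 : ℝ) = w x * f x ^ 2 := fun x => by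
    rw [ENNReal.mul_rpow_of_nonneg _ _ (by norm_num), h3, ENNReal.rpow_two]
  simp only [Pi.mul_apply, ← mul_assoc, h2, h3, h4] at h1
  refine (pow_le_pow_left' h1 2).trans (le_of_eq ?_)
  rw [mul_pow, ← ENNReal.rpow_two, ← ENNReal.rpow_two, ← ENNReal.rpow_mul, ← ENNReal.rpow_mul]
  norm_num

lemma eLpNorm_two_sq {α X : Type*} [MeasurableSpace α] {μ : Measure α} [NormedAddCommGroup X]
    (f : α → X) : eLpNorm f 2 μ ^ 2 = ∫⁻ x, ‖f x‖ₑ ^ 2 ∂μ := by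
  have := eLpNorm_nnreal_pow_eq_lintegral (μ := μ) (f := f) (p := 2) (by norm_num)
  simpa using this

/-- The mollification of `u` by `ψ`. -/
def mol {X : Type*} [NormedAddCommGroup X] [NormedSpace ℝ X] (ψ : Space d → ℝ) (u : Space d → X)
    (x : Space d) : X := ∫ t, ψ (x - t) • u t

section Mollify

variable {X : Type*} [NormedAddCommGroup X] [NormedSpace ℝ X]

lemma mol_eq_convolution (ψ : Space d → ℝ) (u : Space d → X) :
    mol ψ u = convolution u ψ (ContinuousLinearMap.lsmul ℝ ℝ).flip volume := by
  funext x; rfl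

lemma mol_apply (ψ : Space d → ℝ) (u : Space d → X) (x : Space d) :
    mol ψ u x = ∫ z, ψ z • u (x - z) := by
  rw [mol, ← integral_sub_left_eq_self _ volume x]
  simp

/-- A mollifier: smooth, nonnegative, of total mass one. -/
structure IsMollifier (ψ : Space d → ℝ) : Prop where
  smooth : ContDiff ℝ ∞ ψ
  compact : HasCompactSupport ψ
  nonneg : ∀ x, 0 ≤ ψ x
  integral : ∫ x, ψ x = 1

lemma exists_mollifier (a : Space d) {r : ℝ} (hr : 0 < r) :
    ∃ ψ : Space d → ℝ, IsMollifier ψ ∧ tsupport ψ ⊆ closedBall a r := by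
  let b : ContDiffBump a := ⟨r / 2, r, by positivity, by linarith⟩
  exact ⟨b.normed volume, ⟨b.contDiff_normed, b.hasCompactSupport_normed, b.nonneg_normed,
    b.integral_normed⟩, by rw [b.tsupport_normed_eq]⟩

lemma IsMollifier.lintegral {ψ : Space d → ℝ} (hψ : IsMollifier ψ) :
    ∫⁻ x, ENNReal.ofReal (ψ x) = 1 := by
  rw [← ofReal_integral_eq_lintegral_ofReal
    (hψ.smooth.continuous.integrable_of_hasCompactSupport hψ.compact)
    (Eventually.of_forall hψ.nonneg), hψ.integral, ENNReal.ofReal_one]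

lemma IsMollifier.integrable {ψ : Space d → ℝ} (hψ : IsMollifier ψ) {u : Space d → X}
    (hu : LocallyIntegrable u) (x : Space d) : Integrable fun z => ψ z • u (x - z) := by
  have h1 : Integrable fun t => ψ (x - t) • u t := by
    have := hψ.compact.convolutionExists_right ((ContinuousLinearMap.lsmul ℝ ℝ).flip :
      X →L[ℝ] ℝ →L[ℝ] X) hu hψ.smooth.continuous x
    exact this
  have h2 := h1.comp_sub_left x
  simpa using h2

lemma IsMollifier.contDiff [CompleteSpace X] {ψ : Space d → ℝ} (hψ : IsMollifier ψ)
    {u : Space d → X} (hu : LocallyIntegrable u) : ContDiff ℝ ∞ (mol ψ u) := by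
  rw [mol_eq_convolution]
  exact hψ.compact.contDiff_convolution_right _ hu hψ.smooth

/-- Mollification is close to the identity in `L²` when translations are. -/
lemma IsMollifier.eLpNorm_sub_le [CompleteSpace X] {ψ : Space d → ℝ} (hψ : IsMollifier ψ)
    {u : Space d → X} (hu : MemLp u 2) {ε : ℝ≥0∞}
    (h : ∀ z ∈ Function.support ψ, eLpNorm (fun x => u (x - z) - u x) 2 volume ≤ ε) :
    eLpNorm (fun x => mol ψ u x - u x) 2 volume ≤ ε := by
  have hloc : LocallyIntegrable u := hu.locallyIntegrable (by norm_num)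
  have hψm : Measurable ψ := hψ.smooth.continuous.measurable
  have hint : Integrable ψ := hψ.smooth.continuous.integrable_of_hasCompactSupport hψ.compact
  -- Exchanging the integrals below requires joint measurability, so a strongly measurable
  -- representative replaces u.
  obtain ⟨u', hu'm, hu'⟩ := hu.1
  have hae : ∀ x, (fun z => u (x - z)) =ᵐ[volume] fun z => u' (x - z) := fun x =>
    (quasiMeasurePreserving_sub_left volume x).ae_eq_comp hu'
  have haez : ∀ z, (fun x => u (x - z)) =ᵐ[volume] fun x => u' (x - z) := fun z =>
    (measurePreserving_sub_right volume z).quasiMeasurePreserving.ae_eq_comp hu'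
  -- Since ψ has mass one, the difference is the ψ-average of u(x - z) - u(x), and the weighted
  -- Cauchy-Schwarz inequality moves the square inside the average.
  have h1 : ∀ᵐ x, ‖mol ψ u x - u x‖ₑ ^ 2 ≤
      ∫⁻ z, ENNReal.ofReal (ψ z) * ‖u' (x - z) - u' x‖ₑ ^ 2 := by
    filter_upwards [hu'] with x hx
    have e1 : mol ψ u x - u x = ∫ z, ψ z • (u (x - z) - u x) := by
      simp_rw [smul_sub]
      rw [integral_sub (hψ.integrable hloc x) (hint.smul_const _), integral_smul_const, hψ.integral,
        one_smul, mol_apply]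
    have e2 : ‖mol ψ u x - u x‖ₑ ≤ ∫⁻ z, ENNReal.ofReal (ψ z) * ‖u' (x - z) - u' x‖ₑ := by
      rw [e1]
      refine (enorm_integral_le_lintegral_enorm _).trans (lintegral_mono_ae ?_)
      filter_upwards [hae x] with z hz
      rw [enorm_smul, hz, hx, Real.enorm_of_nonneg (hψ.nonneg z)]
    refine (pow_le_pow_left' e2 2).trans ?_
    refine (sq_lintegral_mul_le hψm.ennreal_ofReal.aemeasurable ?_).trans ?_
    · exact (((hu'm.comp_measurable (by fun_prop)).sub stronglyMeasurable_const).enorm).aemeasurable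
    · rw [hψ.lintegral, one_mul]
  have hF : Measurable fun q : Space d × Space d =>
      ENNReal.ofReal (ψ q.2) * ‖u' (q.1 - q.2) - u' q.1‖ₑ ^ 2 := by
    refine (hψm.comp measurable_snd).ennreal_ofReal.mul (Measurable.pow_const ?_ 2)
    exact ((hu'm.comp_measurable (measurable_fst.sub measurable_snd)).sub
      (hu'm.comp_measurable measurable_fst)).enorm
  have h2 : eLpNorm (fun x => mol ψ u x - u x) 2 volume ^ 2 ≤ ε ^ 2 := by
    rw [eLpNorm_two_sq]
    calc ∫⁻ x, ‖mol ψ u x - u x‖ₑ ^ 2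
        ≤ ∫⁻ x, ∫⁻ z, ENNReal.ofReal (ψ z) * ‖u' (x - z) - u' x‖ₑ ^ 2 := lintegral_mono_ae h1
      _ = ∫⁻ z, ∫⁻ x, ENNReal.ofReal (ψ z) * ‖u' (x - z) - u' x‖ₑ ^ 2 :=
          lintegral_lintegral_swap hF.aemeasurable
      _ ≤ ∫⁻ z, ENNReal.ofReal (ψ z) * ε ^ 2 := by
          refine lintegral_mono fun z => ?_
          rw [lintegral_const_mul']
          swap
          · exact ENNReal.ofReal_ne_top
          by_cases hz : z ∈ Function.support ψ
          · gcongr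
            have e : (fun x => u' (x - z) - u' x) =ᵐ[volume] fun x => u (x - z) - u x := by
              filter_upwards [haez z, hu'] with x h1 h2
              rw [h1, h2]
            have e2 := eLpNorm_two_sq (μ := volume) fun x => u' (x - z) - u' x
            rw [← e2, eLpNorm_congr_ae e]
            exact pow_le_pow_left' (h z hz) 2
          · rw [Function.notMem_support.1 hz]; simp
      _ = ε ^ 2 := by
          rw [lintegral_mul_const _ hψm.ennreal_ofReal, hψ.lintegral, one_mul]
  exact (ENNReal.pow_right_strictMono two_ne_zero).le_iff_le.1 h2

/-- Translations are continuous in `L²`. -/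
lemma tendsto_eLpNorm_translate {u : Space d → X} (hu : MemLp u 2) :
    Tendsto (fun z => eLpNorm (fun x => u (x - z) - u x) 2 volume) (𝓝 0) (𝓝 0) := by
  let g : Space d → C(Space d, Space d) := fun z => ⟨fun x => x - z, by fun_prop⟩
  have hg : Continuous g := by
    have : Continuous fun q : Space d × Space d => q.2 - q.1 := by fun_prop
    exact (ContinuousMap.curry ⟨_, this⟩).continuous
  have hgm : ∀ z, MeasurePreserving (g z) volume volume := fun z =>
    measurePreserving_sub_right volume z
  have h1 := (Continuous.compMeasurePreservingLp (f := fun _ : Space d => hu.toLp u)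
    continuous_const hg hgm (by norm_num)).tendsto 0
  have h2 := tendsto_iff_edist_tendsto_0.1 h1
  refine h2.congr fun z => ?_
  rw [Lp.edist_def]
  refine eLpNorm_congr_ae ?_
  have e0 := hu.coeFn_toLp
  filter_upwards [Lp.coeFn_compMeasurePreserving (hu.toLp u) (hgm z),
    Lp.coeFn_compMeasurePreserving (hu.toLp u) (hgm 0), e0,
    (hgm z).quasiMeasurePreserving.ae_eq_comp e0, (hgm 0).quasiMeasurePreserving.ae_eq_comp e0]
    with x a1 a2 a3 a4 a5
  rw [Pi.sub_apply, a1, a2, a4, a5]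
  simp [g]

end Mollify

end Acoustic

end


noncomputable section

namespace Acoustic

open Metric
open scoped ENNReal NNReal Topology

variable {d : ℕ}

/-! ### Approximation in `H¹(O)` -/

/-- Near `K`, the set `O` is stable under translation along an open cone of small vectors. -/
def InwardCone (O K : Set (Space d)) : Prop :=
  ∃ (v : Space d) (c η : ℝ), 0 < c ∧ 0 < η ∧ ∀ y ∈ O, (∃ x ∈ K, dist y x < η) →
    ∀ t ∈ Set.Ioo 0 η, ∀ z ∈ closedBall (t • v) (t * c), y - z ∈ O

section Local

variable {O : Set (Space d)}

lemma memLp_indicator {X : Type*} [NormedAddCommGroup X] (hO : IsOpen O)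
    (p : Lp X 2 (volume.restrict O)) : MemLp (O.indicator p) 2 volume :=
  (memLp_indicator_iff_restrict hO.measurableSet).2 (Lp.memLp p)

lemma pderiv_mol {ψ : Space d → ℝ} (hψ : IsMollifier ψ) {u : Space d → ℂ}
    (hu : LocallyIntegrable u) (i : Fin d) (x : Space d) :
    pderiv i (mol ψ u) x = ∫ t, (fderiv ℝ ψ (x - t) (EuclideanSpace.single i 1)) • u t := by
  have h1 := hψ.compact.hasFDerivAt_convolution_right (μ := volume)
    (ContinuousLinearMap.lsmul ℝ ℝ).flip hu (hψ.smooth.of_le (by simp)) x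
  rw [pderiv, mol_eq_convolution, h1.fderiv]
  have h2 := convolution_precompR_apply (μ := volume)
    (L := ((ContinuousLinearMap.lsmul ℝ ℝ).flip : ℂ →L[ℝ] ℝ →L[ℝ] ℂ))
    (f := u) (g := fderiv ℝ ψ) hu (hψ.compact.fderiv ℝ) (hψ.smooth.continuous_fderiv (by simp)) x
    (EuclideanSpace.single i (1 : ℝ))
  rw [h2]
  rfl

lemma tsupport_reflect_subset {ψ : Space d → ℝ} (hψ : IsMollifier ψ) (x : Space d) :
    tsupport (fun t => (ψ (x - t) : ℂ)) ⊆ (fun z => x - z) '' tsupport ψ := by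
  refine closure_minimal (fun t ht => ⟨x - t, subset_tsupport ψ ?_, by simp⟩)
    (hψ.compact.isCompact.image (by fun_prop)).isClosed
  simpa using ht

/-- The reflected mollifier is the function inserted into the definition of the weak gradient in
order to differentiate a mollification at x. It is admissible precisely because x - supp ψ is in O.
-/
lemma isTest_reflect {ψ : Space d → ℝ} (hψ : IsMollifier ψ) {x : Space d}
    (h : ∀ z ∈ tsupport ψ, x - z ∈ O) : IsTest O fun t => (ψ (x - t) : ℂ) where
  smooth := Complex.ofRealCLM.contDiff.comp (hψ.smooth.comp (contDiff_const.sub contDiff_id))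
  compact := (hψ.compact.isCompact.image (f := fun z => x - z)
    (by fun_prop)).of_isClosed_subset (isClosed_tsupport _) (tsupport_reflect_subset hψ x)
  supp := (tsupport_reflect_subset hψ x).trans (by rintro - ⟨z, hz, rfl⟩; exact h z hz)

lemma pderiv_reflect {ψ : Space d → ℝ} (hψ : IsMollifier ψ) (i : Fin d) (x t : Space d) :
    pderiv i (fun t => (ψ (x - t) : ℂ)) t =
      -((fderiv ℝ ψ (x - t) (EuclideanSpace.single i 1) : ℝ) : ℂ) := by
  have h1 : HasFDerivAt ψ (fderiv ℝ ψ (x - t)) (x - t) :=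
    (hψ.smooth.differentiable (by simp) _).hasFDerivAt
  have h2 : HasFDerivAt (fun t : Space d => x - t) (-ContinuousLinearMap.id ℝ (Space d)) t :=
    (hasFDerivAt_id t).const_sub x
  have h3 := Complex.ofRealCLM.hasFDerivAt.comp t (h1.comp t h2)
  rw [pderiv]
  have h4 : fderiv ℝ (fun t => (ψ (x - t) : ℂ)) t = _ := h3.fderiv
  rw [h4]
  simp

/-- Where the mollifier stays inside the domain, mollification commutes with weak derivatives. -/
lemma pderiv_mol_of_inside (hO : IsOpen O) {p : L2 O} {F : L2Vec O} (h : HasWeakGrad O p F)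
    {ψ : Space d → ℝ} (hψ : IsMollifier ψ) {x : Space d} (hx : ∀ z ∈ tsupport ψ, x - z ∈ O)
    (i : Fin d) :
    pderiv i (mol ψ (O.indicator p)) x = mol ψ (O.indicator fun t => F t i) x := by
  have h1 := h _ (isTest_reflect hψ hx) i
  have hloc : LocallyIntegrable (O.indicator p) :=
    (memLp_indicator hO p).locallyIntegrable (by norm_num)
  rw [pderiv_mol hψ hloc, mol]
  have e1 : ∫ t, (fderiv ℝ ψ (x - t) (EuclideanSpace.single i 1)) • O.indicator p t =
      ∫ t in O, ((fderiv ℝ ψ (x - t) (EuclideanSpace.single i 1) : ℝ) : ℂ) * p t := by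
    rw [← integral_indicator hO.measurableSet]
    refine integral_congr_ae (Eventually.of_forall fun t => ?_)
    by_cases ht : t ∈ O <;> simp [ht]
  have e2 : ∫ t, ψ (x - t) • O.indicator (fun t => F t i) t = ∫ t in O, F t i * (ψ (x - t) : ℂ) := by
    rw [← integral_indicator hO.measurableSet]
    refine integral_congr_ae (Eventually.of_forall fun t => ?_)
    by_cases ht : t ∈ O <;> simp [ht, mul_comm]
  rw [e1, e2, ← neg_inj, ← h1, ← integral_neg]
  refine integral_congr_ae (Eventually.of_forall fun t => ?_)
  simp only [pderiv_reflect hψ]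
  ring

lemma mol_eq_zero_of_far {X : Type*} [NormedAddCommGroup X] [NormedSpace ℝ X] {ψ : Space d → ℝ}
    {u : Space d → X} {K : Set (Space d)} (hu : ∀ᵐ t, t ∉ K → u t = 0) {x : Space d}
    (hx : ∀ t ∈ K, x - t ∉ tsupport ψ) : mol ψ u x = 0 := by
  refine integral_eq_zero_of_ae ?_
  filter_upwards [hu] with t ht
  by_cases h : t ∈ K
  · rw [image_eq_zero_of_notMem_tsupport (hx t h), zero_smul]; rfl
  · rw [ht h, smul_zero]; rfl

lemma mol_apply_coord {ψ : Space d → ℝ} (hψ : IsMollifier ψ) {U : Space d → EuclideanSpace ℂ (Fin d)}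
    (hU : LocallyIntegrable U) (x : Space d) (i : Fin d) :
    mol ψ U x i = mol ψ (fun t => U t i) x := by
  have h1 : Integrable fun t => ψ (x - t) • U t := by
    have := hψ.compact.convolutionExists_right ((ContinuousLinearMap.lsmul ℝ ℝ).flip :
      EuclideanSpace ℂ (Fin d) →L[ℝ] ℝ →L[ℝ] EuclideanSpace ℂ (Fin d)) hU hψ.smooth.continuous x
    exact this
  have := (EuclideanSpace.proj (𝕜 := ℂ) i : EuclideanSpace ℂ (Fin d) →L[ℂ] ℂ).integral_comp_comm h1
  exact this.symm

lemma ae_indicator {X : Type*} [Zero X] (hO : IsOpen O) {K : Set (Space d)} {f : Space d → X}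
    (h : ∀ᵐ x ∂(volume.restrict O), x ∉ K → f x = 0) :
    ∀ᵐ x, x ∉ K → O.indicator f x = 0 := by
  filter_upwards [(ae_restrict_iff' hO.measurableSet).1 h] with x hx hxK
  by_cases hxO : x ∈ O
  · rw [Set.indicator_of_mem hxO, hx hxO hxK]
  · rw [Set.indicator_of_notMem hxO]

/-- The mollifier is centred at tv rather than at 0. At points of O near K the cone condition then
keeps x - supp ψ inside O, so mollification commutes with the gradient up to the boundary; away from
K both sides vanish. -/
lemma exists_mollifier_grad (hO : IsOpen O) {p : L2 O} {F : L2Vec O} (h : HasWeakGrad O p F)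
    {K : Set (Space d)} (hp : ∀ᵐ x ∂(volume.restrict O), x ∉ K → p x = 0)
    (hF : ∀ᵐ x ∂(volume.restrict O), x ∉ K → F x = 0) (hK : InwardCone O K) {ε : ℝ} (hε : 0 < ε) :
    ∃ ψ : Space d → ℝ, IsMollifier ψ ∧ tsupport ψ ⊆ ball 0 ε ∧
      ∀ x ∈ O, grad (mol ψ (O.indicator p)) x = mol ψ (O.indicator F) x := by
  obtain ⟨v, c, η, hc, hη, hcone⟩ := hK
  set m := min ε (η / 2) with hm
  have hm0 : 0 < m := lt_min hε (by positivity)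
  -- The ball of radius tc about tv lies in the ball of radius t(‖v‖ + c) ≤ m/2 about 0.
  set t := min (η / 2) (m / (2 * (‖v‖ + c))) with ht
  have ht0 : 0 < t := by
    refine lt_min (by positivity) ?_
    have := norm_nonneg v
    positivity
  have htη : t < η := (min_le_left _ _).trans_lt (by linarith)
  have htm : t * (‖v‖ + c) < m := by
    have hpos : 0 < ‖v‖ + c := by have := norm_nonneg v; positivity
    calc t * (‖v‖ + c) ≤ m / (2 * (‖v‖ + c)) * (‖v‖ + c) := by
          gcongr; exact min_le_right _ _
      _ = m / 2 := by field_simp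
      _ < m := by linarith
  obtain ⟨ψ, hψ, hsupp⟩ := exists_mollifier (t • v) (r := t * c) (by positivity)
  have hsm : tsupport ψ ⊆ ball 0 m := by
    refine hsupp.trans fun z hz => ?_
    rw [mem_ball_zero_iff]
    rw [mem_closedBall, dist_eq_norm] at hz
    calc ‖z‖ = ‖(z - t • v) + t • v‖ := by rw [sub_add_cancel]
      _ ≤ ‖z - t • v‖ + ‖t • v‖ := norm_add_le _ _
      _ ≤ t * c + t * ‖v‖ := by rw [norm_smul, Real.norm_of_nonneg ht0.le]; gcongr
      _ < m := by rw [← mul_add, add_comm c]; exact htm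
  refine ⟨ψ, hψ, hsm.trans (ball_subset_ball (min_le_left _ _)), fun x hx => ?_⟩
  have hlocF : LocallyIntegrable (O.indicator F) :=
    (memLp_indicator hO F).locallyIntegrable (by norm_num)
  ext i
  rw [mol_apply_coord hψ hlocF]
  have hind : (fun t => O.indicator F t i) = O.indicator fun t => F t i := by
    funext t
    by_cases ht : t ∈ O <;> simp [ht]
  rw [hind]
  change pderiv i _ x = _
  by_cases hxK : ∃ k ∈ K, dist x k < η
  · exact pderiv_mol_of_inside hO h hψ
      (fun z hz => hcone x hx hxK t ⟨ht0, htη⟩ z (hsupp hz)) i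
  · push Not at hxK
    have hfar : ∀ x' ∈ ball x (η / 2), ∀ k ∈ K, x' - k ∉ tsupport ψ := by
      intro x' hx' k hk hmem
      have h1 := hsm hmem
      rw [mem_ball_zero_iff, ← dist_eq_norm] at h1
      have h2 := hxK k hk
      rw [mem_ball, dist_comm] at hx'
      have h3 := dist_triangle x x' k
      have h4 : m ≤ η / 2 := min_le_right _ _
      linarith
    have h1 : mol ψ (O.indicator p) =ᶠ[𝓝 x] fun _ => 0 := by
      filter_upwards [ball_mem_nhds x (half_pos hη)] with x' hx'
      exact mol_eq_zero_of_far (ae_indicator hO hp) (hfar x' hx')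
    rw [pderiv, h1.fderiv_eq, mol_eq_zero_of_far (K := K) _
      (hfar x (mem_ball_self (half_pos hη)))]
    · simp
    · refine ae_indicator hO ?_
      filter_upwards [hF] with y hy hyK
      rw [hy hyK]; rfl

lemma norm_sub_le_of_eLpNorm {X : Type*} [NormedAddCommGroup X] (hO : IsOpen O)
    {p q : Lp X 2 (volume.restrict O)} {f : Space d → X} (hq : q =ᵐ[volume.restrict O] f) {ε : ℝ}
    (hε : 0 ≤ ε) (h : eLpNorm (fun x => f x - O.indicator p x) 2 volume ≤ ENNReal.ofReal ε) :
    ‖q - p‖ ≤ ε := by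
  rw [Lp.norm_def]
  refine ENNReal.toReal_le_of_le_ofReal hε ?_
  have e : (q - p : Lp X 2 (volume.restrict O)) =ᵐ[volume.restrict O]
      fun x => f x - O.indicator p x := by
    filter_upwards [Lp.coeFn_sub q p, hq, ae_restrict_mem hO.measurableSet] with x h1 h2 h3
    rw [h1, Pi.sub_apply, h2, Set.indicator_of_mem h3]
  rw [eLpNorm_congr_ae e]
  exact (eLpNorm_mono_measure _ Measure.restrict_le_self).trans h

lemma exists_translate_le {X : Type*} [NormedAddCommGroup X] [NormedSpace ℝ X] {u : Space d → X} (hu : MemLp u 2)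
    {ε : ℝ} (hε : 0 < ε) : ∃ r > 0, ∀ z ∈ ball (0 : Space d) r,
      eLpNorm (fun x => u (x - z) - u x) 2 volume ≤ ENNReal.ofReal ε := by
  have h := (tendsto_eLpNorm_translate hu).eventually
    (Iic_mem_nhds (ENNReal.ofReal_pos.2 hε))
  obtain ⟨r, hr, hb⟩ := Metric.eventually_nhds_iff_ball.1 h
  exact ⟨r, hr, hb⟩

/-- Approximation of an element of `H¹(O)` that is supported where `O` has an inward cone. -/
lemma exists_mollifier_approx (hO : IsOpen O) {p : L2 O} {F : L2Vec O} (h : HasWeakGrad O p F)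
    {K : Set (Space d)} (hp : ∀ᵐ x ∂(volume.restrict O), x ∉ K → p x = 0)
    (hF : ∀ᵐ x ∂(volume.restrict O), x ∉ K → F x = 0) (hK : InwardCone O K) {ε : ℝ} (hε : 0 < ε) :
    ∃ ψ : Space d → ℝ, IsMollifier ψ ∧ tsupport ψ ⊆ ball 0 ε ∧
      ∀ (q : L2 O) (G : L2Vec O), q =ᵐ[volume.restrict O] mol ψ (O.indicator p) →
        G =ᵐ[volume.restrict O] grad (mol ψ (O.indicator p)) → ‖q - p‖ ≤ ε ∧ ‖G - F‖ ≤ ε := by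
  obtain ⟨r, hr, h1⟩ := exists_translate_le (memLp_indicator hO p) hε
  obtain ⟨s, hs, h2⟩ := exists_translate_le (memLp_indicator hO F) hε
  obtain ⟨ψ, hψ, hsupp, hg⟩ := exists_mollifier_grad hO h hp hF hK (lt_min hε (lt_min hr hs))
  have hψs : ∀ z ∈ Function.support ψ, z ∈ ball (0 : Space d) (min r s) := fun z hz =>
    ball_subset_ball (min_le_right _ _) (hsupp (subset_tsupport ψ hz))
  refine ⟨ψ, hψ, hsupp.trans (ball_subset_ball (min_le_left _ _)), fun q G hq hG => ⟨?_, ?_⟩⟩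
  · exact norm_sub_le_of_eLpNorm hO hq hε.le (hψ.eLpNorm_sub_le (memLp_indicator hO p)
      fun z hz => h1 z (ball_subset_ball (min_le_left _ _) (hψs z hz)))
  · refine norm_sub_le_of_eLpNorm hO (f := mol ψ (O.indicator F)) ?_ hε.le
      (hψ.eLpNorm_sub_le (memLp_indicator hO F)
      fun z hz => h2 z (ball_subset_ball (min_le_right _ _) (hψs z hz)))
    filter_upwards [hG, ae_restrict_mem hO.measurableSet] with x hx hxO
    rw [hx, hg x hxO]

lemma inwardCone_of_compact (hO : IsOpen O) {K : Set (Space d)} (hK : IsCompact K) (hKO : K ⊆ O) :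
    InwardCone O K := by
  obtain ⟨δ, hδ, h⟩ := hK.exists_cthickening_subset_open hO hKO
  refine ⟨0, 1, δ / 2, one_pos, by positivity, fun y _ ⟨x, hx, hyx⟩ t ht z hz => h ?_⟩
  refine mem_cthickening_of_dist_le _ x δ K hx ?_
  rw [smul_zero, mul_one, mem_closedBall_zero_iff] at hz
  have h1 : dist (y - z) y = ‖z‖ := by rw [dist_eq_norm]; simp
  have := dist_triangle (y - z) y x
  linarith [ht.2]

/-- An element of `H¹(O)` with compact support in `O` belongs to `H¹₀(O)`. -/
lemma hasWeakGradZero_of_compact (hO : IsOpen O) {p : L2 O} {F : L2Vec O} (h : HasWeakGrad O p F)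
    {K : Set (Space d)} (hK : IsCompact K) (hKO : K ⊆ O)
    (hp : ∀ᵐ x ∂(volume.restrict O), x ∉ K → p x = 0)
    (hF : ∀ᵐ x ∂(volume.restrict O), x ∉ K → F x = 0) : HasWeakGradZero O p F := by
  refine ⟨h, ?_⟩
  obtain ⟨δ, hδ, hδO⟩ := hK.exists_cthickening_subset_open hO hKO
  refine Metric.mem_closure_iff.2 fun ε hε => ?_
  obtain ⟨ψ, hψ, hsupp, hψq⟩ := exists_mollifier_approx hO h hp hF
    (inwardCone_of_compact hO hK hKO) (lt_min hδ (half_pos hε))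
  set φ := mol ψ (O.indicator p) with hφ
  -- Mollification at scale below δ enlarges the support by less than δ, so it remains a compact
  -- subset of O.
  have hsub : tsupport φ ⊆ cthickening δ K := by
    refine closure_minimal (fun x hx => ?_) isClosed_cthickening
    by_contra hxK
    refine hx (mol_eq_zero_of_far (ae_indicator hO hp) fun t ht hmem => hxK ?_)
    have h1 := hsupp hmem
    rw [mem_ball_zero_iff, ← dist_eq_norm] at h1
    exact mem_cthickening_of_dist_le _ t δ K ht (h1.le.trans (min_le_left _ _))
  have htest : IsTest O φ := ⟨hψ.contDiff ((memLp_indicator hO p).locallyIntegrable (by norm_num)),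
    hK.cthickening.of_isClosed_subset (isClosed_tsupport _) hsub, hsub.trans hδO⟩
  have hgrad : MemLp (grad φ) 2 (volume.restrict O) :=
    memLp_piLp_iff.2 fun i => htest.memLp_pderiv i
  obtain ⟨e1, e2⟩ := hψq _ _ htest.memLp.coeFn_toLp hgrad.coeFn_toLp
  refine ⟨(htest.memLp.toLp, hgrad.toLp), ⟨φ, htest, htest.memLp.coeFn_toLp, hgrad.coeFn_toLp⟩, ?_⟩
  rw [dist_comm, Prod.dist_eq, max_lt_iff, dist_eq_norm, dist_eq_norm]
  have : min δ (ε / 2) < ε := (min_le_right _ _).trans_lt (by linarith)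
  exact ⟨e1.trans_lt this, e2.trans_lt this⟩

end Local

end Acoustic

end


/-! ### Localisation and density of smooth functions in H¹(O) -/

noncomputable section

namespace Acoustic

open Metric
open scoped ENNReal NNReal Topology Manifold

variable {d : ℕ}

section Product

variable {O : Set (Space d)}

lemma pderiv_mul {χ φ : Space d → ℂ} (hχ : ContDiff ℝ ∞ χ) (hφ : ContDiff ℝ ∞ φ) (i : Fin d)
    (x : Space d) : pderiv i (fun y => χ y * φ y) x = χ x * pderiv i φ x + pderiv i χ x * φ x := by
  rw [pderiv, fderiv_fun_mul (hχ.differentiable (by simp) x) (hφ.differentiable (by simp) x)]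
  simp [pderiv, mul_comm]

lemma continuous_pderiv {φ : Space d → ℂ} (hφ : ContDiff ℝ ∞ φ) (i : Fin d) :
    Continuous (pderiv i φ) :=
  (hφ.continuous_fderiv (by simp)).clm_apply continuous_const

lemma continuous_grad {φ : Space d → ℂ} (hφ : ContDiff ℝ ∞ φ) : Continuous (grad φ) :=
  (PiLp.continuous_toLp 2 _).comp (continuous_pi fun i => continuous_pderiv hφ i)

lemma IsTest.mul {χ φ : Space d → ℂ} (hχ : ContDiff ℝ ∞ χ) (hφ : IsTest O φ) :
    IsTest O fun y => χ y * φ y :=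
  ⟨hχ.mul hφ.smooth, hφ.compact.mul_left, (tsupport_mul_subset_right).trans hφ.supp⟩

/-- The product of an element of `H¹(O)` with a smooth compactly supported function. -/
lemma HasWeakGrad.mul_smooth {p : L2 O} {F : L2Vec O} (h : HasWeakGrad O p F)
    {χ : Space d → ℂ} (hχ : ContDiff ℝ ∞ χ) (hc : HasCompactSupport χ) :
    ∃ (q : L2 O) (G : L2Vec O), q =ᵐ[volume.restrict O] (fun x => χ x * p x) ∧
      G =ᵐ[volume.restrict O] (fun x => χ x • F x + p x • grad χ x) ∧ HasWeakGrad O q G := by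
  obtain ⟨C, hC⟩ := hc.exists_bound_of_continuous hχ.continuous
  have hgc : HasCompactSupport (grad χ) := by
    refine (hc.fderiv ℝ).mono fun x hx => ?_
    intro h0
    refine hx ?_
    ext i
    simp [grad, pderiv, h0]
  obtain ⟨D, hD⟩ := hgc.exists_bound_of_continuous (continuous_grad hχ)
  have m1 : MemLp (fun x => χ x * p x) 2 (volume.restrict O) := by
    refine (Lp.memLp p).of_le_mul (c := C)
      (hχ.continuous.aestronglyMeasurable.mul (Lp.aestronglyMeasurable p))
      (Eventually.of_forall fun x => ?_)
    rw [norm_mul]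
    exact mul_le_mul_of_nonneg_right (hC x) (norm_nonneg _)
  have m2 : MemLp (fun x => χ x • F x) 2 (volume.restrict O) := by
    refine (Lp.memLp F).of_le_mul (c := C)
      (hχ.continuous.aestronglyMeasurable.smul (Lp.aestronglyMeasurable F))
      (Eventually.of_forall fun x => ?_)
    rw [norm_smul]
    exact mul_le_mul_of_nonneg_right (hC x) (norm_nonneg _)
  have m3 : MemLp (fun x => p x • grad χ x) 2 (volume.restrict O) := by
    refine (Lp.memLp p).of_le_mul (c := D)
      ((Lp.aestronglyMeasurable p).smul (continuous_grad hχ).aestronglyMeasurable)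
      (Eventually.of_forall fun x => ?_)
    rw [norm_smul, mul_comm]
    exact mul_le_mul_of_nonneg_right (hD x) (norm_nonneg _)
  refine ⟨MemLp.toLp _ m1, MemLp.toLp _ (m2.add m3), m1.coeFn_toLp, (m2.add m3).coeFn_toLp, fun φ hφ i => ?_⟩
  -- The product rule is obtained by testing p against χφ, which is again a test function.
  have hχφ := hφ.mul hχ
  have h1 := h _ hχφ i
  have i1 : Integrable (fun x => p x * pderiv i (fun y => χ y * φ y) x) (volume.restrict O) :=
    (Lp.memLp p).integrable_mul (hχφ.memLp_pderiv i)
  have hm : MemLp (fun x => pderiv i χ x * φ x) 2 (volume.restrict O) := by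
    have hcont : Continuous fun x => pderiv i χ x * φ x :=
      (continuous_pderiv hχ i).mul hφ.smooth.continuous
    exact (hcont.memLp_of_hasCompactSupport hφ.compact.mul_left).restrict O
  have i2 : Integrable (fun x => p x * (pderiv i χ x * φ x)) (volume.restrict O) :=
    (Lp.memLp p).integrable_mul hm
  have i3 : Integrable (fun x => F x i * (χ x * φ x)) (volume.restrict O) :=
    (F.memLp_apply i).integrable_mul hχφ.memLp
  have e1 : ∫ x in O, (MemLp.toLp _ m1 : L2 O) x * pderiv i φ x =
      ∫ x in O, (p x * pderiv i (fun y => χ y * φ y) x - p x * (pderiv i χ x * φ x)) := by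
    refine integral_congr_ae ?_
    filter_upwards [m1.coeFn_toLp] with x hx
    rw [hx, pderiv_mul hχ hφ.smooth]; ring
  have e2 : ∫ x in O, (MemLp.toLp _ (m2.add m3) : L2Vec O) x i * φ x =
      ∫ x in O, (F x i * (χ x * φ x) + p x * (pderiv i χ x * φ x)) := by
    refine integral_congr_ae ?_
    filter_upwards [(m2.add m3).coeFn_toLp] with x hx
    rw [hx]
    simp [grad]; ring
  rw [e1, e2, integral_sub i1 i2, h1, integral_add i3 i2]
  ring

end Product

/-- The pairs `(φ, ∇φ)` for `φ ∈ C^∞(ℝ^d)`. -/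
def smoothGraph (O : Set (Space d)) : Submodule ℂ (L2 O × L2Vec O) :=
  (restrictionGraph O).map
    ((LinearMap.fst ℂ (L2 O) (L2Vec O × L2Bdry O)).prod
      ((LinearMap.fst ℂ (L2Vec O) (L2Bdry O)).comp (LinearMap.snd ℂ (L2 O) (L2Vec O × L2Bdry O))))

section Smooth

variable {O : Set (Space d)}

lemma memLp_volume_of_continuous {X : Type*} [NormedAddCommGroup X]
    [SecondCountableTopologyEither (Space d) X] (hO : IsLipschitzDomain O) {φ : Space d → X}
    (hφ : Continuous φ) : MemLp φ 2 (volume.restrict O) := by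
  have hK : IsCompact (closure O) := hO.isBounded.isCompact_closure
  obtain ⟨C, hC⟩ := hK.exists_bound_of_continuousOn hφ.continuousOn
  have : IsFiniteMeasure (volume.restrict O) :=
    ⟨by rw [Measure.restrict_apply_univ]; exact hO.isBounded.measure_lt_top⟩
  refine MemLp.of_bound hφ.aestronglyMeasurable C ?_
  filter_upwards [ae_restrict_mem hO.isOpen.measurableSet] with x hx
  exact hC x (subset_closure hx)

lemma memLp_surface_of_continuous (hO : IsLipschitzDomain O) {φ : Space d → ℂ}
    (hφ : Continuous φ) : MemLp φ 2 (surfaceMeasure O) := by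
  obtain ⟨C, hC⟩ := hO.isCompact_frontier.exists_bound_of_continuousOn hφ.continuousOn
  have := isFiniteMeasure_surface hO
  refine MemLp.of_bound hφ.aestronglyMeasurable C ?_
  filter_upwards [ae_surface_mem (O := O)] with x hx
  exact hC x hx

lemma mem_smoothGraph (hO : IsLipschitzDomain O) {φ : Space d → ℂ} (hφ : ContDiff ℝ ∞ φ)
    {p : L2 O} {F : L2Vec O} (hp : p =ᵐ[volume.restrict O] φ)
    (hF : F =ᵐ[volume.restrict O] grad φ) : (p, F) ∈ smoothGraph O :=
  ⟨(p, F, (memLp_surface_of_continuous hO hφ.continuous).toLp),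
    ⟨φ, hφ, hp, hF, (memLp_surface_of_continuous hO hφ.continuous).coeFn_toLp⟩, rfl⟩

lemma mem_closure_smoothGraph_of_cone (hO : IsLipschitzDomain O) {p : L2 O} {F : L2Vec O}
    (h : HasWeakGrad O p F) {K : Set (Space d)}
    (hp : ∀ᵐ x ∂(volume.restrict O), x ∉ K → p x = 0)
    (hF : ∀ᵐ x ∂(volume.restrict O), x ∉ K → F x = 0) (hK : InwardCone O K) :
    (p, F) ∈ (smoothGraph O).topologicalClosure := by
  refine Metric.mem_closure_iff.2 fun ε hε => ?_
  obtain ⟨ψ, hψ, -, hψq⟩ := exists_mollifier_approx hO.isOpen h hp hF hK (half_pos hε)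
  have hφ : ContDiff ℝ ∞ (mol ψ (O.indicator p)) :=
    hψ.contDiff ((memLp_indicator hO.isOpen p).locallyIntegrable (by norm_num))
  have m1 := memLp_volume_of_continuous hO hφ.continuous
  have m2 := memLp_volume_of_continuous hO (continuous_grad hφ)
  obtain ⟨e1, e2⟩ := hψq _ _ m1.coeFn_toLp m2.coeFn_toLp
  refine ⟨(m1.toLp, m2.toLp), mem_smoothGraph hO hφ m1.coeFn_toLp m2.coeFn_toLp, ?_⟩
  rw [dist_comm, Prod.dist_eq, max_lt_iff, dist_eq_norm, dist_eq_norm]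
  exact ⟨e1.trans_lt (by linarith), e2.trans_lt (by linarith)⟩

/-- Every point of the closure of a Lipschitz domain has a neighbourhood with an inward cone. -/
lemma exists_ball_inwardCone (hO : IsLipschitzDomain O) {x : Space d} (hx : x ∈ closure O) :
    ∃ r > 0, InwardCone O (ball x r) := by
  by_cases hxO : x ∈ O
  · obtain ⟨r, hr, h⟩ := Metric.isOpen_iff.1 hO.isOpen x hxO
    refine ⟨r / 3, by positivity, 0, 1, r / 3, one_pos, by positivity, ?_⟩
    rintro y - ⟨k, hk, hyk⟩ t ht z hz
    refine h ?_
    rw [smul_zero, mul_one, mem_closedBall_zero_iff] at hz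
    rw [mem_ball] at hk ⊢
    have h1 : dist (y - z) y = ‖z‖ := by rw [dist_eq_norm]; simp
    have := dist_triangle (y - z) y x
    have := dist_triangle y k x
    linarith [ht.2]
  · have hf : x ∈ frontier O := by rw [hO.isOpen.frontier_eq]; exact ⟨hx, hxO⟩
    obtain ⟨Γ⟩ := hO.exists_chart hf
    have hρ := Γ.ρ_pos
    have hc := Γ.c_pos
    refine ⟨Γ.ρ / 2, by positivity, Γ.e, Γ.c / 2, Γ.ρ / 2, by positivity, by positivity, ?_⟩
    rintro y hy ⟨k, hk, hyk⟩ t ht z hz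
    have hyb : y ∈ ball x Γ.ρ := by
      rw [mem_ball] at hk ⊢
      have := dist_triangle y k x
      linarith
    have ht0 : t ≠ 0 := ht.1.ne'
    -- A z within tc/2 of te is t(e + z') with ‖z'‖ ≤ c/2 < c, so the cone of the chart contains the
    -- displacement.
    have h1 := Γ.inward y (subset_closure hy) hyb t ⟨ht.1, by linarith [ht.2]⟩
      (t⁻¹ • (z - t • Γ.e)) (by
        rw [mem_closedBall, dist_eq_norm] at hz
        rw [norm_smul, norm_inv, Real.norm_of_nonneg ht.1.le, inv_mul_lt_iff₀ ht.1]
        nlinarith [ht.1])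
    rwa [smul_add, smul_smul, mul_inv_cancel₀ ht0, one_smul, add_sub_cancel] at h1

lemma grad_eq_zero_of_notMem_tsupport {χ : Space d → ℂ} {x : Space d} (hx : x ∉ tsupport χ) :
    grad χ x = 0 := by
  have h1 : fderiv ℝ χ x = 0 := by
    by_contra h
    exact hx (support_fderiv_subset ℝ h)
  ext i
  simp [grad, pderiv, h1]

/-- The restrictions of smooth functions are dense in `H¹(O)`. -/
theorem HasWeakGrad.mem_closure_smoothGraph (hO : IsLipschitzDomain O) {p : L2 O} {F : L2Vec O}
    (h : HasWeakGrad O p F) : (p, F) ∈ (smoothGraph O).topologicalClosure := by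
  have hK : IsCompact (closure O) := hO.isBounded.isCompact_closure
  choose r hr hcone using fun x : closure O => exists_ball_inwardCone hO x.2
  obtain ⟨s, hs⟩ := hK.elim_finite_subcover (fun x : closure O => ball (x : Space d) (r x))
    (fun _ => isOpen_ball) (fun x hx => Set.mem_iUnion.2 ⟨⟨x, hx⟩, mem_ball_self (hr _)⟩)
  -- Each piece of the partition lives where O has a single inward cone, and can therefore be
  -- mollified in that direction.
  obtain ⟨f, hf⟩ := SmoothPartitionOfUnity.exists_isSubordinate (I := 𝓘(ℝ, Space d))
    (s := closure O) isClosed_closure (fun x : s => ball (x : Space d) (r x))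
    (fun _ => isOpen_ball) (by
      intro x hx
      obtain ⟨i, hi, hxi⟩ := Set.mem_iUnion₂.1 (hs hx)
      exact Set.mem_iUnion.2 ⟨⟨i, hi⟩, hxi⟩)
  let χ : s → Space d → ℂ := fun i x => (f i x : ℂ)
  have hχ : ∀ i, ContDiff ℝ ∞ (χ i) := fun i =>
    Complex.ofRealCLM.contDiff.comp (f i).contMDiff.contDiff
  have hχsupp : ∀ i, tsupport (χ i) ⊆ ball (i : Space d) (r i) := fun i =>
    (tsupport_comp_subset (g := Complex.ofReal) Complex.ofReal_zero (f i)).trans (hf i)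
  have hχc : ∀ i, HasCompactSupport (χ i) := fun i =>
    Metric.isCompact_of_isClosed_isBounded (isClosed_tsupport _)
      (isBounded_ball.subset (hχsupp i))
  have hsum : ∀ x ∈ closure O, ∑ i, χ i x = 1 := by
    intro x hx
    have := f.sum_eq_one hx
    rw [finsum_eq_sum_of_fintype] at this
    simp only [χ, ← Complex.ofReal_sum, this, Complex.ofReal_one]
  choose q G hq hG hqG using fun i => h.mul_smooth (hχ i) (hχc i)
  have hmem : ∀ i, (q i, G i) ∈ (smoothGraph O).topologicalClosure := by
    intro i
    refine mem_closure_smoothGraph_of_cone hO (hqG i) (K := ball (i : Space d) (r i)) ?_ ?_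
      (hcone i)
    · filter_upwards [hq i] with x hx hxK
      rw [hx, image_eq_zero_of_notMem_tsupport fun h => hxK (hχsupp i h), zero_mul]
    · filter_upwards [hG i] with x hx hxK
      rw [hx, image_eq_zero_of_notMem_tsupport fun h => hxK (hχsupp i h),
        grad_eq_zero_of_notMem_tsupport fun h => hxK (hχsupp i h), zero_smul, smul_zero, add_zero]
  have hsum1 : ∑ i, q i = p := by
    refine Lp.ext ?_
    have h1 : ((∑ i, q i : L2 O) : Space d → ℂ) =ᵐ[volume.restrict O] ∑ i, ⇑(q i) :=
      Lp.coeFn_finsetSum _ _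
    filter_upwards [h1, ae_all_iff.2 hq, ae_restrict_mem hO.isOpen.measurableSet] with x e1 e2 e3
    rw [e1, Finset.sum_apply, Finset.sum_congr rfl fun i _ => e2 i, ← Finset.sum_mul,
      hsum x (subset_closure e3), one_mul]
  have hweak : ∀ t : Finset s, HasWeakGrad O (∑ i ∈ t, q i) (∑ i ∈ t, G i) := by
    classical
    intro t
    induction t using Finset.induction with
    | empty => simpa using HasWeakGrad.zero
    | insert a t ha ih =>
      rw [Finset.sum_insert ha, Finset.sum_insert ha]
      exact (hqG a).add ih
  -- The sum of the G i is a weak gradient of ∑ q i = p, so uniqueness identifies it with F; the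
  -- partition functions need not be differentiated.
  have hsum2 : ∑ i, G i = F := by
    have h1 := (hweak Finset.univ).add (h.smul (-1))
    rw [hsum1] at h1
    have h2 : HasWeakGrad O 0 (∑ i, G i + (-1 : ℂ) • F) := by simpa using h1
    have h3 := h2.unique hO.isOpen
    rw [neg_one_smul, ← sub_eq_add_neg, sub_eq_zero] at h3
    exact h3
  have h4 := Submodule.sum_mem _ fun (i : s) (_ : i ∈ Finset.univ) => hmem i
  have h5 : ∑ i, (q i, G i) = (p, F) := by
    rw [← hsum1, ← hsum2]
    exact Prod.ext (by simp [Prod.fst_sum]) (by simp [Prod.snd_sum])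
  rwa [h5] at h4

end Smooth

end Acoustic

end


/-! ### Hardy's inequality along inward rays -/

noncomputable section

namespace Acoustic

open Metric
open scoped ENNReal NNReal Topology

variable {d : ℕ}

section Hardy

lemma lintegral_rpow_neg_half_le {t : ℝ} (ht : 0 < t) :
    ∫⁻ s in Set.Ioo 0 t, ENNReal.ofReal (s ^ (-(1 / 2) : ℝ)) =
      ENNReal.ofReal (2 * t ^ ((1 / 2) : ℝ)) := by
  have hi : IntegrableOn (fun s : ℝ => s ^ (-(1 / 2) : ℝ)) (Set.Ioo 0 t) := by
    have := (intervalIntegral.intervalIntegrable_rpow' (a := 0) (b := t)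
      (r := (-(1 / 2) : ℝ)) (by norm_num))
    rw [intervalIntegrable_iff_integrableOn_Ioo_of_le ht.le] at this
    exact this
  rw [← ofReal_integral_eq_lintegral_ofReal hi]
  · rw [← integral_Ioc_eq_integral_Ioo, ← intervalIntegral.integral_of_le ht.le,
      integral_rpow (Or.inl (by norm_num)), show (-(1 / 2) : ℝ) + 1 = 1 / 2 by norm_num,
      Real.zero_rpow (by norm_num)]
    congr 1
    ring
  · filter_upwards [ae_restrict_mem measurableSet_Ioo] with s hs
    exact Real.rpow_nonneg hs.1.le _

lemma lintegral_rpow_tail_le {s T : ℝ} (hs : 0 < s) :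
    ∫⁻ t in Set.Ioo s T, ENNReal.ofReal (t ^ (-(3 / 2) : ℝ)) ≤
      ENNReal.ofReal (2 * s ^ (-(1 / 2) : ℝ)) := by
  calc _ ≤ ∫⁻ t in Set.Ioi s, ENNReal.ofReal (t ^ (-(3 / 2) : ℝ)) :=
        lintegral_mono_set Set.Ioo_subset_Ioi_self
    _ = _ := by
        rw [← ofReal_integral_eq_lintegral_ofReal
          (integrableOn_Ioi_rpow_of_lt (by norm_num) hs)]
        · rw [integral_Ioi_rpow_of_lt (by norm_num) hs,
            show (-(3 / 2) : ℝ) + 1 = -(1 / 2) by norm_num]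
          congr 1
          ring
        · filter_upwards [ae_restrict_mem measurableSet_Ioi] with t ht
          exact Real.rpow_nonneg (hs.trans ht).le _

/-- Hardy's inequality. -/
lemma hardy {G : ℝ → ℝ≥0∞} (hG : Measurable G) (T : ℝ) :
    ∫⁻ t in Set.Ioo 0 T, ENNReal.ofReal (t ^ (-2 : ℝ)) * (∫⁻ s in Set.Ioo 0 t, G s) ^ 2 ≤
      4 * ∫⁻ s in Set.Ioo 0 T, G s ^ 2 := by
  -- Splitting G as s^{-1/2} · s^{1/2}G in the weighted Cauchy-Schwarz inequality gives (∫₀ᵗ G)² ≤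
  -- 2t^{1/2} ∫₀ᵗ s^{1/2}G². The remaining weight in t is 2t^{-3/2}.
  have h1 : ∀ t ∈ Set.Ioo 0 T, ENNReal.ofReal (t ^ (-2 : ℝ)) * (∫⁻ s in Set.Ioo 0 t, G s) ^ 2 ≤
      ∫⁻ s in Set.Ioo 0 T, (Set.Ioo s T).indicator
        (fun t => ENNReal.ofReal (2 * t ^ (-(3 / 2) : ℝ))) t *
          (ENNReal.ofReal (s ^ ((1 / 2) : ℝ)) * G s ^ 2) := by
    intro t ht
    have e1 : ∫⁻ s in Set.Ioo 0 t, G s = ∫⁻ s in Set.Ioo 0 t,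
        ENNReal.ofReal (s ^ (-(1 / 2) : ℝ)) * (ENNReal.ofReal (s ^ ((1 / 2) : ℝ)) * G s) := by
      refine setLIntegral_congr_fun measurableSet_Ioo fun s hs => ?_
      rw [← mul_assoc, ← ENNReal.ofReal_mul (Real.rpow_nonneg hs.1.le _),
        ← Real.rpow_add hs.1]
      norm_num
    have e2 := sq_lintegral_mul_le (μ := volume.restrict (Set.Ioo 0 t))
      (w := fun s => ENNReal.ofReal (s ^ (-(1 / 2) : ℝ)))
      (f := fun s => ENNReal.ofReal (s ^ ((1 / 2) : ℝ)) * G s)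
      (by fun_prop) (by fun_prop)
    rw [e1]
    refine (mul_le_mul_right e2 _).trans ?_
    rw [lintegral_rpow_neg_half_le ht.1, ← mul_assoc,
      ← ENNReal.ofReal_mul (Real.rpow_nonneg ht.1.le _)]
    have e3 : t ^ (-2 : ℝ) * (2 * t ^ ((1 / 2) : ℝ)) = 2 * t ^ (-(3 / 2) : ℝ) := by
      rw [mul_left_comm, ← Real.rpow_add ht.1]; norm_num
    rw [e3, ← lintegral_const_mul _ (by fun_prop)]
    have e4 : ∀ s ∈ Set.Ioo 0 t, ENNReal.ofReal (2 * t ^ (-(3 / 2) : ℝ)) *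
        (ENNReal.ofReal (s ^ (-(1 / 2) : ℝ)) * (ENNReal.ofReal (s ^ ((1 / 2) : ℝ)) * G s) ^ 2) =
        (Set.Ioo s T).indicator (fun t => ENNReal.ofReal (2 * t ^ (-(3 / 2) : ℝ))) t *
          (ENNReal.ofReal (s ^ ((1 / 2) : ℝ)) * G s ^ 2) := by
      intro s hs
      rw [Set.indicator_of_mem (show t ∈ Set.Ioo s T from ⟨hs.2, ht.2⟩)]
      congr 1
      rw [mul_pow, ← mul_assoc, sq (ENNReal.ofReal _), ← mul_assoc,
        ← ENNReal.ofReal_mul (Real.rpow_nonneg hs.1.le _), ← Real.rpow_add hs.1]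
      norm_num
    rw [setLIntegral_congr_fun measurableSet_Ioo e4]
    exact lintegral_mono_set (Set.Ioo_subset_Ioo_right ht.2.le)
  refine (setLIntegral_mono' measurableSet_Ioo h1).trans ?_
  -- After the exchange, the integral of 2t^{-3/2} over t > s is at most 4s^{-1/2}, which cancels
  -- s^{1/2} and yields the constant 4.
  rw [lintegral_lintegral_swap]
  · rw [← lintegral_const_mul _ (by fun_prop)]
    refine setLIntegral_mono' measurableSet_Ioo fun s hs => ?_
    rw [lintegral_mul_const _ (by
      exact (by fun_prop : Measurable fun t : ℝ => ENNReal.ofReal (2 * t ^ (-(3 / 2) : ℝ))).indicator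
        measurableSet_Ioo)]
    have e5 : ∫⁻ t in Set.Ioo 0 T, (Set.Ioo s T).indicator
        (fun t => ENNReal.ofReal (2 * t ^ (-(3 / 2) : ℝ))) t ≤
        ENNReal.ofReal (4 * s ^ (-(1 / 2) : ℝ)) := by
      refine (lintegral_mono' Measure.restrict_le_self le_rfl).trans ?_
      rw [lintegral_indicator measurableSet_Ioo]
      have e6 : ∀ t ∈ Set.Ioo s T, ENNReal.ofReal (2 * t ^ (-(3 / 2) : ℝ)) =
          2 * ENNReal.ofReal (t ^ (-(3 / 2) : ℝ)) := fun t _ => by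
        rw [ENNReal.ofReal_mul (by norm_num)]; norm_num
      rw [setLIntegral_congr_fun measurableSet_Ioo e6, lintegral_const_mul _ (by fun_prop)]
      refine (mul_le_mul_right (lintegral_rpow_tail_le hs.1) _).trans (le_of_eq ?_)
      rw [show (2 : ℝ≥0∞) = ENNReal.ofReal 2 by norm_num, ← ENNReal.ofReal_mul (by norm_num)]
      ring_nf
    refine (mul_le_mul_left e5 _).trans (le_of_eq ?_)
    rw [← mul_assoc, ← ENNReal.ofReal_mul (by have := Real.rpow_nonneg hs.1.le (-(1 / 2)); positivity),
      mul_assoc, ← Real.rpow_add hs.1]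
    norm_num
  · refine Measurable.aemeasurable ?_
    have m1 : Measurable fun x : ℝ × ℝ =>
        {x : ℝ × ℝ | x.2 < x.1 ∧ x.1 < T}.indicator
          (fun x => ENNReal.ofReal (2 * x.1 ^ (-(3 / 2) : ℝ))) x :=
      (by fun_prop : Measurable fun x : ℝ × ℝ =>
        ENNReal.ofReal (2 * x.1 ^ (-(3 / 2) : ℝ))).indicator
        ((measurableSet_lt measurable_snd measurable_fst).inter
          (measurableSet_lt measurable_fst measurable_const))
    exact m1.mul (by fun_prop)

end Hardy

section Segment

lemma norm_fderiv_apply_le (φ : Space d → ℂ) (x w : Space d) :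
    ‖fderiv ℝ φ x w‖ ≤ ‖grad φ x‖ * ‖w‖ := by
  have h1 : fderiv ℝ φ x w = inner ℂ (WithLp.toLp 2 fun i => (w i : ℂ)) (grad φ x) := by
    conv_lhs => rw [← (EuclideanSpace.basisFun (Fin d) ℝ).sum_repr w]
    rw [map_sum]
    simp [PiLp.inner_apply, grad, pderiv, mul_comm]
  have h2 : ‖(WithLp.toLp 2 fun i => (w i : ℂ) : EuclideanSpace ℂ (Fin d))‖ = ‖w‖ := by
    simp [EuclideanSpace.norm_eq]
  rw [h1, mul_comm, ← h2]
  exact norm_inner_le_norm _ _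

lemma enorm_sub_le_segment {φ : Space d → ℂ} (hφ : ContDiff ℝ ∞ φ) (y w : Space d) {t : ℝ}
    (ht : 0 ≤ t) :
    ‖φ y - φ (y - t • w)‖ₑ ≤ ‖w‖ₑ * ∫⁻ s in Set.Ioo 0 t, ‖grad φ (y - s • w)‖ₑ := by
  have hc : Continuous fun s : ℝ => fderiv ℝ φ (y - s • w) (-w) :=
    ((hφ.continuous_fderiv (by simp)).comp (by fun_prop)).clm_apply continuous_const
  have h1 : ∀ s ∈ Set.uIcc 0 t, HasDerivAt (fun s : ℝ => φ (y - s • w))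
      (fderiv ℝ φ (y - s • w) (-w)) s := by
    intro s _
    have h2 : HasDerivAt (fun s : ℝ => y - s • w) (-w) s := by
      have := ((hasDerivAt_id s).smul_const w).const_sub y
      simpa using this
    exact ((hφ.differentiable (by simp) _).hasFDerivAt).comp_hasDerivAt s h2
  have h2 := intervalIntegral.integral_eq_sub_of_hasDerivAt h1 (hc.intervalIntegrable _ _)
  rw [zero_smul, sub_zero] at h2
  rw [← enorm_neg, neg_sub, ← h2, intervalIntegral.integral_of_le ht, integral_Ioc_eq_integral_Ioo]
  refine (enorm_integral_le_lintegral_enorm _).trans ?_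
  rw [← lintegral_const_mul _ (by
    exact ((continuous_grad hφ).comp (by fun_prop)).enorm.measurable)]
  refine lintegral_mono fun s => ?_
  have h3 := norm_fderiv_apply_le φ (y - s • w) (-w)
  rw [norm_neg, mul_comm] at h3
  rw [← ofReal_norm, ← ofReal_norm, ← ofReal_norm, ← ENNReal.ofReal_mul (norm_nonneg _)]
  exact ENNReal.ofReal_le_ofReal h3

lemma hardy_segment {φ : Space d → ℂ} (hφ : ContDiff ℝ ∞ φ) (y w : Space d) (T : ℝ) :
    ∫⁻ t in Set.Ioo 0 T, ENNReal.ofReal (t ^ (-2 : ℝ)) * ‖φ y - φ (y - t • w)‖ₑ ^ 2 ≤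
      4 * ‖w‖ₑ ^ 2 * ∫⁻ s in Set.Ioo 0 T, ‖grad φ (y - s • w)‖ₑ ^ 2 := by
  have hm : Measurable fun s : ℝ => ‖grad φ (y - s • w)‖ₑ :=
    ((continuous_grad hφ).comp (by fun_prop)).enorm.measurable
  have h1 := hardy hm T
  calc _ ≤ ∫⁻ t in Set.Ioo 0 T, ‖w‖ₑ ^ 2 * (ENNReal.ofReal (t ^ (-2 : ℝ)) *
        (∫⁻ s in Set.Ioo 0 t, ‖grad φ (y - s • w)‖ₑ) ^ 2) := by
        refine setLIntegral_mono' measurableSet_Ioo fun t ht => ?_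
        rw [mul_left_comm, ← mul_pow]
        gcongr
        exact enorm_sub_le_segment hφ y w ht.1.le
    _ = ‖w‖ₑ ^ 2 * ∫⁻ t in Set.Ioo 0 T, (ENNReal.ofReal (t ^ (-2 : ℝ)) *
        (∫⁻ s in Set.Ioo 0 t, ‖grad φ (y - s • w)‖ₑ) ^ 2) :=
        lintegral_const_mul' _ _ (by simp)
    _ ≤ _ := by
        refine (mul_le_mul_right h1 _).trans (le_of_eq ?_)
        ring

variable {O : Set (Space d)} {x₀ : Space d}

/-- The gradient energy of `φ` in the part of `O` that is `ε`-close to the boundary. -/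
def layerEnergy (O : Set (Space d)) (F : Space d → EuclideanSpace ℂ (Fin d)) (ε : ℝ) : ℝ≥0∞ :=
  ∫⁻ x in O ∩ {x | infDist x (frontier O) < ε}, ‖F x‖ₑ ^ 2

lemma layerEnergy_le (F : Space d → EuclideanSpace ℂ (Fin d)) (ε : ℝ) :
    layerEnergy O F ε ≤ ∫⁻ x in O, ‖F x‖ₑ ^ 2 :=
  lintegral_mono_set Set.inter_subset_left

/-- Hardy's inequality on each ray in the direction -(e + z), summed over the boundary by `sweep`.
As ‖e + z‖ ≤ 2, a ray of parameter length T stays within 2T of the boundary, so only the energy of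
that layer enters; 16 is 4 · 2². -/
lemma Chart.hardy (Γ : Chart O x₀) {φ : Space d → ℂ} (hφ : ContDiff ℝ ∞ φ)
    {z : Space d} (hz : ‖z‖ < Γ.c) {T : ℝ} (hT : T ≤ Γ.ρ) :
    ∫⁻ y in ball x₀ Γ.ρ, (∫⁻ t in Set.Ioo 0 T, ENNReal.ofReal (t ^ (-2 : ℝ)) *
        ‖φ y - φ (y - t • (Γ.e + z))‖ₑ ^ 2) ∂(surfaceMeasure O) ≤
      16 * Γ.C * layerEnergy O (grad φ) (2 * T) := by
  have hw : ‖Γ.e + z‖ ≤ 2 := by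
    have := norm_add_le Γ.e z
    have := Γ.norm_e
    have := Γ.c_le
    linarith
  have hw' : ‖Γ.e + z‖ₑ ≤ 2 := by
    rw [← ofReal_norm]; exact ENNReal.ofReal_le_of_le_toReal (by simpa using hw)
  set S := {x | infDist x (frontier O) < 2 * T} with hS
  have hSm : MeasurableSet S := measurableSet_lt (measurable_infDist) measurable_const
  have hgm : Measurable (S.indicator fun x => ‖grad φ x‖ₑ ^ 2) :=
    ((continuous_grad hφ).enorm.measurable.pow_const 2).indicator hSm
  calc _ ≤ ∫⁻ y in ball x₀ Γ.ρ, (16 * ∫⁻ s in Set.Ioo 0 Γ.ρ,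
        S.indicator (fun x => ‖grad φ x‖ₑ ^ 2) (y - s • (Γ.e + z))) ∂(surfaceMeasure O) := by
        refine lintegral_mono_ae ?_
        filter_upwards [ae_restrict_of_ae (ae_surface_mem (O := O))] with y hy
        refine (hardy_segment hφ y _ T).trans ?_
        refine mul_le_mul' ?_ ?_
        · calc 4 * ‖Γ.e + z‖ₑ ^ 2 ≤ 4 * 2 ^ 2 := by gcongr
            _ = 16 := by norm_num
        · refine le_trans (le_of_eq ?_) (lintegral_mono_set (Set.Ioo_subset_Ioo_right hT))
          refine setLIntegral_congr_fun measurableSet_Ioo fun s hs => ?_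
          rw [Set.indicator_of_mem]
          rw [hS, Set.mem_ofPred_eq]
          calc infDist (y - s • (Γ.e + z)) (frontier O) ≤ dist (y - s • (Γ.e + z)) y :=
                infDist_le_dist_of_mem hy
            _ = s * ‖Γ.e + z‖ := by
                rw [dist_eq_norm, sub_sub_cancel_left, norm_neg, norm_smul,
                  Real.norm_of_nonneg hs.1.le]
            _ ≤ s * 2 := by gcongr; exact hs.1.le
            _ < 2 * T := by linarith [hs.2]
    _ = 16 * ∫⁻ y in ball x₀ Γ.ρ, (∫⁻ s in Set.Ioo 0 Γ.ρ,
        S.indicator (fun x => ‖grad φ x‖ₑ ^ 2) (y - s • (Γ.e + z))) ∂(surfaceMeasure O) :=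
        lintegral_const_mul' _ _ (by simp)
    _ ≤ 16 * (Γ.C * ∫⁻ x in O, S.indicator (fun x => ‖grad φ x‖ₑ ^ 2) x) := by
        gcongr; exact Γ.sweep z hz _ hgm
    _ = _ := by
        rw [mul_assoc, layerEnergy, lintegral_indicator hSm, Measure.restrict_restrict hSm,
          Set.inter_comm]

/-- The variation of `φ` in a boundary layer. -/
lemma Chart.layer_variation (Γ : Chart O x₀) {φ : Space d → ℂ} (hφ : ContDiff ℝ ∞ φ) {T : ℝ}
    (hT : T ≤ Γ.ρ) :
    ∫⁻ y in ball x₀ Γ.ρ, (∫⁻ t in Set.Ioo 0 T, ‖φ y - φ (y - t • Γ.e)‖ₑ ^ 2) ∂(surfaceMeasure O) ≤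
      ENNReal.ofReal (T ^ 2) * (16 * Γ.C * layerEnergy O (grad φ) (2 * T)) := by
  have h := Γ.hardy hφ (z := 0) (by simpa using Γ.c_pos) hT
  rw [add_zero] at h
  refine le_trans ?_ (mul_le_mul_right h _)
  rw [← lintegral_const_mul' _ _ (by simp)]
  refine lintegral_mono fun y => ?_
  rw [← lintegral_const_mul' _ _ (by simp)]
  refine setLIntegral_mono' measurableSet_Ioo fun t ht => ?_
  rw [← mul_assoc, ← ENNReal.ofReal_mul (by positivity)]
  -- On (0, T) the Hardy weight satisfies 1 ≤ T²t^{-2}.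
  refine le_mul_of_one_le_left' ?_
  rw [ENNReal.one_le_ofReal, Real.rpow_neg ht.1.le, Real.rpow_two, ← div_eq_mul_inv,
    one_le_div (pow_pos ht.1 2)]
  exact pow_le_pow_left₀ ht.1.le ht.2.le 2

end Segment

end Acoustic

end


/-! ### Local trace estimates in L² and in the Slobodeckij seminorm -/

noncomputable section

namespace Acoustic

open Metric
open scoped ENNReal NNReal Topology

variable {d : ℕ}

lemma enorm_add_sq_le (a b : ℝ≥0∞) : (a + b) ^ 2 ≤ 2 * a ^ 2 + 2 * b ^ 2 := by
  by_cases ha : a = ⊤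
  · simp [ha]
  by_cases hb : b = ⊤
  · simp [hb]
  lift a to ℝ≥0 using ha
  lift b to ℝ≥0 using hb
  norm_cast
  rw [← NNReal.coe_le_coe]
  push_cast
  nlinarith [sq_nonneg ((a : ℝ) - b)]

lemma enorm_sub_sq_le {X : Type*} [NormedAddCommGroup X] (a b c : X) :
    ‖a - c‖ₑ ^ 2 ≤ 2 * ‖a - b‖ₑ ^ 2 + 2 * ‖b - c‖ₑ ^ 2 := by
  have h : ‖a - c‖ₑ ≤ ‖a - b‖ₑ + ‖b - c‖ₑ := by
    rw [← sub_add_sub_cancel a b c]; exact enorm_add_le _ _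
  exact (pow_le_pow_left' h 2).trans (enorm_add_sq_le _ _)

lemma enorm_sq_le {X : Type*} [NormedAddCommGroup X] (a b : X) :
    ‖a‖ₑ ^ 2 ≤ 2 * ‖a - b‖ₑ ^ 2 + 2 * ‖b‖ₑ ^ 2 := by
  simpa using enorm_sub_sq_le a b 0

section Trace

variable {O : Set (Space d)} {x₀ : Space d}

/-- Compare φ(y) with φ(y - te) and integrate over t in (0, ρ): the difference is controlled by
`layer_variation`, the interior values by `sweep`. Dividing by the length ρ gives the claim. -/
lemma Chart.lintegral_trace_le (Γ : Chart O x₀) : ∃ K : ℝ≥0, ∀ φ : Space d → ℂ, ContDiff ℝ ∞ φ →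
    ∫⁻ y in ball x₀ Γ.ρ, ‖φ y‖ₑ ^ 2 ∂(surfaceMeasure O) ≤
      K * ((∫⁻ x in O, ‖φ x‖ₑ ^ 2) + ∫⁻ x in O, ‖grad φ x‖ₑ ^ 2) := by
  have hρ := Γ.ρ_pos
  refine ⟨(Real.toNNReal Γ.ρ)⁻¹ * (2 * Γ.C + 32 * (Real.toNNReal Γ.ρ) ^ 2 * Γ.C), fun φ hφ => ?_⟩
  have h1 := Γ.layer_variation hφ le_rfl
  have h2 := Γ.sweep 0 (by simpa using Γ.c_pos) (fun x => ‖φ x‖ₑ ^ 2)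
    (hφ.continuous.enorm.measurable.pow_const 2)
  rw [add_zero] at h2
  have h3 : ENNReal.ofReal Γ.ρ * ∫⁻ y in ball x₀ Γ.ρ, ‖φ y‖ₑ ^ 2 ∂(surfaceMeasure O) ≤
      2 * (ENNReal.ofReal (Γ.ρ ^ 2) * (16 * Γ.C * layerEnergy O (grad φ) (2 * Γ.ρ))) +
      2 * (Γ.C * ∫⁻ x in O, ‖φ x‖ₑ ^ 2) := by
    refine le_trans ?_ (add_le_add (mul_le_mul_right h1 2) (mul_le_mul_right h2 2))
    rw [← lintegral_const_mul' _ _ (by simp), ← lintegral_const_mul' _ _ (by simp),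
      ← lintegral_const_mul' _ _ (by simp)]
    have hφc := hφ.continuous
    have m1 : Measurable fun x : Space d × ℝ => ‖φ x.1 - φ (x.1 - x.2 • Γ.e)‖ₑ ^ 2 :=
      Measurable.pow_const (Continuous.measurable (by fun_prop)) 2
    have m2 : ∀ y, Measurable fun t : ℝ => 2 * ‖φ y - φ (y - t • Γ.e)‖ₑ ^ 2 := fun y =>
      (Measurable.pow_const (Continuous.measurable (by fun_prop)) 2).const_mul 2
    rw [← lintegral_add_left (m1.lintegral_prod_right'.const_mul 2)]
    refine lintegral_mono fun y => ?_
    rw [← lintegral_const_mul' _ _ (by simp), ← lintegral_const_mul' _ _ (by simp),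
      ← lintegral_add_left (m2 y)]
    calc _ = ∫⁻ _t in Set.Ioo 0 Γ.ρ, ‖φ y‖ₑ ^ 2 := by
          rw [setLIntegral_const, Real.volume_Ioo, sub_zero, mul_comm]
      _ ≤ _ := lintegral_mono fun t => enorm_sq_le (φ y) (φ (y - t • Γ.e))
  have hne : ENNReal.ofReal Γ.ρ ≠ 0 := by simpa using hρ
  rw [mul_comm, ← ENNReal.le_div_iff_mul_le (Or.inl hne) (Or.inl (by simp))] at h3
  refine h3.trans ?_
  rw [ENNReal.div_eq_inv_mul]
  have e1 : (((Real.toNNReal Γ.ρ)⁻¹ * (2 * Γ.C + 32 * (Real.toNNReal Γ.ρ) ^ 2 * Γ.C) : ℝ≥0) : ℝ≥0∞) =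
      (ENNReal.ofReal Γ.ρ)⁻¹ * (2 * Γ.C + 32 * ENNReal.ofReal (Γ.ρ ^ 2) * Γ.C) := by
    push_cast
    rw [ENNReal.coe_inv (by simpa using hρ), ENNReal.ofReal_pow hρ.le]; rfl
  rw [e1, mul_assoc (ENNReal.ofReal Γ.ρ)⁻¹]
  refine mul_le_mul_right ?_ _
  calc _ ≤ 2 * (ENNReal.ofReal (Γ.ρ ^ 2) * (16 * Γ.C * ∫⁻ x in O, ‖grad φ x‖ₑ ^ 2)) +
      2 * (Γ.C * ∫⁻ x in O, ‖φ x‖ₑ ^ 2) := by gcongr; exact layerEnergy_le _ _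
    _ = 2 * Γ.C * (∫⁻ x in O, ‖φ x‖ₑ ^ 2) +
        32 * ENNReal.ofReal (Γ.ρ ^ 2) * Γ.C * ∫⁻ x in O, ‖grad φ x‖ₑ ^ 2 := by ring
    _ ≤ _ := by
        rw [mul_add]
        exact add_le_add (mul_le_mul_left le_self_add _) (mul_le_mul_left le_add_self _)

/-- The mean square variation of `φ` over a cone with vertex `y`, at height `t`. -/
def coneVariation (φ : Space d → ℂ) (e : Space d) (c : ℝ) (y : Space d) (t : ℝ) : ℝ≥0∞ :=
  ∫⁻ z in ball 0 c, ‖φ y - φ (y - t • (e + z))‖ₑ ^ 2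

lemma measurable_coneVariation {φ : Space d → ℂ} (hφ : Continuous φ) (e : Space d) (c : ℝ) :
    Measurable fun x : Space d × ℝ => coneVariation φ e c x.1 x.2 := by
  refine Measurable.lintegral_prod_right'
    (f := fun x : (Space d × ℝ) × Space d => ‖φ x.1.1 - φ (x.1.1 - x.1.2 • (e + x.2))‖ₑ ^ 2) ?_
  exact Measurable.pow_const (Continuous.measurable (by fun_prop)) 2

/-- When |y - y'| < ct/2 the cones with vertices y and y' overlap at height t. A common point y -
t(e + z) is written as y' - t(e + z + a) with a = (y' - y)/t, ‖a‖ < c/2, and φ(y), φ(y') are both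
compared with the value there; then average over z. -/
lemma enorm_sub_sq_le_coneVariation {φ : Space d → ℂ} (hφ : Continuous φ) (e : Space d) {c t : ℝ}
    {y y' : Space d} (ht : 2 * dist y y' < c * t) (ht0 : 0 < t) :
    volume (ball (0 : Space d) (c / 2)) * ‖φ y - φ y'‖ₑ ^ 2 ≤
      2 * coneVariation φ e c y t + 2 * coneVariation φ e c y' t := by
  set a : Space d := t⁻¹ • (y' - y)
  have ha : ‖a‖ < c / 2 := by
    rw [norm_smul, norm_inv, Real.norm_of_nonneg ht0.le, inv_mul_lt_iff₀ ht0, ← dist_eq_norm,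
      dist_comm]
    linarith
  have hta : t • a = y' - y := by rw [smul_smul, mul_inv_cancel₀ ht0.ne', one_smul]
  have hc : 0 ≤ c := by linarith [norm_nonneg a]
  have h1 : ∫⁻ z in ball (0 : Space d) (c / 2), ‖φ y - φ (y - t • (e + z))‖ₑ ^ 2 ≤
      coneVariation φ e c y t := lintegral_mono_set (ball_subset_ball (by linarith))
  have h2 : ∫⁻ z in ball (0 : Space d) (c / 2), ‖φ y' - φ (y - t • (e + z))‖ₑ ^ 2 ≤
      coneVariation φ e c y' t := by
    rw [coneVariation, ← lintegral_indicator measurableSet_ball,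
      ← lintegral_indicator measurableSet_ball,
      ← lintegral_add_right_eq_self
        ((ball (0 : Space d) c).indicator fun z => ‖φ y' - φ (y' - t • (e + z))‖ₑ ^ 2) a]
    refine lintegral_mono fun z => ?_
    by_cases hz : z ∈ ball (0 : Space d) (c / 2)
    · rw [Set.indicator_of_mem hz, Set.indicator_of_mem]
      · refine le_of_eq ?_
        congr 4
        rw [← add_assoc, smul_add t (e + z), hta]; abel
      · rw [mem_ball_zero_iff] at hz ⊢
        linarith [norm_add_le z a]
    · rw [Set.indicator_of_notMem hz]; exact zero_le
  calc _ = ∫⁻ _z in ball (0 : Space d) (c / 2), ‖φ y - φ y'‖ₑ ^ 2 := by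
        rw [setLIntegral_const, mul_comm]
    _ ≤ ∫⁻ z in ball (0 : Space d) (c / 2), (2 * ‖φ y - φ (y - t • (e + z))‖ₑ ^ 2 +
        2 * ‖φ y' - φ (y - t • (e + z))‖ₑ ^ 2) := by
        refine lintegral_mono fun z => ?_
        have := enorm_sub_sq_le (φ y) (φ (y - t • (e + z))) (φ y')
        rwa [← enorm_neg (φ (y - t • (e + z)) - φ y'), neg_sub] at this
    _ ≤ _ := by
        have m1 : Measurable fun z : Space d => 2 * ‖φ y - φ (y - t • (e + z))‖ₑ ^ 2 :=
          (Measurable.pow_const (Continuous.measurable (by fun_prop)) 2).const_mul 2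
        rw [lintegral_add_left m1, lintegral_const_mul' _ _ (by simp),
          lintegral_const_mul' _ _ (by simp)]
        exact add_le_add (mul_le_mul_right h1 2) (mul_le_mul_right h2 2)

/-- A kernel on pairs of boundary points, dominating `|y - y'|^{-d-1}` near `|y - y'| ~ t`. -/
def coneKernel (c : ℝ) (t : ℝ) (y y' : Space d) : ℝ≥0∞ :=
  {x : Space d × Space d | 2 * dist x.1 x.2 < c * t}.indicator
    (fun _ => ENNReal.ofReal ((4 / (c * t)) ^ (d + 1))) (y, y')

lemma coneKernel_comm (c t : ℝ) (y y' : Space d) : coneKernel c t y y' = coneKernel c t y' y := by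
  simp only [coneKernel, Set.indicator, Set.mem_ofPred_eq, dist_comm]

lemma measurable_coneKernel (c : ℝ) :
    Measurable fun x : (Space d × Space d) × ℝ => coneKernel c x.2 x.1.1 x.1.2 := by
  have h : (fun x : (Space d × Space d) × ℝ => coneKernel c x.2 x.1.1 x.1.2) =
      {x : (Space d × Space d) × ℝ | 2 * dist x.1.1 x.1.2 < c * x.2}.indicator
        (fun x => ENNReal.ofReal ((4 / (c * x.2)) ^ (d + 1))) := by
    funext x; simp only [coneKernel, Set.indicator, Set.mem_ofPred_eq]
  rw [h]
  exact Measurable.indicator (by fun_prop) (measurableSet_lt (by fun_prop) (by fun_prop))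

lemma measurable_coneKernel_right (c t : ℝ) (y : Space d) :
    Measurable fun y' => coneKernel c t y y' := by
  have h : MeasurableSet {x : Space d × Space d | 2 * dist x.1 x.2 < c * t} :=
    measurableSet_lt (by fun_prop) (by fun_prop)
  exact (measurable_const.indicator h).comp measurable_prodMk_left

/-- With r = |y - y'|, integrate the cone comparison over t in (2r/c, 4r/c). On this interval the
cones overlap and the kernel is at least r^{-d-1}; its length 2r/c turns this into (2/c)r^{-d}, the
Slobodeckij weight. -/
lemma difference_quotient_le {φ : Space d → ℂ} (hφ : Continuous φ) (e : Space d) {c ρ : ℝ}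
    (hc : 0 < c) {y y' : Space d} (hr : 4 * dist y y' < c * ρ) :
    volume (ball (0 : Space d) (c / 2)) * ENNReal.ofReal (2 / c) *
        (‖φ y - φ y'‖ₑ ^ 2 * ENNReal.ofReal ((dist y y')⁻¹ ^ d)) ≤
      ∫⁻ t in Set.Ioo 0 ρ, (2 * coneVariation φ e c y t + 2 * coneVariation φ e c y' t) *
        coneKernel c t y y' := by
  rcases eq_or_ne y y' with rfl | hne
  · simp
  have hr0 : 0 < dist y y' := dist_pos.2 hne
  set r := dist y y' with hrdef
  have hsub : Set.Ioo (2 * r / c) (4 * r / c) ⊆ Set.Ioo 0 ρ := by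
    refine Set.Ioo_subset_Ioo (by positivity) ?_
    rw [div_le_iff₀ hc]; linarith
  calc _ = ∫⁻ _t in Set.Ioo (2 * r / c) (4 * r / c),
        volume (ball (0 : Space d) (c / 2)) * ‖φ y - φ y'‖ₑ ^ 2 *
          ENNReal.ofReal (r⁻¹ ^ (d + 1)) := by
        rw [setLIntegral_const, Real.volume_Ioo, mul_assoc _ (ENNReal.ofReal _) (ENNReal.ofReal _),
          ← ENNReal.ofReal_mul (by positivity)]
        have e1 : r⁻¹ ^ (d + 1) * (4 * r / c - 2 * r / c) = 2 / c * r⁻¹ ^ d := by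
          rw [pow_succ]; field_simp; ring
        rw [e1, ENNReal.ofReal_mul (by positivity)]
        ring
    _ ≤ ∫⁻ t in Set.Ioo (2 * r / c) (4 * r / c),
        (2 * coneVariation φ e c y t + 2 * coneVariation φ e c y' t) * coneKernel c t y y' := by
        refine setLIntegral_mono' measurableSet_Ioo fun t ht => ?_
        have ht0 : 0 < t := (by positivity : 0 < 2 * r / c).trans ht.1
        have h1 : 2 * r < c * t := by
          have := (div_lt_iff₀ hc).1 ht.1; linarith
        have h2 : c * t < 4 * r := by
          have := (lt_div_iff₀ hc).1 ht.2; linarith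
        refine mul_le_mul' (enorm_sub_sq_le_coneVariation hφ e h1 ht0) ?_
        rw [coneKernel, Set.indicator_of_mem (by exact h1)]
        refine ENNReal.ofReal_le_ofReal (pow_le_pow_left₀ (by positivity) ?_ _)
        rw [inv_eq_one_div, div_le_div_iff₀ hr0 (by positivity)]
        linarith
    _ ≤ _ := lintegral_mono_set hsub

/-- The kernel has size t^{-d-1} on a ball of radius ct/2, whose surface measure is at most of order
t^{d-1} by upper Ahlfors regularity. The product t^{-2} is exactly Hardy's weight. -/
lemma Chart.lintegral_coneKernel_le (hd : 2 ≤ d) (Γ : Chart O x₀) {y : Space d} (hy : y ∈ ball x₀ Γ.ρ)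
    {t : ℝ} (ht : t ∈ Set.Ioo 0 Γ.ρ) :
    ∫⁻ y' in ball x₀ Γ.ρ, coneKernel Γ.c t y y' ∂(surfaceMeasure O) ≤
      ENNReal.ofReal ((4 / Γ.c) ^ (d + 1) * (Γ.C * (Γ.c / 2) ^ (d - 1))) *
        ENNReal.ofReal (t ^ (-2 : ℝ)) := by
  have hc := Γ.c_pos
  have hc' := Γ.c_le
  have ht0 := ht.1
  have h1 : ∀ y', coneKernel Γ.c t y y' =
      (ball y (Γ.c * t / 2)).indicator (fun _ => ENNReal.ofReal ((4 / (Γ.c * t)) ^ (d + 1))) y' := by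
    intro y'
    simp only [coneKernel, Set.indicator, Set.mem_ofPred_eq, mem_ball, dist_comm y' y]
    congr 1
    rw [eq_iff_iff]
    constructor <;> intro h <;> linarith
  simp only [h1]
  refine (lintegral_mono' Measure.restrict_le_self le_rfl).trans ?_
  rw [lintegral_indicator measurableSet_ball, setLIntegral_const]
  have h2 := Γ.upper y hy (Γ.c * t / 2) ⟨by positivity, by nlinarith [ht.2]⟩
  refine (mul_le_mul_right h2 _).trans (le_of_eq ?_)
  rw [← ENNReal.ofReal_mul (by positivity), ← ENNReal.ofReal_mul (by positivity)]
  congr 1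
  rw [Real.rpow_neg ht0.le, Real.rpow_two]
  obtain ⟨k, rfl⟩ : ∃ k, d = k + 1 := ⟨d - 1, by omega⟩
  rw [Nat.add_sub_cancel, div_mul_eq_div_div, div_pow _ t, mul_comm Γ.c t, mul_div_assoc, mul_pow t]
  field_simp
  ring

/-- Exchange the integrals so that z is outermost; for each fixed direction e + z this is
`Chart.hardy`, with a bound uniform in z. -/
lemma Chart.lintegral_coneVariation_le (Γ : Chart O x₀) [IsFiniteMeasure (surfaceMeasure O)]
    {φ : Space d → ℂ} (hφ : ContDiff ℝ ∞ φ) :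
    ∫⁻ y in ball x₀ Γ.ρ, (∫⁻ t in Set.Ioo 0 Γ.ρ, ENNReal.ofReal (t ^ (-2 : ℝ)) *
        coneVariation φ Γ.e Γ.c y t) ∂(surfaceMeasure O) ≤
      volume (ball (0 : Space d) Γ.c) * (16 * Γ.C * ∫⁻ x in O, ‖grad φ x‖ₑ ^ 2) := by
  have hφc := hφ.continuous
  have hm : Measurable fun x : (Space d × ℝ) × Space d =>
      ENNReal.ofReal (x.1.2 ^ (-2 : ℝ)) * ‖φ x.1.1 - φ (x.1.1 - x.1.2 • (Γ.e + x.2))‖ₑ ^ 2 := by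
    have m0 : Measurable fun x : (Space d × ℝ) × Space d =>
      ENNReal.ofReal (x.1.2 ^ (-2 : ℝ)) := by fun_prop
    refine m0.mul (Measurable.pow_const (Continuous.measurable ?_) 2)
    fun_prop
  calc _ = ∫⁻ y in ball x₀ Γ.ρ, (∫⁻ t in Set.Ioo 0 Γ.ρ, ∫⁻ z in ball (0 : Space d) Γ.c,
        ENNReal.ofReal (t ^ (-2 : ℝ)) *
          ‖φ y - φ (y - t • (Γ.e + z))‖ₑ ^ 2) ∂(surfaceMeasure O) := by
        simp only [coneVariation, lintegral_const_mul' _ _ ENNReal.ofReal_ne_top]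
    _ = ∫⁻ y in ball x₀ Γ.ρ, (∫⁻ z in ball (0 : Space d) Γ.c, ∫⁻ t in Set.Ioo 0 Γ.ρ,
        ENNReal.ofReal (t ^ (-2 : ℝ)) *
          ‖φ y - φ (y - t • (Γ.e + z))‖ₑ ^ 2) ∂(surfaceMeasure O) := by
        refine lintegral_congr fun y => ?_
        rw [lintegral_lintegral_swap]
        exact (hm.comp (by fun_prop : Measurable fun x : ℝ × Space d => ((y, x.1), x.2))).aemeasurable
    _ = ∫⁻ z in ball (0 : Space d) Γ.c, ∫⁻ y in ball x₀ Γ.ρ, (∫⁻ t in Set.Ioo 0 Γ.ρ,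
        ENNReal.ofReal (t ^ (-2 : ℝ)) *
          ‖φ y - φ (y - t • (Γ.e + z))‖ₑ ^ 2) ∂(surfaceMeasure O) := by
        rw [lintegral_lintegral_swap]
        refine Measurable.aemeasurable ?_
        refine Measurable.lintegral_prod_right' (f := fun x : (Space d × Space d) × ℝ =>
          ENNReal.ofReal (x.2 ^ (-2 : ℝ)) *
            ‖φ x.1.1 - φ (x.1.1 - x.2 • (Γ.e + x.1.2))‖ₑ ^ 2) ?_
        exact hm.comp (by fun_prop : Measurable fun x : (Space d × Space d) × ℝ =>
          ((x.1.1, x.2), x.1.2))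
    _ ≤ ∫⁻ _z in ball (0 : Space d) Γ.c, 16 * Γ.C * ∫⁻ x in O, ‖grad φ x‖ₑ ^ 2 := by
        refine setLIntegral_mono' measurableSet_ball fun z hz => ?_
        refine (Γ.hardy hφ (by simpa using hz) le_rfl).trans ?_
        gcongr
        exact layerEnergy_le _ _
    _ = _ := by rw [setLIntegral_const, mul_comm]

/-- The seminorm of nearby pairs is dominated by cone variations (`difference_quotient_le`).
Integrating out one boundary variable leaves the weight t^{-2} (`Chart.lintegral_coneKernel_le`),
after which Hardy's inequality bounds everything by the Dirichlet energy. -/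
lemma Chart.lintegral_slobodeckij_le (hd : 2 ≤ d) (Γ : Chart O x₀)
    [IsFiniteMeasure (surfaceMeasure O)] :
    ∃ K : ℝ≥0, ∀ φ : Space d → ℂ, ContDiff ℝ ∞ φ →
    ∫⁻ y in ball x₀ Γ.ρ, (∫⁻ y' in ball x₀ Γ.ρ,
      {x : Space d | 4 * dist y x < Γ.c * Γ.ρ}.indicator (fun x => ‖φ y - φ x‖ₑ ^ 2 *
        ENNReal.ofReal ((dist y x)⁻¹ ^ d)) y' ∂(surfaceMeasure O)) ∂(surfaceMeasure O) ≤
      K * ∫⁻ x in O, ‖grad φ x‖ₑ ^ 2 := by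
  have hc := Γ.c_pos
  set σ := (surfaceMeasure O).restrict (ball x₀ Γ.ρ) with hσ
  set m := volume (ball (0 : Space d) (Γ.c / 2)) * ENNReal.ofReal (2 / Γ.c) with hm
  have hm0 : m ≠ 0 := mul_ne_zero (measure_ball_pos volume 0 (by positivity)).ne'
    (by simpa using hc)
  have hmt : m ≠ ⊤ := ENNReal.mul_ne_top measure_ball_lt_top.ne ENNReal.ofReal_ne_top
  obtain ⟨A, hA⟩ : ∃ A, A = ENNReal.ofReal ((4 / Γ.c) ^ (d + 1) * (Γ.C * (Γ.c / 2) ^ (d - 1))) :=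
    ⟨_, rfl⟩
  have hAt : A ≠ ⊤ := hA ▸ ENNReal.ofReal_ne_top
  set v := volume (ball (0 : Space d) Γ.c) with hv
  have hvt : v ≠ ⊤ := measure_ball_lt_top.ne
  have hKt : m⁻¹ * (4 * A * (v * (16 * Γ.C))) ≠ ⊤ := by
    refine ENNReal.mul_ne_top (by simpa using hm0) ?_
    refine ENNReal.mul_ne_top (ENNReal.mul_ne_top (by simp) hAt) ?_
    exact ENNReal.mul_ne_top hvt (ENNReal.mul_ne_top (by simp) (by simp))
  refine ⟨(m⁻¹ * (4 * A * (v * (16 * Γ.C)))).toNNReal, fun φ hφ => ?_⟩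
  rw [ENNReal.coe_toNNReal hKt]
  have hφc := hφ.continuous
  set E : Space d → ℝ → ℝ≥0∞ := coneVariation φ Γ.e Γ.c with hE
  have hEm : Measurable fun x : Space d × ℝ => E x.1 x.2 := measurable_coneVariation hφc _ _
  have hkm := measurable_coneKernel (d := d) Γ.c
  clear_value E m v
  set J : ℝ≥0∞ := ∫⁻ y, ∫⁻ y', (∫⁻ t in Set.Ioo 0 Γ.ρ, E y t * coneKernel Γ.c t y y') ∂σ ∂σ with hJ
  have hmeas : Measurable fun x : (Space d × Space d) × ℝ =>
      E x.1.1 x.2 * coneKernel Γ.c x.2 x.1.1 x.1.2 :=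
    (hEm.comp (by fun_prop : Measurable fun x : (Space d × Space d) × ℝ => (x.1.1, x.2))).mul hkm
  have hpt : ∀ y ∈ ball x₀ Γ.ρ, ∀ t ∈ Set.Ioo 0 Γ.ρ, ∫⁻ y', E y t * coneKernel Γ.c t y y' ∂σ ≤
      A * (ENNReal.ofReal (t ^ (-2 : ℝ)) * E y t) := by
    intro y hy t ht
    have m0 := measurable_coneKernel_right Γ.c t y
    have h3 := Γ.lintegral_coneKernel_le hd hy ht
    rw [← hA, ← hσ] at h3
    rw [lintegral_const_mul _ m0]
    generalize E y t = X
    generalize ENNReal.ofReal (t ^ (-2 : ℝ)) = Y at h3 ⊢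
    generalize ∫⁻ y', coneKernel Γ.c t y y' ∂σ = Z at h3 ⊢
    clear * - h3
    calc X * Z ≤ X * (A * Y) := by gcongr
      _ = A * (Y * X) := by ring
  have hJle : J ≤ A * (v * (16 * Γ.C * ∫⁻ x in O, ‖grad φ x‖ₑ ^ 2)) := by
    calc J = ∫⁻ y, (∫⁻ t in Set.Ioo 0 Γ.ρ, ∫⁻ y', E y t * coneKernel Γ.c t y y' ∂σ) ∂σ := by
          refine lintegral_congr fun y => ?_
          rw [lintegral_lintegral_swap]
          exact (hmeas.comp (by fun_prop : Measurable fun x : Space d × ℝ =>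
            ((y, x.1), x.2))).aemeasurable
      _ ≤ ∫⁻ y, (∫⁻ t in Set.Ioo 0 Γ.ρ, A * (ENNReal.ofReal (t ^ (-2 : ℝ)) * E y t)) ∂σ := by
          exact setLIntegral_mono' measurableSet_ball fun y hy =>
            setLIntegral_mono' measurableSet_Ioo fun t ht => hpt y hy t ht
      _ = A * ∫⁻ y, (∫⁻ t in Set.Ioo 0 Γ.ρ, (ENNReal.ofReal (t ^ (-2 : ℝ)) * E y t)) ∂σ := by
          rw [← lintegral_const_mul' _ _ hAt]
          exact lintegral_congr fun y => lintegral_const_mul' _ _ hAt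
      _ ≤ _ := by
          have h5 := Γ.lintegral_coneVariation_le hφ
          rw [← hE, ← hσ, ← hv] at h5
          gcongr
  have hmain : m * ∫⁻ y, (∫⁻ y', {x : Space d | 4 * dist y x < Γ.c * Γ.ρ}.indicator
      (fun x => ‖φ y - φ x‖ₑ ^ 2 * ENNReal.ofReal ((dist y x)⁻¹ ^ d)) y' ∂σ) ∂σ ≤
      2 * J + 2 * J := by
    -- The kernel is symmetric, so the variations at y and at y' contribute the same amount.
    have hJ' : J = ∫⁻ y, ∫⁻ y', (∫⁻ t in Set.Ioo 0 Γ.ρ, E y' t * coneKernel Γ.c t y y') ∂σ ∂σ := by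
      rw [hJ, lintegral_lintegral_swap]
      · simp only [coneKernel_comm]
      · exact (hmeas.lintegral_prod_right' (f := fun x : (Space d × Space d) × ℝ =>
          E x.1.1 x.2 * coneKernel Γ.c x.2 x.1.1 x.1.2)).aemeasurable
    nth_rw 2 [hJ']
    rw [hJ, ← lintegral_const_mul' _ _ hmt, ← lintegral_const_mul' _ _ (by simp),
      ← lintegral_const_mul' _ _ (by simp)]
    simp only [← lintegral_const_mul' m _ hmt, ← lintegral_const_mul' 2 _ ENNReal.ofNat_ne_top]
    have hm1 : ∀ y y', Measurable fun t : ℝ => 2 * (E y t * coneKernel Γ.c t y y') := fun y y' =>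
      (hmeas.comp (by fun_prop : Measurable fun t : ℝ => ((y, y'), t))).const_mul 2
    have hm2 : Measurable fun x : Space d × Space d =>
        ∫⁻ t in Set.Ioo 0 Γ.ρ, 2 * (E x.1 t * coneKernel Γ.c t x.1 x.2) :=
      (hmeas.const_mul 2).lintegral_prod_right' (f := fun x : (Space d × Space d) × ℝ =>
          2 * (E x.1.1 x.2 * coneKernel Γ.c x.2 x.1.1 x.1.2))
    rw [← lintegral_add_left hm2.lintegral_prod_right']
    refine lintegral_mono fun y => ?_
    have hm3 : Measurable fun y' =>
        ∫⁻ t in Set.Ioo 0 Γ.ρ, 2 * (E y t * coneKernel Γ.c t y y') :=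
      hm2.comp measurable_prodMk_left
    dsimp only
    rw [← lintegral_add_left hm3]
    refine lintegral_mono fun y' => ?_
    rw [← lintegral_add_left (hm1 y y')]
    by_cases hyy : 4 * dist y y' < Γ.c * Γ.ρ
    · rw [Set.indicator_of_mem (by exact hyy)]
      rw [hm]
      refine (difference_quotient_le hφc Γ.e hc hyy).trans (le_of_eq ?_)
      refine lintegral_congr fun t => ?_
      simp only [hE]
      ring
    · rw [Set.indicator_of_notMem (by exact hyy), mul_zero]
      exact zero_le
  have h4 : 2 * J + 2 * J ≤ 4 * A * (v * (16 * Γ.C)) * ∫⁻ x in O, ‖grad φ x‖ₑ ^ 2 := by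
    calc 2 * J + 2 * J = 4 * J := by ring
      _ ≤ 4 * (A * (v * (16 * Γ.C * ∫⁻ x in O, ‖grad φ x‖ₑ ^ 2))) := by gcongr
      _ = _ := by ring
  rw [mul_assoc m⁻¹, ← ENNReal.div_eq_inv_mul, ENNReal.le_div_iff_mul_le (Or.inl hm0) (Or.inl hmt),
    mul_comm]
  exact hmain.trans h4

end Trace

end Acoustic

end


/-! ### Global trace and boundary layer estimates -/

noncomputable section

namespace Acoustic

open Metric
open scoped ENNReal NNReal Topology

variable {d : ℕ}

lemma lintegral_le_sum_cover {α ι : Type*} [MeasurableSpace α] {μ : Measure α} (s : Finset ι)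
    (U : ι → Set α) (h : ∀ᵐ x ∂μ, x ∈ ⋃ i ∈ s, U i) (f : α → ℝ≥0∞) :
    ∫⁻ x, f x ∂μ ≤ ∑ i ∈ s, ∫⁻ x in U i, f x ∂μ := by
  have h1 : (⋃ i ∈ s, U i) = ⋃ i : s, U i := by
    ext x; simp
  rw [h1] at h
  rw [← Measure.restrict_eq_self_of_ae_mem h]
  refine (lintegral_iUnion_le _ _).trans ?_
  rw [tsum_fintype, Finset.sum_coe_sort s fun i => ∫⁻ x in U i, f x ∂μ]
  rw [Measure.restrict_eq_self_of_ae_mem h]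

section Global

variable {O : Set (Space d)}

lemma IsLipschitzDomain.frontier_nonempty (hd : 2 ≤ d) (hO : IsLipschitzDomain O) :
    (frontier O).Nonempty := by
  by_contra h
  rw [Set.not_nonempty_iff_eq_empty, ← isClopen_iff_frontier_eq_empty, isClopen_iff] at h
  have : Nontrivial (Space d) := by
    have : Nonempty (Fin d) := ⟨⟨0, by omega⟩⟩
    infer_instance
  rcases h with h | h
  · exact hO.isConnected.nonempty.ne_empty h
  · exact NormedSpace.unbounded_univ ℝ (Space d) (h ▸ hO.isBounded)

lemma exists_lintegral_trace_le (hO : IsLipschitzDomain O) : ∃ K : ℝ≥0, ∀ φ : Space d → ℂ,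
    ContDiff ℝ ∞ φ → ∫⁻ y, ‖φ y‖ₑ ^ 2 ∂(surfaceMeasure O) ≤
      K * ((∫⁻ x in O, ‖φ x‖ₑ ^ 2) + ∫⁻ x in O, ‖grad φ x‖ₑ ^ 2) := by
  obtain ⟨s, Γ, hs⟩ := exists_chart_cover hO (fun _ Γ => Γ.ρ) (fun _ Γ => Γ.ρ_pos)
  choose K hK using fun x => (Γ x).lintegral_trace_le
  refine ⟨∑ x ∈ s, K x, fun φ hφ => ?_⟩
  refine (lintegral_le_sum_cover s _ (ae_surface_mem.mono fun x hx => hs hx) _).trans ?_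
  push_cast
  rw [Finset.sum_mul]
  exact Finset.sum_le_sum fun x _ => hK x φ hφ

/-- Pairs at distance below m stay inside the chart when y is in the half ball, since m ≤ cρ/4 ≤
ρ/8. For all other pairs the weight is at most m^{-d}, and the L² norm on the boundary suffices. -/
lemma Chart.lintegral_slobodeckij_half_le {x₀ : Space d} (Γ : Chart O x₀)
    [IsFiniteMeasure (surfaceMeasure O)] {m : ℝ} (hm : 0 < m) (hmc : m ≤ Γ.c * Γ.ρ / 4)
    {φ : Space d → ℂ} (hφ : Continuous φ) :
    ∫⁻ y in ball x₀ (Γ.ρ / 2), (∫⁻ y', ‖φ y - φ y'‖ₑ ^ 2 * ENNReal.ofReal ((dist y y')⁻¹ ^ d)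
        ∂(surfaceMeasure O)) ∂(surfaceMeasure O) ≤
      (∫⁻ y in ball x₀ Γ.ρ, (∫⁻ y' in ball x₀ Γ.ρ,
        {x : Space d | 4 * dist y x < Γ.c * Γ.ρ}.indicator (fun x => ‖φ y - φ x‖ₑ ^ 2 *
          ENNReal.ofReal ((dist y x)⁻¹ ^ d)) y' ∂(surfaceMeasure O)) ∂(surfaceMeasure O)) +
      4 * surfaceMeasure O Set.univ * ENNReal.ofReal (m⁻¹ ^ d) *
        ∫⁻ y, ‖φ y‖ₑ ^ 2 ∂(surfaceMeasure O) := by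
  have hφm := hφ.measurable
  obtain ⟨b, hb⟩ : ∃ b, b = ENNReal.ofReal (m⁻¹ ^ d) := ⟨_, rfl⟩
  have hbt : b ≠ ⊤ := hb ▸ ENNReal.ofReal_ne_top
  rw [← hb]
  have hρ := Γ.ρ_pos
  have hc' := Γ.c_le
  have hpt : ∀ y ∈ ball x₀ (Γ.ρ / 2), ∀ y',
      ‖φ y - φ y'‖ₑ ^ 2 * ENNReal.ofReal ((dist y y')⁻¹ ^ d) ≤
      (ball x₀ Γ.ρ).indicator
        ({x' : Space d | 4 * dist y x' < Γ.c * Γ.ρ}.indicator (fun x' => ‖φ y - φ x'‖ₑ ^ 2 *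
          ENNReal.ofReal ((dist y x')⁻¹ ^ d))) y' +
        b * (2 * ‖φ y‖ₑ ^ 2 + 2 * ‖φ y'‖ₑ ^ 2) := by
    intro y hy y'
    rcases lt_or_ge (dist y y') m with h | h
    · refine le_trans (le_of_eq ?_) le_self_add
      rw [Set.indicator_of_mem, Set.indicator_of_mem]
      · rw [Set.mem_ofPred_eq]; linarith
      · rw [mem_ball] at hy ⊢
        have := dist_triangle y' y x₀
        rw [dist_comm y' y] at this
        have h3 : Γ.c * Γ.ρ ≤ 1 / 2 * Γ.ρ := mul_le_mul_of_nonneg_right hc' hρ.le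
        linarith
    · refine le_trans ?_ le_add_self
      rw [mul_comm, hb]
      refine mul_le_mul' (ENNReal.ofReal_le_ofReal ?_) ?_
      · gcongr
      · have := enorm_sub_sq_le (φ y) 0 (φ y')
        simpa using this
  have mfar : Measurable fun z : Space d × Space d => b * (2 * ‖φ z.1‖ₑ ^ 2 + 2 * ‖φ z.2‖ₑ ^ 2) :=
    by fun_prop
  have mfar' : ∀ y, Measurable fun y' => b * (2 * ‖φ y‖ₑ ^ 2 + 2 * ‖φ y'‖ₑ ^ 2) := fun y => by
    fun_prop
  have hSt : surfaceMeasure O Set.univ ≠ ⊤ := measure_ne_top _ _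
  have h1 : ∀ y, ∫⁻ y', b * (2 * ‖φ y‖ₑ ^ 2 + 2 * ‖φ y'‖ₑ ^ 2) ∂(surfaceMeasure O) =
      b * (2 * surfaceMeasure O Set.univ * ‖φ y‖ₑ ^ 2 +
        2 * ∫⁻ y', ‖φ y'‖ₑ ^ 2 ∂(surfaceMeasure O)) := by
    intro y
    rw [lintegral_const_mul' _ _ hbt, lintegral_add_left measurable_const,
      lintegral_const, lintegral_const_mul' _ _ (by simp)]
    ring
  have h2 : ∫⁻ y, (∫⁻ y', b * (2 * ‖φ y‖ₑ ^ 2 + 2 * ‖φ y'‖ₑ ^ 2) ∂(surfaceMeasure O))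
      ∂(surfaceMeasure O) = 4 * surfaceMeasure O Set.univ * b *
        ∫⁻ y, ‖φ y‖ₑ ^ 2 ∂(surfaceMeasure O) := by
    simp only [h1]
    rw [lintegral_const_mul' _ _ hbt, lintegral_add_right _ measurable_const, lintegral_const,
      lintegral_const_mul' _ _ (ENNReal.mul_ne_top (by simp) hSt)]
    ring
  refine (setLIntegral_mono' measurableSet_ball fun y hy =>
    lintegral_mono fun y' => hpt y hy y').trans ?_
  simp only [lintegral_add_right _ (mfar' _)]
  rw [lintegral_add_right _ mfar.lintegral_prod_right', ← h2]
  refine add_le_add ?_ (lintegral_mono' Measure.restrict_le_self le_rfl)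
  have hsub : ball x₀ (Γ.ρ / 2) ⊆ ball x₀ Γ.ρ := ball_subset_ball (by linarith)
  simp only [lintegral_indicator measurableSet_ball]
  exact lintegral_mono_set hsub

lemma exists_lintegral_slobodeckij_le (hd : 2 ≤ d) (hO : IsLipschitzDomain O) :
    ∃ K : ℝ≥0, ∀ φ : Space d → ℂ, ContDiff ℝ ∞ φ →
      ∫⁻ y, (∫⁻ y', ‖φ y - φ y'‖ₑ ^ 2 * ENNReal.ofReal ((dist y y')⁻¹ ^ d)
        ∂(surfaceMeasure O)) ∂(surfaceMeasure O) ≤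
      K * ((∫⁻ x in O, ‖φ x‖ₑ ^ 2) + ∫⁻ x in O, ‖grad φ x‖ₑ ^ 2) := by
  have hfin := isFiniteMeasure_surface hO
  obtain ⟨s, Γ, hs⟩ := exists_chart_cover hO (fun _ Γ => Γ.ρ / 2) (fun _ Γ => half_pos Γ.ρ_pos)
  obtain ⟨m, hm, hms⟩ := exists_pos_le s (fun x => (Γ x).c * (Γ x).ρ / 4)
    (fun x => by have := (Γ x).c_pos; have := (Γ x).ρ_pos; positivity)
  choose K hK using fun x => (Γ x).lintegral_slobodeckij_le hd
  obtain ⟨L, hL⟩ := exists_lintegral_trace_le hO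
  obtain ⟨B, hB⟩ : ∃ B : ℝ≥0, (B : ℝ≥0∞) =
      4 * surfaceMeasure O Set.univ * ENNReal.ofReal (m⁻¹ ^ d) := by
    refine ⟨_, ENNReal.coe_toNNReal (ENNReal.mul_ne_top (ENNReal.mul_ne_top (by simp) ?_) ?_)⟩
    · exact measure_ne_top _ _
    · exact ENNReal.ofReal_ne_top
  refine ⟨∑ x ∈ s, (K x + B * L), fun φ hφ => ?_⟩
  refine (lintegral_le_sum_cover s _ (ae_surface_mem.mono fun x hx => hs hx) _).trans ?_
  push_cast
  rw [Finset.sum_mul]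
  refine Finset.sum_le_sum fun x hx => ?_
  refine ((Γ x).lintegral_slobodeckij_half_le hm (hms x hx) hφ.continuous).trans ?_
  rw [← hB, add_mul, mul_assoc (B : ℝ≥0∞)]
  exact add_le_add ((hK x φ hφ).trans (mul_le_mul_right le_add_self _))
    (mul_le_mul_right (hL φ hφ) _)

/-- The behaviour of a smooth function in a thin boundary layer. -/
lemma exists_layer_le (hd : 2 ≤ d) (hO : IsLipschitzDomain O) : ∃ K : ℝ≥0, ∃ δ > 0, ∀ φ : Space d → ℂ,
    ContDiff ℝ ∞ φ → ∀ ε ∈ Set.Ioo 0 δ,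
      ∫⁻ x in O ∩ {x | infDist x (frontier O) < ε}, ‖φ x‖ₑ ^ 2 ≤
        K * ENNReal.ofReal ε * (∫⁻ y, ‖φ y‖ₑ ^ 2 ∂(surfaceMeasure O)) +
        K * ENNReal.ofReal (ε ^ 2) * layerEnergy O (grad φ) (K * ε) := by
  obtain ⟨s, Γ, hs⟩ := exists_chart_cover hO (fun _ Γ => Γ.δ / 2) (fun _ Γ => half_pos Γ.δ_pos)
  obtain ⟨δ, hδ, hδs⟩ := exists_pos_le s (fun x => (Γ x).δ / 2) (fun x => half_pos (Γ x).δ_pos)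
  have hfin := isFiniteMeasure_surface hO
  refine ⟨∑ x ∈ s, (2 * (Γ x).C + 32 * (Γ x).C ^ 3), δ, hδ, fun φ hφ ε hε => ?_⟩
  have hφc := hφ.continuous
  set K : ℝ≥0 := ∑ x ∈ s, (2 * (Γ x).C + 32 * (Γ x).C ^ 3) with hK
  set T := ∫⁻ y, ‖φ y‖ₑ ^ 2 ∂(surfaceMeasure O) with hT
  have hcov : ∀ᵐ x ∂(volume.restrict (O ∩ {x | infDist x (frontier O) < ε})),
      x ∈ ⋃ i ∈ s, ball (i : Space d) (Γ i).δ ∩ {x | infDist x (frontier O) < ε} := by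
    have hm : MeasurableSet (O ∩ {x | infDist x (frontier O) < ε}) :=
      hO.isOpen.measurableSet.inter (measurableSet_lt measurable_infDist measurable_const)
    filter_upwards [ae_restrict_mem hm] with x hx
    have hne := hO.frontier_nonempty hd
    -- The half-size balls cover the boundary; a point of the layer is within ε < Γ.δ/2 of the
    -- boundary, hence in one of the full balls of radius Γ.δ.
    obtain ⟨y, hy, hxy⟩ := (infDist_lt_iff hne).1 hx.2
    obtain ⟨i, hi, hyi⟩ := Set.mem_iUnion₂.1 (hs hy)
    refine Set.mem_iUnion₂.2 ⟨i, hi, ?_, hx.2⟩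
    have h1 := hδs i hi
    have h2 := dist_triangle x y i
    rw [mem_ball] at hyi ⊢
    linarith [hε.2]
  refine (lintegral_le_sum_cover s _ hcov _).trans ?_
  have hterm : ∀ i ∈ s, ∫⁻ x in ball (i : Space d) (Γ i).δ ∩ {x | infDist x (frontier O) < ε},
      ‖φ x‖ₑ ^ 2 ∂(volume.restrict (O ∩ {x | infDist x (frontier O) < ε})) ≤
      (2 * (Γ i).C + 32 * (Γ i).C ^ 3 : ℝ≥0) * (ENNReal.ofReal ε * T +
        ENNReal.ofReal (ε ^ 2) * layerEnergy O (grad φ) (K * ε)) := by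
    intro i hi
    have hε' : ε ∈ Set.Ioo 0 (Γ i).δ := ⟨hε.1, by linarith [hδs i hi, hε.2, (Γ i).δ_pos]⟩
    have hCε : (Γ i).C * ε ≤ (Γ i).ρ :=
      (mul_le_mul_of_nonneg_left hε'.2.le (Γ i).C.2).trans (Γ i).layer_le
    have h1 := (Γ i).layer ε hε' (fun x => ‖φ x‖ₑ ^ 2) (hφc.enorm.measurable.pow_const 2)
    have h2 := (Γ i).layer_variation hφ hCε
    have h3 : layerEnergy O (grad φ) (2 * ((Γ i).C * ε)) ≤ layerEnergy O (grad φ) (K * ε) := by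
      refine lintegral_mono_set (Set.inter_subset_inter_right _ fun x hx => ?_)
      rw [Set.mem_ofPred_eq] at hx ⊢
      refine hx.trans_le ?_
      rw [← mul_assoc]
      refine mul_le_mul_of_nonneg_right ?_ hε.1.le
      have h4 : 2 * (Γ i).C ≤ K :=
        le_self_add.trans (Finset.single_le_sum (f := fun x => 2 * (Γ x).C + 32 * (Γ x).C ^ 3)
          (fun _ _ => zero_le) hi)
      exact_mod_cast h4
    have m1 : Measurable fun x : Space d × ℝ => ‖φ x.1 - φ (x.1 - x.2 • (Γ i).e)‖ₑ ^ 2 :=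
      Measurable.pow_const (Continuous.measurable (by fun_prop)) 2
    have m2 : ∀ y, Measurable fun t : ℝ => 2 * ‖φ y - φ (y - t • (Γ i).e)‖ₑ ^ 2 := fun y =>
      (Measurable.pow_const (Continuous.measurable (by fun_prop)) 2).const_mul 2
    calc _ = ∫⁻ x in O ∩ (ball (i : Space d) (Γ i).δ ∩ {x | infDist x (frontier O) < ε}),
          ‖φ x‖ₑ ^ 2 := by
          rw [Measure.restrict_restrict (measurableSet_ball.inter
            (measurableSet_lt measurable_infDist measurable_const))]
          congr 2
          ext x
          simp only [Set.mem_inter_iff]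
          tauto
      _ ≤ _ := h1
      -- Compare φ on the ray with its value at the foot point. The foot values contribute a term of
      -- order ε, the variation along the ray a term ε² times the energy of the layer; keeping that
      -- localised energy is what later makes the cut-off argument converge.
      _ ≤ ∫⁻ x in ball (i : Space d) (Γ i).ρ, (2 * (∫⁻ r in Set.Ioo (0 : ℝ) ((Γ i).C * ε),
          ‖φ x - φ (x - r • (Γ i).e)‖ₑ ^ 2) + 2 * ENNReal.ofReal ((Γ i).C * ε) * ‖φ x‖ₑ ^ 2)
            ∂(surfaceMeasure O) := by
          refine lintegral_mono fun y => ?_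
          have h5 : 2 * ENNReal.ofReal ((Γ i).C * ε) * ‖φ y‖ₑ ^ 2 =
              ∫⁻ _r in Set.Ioo (0 : ℝ) ((Γ i).C * ε), 2 * ‖φ y‖ₑ ^ 2 := by
            rw [setLIntegral_const, Real.volume_Ioo, sub_zero]; ring
          rw [h5, ← lintegral_const_mul' _ _ (by simp), ← lintegral_add_left (m2 y)]
          refine lintegral_mono fun t => ?_
          have := enorm_sq_le (φ (y - t • (Γ i).e)) (φ y)
          rwa [← enorm_neg (_ - _), neg_sub] at this
      _ = 2 * (∫⁻ x in ball (i : Space d) (Γ i).ρ, (∫⁻ r in Set.Ioo (0 : ℝ) ((Γ i).C * ε),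
          ‖φ x - φ (x - r • (Γ i).e)‖ₑ ^ 2) ∂(surfaceMeasure O)) +
          2 * ENNReal.ofReal ((Γ i).C * ε) *
            ∫⁻ x in ball (i : Space d) (Γ i).ρ, ‖φ x‖ₑ ^ 2 ∂(surfaceMeasure O) := by
          rw [lintegral_add_left (m1.lintegral_prod_right'.const_mul 2),
            lintegral_const_mul' _ _ (by simp),
            lintegral_const_mul' _ _ (ENNReal.mul_ne_top (by simp) ENNReal.ofReal_ne_top)]
      _ ≤ 2 * (ENNReal.ofReal (((Γ i).C * ε) ^ 2) *
            (16 * (Γ i).C * layerEnergy O (grad φ) (K * ε))) +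
          2 * ENNReal.ofReal ((Γ i).C * ε) * T := by
          refine add_le_add (mul_le_mul_right (h2.trans (mul_le_mul_right
            (mul_le_mul_right h3 _) _)) _) (mul_le_mul_right ?_ _)
          exact lintegral_mono' Measure.restrict_le_self le_rfl
      _ = 32 * (Γ i).C ^ 3 * (ENNReal.ofReal (ε ^ 2) * layerEnergy O (grad φ) (K * ε)) +
          2 * (Γ i).C * (ENNReal.ofReal ε * T) := by
          rw [mul_pow, ENNReal.ofReal_mul (by positivity), ENNReal.ofReal_mul (by positivity),
            ENNReal.ofReal_pow (by positivity), ENNReal.ofReal_coe_nnreal]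
          ring
      _ ≤ _ := by
          push_cast
          rw [mul_add, add_comm]
          exact add_le_add (mul_le_mul_left le_self_add _) (mul_le_mul_left le_add_self _)
  refine (Finset.sum_le_sum hterm).trans (le_of_eq ?_)
  rw [← Finset.sum_mul, ← ENNReal.ofNNReal_finsetSum, ← hK]
  ring

end Global

end Acoustic

end


/-! ### The trace operator into H^{1/2}(∂O) -/

noncomputable section

namespace Acoustic

open Metric
open scoped ENNReal NNReal Topology

variable {d : ℕ}

lemma enorm_sq_eq_lintegral {α X : Type*} [MeasurableSpace α] {μ : Measure α}
    [NormedAddCommGroup X] (f : Lp X 2 μ) : ‖f‖ₑ ^ 2 = ∫⁻ x, ‖f x‖ₑ ^ 2 ∂μ := by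
  rw [Lp.enorm_def, eLpNorm_two_sq]

lemma enorm_div_rpow_sq (a : ℂ) {r : ℝ} (hr : 0 ≤ r) :
    ‖a / ((r ^ ((d : ℝ) / 2) : ℝ) : ℂ)‖ₑ ^ 2 = ‖a‖ₑ ^ 2 * ENNReal.ofReal (r⁻¹ ^ d) := by
  rw [← ofReal_norm, ← ofReal_norm, ← ENNReal.ofReal_pow (norm_nonneg _),
    ← ENNReal.ofReal_pow (norm_nonneg _), ← ENNReal.ofReal_mul (by positivity), norm_div,
    Complex.norm_real, Real.norm_of_nonneg (Real.rpow_nonneg hr _), div_pow,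
    ← Real.rpow_natCast (r ^ _) 2, ← Real.rpow_mul hr]
  have : (d : ℝ) / 2 * (2 : ℕ) = (d : ℕ) := by push_cast; ring
  rw [this, Real.rpow_natCast, inv_pow, div_eq_mul_inv]

section Graph

variable {E F : Type*} [NormedAddCommGroup E] [NormedSpace ℂ E] [NormedAddCommGroup F]
  [NormedSpace ℂ F]

lemma norm_snd_le_of_mem_closure {S : Submodule ℂ (E × F)} {K : ℝ}
    (hS : ∀ w ∈ S, ‖w.2‖ ≤ K * ‖w.1‖) {w : E × F} (hw : w ∈ S.topologicalClosure) :
    ‖w.2‖ ≤ K * ‖w.1‖ := by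
  have hc : IsClosed {w : E × F | ‖w.2‖ ≤ K * ‖w.1‖} := isClosed_le (by fun_prop) (by fun_prop)
  exact closure_minimal (fun w hw => hS w hw) hc hw

/-- Extension of a bounded linear map by continuity, phrased for graphs: approximating arguments
have Cauchy images, because the bound applies to differences. -/
lemma exists_mem_closure_of_bound [CompleteSpace F] {S : Submodule ℂ (E × F)} {K : ℝ} (hK : 0 ≤ K)
    (hS : ∀ w ∈ S, ‖w.2‖ ≤ K * ‖w.1‖) {x : E}
    (hx : x ∈ (S.map (LinearMap.fst ℂ E F)).topologicalClosure) :
    ∃ y, (x, y) ∈ S.topologicalClosure := by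
  obtain ⟨u, hu, hux⟩ := mem_closure_iff_seq_limit.1 hx
  choose w hw hwu using hu
  have hc : CauchySeq fun n => (w n).2 := by
    refine Metric.cauchySeq_iff.2 fun ε hε => ?_
    obtain ⟨N, hN⟩ := Metric.cauchySeq_iff.1 hux.cauchySeq (ε / (K + 1)) (by positivity)
    refine ⟨N, fun m hm n hn => ?_⟩
    have h1 := hS _ (S.sub_mem (hw m) (hw n))
    have h2 := hN m hm n hn
    rw [← hwu m, ← hwu n, dist_eq_norm] at h2
    rw [dist_eq_norm]
    rw [lt_div_iff₀ (by positivity)] at h2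
    refine h1.trans_lt (lt_of_le_of_lt ?_ h2)
    change K * ‖(w m).1 - (w n).1‖ ≤ ‖(w m).1 - (w n).1‖ * (K + 1)
    nlinarith [norm_nonneg ((w m).1 - (w n).1)]
  obtain ⟨y, hy⟩ := cauchySeq_tendsto_of_complete hc
  refine ⟨y, mem_closure_iff_seq_limit.2 ⟨w, hw, ?_⟩⟩
  have h1 : Tendsto (fun n => (w n).1) atTop (𝓝 x) := by
    refine hux.congr fun n => ?_
    rw [← hwu n]; rfl
  exact h1.prodMk_nhds hy

end Graph

section Trace

variable {O : Set (Space d)}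

/-- The embedding `H^{1/2}(∂O) → L²(∂O)` as a bounded operator. -/
def HHalf.toL2L (O : Set (Space d)) : HHalf O →L[ℂ] L2Bdry O :=
  LinearMap.mkContinuous
    { toFun := HHalf.toL2
      map_add' := fun _ _ => rfl
      map_smul' := fun _ _ => rfl } 1 fun h => by
    rw [one_mul]
    have h1 : ‖h‖ ^ 2 = ‖h.toL2‖ ^ 2 + ‖h.1.snd‖ ^ 2 := WithLp.prod_norm_sq_eq_of_L2 h.1
    exact (sq_le_sq₀ (norm_nonneg _) (norm_nonneg _)).1 (by change ‖h.toL2‖ ^ 2 ≤ _; nlinarith [sq_nonneg ‖h.1.snd‖])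

lemma HHalf.norm_sq (h : HHalf O) : ‖h‖ₑ ^ 2 = ‖h.toL2‖ₑ ^ 2 + ‖h.1.snd‖ₑ ^ 2 := by
  have h1 : ‖h‖ ^ 2 = ‖h.toL2‖ ^ 2 + ‖h.1.snd‖ ^ 2 := WithLp.prod_norm_sq_eq_of_L2 h.1
  rw [← ofReal_norm, ← ofReal_norm, ← ofReal_norm, ← ENNReal.ofReal_pow (norm_nonneg _),
    ← ENNReal.ofReal_pow (norm_nonneg _), ← ENNReal.ofReal_pow (norm_nonneg _),
    ← ENNReal.ofReal_add (by positivity) (by positivity), h1]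

/-- The Slobodeckij seminorm. -/
lemma HHalf.enorm_snd_sq [IsFiniteMeasure (surfaceMeasure O)] (h : HHalf O) :
    ‖h.1.snd‖ₑ ^ 2 = ∫⁻ x, (∫⁻ y, ‖h.toL2 x - h.toL2 y‖ₑ ^ 2 * ENNReal.ofReal ((dist x y)⁻¹ ^ d)
      ∂(surfaceMeasure O)) ∂(surfaceMeasure O) := by
  have h1 : (fun z => ‖h.1.snd z‖ₑ ^ 2) =ᵐ[(surfaceMeasure O).prod (surfaceMeasure O)]
      fun z => ‖h.toL2 z.1 - h.toL2 z.2‖ₑ ^ 2 * ENNReal.ofReal ((dist z.1 z.2)⁻¹ ^ d) := by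
    have h2 : h.1.snd =ᵐ[(surfaceMeasure O).prod (surfaceMeasure O)]
      fun z => (h.toL2 z.1 - h.toL2 z.2) / ((‖z.1 - z.2‖ ^ ((d : ℝ) / 2) : ℝ) : ℂ) := h.2
    filter_upwards [h2] with z hz
    rw [hz, enorm_div_rpow_sq _ (norm_nonneg _), dist_eq_norm]
  rw [enorm_sq_eq_lintegral, lintegral_congr_ae h1, lintegral_prod]
  exact ((Lp.aestronglyMeasurable h.1.snd).enorm.pow_const 2).congr h1

lemma HHalf.toL2_injective : Function.Injective (HHalf.toL2 (O := O)) := by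
  intro h k hk
  have h2 : h.1.snd =ᵐ[(surfaceMeasure O).prod (surfaceMeasure O)]
      fun z => (h.toL2 z.1 - h.toL2 z.2) / ((‖z.1 - z.2‖ ^ ((d : ℝ) / 2) : ℝ) : ℂ) := h.2
  have k2 : k.1.snd =ᵐ[(surfaceMeasure O).prod (surfaceMeasure O)]
      fun z => (k.toL2 z.1 - k.toL2 z.2) / ((‖z.1 - z.2‖ ^ ((d : ℝ) / 2) : ℝ) : ℂ) := k.2
  rw [← hk] at k2
  have hs : h.1.snd = k.1.snd := Lp.ext (h2.trans k2.symm)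
  exact Subtype.ext (WithLp.ofLp_injective 2 (Prod.ext hk hs))

/-- The boundary values of a smooth function are in `H^{1/2}(∂O)`. -/
lemma exists_HHalf_of_smooth (hd : 2 ≤ d) (hO : IsLipschitzDomain O) : ∃ K : ℝ, 0 ≤ K ∧
    ∀ φ : Space d → ℂ, ContDiff ℝ ∞ φ → ∃ h : HHalf O, h.toL2 =ᵐ[surfaceMeasure O] φ ∧
      ∀ (p : L2 O) (F : L2Vec O), p =ᵐ[volume.restrict O] φ → F =ᵐ[volume.restrict O] grad φ →
        ‖h‖ ≤ K * ‖(p, F)‖ := by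
  have hfin := isFiniteMeasure_surface hO
  obtain ⟨K, hK⟩ := exists_lintegral_trace_le hO
  obtain ⟨L, hL⟩ := exists_lintegral_slobodeckij_le hd hO
  -- K bounds the L² part and L the seminorm; the factor 2 passes from ‖p‖² + ‖F‖² to the maximum
  -- norm of the pair.
  refine ⟨√((K + L) * 2), Real.sqrt_nonneg _, fun φ hφ => ?_⟩
  have hφc := hφ.continuous
  set q : Space d × Space d → ℂ := fun z =>
    (φ z.1 - φ z.2) / ((‖z.1 - z.2‖ ^ ((d : ℝ) / 2) : ℝ) : ℂ) with hq
  have hqm : Measurable q := by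
    have : Measurable fun z : Space d × Space d => ‖z.1 - z.2‖ ^ ((d : ℝ) / 2) :=
      Measurable.pow_const (Continuous.measurable (by fun_prop)) _
    have h1 : Measurable fun z : Space d × Space d => φ z.1 - φ z.2 :=
      Continuous.measurable (by fun_prop)
    exact h1.div (Complex.measurable_ofReal.comp this)
  have hq2 : eLpNorm q 2 ((surfaceMeasure O).prod (surfaceMeasure O)) ^ 2 ≤
      L * ((∫⁻ x in O, ‖φ x‖ₑ ^ 2) + ∫⁻ x in O, ‖grad φ x‖ₑ ^ 2) := by
    rw [eLpNorm_two_sq, lintegral_prod _ (hqm.enorm.pow_const 2).aemeasurable]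
    refine le_trans (le_of_eq ?_) (hL φ hφ)
    simp only [hq, enorm_div_rpow_sq _ (norm_nonneg _), dist_eq_norm]
  have m1 := memLp_volume_of_continuous hO hφc
  have m2 := memLp_volume_of_continuous hO (continuous_grad hφ)
  have hI : (∫⁻ x in O, ‖φ x‖ₑ ^ 2) + (∫⁻ x in O, ‖grad φ x‖ₑ ^ 2) ≠ ⊤ := by
    rw [← eLpNorm_two_sq, ← eLpNorm_two_sq]
    exact ENNReal.add_ne_top.2 ⟨ENNReal.pow_ne_top m1.2.ne, ENNReal.pow_ne_top m2.2.ne⟩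
  have mq : MemLp q 2 ((surfaceMeasure O).prod (surfaceMeasure O)) := by
    refine ⟨hqm.aestronglyMeasurable, ?_⟩
    have h1 := hq2.trans_lt (ENNReal.mul_lt_top ENNReal.coe_lt_top hI.lt_top)
    by_contra h
    rw [not_lt_top_iff] at h
    simp [h] at h1
  have mφ := memLp_surface_of_continuous hO hφc
  have hmem : (WithLp.toLp 2 (MemLp.toLp _ mφ, MemLp.toLp _ mq) :
      WithLp 2 (L2Bdry O × Lp ℂ 2 ((surfaceMeasure O).prod (surfaceMeasure O)))) ∈
      sobolevHalf O := by
    change MemLp.toLp _ mq =ᵐ[(surfaceMeasure O).prod (surfaceMeasure O)] fun z =>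
      ((MemLp.toLp _ mφ : L2Bdry O) z.1 - (MemLp.toLp _ mφ : L2Bdry O) z.2) /
        ((‖z.1 - z.2‖ ^ ((d : ℝ) / 2) : ℝ) : ℂ)
    have h1 := Measure.quasiMeasurePreserving_fst (μ := surfaceMeasure O)
      (ν := surfaceMeasure O) |>.ae mφ.coeFn_toLp
    have h2 := Measure.quasiMeasurePreserving_snd (μ := surfaceMeasure O)
      (ν := surfaceMeasure O) |>.ae mφ.coeFn_toLp
    filter_upwards [mq.coeFn_toLp, h1, h2] with z a b c
    rw [a, b, c]
  refine ⟨⟨_, hmem⟩, mφ.coeFn_toLp, fun p F hp hF => ?_⟩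
  have e1 : ∫⁻ x in O, ‖φ x‖ₑ ^ 2 = ‖p‖ₑ ^ 2 := by
    rw [enorm_sq_eq_lintegral]
    exact lintegral_congr_ae (hp.mono fun x hx => by simp only [hx])
  have e2 : ∫⁻ x in O, ‖grad φ x‖ₑ ^ 2 = ‖F‖ₑ ^ 2 := by
    rw [enorm_sq_eq_lintegral]
    exact lintegral_congr_ae (hF.mono fun x hx => by simp only [hx])
  have e3 : ‖(MemLp.toLp _ mφ : L2Bdry O)‖ₑ ^ 2 ≤ K * (‖p‖ₑ ^ 2 + ‖F‖ₑ ^ 2) := by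
    rw [Lp.enorm_def, eLpNorm_congr_ae mφ.coeFn_toLp, eLpNorm_two_sq, ← e1, ← e2]
    exact hK φ hφ
  have e4 : ‖(MemLp.toLp _ mq : Lp ℂ 2 ((surfaceMeasure O).prod (surfaceMeasure O)))‖ₑ ^ 2 ≤
      L * (‖p‖ₑ ^ 2 + ‖F‖ₑ ^ 2) := by
    rw [Lp.enorm_def, eLpNorm_congr_ae mq.coeFn_toLp, ← e1, ← e2]
    exact hq2
  have e5 : ‖(⟨_, hmem⟩ : HHalf O)‖ₑ ^ 2 ≤ ENNReal.ofReal ((K + L) * (‖p‖ ^ 2 + ‖F‖ ^ 2)) := by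
    rw [HHalf.norm_sq]
    refine (add_le_add e3 e4).trans (le_of_eq ?_)
    rw [← add_mul, ENNReal.ofReal_mul (by positivity), ENNReal.ofReal_add (by positivity)
      (by positivity), ENNReal.ofReal_add (by positivity) (by positivity),
      ENNReal.ofReal_pow (norm_nonneg _), ENNReal.ofReal_pow (norm_nonneg _), ofReal_norm,
      ofReal_norm, ENNReal.ofReal_coe_nnreal, ENNReal.ofReal_coe_nnreal]
  rw [← ofReal_norm, ← ENNReal.ofReal_pow (norm_nonneg _),
    ENNReal.ofReal_le_ofReal_iff (by positivity)] at e5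
  have e6 : ‖p‖ ≤ ‖(p, F)‖ := norm_fst_le (p, F)
  have e7 : ‖F‖ ≤ ‖(p, F)‖ := norm_snd_le (p, F)
  rw [← Real.sqrt_sq (norm_nonneg (p, F)), ← Real.sqrt_mul (by positivity)]
  refine Real.le_sqrt_of_sq_le (e5.trans ?_)
  rw [mul_assoc]
  have e8 : ‖p‖ ^ 2 ≤ ‖(p, F)‖ ^ 2 := pow_le_pow_left₀ (norm_nonneg _) e6 2
  have e9 : ‖F‖ ^ 2 ≤ ‖(p, F)‖ ^ 2 := pow_le_pow_left₀ (norm_nonneg _) e7 2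
  gcongr
  linarith

/-- The graph of the trace operator on smooth functions. -/
def traceGraph (O : Set (Space d)) : Submodule ℂ ((L2 O × L2Vec O) × HHalf O) :=
  (restrictionGraph O).comap
    (((LinearMap.fst ℂ (L2 O) (L2Vec O)).comp (LinearMap.fst ℂ (L2 O × L2Vec O) (HHalf O))).prod
      (((LinearMap.snd ℂ (L2 O) (L2Vec O)).comp (LinearMap.fst ℂ (L2 O × L2Vec O) (HHalf O))).prod
        ((HHalf.toL2L O : HHalf O →ₗ[ℂ] L2Bdry O).comp
          (LinearMap.snd ℂ (L2 O × L2Vec O) (HHalf O)))))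

lemma exists_traceGraph_bound (hd : 2 ≤ d) (hO : IsLipschitzDomain O) : ∃ K : ℝ, 0 ≤ K ∧
    ∀ w ∈ traceGraph O, ‖w.2‖ ≤ K * ‖w.1‖ := by
  obtain ⟨K, hK, h⟩ := exists_HHalf_of_smooth hd hO
  refine ⟨K, hK, ?_⟩
  rintro ⟨⟨p, F⟩, k⟩ ⟨φ, hφ, h1, h2, h3⟩
  obtain ⟨k', hk', hk⟩ := h φ hφ
  have h3' : k.toL2 =ᵐ[surfaceMeasure O] φ := h3
  have : k = k' := HHalf.toL2_injective (Lp.ext (h3'.trans hk'.symm))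
  rw [this]
  exact hk p F h1 h2

lemma map_fst_traceGraph (hd : 2 ≤ d) (hO : IsLipschitzDomain O) :
    (traceGraph O).map (LinearMap.fst ℂ _ _) = smoothGraph O := by
  obtain ⟨K, hK, h⟩ := exists_HHalf_of_smooth hd hO
  ext ⟨p, F⟩
  constructor
  · rintro ⟨⟨⟨p, F⟩, k⟩, hw, he⟩
    rw [← he]
    exact ⟨_, hw, rfl⟩
  · rintro ⟨⟨p', F', b⟩, ⟨φ, hφ, h1, h2, h3⟩, he⟩
    obtain ⟨rfl, rfl⟩ := Prod.mk.inj he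
    obtain ⟨k, hk, -⟩ := h φ hφ
    exact ⟨((p', F'), k), ⟨φ, hφ, h1, h2, hk⟩, rfl⟩

/-- `IsTrace` asks for convergence of boundary values in L²(∂O) only, and this is weaker than the
H^{1/2}(∂O) convergence obtained by completion. -/
lemma mem_closure_restrictionGraph {p : L2 O} {F : L2Vec O} {h : HHalf O}
    (hw : ((p, F), h) ∈ (traceGraph O).topologicalClosure) :
    (p, F, h.toL2) ∈ (restrictionGraph O).topologicalClosure := by
  have hc : Continuous fun w : (L2 O × L2Vec O) × HHalf O =>
      (w.1.1, w.1.2, HHalf.toL2L O w.2) := by fun_prop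
  exact map_mem_closure (f := fun w : (L2 O × L2Vec O) × HHalf O =>
      (w.1.1, w.1.2, HHalf.toL2L O w.2)) hc hw fun w hw => hw

/-- The trace theorem. -/
theorem exists_trace (hd : 2 ≤ d) (hO : IsLipschitzDomain O) [CompleteSpace (HHalf O)] :
    ∃ K : ℝ, ∀ (p : L2 O) (F : L2Vec O), HasWeakGrad O p F →
      ∃ h : HHalf O, IsTrace O p h ∧ ‖h‖ ≤ K * ‖(p, F)‖ := by
  obtain ⟨K, hK0, hK⟩ := exists_traceGraph_bound hd hO
  refine ⟨K, fun p F hF => ?_⟩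
  have h1 := hF.mem_closure_smoothGraph hO
  rw [← map_fst_traceGraph hd hO] at h1
  obtain ⟨h, hh⟩ := exists_mem_closure_of_bound hK0 hK h1
  have h2 := norm_snd_le_of_mem_closure hK hh
  exact ⟨h, ⟨F, hF, mem_closure_restrictionGraph hh⟩, h2⟩

/-- The L² trace inequality is a closed condition on triples, so it survives in the closure of the
restriction graph. This is the closability behind uniqueness of the trace. -/
lemma eq_zero_of_mem_closure_restrictionGraph (hO : IsLipschitzDomain O) {b : L2Bdry O}
    (hb : ((0 : L2 O), (0 : L2Vec O), b) ∈ (restrictionGraph O).topologicalClosure) : b = 0 := by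
  obtain ⟨K, hK⟩ := exists_lintegral_trace_le hO
  have hc : IsClosed {w : L2 O × L2Vec O × L2Bdry O |
      ‖w.2.2‖ₑ ^ 2 ≤ K * (‖w.1‖ₑ ^ 2 + ‖w.2.1‖ₑ ^ 2)} := by
    refine isClosed_le (by fun_prop) ?_
    exact (ENNReal.continuous_const_mul ENNReal.coe_ne_top).comp (by fun_prop)
  have h1 := closure_minimal (s := (restrictionGraph O : Set (L2 O × L2Vec O × L2Bdry O))) (by
    rintro ⟨p, F, b⟩ ⟨φ, hφ, h1, h2, h3⟩
    simp only [Set.mem_ofPred_eq]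
    dsimp only at h1 h2 h3
    rw [Lp.enorm_def, Lp.enorm_def, Lp.enorm_def, eLpNorm_congr_ae h1, eLpNorm_congr_ae h2,
      eLpNorm_congr_ae h3, eLpNorm_two_sq, eLpNorm_two_sq, eLpNorm_two_sq]
    exact hK φ hφ) hc hb
  simpa using h1

lemma IsTrace.unique (hO : IsLipschitzDomain O) {p : L2 O} {h k : HHalf O} (hh : IsTrace O p h)
    (hk : IsTrace O p k) : h = k := by
  obtain ⟨F, h1, h2⟩ := hh
  obtain ⟨G, k1, k2⟩ := hk
  have h3 := h1.add (k1.smul (-1))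
  rw [neg_one_smul, neg_one_smul, add_neg_cancel] at h3
  have h4 := h3.unique hO.isOpen
  rw [← sub_eq_add_neg, sub_eq_zero] at h4
  subst h4
  have h5 := Submodule.sub_mem _ h2 k2
  rw [Prod.mk_sub_mk, Prod.mk_sub_mk, sub_self, sub_self] at h5
  exact HHalf.toL2_injective (sub_eq_zero.1 (eq_zero_of_mem_closure_restrictionGraph hO h5))

end Trace

end Acoustic

end


/-! ### Cut-off functions and the kernel of the trace -/

noncomputable section

namespace Acoustic

open Metric
open scoped ENNReal NNReal Topology

variable {d : ℕ}

section Cutoff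

variable {O : Set (Space d)}

lemma norm_grad_sq_le {φ : Space d → ℂ} {C : ℝ} {x : Space d} (h : ‖fderiv ℝ φ x‖ ≤ C) :
    ‖grad φ x‖ ^ 2 ≤ d * C ^ 2 := by
  rw [EuclideanSpace.norm_sq_eq]
  calc _ ≤ ∑ _i : Fin d, C ^ 2 := by
        refine Finset.sum_le_sum fun i _ => pow_le_pow_left₀ (norm_nonneg _) ?_ 2
        have h1 := (fderiv ℝ φ x).le_opNorm (EuclideanSpace.single i 1)
        rw [PiLp.norm_single, norm_one, mul_one] at h1
        exact h1.trans h
    _ = _ := by simp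

lemma IsMollifier.norm_mol_sub_le {ψ : Space d → ℝ} (hψ : IsMollifier ψ) {u : Space d → ℂ}
    {C : ℝ≥0} (hu : LipschitzWith C u) (x y : Space d) :
    ‖mol ψ u x - mol ψ u y‖ ≤ C * ‖x - y‖ := by
  have hl : LocallyIntegrable u := hu.continuous.locallyIntegrable
  have hi : Integrable ψ := hψ.smooth.continuous.integrable_of_hasCompactSupport hψ.compact
  rw [mol_apply, mol_apply, ← integral_sub (hψ.integrable hl x) (hψ.integrable hl y)]
  have h1 : ∫ z, ψ z * (C * ‖x - y‖) = C * ‖x - y‖ := by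
    rw [integral_mul_const, hψ.integral, one_mul]
  rw [← h1]
  refine norm_integral_le_of_norm_le (hi.mul_const _) (Eventually.of_forall fun z => ?_)
  rw [← smul_sub, norm_smul, Real.norm_of_nonneg (hψ.nonneg z)]
  refine mul_le_mul_of_nonneg_left ?_ (hψ.nonneg z)
  have := hu.norm_sub_le (x - z) (y - z)
  rwa [sub_sub_sub_cancel_right] at this

lemma IsMollifier.norm_sub_mol_le {ψ : Space d → ℝ} (hψ : IsMollifier ψ) {u : Space d → ℂ}
    (hu : Continuous u) {a : ℂ} {x : Space d} {C : ℝ} (h : ∀ z, ψ z ≠ 0 → ‖a - u (x - z)‖ ≤ C) :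
    ‖a - mol ψ u x‖ ≤ C := by
  have hi : Integrable ψ := hψ.smooth.continuous.integrable_of_hasCompactSupport hψ.compact
  have h1 : ∫ z, ψ z • a = a := by rw [integral_smul_const, hψ.integral, one_smul]
  have h2 : ∫ z, ψ z * C = C := by rw [integral_mul_const, hψ.integral, one_mul]
  rw [mol_apply]
  nth_rw 1 [← h1]
  rw [← integral_sub (hi.smul_const a) (hψ.integrable hu.locallyIntegrable x), ← h2]
  refine norm_integral_le_of_norm_le (hi.mul_const _) (Eventually.of_forall fun z => ?_)
  rw [← smul_sub, norm_smul, Real.norm_of_nonneg (hψ.nonneg z)]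
  by_cases hz : ψ z = 0
  · simp [hz]
  · exact mul_le_mul_of_nonneg_left (h z hz) (hψ.nonneg z)

/-- Cut-off functions with gradient of order `ε⁻¹`. -/
lemma exists_cutoff (hb : Bornology.IsBounded O) (hne : O ≠ Set.univ) {ε : ℝ}
    (hε : 0 < ε) : ∃ χ : Space d → ℂ, IsTest O χ ∧ (∀ x, ‖1 - χ x‖ ≤ 1) ∧
      (∀ x, ‖grad χ x‖ ^ 2 ≤ d * (3 / ε) ^ 2) ∧
      ∀ x ∈ O, ε ≤ infDist x (frontier O) → χ x = 1 ∧ grad χ x = 0 := by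
  -- Piecewise linear in the distance to the complement: 0 up to ε/3, 1 from 2ε/3 on, slope 3/ε.
  -- Mollification at scale ε/9 preserves the Lipschitz constant and leaves a function that vanishes
  -- for distance below ε/9 and equals 1 from 8ε/9 on.
  set v : Space d → ℝ := fun x => max 0 (min 1 (3 / ε * infDist x Oᶜ - 1)) with hv
  have hne' : (Oᶜ).Nonempty := Set.nonempty_compl.2 hne
  have hvl : LipschitzWith (3 / ε).toNNReal v := by
    refine LipschitzWith.const_max (LipschitzWith.const_min ?_ 1) 0
    refine LipschitzWith.of_dist_le_mul fun x y => ?_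
    have h1 := (lipschitz_infDist_pt Oᶜ).dist_le_mul x y
    rw [NNReal.coe_one, one_mul] at h1
    rw [Real.coe_toNNReal _ (by positivity), Real.dist_eq, sub_sub_sub_cancel_right, ← mul_sub,
      abs_mul, abs_of_pos (by positivity : 0 < 3 / ε)]
    exact mul_le_mul_of_nonneg_left h1 (by positivity)
  set u : Space d → ℂ := fun x => (v x : ℂ) with hu
  have hul : LipschitzWith (3 / ε).toNNReal u := by
    refine LipschitzWith.of_dist_le_mul fun x y => ?_
    rw [hu, dist_eq_norm, ← Complex.ofReal_sub, Complex.norm_real, ← dist_eq_norm]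
    exact hvl.dist_le_mul x y
  obtain ⟨ψ, hψ, hsupp⟩ := exists_mollifier (0 : Space d) (r := ε / 9) (by positivity)
  have hψ0 : ∀ z, ψ z ≠ 0 → ‖z‖ ≤ ε / 9 := fun z hz => by
    simpa using hsupp (subset_tsupport ψ hz)
  have hinf : ∀ x z : Space d, |infDist (x - z) Oᶜ - infDist x Oᶜ| ≤ ‖z‖ := by
    intro x z
    have h1 := (lipschitz_infDist_pt Oᶜ).dist_le_mul (x - z) x
    rw [NNReal.coe_one, one_mul, Real.dist_eq, dist_eq_norm] at h1
    simpa using h1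
  have hsm : ContDiff ℝ ∞ (mol ψ u) := hψ.contDiff hul.continuous.locallyIntegrable
  set K : Set (Space d) := {x | ε / 9 ≤ infDist x Oᶜ} with hK
  have hKc : IsClosed K := isClosed_le continuous_const (continuous_infDist_pt _)
  have hKO : K ⊆ O := by
    intro x hx
    by_contra hxO
    have h1 : infDist x Oᶜ = 0 := infDist_zero_of_mem hxO
    rw [hK, Set.mem_ofPred_eq, h1] at hx
    linarith
  have hsub : tsupport (mol ψ u) ⊆ K := by
    refine closure_minimal (fun x hx => ?_) hKc
    by_contra hxK
    refine hx ?_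
    rw [hK, Set.mem_ofPred_eq, not_le] at hxK
    have h1 := hψ.norm_sub_mol_le hul.continuous (a := 0) (x := x) (C := 0) fun z hz => by
      have h2 := hψ0 z hz
      have h3 := abs_le.1 (hinf x z)
      have h4 : v (x - z) = 0 := by
        refine max_eq_left (min_le_of_right_le ?_)
        have : 3 / ε * infDist (x - z) Oᶜ ≤ 3 / ε * (ε / 3) :=
          mul_le_mul_of_nonneg_left (by linarith) (by positivity)
        have h5 : 3 / ε * (ε / 3) = 1 := by field_simp
        linarith
      simp [hu, h4]
    simpa using h1
  have hone : ∀ x, 8 / 9 * ε ≤ infDist x Oᶜ → mol ψ u x = 1 := by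
    intro x hx
    have h1 := hψ.norm_sub_mol_le hul.continuous (a := 1) (x := x) (C := 0) fun z hz => by
      have h2 := hψ0 z hz
      have h3 := abs_le.1 (hinf x z)
      have h4 : v (x - z) = 1 := by
        have : 3 / ε * (2 / 3 * ε) ≤ 3 / ε * infDist (x - z) Oᶜ :=
          mul_le_mul_of_nonneg_left (by linarith) (by positivity)
        have h5 : 3 / ε * (2 / 3 * ε) = 2 := by field_simp
        rw [hv]
        dsimp only
        rw [min_eq_left (by linarith), max_eq_right zero_le_one]
      simp [hu, h4]
    exact (sub_eq_zero.1 (norm_le_zero_iff.1 h1)).symm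
  refine ⟨mol ψ u, ⟨hsm, Metric.isCompact_of_isClosed_isBounded (isClosed_tsupport _)
    (hb.subset (hsub.trans hKO)), hsub.trans hKO⟩, fun x => ?_, fun x => ?_, fun x hx hxε => ?_⟩
  · refine hψ.norm_sub_mol_le hul.continuous fun z _ => ?_
    have h1 : 0 ≤ v (x - z) := le_max_left _ _
    have h2 : v (x - z) ≤ 1 := max_le zero_le_one (min_le_left _ _)
    rw [hu]
    dsimp only
    rw [← Complex.ofReal_one, ← Complex.ofReal_sub, Complex.norm_real, Real.norm_eq_abs, abs_le]
    constructor <;> linarith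
  · refine norm_grad_sq_le (norm_fderiv_le_of_lip' ℝ (by positivity) (Eventually.of_forall
      fun y => ?_))
    have := hψ.norm_mol_sub_le hul y x
    rwa [Real.coe_toNNReal _ (by positivity)] at this
  -- For a point of O the distance to the complement is attained on the frontier, so the two
  -- distances can be exchanged.
  · obtain ⟨y, hy, hxy⟩ := exists_mem_frontier_infDist_compl_eq_dist hx hne
    have h1 : ε ≤ infDist x Oᶜ := hxy ▸ hxε.trans (infDist_le_dist_of_mem hy)
    refine ⟨hone x (by linarith), ?_⟩
    have h2 : mol ψ u =ᶠ[𝓝 x] fun _ => 1 := by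
      have h3 : {y | 8 / 9 * ε < infDist y Oᶜ} ∈ 𝓝 x :=
        (isOpen_lt continuous_const (continuous_infDist_pt _)).mem_nhds (by
          rw [Set.mem_ofPred_eq]; linarith)
      filter_upwards [h3] with y hy using hone y hy.le
    ext i
    simp [grad, pderiv, h2.fderiv_eq]

end Cutoff

section Kernel

variable {O : Set (Space d)}

lemma continuous_setLIntegral_enorm_sq {α X : Type*} [MeasurableSpace α] {μ : Measure α}
    [NormedAddCommGroup X] [NormedSpace ℝ X] (s : Set α) :
    Continuous fun f : Lp X 2 μ => ∫⁻ x in s, ‖f x‖ₑ ^ 2 ∂μ := by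
  have h : (fun f : Lp X 2 μ => ∫⁻ x in s, ‖f x‖ₑ ^ 2 ∂μ) =
      fun f => ‖LpToLpRestrictCLM α X ℝ μ 2 s f‖ₑ ^ 2 := by
    funext f
    rw [enorm_sq_eq_lintegral]
    refine lintegral_congr_ae ?_
    filter_upwards [LpToLpRestrictCLM_coeFn ℝ s f] with x hx
    rw [hx]
  rw [h]
  fun_prop

/-- The part of the domain that is `ε`-close to the boundary. -/
lemma setLIntegral_layer (g : Space d → ℝ≥0∞) (ε : ℝ) :
    ∫⁻ x in O ∩ {x | infDist x (frontier O) < ε}, g x =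
      ∫⁻ x in {x | infDist x (frontier O) < ε}, g x ∂(volume.restrict O) := by
  rw [Measure.restrict_restrict (measurableSet_lt measurable_infDist measurable_const),
    Set.inter_comm]

/-- The layers shrink to the part of O inside its frontier, which is empty because O is open;
absolute continuity of the integral does the rest. -/
lemma tendsto_layerEnergy (hd : 2 ≤ d) (hO : IsLipschitzDomain O) (F : L2Vec O) :
    Tendsto (fun ε => layerEnergy O F ε) (𝓝[>] 0) (𝓝 0) := by
  have hfin : IsFiniteMeasure (volume.restrict O) :=
    ⟨by rw [Measure.restrict_apply_univ]; exact hO.isBounded.measure_lt_top⟩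
  simp only [layerEnergy, setLIntegral_layer]
  refine tendsto_setLIntegral_zero ?_ ?_
  · rw [← enorm_sq_eq_lintegral]; simp
  · have h1 := tendsto_measure_biInter_gt (μ := volume.restrict O)
      (s := fun ε : ℝ => {x : Space d | infDist x (frontier O) < ε}) (a := 0)
      (fun r _ => (measurableSet_lt measurable_infDist measurable_const).nullMeasurableSet)
      (fun i j _ hij x hx => lt_of_lt_of_le hx hij) ⟨1, one_pos, measure_ne_top _ _⟩
    have h2 : volume.restrict O (⋂ r > 0, {x : Space d | infDist x (frontier O) < r}) = 0 := by
      refine measure_mono_null (t := frontier O) (fun x hx => ?_) ?_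
      · rw [isClosed_frontier.mem_iff_infDist_zero (hO.frontier_nonempty hd)]
        refine le_antisymm (le_of_forall_pos_lt_add fun r hr => ?_) infDist_nonneg
        rw [zero_add]
        exact Set.mem_iInter₂.1 hx r hr
      · rw [Measure.restrict_apply isClosed_frontier.measurableSet, hO.isOpen.frontier_eq,
          Set.sdiff_inter_self, measure_empty]
    rwa [h2] at h1

lemma _root_.Continuous.setLIntegral_enorm_sq {α β X : Type*} [MeasurableSpace α]
    [TopologicalSpace β] {μ : Measure α} [NormedAddCommGroup X] [NormedSpace ℝ X]
    {f : β → Lp X 2 μ} (hf : Continuous f) (s : Set α) :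
    Continuous fun w => ∫⁻ x in s, ‖f w x‖ₑ ^ 2 ∂μ :=
  (continuous_setLIntegral_enorm_sq s).comp hf

lemma continuous_const_mul_of_ne_top {α : Type*} [TopologicalSpace α] {f : α → ℝ≥0∞} {a : ℝ≥0∞}
    (ha : a ≠ ⊤) (hf : Continuous f) : Continuous fun x => a * f x :=
  (ENNReal.continuous_const_mul ha).comp hf

/-- Every term of the layer estimate is continuous in (p, F, b), so it passes from smooth functions
to the closure. This is the form in which a vanishing trace can be exploited. -/
lemma exists_layer_le_of_trace (hd : 2 ≤ d) (hO : IsLipschitzDomain O) :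
    ∃ K : ℝ≥0, ∃ δ > 0, ∀ (p : L2 O) (F : L2Vec O) (b : L2Bdry O),
      (p, F, b) ∈ (restrictionGraph O).topologicalClosure → ∀ ε ∈ Set.Ioo 0 δ,
      ∫⁻ x in O ∩ {x | infDist x (frontier O) < ε}, ‖p x‖ₑ ^ 2 ≤
        K * ENNReal.ofReal ε * ‖b‖ₑ ^ 2 +
        K * ENNReal.ofReal (ε ^ 2) * layerEnergy O F (K * ε) := by
  obtain ⟨K, δ, hδ, hK⟩ := exists_layer_le hd hO
  refine ⟨K, δ, hδ, fun p F b hw ε hε => ?_⟩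
  have c1 : Continuous fun w : L2 O × L2Vec O × L2Bdry O =>
      ∫⁻ x in {x | infDist x (frontier O) < ε}, ‖w.1 x‖ₑ ^ 2 ∂(volume.restrict O) :=
    continuous_fst.setLIntegral_enorm_sq _
  have c2 : Continuous fun w : L2 O × L2Vec O × L2Bdry O => K * ENNReal.ofReal ε * ‖w.2.2‖ₑ ^ 2 := by
    have h1 : Continuous fun w : L2 O × L2Vec O × L2Bdry O => ‖w.2.2‖ₑ ^ 2 := by fun_prop
    exact continuous_const_mul_of_ne_top (ENNReal.mul_ne_top ENNReal.coe_ne_top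
      ENNReal.ofReal_ne_top) h1
  have c3 : Continuous fun w : L2 O × L2Vec O × L2Bdry O => K * ENNReal.ofReal (ε ^ 2) *
      ∫⁻ x in {x | infDist x (frontier O) < K * ε}, ‖w.2.1 x‖ₑ ^ 2 ∂(volume.restrict O) := by
    have h0 : Continuous fun w : L2 O × L2Vec O × L2Bdry O => w.2.1 := by fun_prop
    have h1 := h0.setLIntegral_enorm_sq {x | infDist x (frontier O) < K * ε}
    exact continuous_const_mul_of_ne_top (ENNReal.mul_ne_top ENNReal.coe_ne_top
      ENNReal.ofReal_ne_top) h1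
  have hc : IsClosed {w : L2 O × L2Vec O × L2Bdry O |
      ∫⁻ x in O ∩ {x | infDist x (frontier O) < ε}, ‖w.1 x‖ₑ ^ 2 ≤
        K * ENNReal.ofReal ε * ‖w.2.2‖ₑ ^ 2 +
        K * ENNReal.ofReal (ε ^ 2) * layerEnergy O w.2.1 (K * ε)} := by
    simp only [layerEnergy, setLIntegral_layer]
    exact isClosed_le c1 (c2.add c3)
  have hsub : (restrictionGraph O : Set (L2 O × L2Vec O × L2Bdry O)) ⊆
      {w : L2 O × L2Vec O × L2Bdry O |
      ∫⁻ x in O ∩ {x | infDist x (frontier O) < ε}, ‖w.1 x‖ₑ ^ 2 ≤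
        K * ENNReal.ofReal ε * ‖w.2.2‖ₑ ^ 2 +
        K * ENNReal.ofReal (ε ^ 2) * layerEnergy O w.2.1 (K * ε)} := by
    rintro ⟨p, F, b⟩ ⟨φ, hφ, h1, h2, h3⟩
    have h4 := hK φ hφ ε hε
    rw [Set.mem_ofPred_eq]
    rw [setLIntegral_layer, layerEnergy, setLIntegral_layer] at h4 ⊢
    have e1 : ∫⁻ y, ‖φ y‖ₑ ^ 2 ∂(surfaceMeasure O) = ‖b‖ₑ ^ 2 := by
      rw [enorm_sq_eq_lintegral]
      exact lintegral_congr_ae (h3.mono fun x hx => congrArg (fun z => ‖z‖ₑ ^ 2) hx.symm)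
    have e2 : ∫⁻ x in {x | infDist x (frontier O) < ε}, ‖φ x‖ₑ ^ 2 ∂(volume.restrict O) =
        ∫⁻ x in {x | infDist x (frontier O) < ε}, ‖p x‖ₑ ^ 2 ∂(volume.restrict O) :=
      lintegral_congr_ae (ae_restrict_of_ae (h1.mono fun x hx => congrArg (fun z => ‖z‖ₑ ^ 2) hx.symm))
    have e3 : ∫⁻ x in {x | infDist x (frontier O) < K * ε}, ‖grad φ x‖ₑ ^ 2 ∂(volume.restrict O) =
        ∫⁻ x in {x | infDist x (frontier O) < K * ε}, ‖F x‖ₑ ^ 2 ∂(volume.restrict O) :=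
      lintegral_congr_ae (ae_restrict_of_ae (h2.mono fun x hx => congrArg (fun z => ‖z‖ₑ ^ 2) hx.symm))
    rw [e1, e2, e3] at h4
    exact h4
  rw [← SetLike.mem_coe, Submodule.topologicalClosure_coe] at hw
  have hw' := closure_minimal hsub hc hw
  rw [Set.mem_ofPred_eq] at hw'
  exact hw'

lemma enorm_sq_le_setLIntegral {X : Type*} [NormedAddCommGroup X] {f : Lp X 2 (volume.restrict O)}
    {ε : ℝ} {g : Space d → ℝ≥0∞}
    (h : ∀ᵐ x ∂(volume.restrict O), ‖f x‖ₑ ^ 2 ≤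
      {x | infDist x (frontier O) < ε}.indicator g x) :
    ‖f‖ₑ ^ 2 ≤ ∫⁻ x in O ∩ {x | infDist x (frontier O) < ε}, g x := by
  rw [enorm_sq_eq_lintegral, setLIntegral_layer, ← lintegral_indicator
    (measurableSet_lt measurable_infDist measurable_const)]
  exact lintegral_mono_ae h

/-- The kernel of the trace is `H¹₀(O)`. -/
theorem hasWeakGradZero_of_isTrace_zero (hd : 2 ≤ d) (hO : IsLipschitzDomain O) {p : L2 O}
    {F : L2Vec O} (hF : HasWeakGrad O p F) (h : IsTrace O p 0) : HasWeakGradZero O p F := by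
  obtain ⟨G, hG, hw⟩ := h
  have hGF : G = F := by
    have h1 := hG.add (hF.smul (-1))
    rw [neg_one_smul, neg_one_smul, add_neg_cancel] at h1
    have h2 := h1.unique hO.isOpen
    rwa [← sub_eq_add_neg, sub_eq_zero] at h2
  subst hGF
  obtain ⟨K, δ, hδ, hK⟩ := exists_layer_le_of_trace hd hO
  -- With zero trace the term of order ε disappears. What is left is ε² times an energy tending to
  -- 0, which compensates |∇χ|² of order ε^{-2}.
  have hK' : ∀ ε ∈ Set.Ioo 0 δ, ∫⁻ x in O ∩ {x | infDist x (frontier O) < ε}, ‖p x‖ₑ ^ 2 ≤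
      K * ENNReal.ofReal (ε ^ 2) * layerEnergy O G (K * ε) := by
    intro ε hε
    have h1 := hK p G _ hw ε hε
    have h2 : (0 : HHalf O).toL2 = 0 := rfl
    rw [h2] at h1
    simpa using h1
  refine ⟨hF, ?_⟩
  have hclosed := (testGraph O).isClosed_topologicalClosure
  -- Since the closure is closed, it suffices to approximate by truncations χp; these have compact
  -- support in O and hence are already in H¹₀(O).
  refine hclosed.closure_subset (Metric.mem_closure_iff.2 fun η hη => ?_)
  -- The sum of the constants of the two distance estimates below; 18d is 2 · 9d, where 9d is the
  -- product of ε² with the bound d(3/ε)² for |∇χ|².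
  obtain ⟨B, hB⟩ : ∃ B : ℝ≥0, B = K + (2 + 18 * d * K) := ⟨_, rfl⟩
  have hlim : Tendsto (fun ε => (B : ℝ≥0∞) * layerEnergy O G ((K + 1) * ε)) (𝓝[>] 0) (𝓝 0) := by
    have h1 : Tendsto (fun ε : ℝ => ((K : ℝ) + 1) * ε) (𝓝[>] 0) (𝓝[>] 0) := by
      refine tendsto_nhdsWithin_iff.2 ⟨?_, ?_⟩
      · have : Continuous fun ε : ℝ => ((K : ℝ) + 1) * ε := by fun_prop
        have h2 := this.tendsto 0
        rw [mul_zero] at h2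
        exact h2.mono_left nhdsWithin_le_nhds
      · filter_upwards [self_mem_nhdsWithin] with ε hε
        have : (0 : ℝ) < ε := hε
        exact Set.mem_Ioi.2 (by positivity)
    have h2 := ENNReal.Tendsto.const_mul (a := (B : ℝ≥0∞)) ((tendsto_layerEnergy hd hO G).comp h1)
      (Or.inr ENNReal.coe_ne_top)
    rwa [mul_zero] at h2
  obtain ⟨ε, hε1, hε⟩ := ((hlim.eventually (gt_mem_nhds (ENNReal.ofReal_pos.2 (pow_pos hη 2)))).and
    (Ioo_mem_nhdsGT (lt_min hδ one_pos))).exists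
  have hεδ : ε ∈ Set.Ioo 0 δ := ⟨hε.1, hε.2.trans_le (min_le_left _ _)⟩
  have hε0 := hε.1
  have hε2 : ε < 1 := hε.2.trans_le (min_le_right _ _)
  have hK0 : (0 : ℝ) ≤ K := K.2
  obtain ⟨E, hE⟩ : ∃ E, E = layerEnergy O G ((K + 1) * ε) := ⟨_, rfl⟩
  have hEK : layerEnergy O G (K * ε) ≤ E := by
    rw [hE]
    refine lintegral_mono_set (Set.inter_subset_inter_right _ fun x hx => ?_)
    rw [Set.mem_ofPred_eq] at hx ⊢
    nlinarith
  have hE1 : layerEnergy O G ε ≤ E := by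
    rw [hE]
    refine lintegral_mono_set (Set.inter_subset_inter_right _ fun x hx => ?_)
    rw [Set.mem_ofPred_eq] at hx ⊢
    nlinarith
  have hne : O ≠ Set.univ := by
    intro h
    have := hO.frontier_nonempty hd
    rw [h, frontier_univ] at this
    exact Set.not_nonempty_empty this
  obtain ⟨χ, hχ, hχ1, hχ2, hχ3⟩ := exists_cutoff hO.isBounded hne hε0
  obtain ⟨q, G', hq, hG', hqG⟩ := hF.mul_smooth hχ.smooth hχ.compact
  have hmem : HasWeakGradZero O q G' := by
    refine hasWeakGradZero_of_compact hO.isOpen hqG hχ.compact hχ.supp ?_ ?_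
    · filter_upwards [hq] with x hx hxK
      rw [hx, image_eq_zero_of_notMem_tsupport hxK, zero_mul]
    · filter_upwards [hG'] with x hx hxK
      rw [hx, image_eq_zero_of_notMem_tsupport hxK, grad_eq_zero_of_notMem_tsupport hxK,
        zero_smul, smul_zero, add_zero]
  have hdist1 : ‖p - q‖ₑ ^ 2 ≤ K * E := by
    calc ‖p - q‖ₑ ^ 2 ≤ ∫⁻ x in O ∩ {x | infDist x (frontier O) < ε}, ‖p x‖ₑ ^ 2 := by
          refine enorm_sq_le_setLIntegral ?_
          filter_upwards [Lp.coeFn_sub p q, hq, ae_restrict_mem hO.isOpen.measurableSet]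
            with x h1 h2 h3
          rw [h1, Pi.sub_apply, h2]
          by_cases hx : infDist x (frontier O) < ε
          · rw [Set.indicator_of_mem (by exact hx), ← one_sub_mul, enorm_mul]
            gcongr
            refine mul_le_of_le_one_left' ?_
            rw [← ofReal_norm]
            exact ENNReal.ofReal_le_one.2 (hχ1 x)
          · rw [(hχ3 x h3 (not_lt.1 hx)).1]; simp
      _ ≤ _ := hK' ε hεδ
      _ ≤ K * 1 * E := by
          gcongr
          exact ENNReal.ofReal_le_one.2 (pow_le_one₀ hε0.le hε2.le)
      _ = _ := by rw [mul_one]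
  have hdist2 : ‖G - G'‖ₑ ^ 2 ≤ (2 + 18 * d * K) * E := by
    obtain ⟨c, hc⟩ : ∃ c, c = ENNReal.ofReal (d * (3 / ε) ^ 2) := ⟨_, rfl⟩
    have hct : c ≠ ⊤ := hc ▸ ENNReal.ofReal_ne_top
    calc ‖G - G'‖ₑ ^ 2 ≤ ∫⁻ x in O ∩ {x | infDist x (frontier O) < ε},
          (2 * ‖G x‖ₑ ^ 2 + 2 * c * ‖p x‖ₑ ^ 2) := by
          refine enorm_sq_le_setLIntegral ?_
          filter_upwards [Lp.coeFn_sub G G', hG', ae_restrict_mem hO.isOpen.measurableSet]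
            with x h1 h2 h3
          rw [h1, Pi.sub_apply, h2]
          by_cases hx : infDist x (frontier O) < ε
          · rw [Set.indicator_of_mem (by exact hx)]
            have e1 : G x - (χ x • G x + p x • grad χ x) = (1 - χ x) • G x - p x • grad χ x := by
              rw [sub_smul, one_smul, sub_sub]
            rw [e1]
            have e2 := enorm_sub_sq_le ((1 - χ x) • G x) 0 (p x • grad χ x)
            rw [sub_zero, zero_sub, enorm_neg, enorm_smul, enorm_smul] at e2
            refine e2.trans (add_le_add ?_ ?_)
            · gcongr
              refine mul_le_of_le_one_left' ?_
              rw [← ofReal_norm]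
              exact ENNReal.ofReal_le_one.2 (hχ1 x)
            · rw [mul_pow, mul_assoc, mul_comm (‖p x‖ₑ ^ 2)]
              gcongr
              rw [hc, ← ofReal_norm, ← ENNReal.ofReal_pow (norm_nonneg _)]
              exact ENNReal.ofReal_le_ofReal (hχ2 x)
          · rw [(hχ3 x h3 (not_lt.1 hx)).1, (hχ3 x h3 (not_lt.1 hx)).2]; simp
      _ = 2 * layerEnergy O G ε +
          2 * c * ∫⁻ x in O ∩ {x | infDist x (frontier O) < ε}, ‖p x‖ₑ ^ 2 := by
          rw [lintegral_add_left', lintegral_const_mul' _ _ (by simp),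
            lintegral_const_mul' _ _ (ENNReal.mul_ne_top (by simp) hct), layerEnergy]
          have := ((Lp.aestronglyMeasurable G).enorm.pow_const 2).const_mul 2
          exact this.mono_measure (Measure.restrict_mono_set _ Set.inter_subset_left)
      _ ≤ 2 * E + 2 * c * (K * ENNReal.ofReal (ε ^ 2) * E) := by
          refine add_le_add (mul_le_mul_right hE1 _) (mul_le_mul_right ?_ _)
          exact (hK' ε hεδ).trans (mul_le_mul_right hEK _)
      _ = 2 * E + 2 * (c * ENNReal.ofReal (ε ^ 2)) * K * E := by ring
      _ = _ := by
          have e1 : c * ENNReal.ofReal (ε ^ 2) = 9 * d := by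
            rw [hc, ← ENNReal.ofReal_mul (by positivity)]
            have : (d : ℝ) * (3 / ε) ^ 2 * ε ^ 2 = 9 * d := by field_simp; ring
            rw [this, ENNReal.ofReal_mul (by norm_num), ENNReal.ofReal_natCast]
            norm_num
          rw [e1]
          ring
  refine ⟨(q, G'), hmem.2, ?_⟩
  rw [← hE, hB] at hε1
  push_cast at hε1
  rw [Prod.dist_eq, max_lt_iff, dist_eq_norm, dist_eq_norm]
  constructor
  · have h1 := (hdist1.trans (mul_le_mul_left (le_self_add (a := (K : ℝ≥0∞))) E)).trans_lt hε1
    rw [← ofReal_norm, ← ENNReal.ofReal_pow (norm_nonneg _),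
      ENNReal.ofReal_lt_ofReal_iff (pow_pos hη 2)] at h1
    exact lt_of_pow_lt_pow_left₀ 2 hη.le h1
  · have h1 := (hdist2.trans (mul_le_mul_left (le_add_self (b := (K : ℝ≥0∞))) E)).trans_lt hε1
    rw [← ofReal_norm, ← ENNReal.ofReal_pow (norm_nonneg _),
      ENNReal.ofReal_lt_ofReal_iff (pow_pos hη 2)] at h1
    exact lt_of_pow_lt_pow_left₀ 2 hη.le h1

end Kernel

end Acoustic

end


noncomputable section

namespace Acoustic

open Metric
open scoped ENNReal NNReal Topology

variable {d : ℕ}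

/-! ### The extension operator -/

/-- The kernel `|x - y|^{-2d}`. -/
def liftKernel (x y : Space d) : ℝ := ((‖x - y‖ ^ 2) ^ d)⁻¹

/-- The derivative of `liftKernel · y`. -/
def liftKernelDeriv (x y : Space d) : Space d →L[ℝ] ℝ :=
  (-(d * (‖x - y‖ ^ 2) ^ (d - 1)) / ((‖x - y‖ ^ 2) ^ d) ^ 2) • ((2 : ℝ) • innerSL ℝ (x - y))

lemma liftKernel_nonneg (x y : Space d) : 0 ≤ liftKernel x y := by
  unfold liftKernel; positivity

lemma measurable_liftKernel : Measurable fun z : Space d × Space d => liftKernel z.1 z.2 := by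
  unfold liftKernel; fun_prop

lemma hasFDerivAt_liftKernel {x y : Space d} (h : x ≠ y) :
    HasFDerivAt (fun x => liftKernel x y) (liftKernelDeriv x y) x := by
  have h0 := norm_pos_iff.2 (sub_ne_zero.2 h)
  have h1 : HasFDerivAt (fun x : Space d => ‖x - y‖ ^ 2) ((2 : ℝ) • innerSL ℝ (x - y)) x := by
    have := ((hasFDerivAt_id x).sub_const y).norm_sq
    refine this.congr_fderiv ?_
    ext v
    simp
  have h2 : HasDerivAt (fun t : ℝ => (t ^ d)⁻¹)
      (-(d * (‖x - y‖ ^ 2) ^ (d - 1)) / ((‖x - y‖ ^ 2) ^ d) ^ 2) (‖x - y‖ ^ 2) :=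
    (hasDerivAt_pow d (‖x - y‖ ^ 2)).inv (by positivity)
  exact HasDerivAt.comp_hasFDerivAt (h₂ := fun t : ℝ => (t ^ d)⁻¹)
    (f := fun x : Space d => ‖x - y‖ ^ 2) x h2 h1

lemma norm_liftKernelDeriv_le {x y : Space d} (h : x ≠ y) :
    ‖liftKernelDeriv x y‖ ≤ 2 * d / ‖x - y‖ * liftKernel x y := by
  have h0 := norm_pos_iff.2 (sub_ne_zero.2 h)
  rw [liftKernelDeriv, norm_smul, norm_smul, innerSL_apply_norm, norm_div, norm_neg, liftKernel]
  rw [Real.norm_of_nonneg (by positivity), Real.norm_of_nonneg (by positivity),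
    Real.norm_of_nonneg (by positivity)]
  rcases Nat.eq_zero_or_pos d with hd | hd
  · simp [hd]
  · obtain ⟨k, hk⟩ : ∃ k, d = k + 1 := ⟨d - 1, by omega⟩
    refine le_of_eq ?_
    generalize ‖x - y‖ = r at h0
    have : (d : ℝ) ≠ 0 := by positivity
    have e : (r ^ 2) ^ d = (r ^ 2) ^ (d - 1) * r ^ 2 := by rw [hk, Nat.add_sub_cancel, pow_succ]
    rw [e]
    field_simp

lemma measurable_liftKernelDeriv (x : Space d) : Measurable fun y => liftKernelDeriv x y := by
  unfold liftKernelDeriv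
  have h : Continuous fun y : Space d => (2 : ℝ) • innerSL ℝ (x - y) := by fun_prop
  have h0 : Measurable fun y : Space d =>
      -(d * (‖x - y‖ ^ 2) ^ (d - 1)) / ((‖x - y‖ ^ 2) ^ d) ^ 2 := by fun_prop
  exact h0.smul h.measurable

section Potential

variable {O : Set (Space d)}

lemma IsLipschitzDomain.infDist_pos (hd : 2 ≤ d) (hO : IsLipschitzDomain O) {x : Space d}
    (hx : x ∈ O) : 0 < infDist x (frontier O) := by
  refine (isClosed_frontier.notMem_iff_infDist_pos (hO.frontier_nonempty hd)).1 fun h => ?_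
  rw [hO.isOpen.frontier_eq] at h
  exact h.2 hx

lemma liftKernel_le {x y : Space d} {r : ℝ} (hr : 0 < r) (h : r ≤ ‖x - y‖) :
    liftKernel x y ≤ ((r ^ 2) ^ d)⁻¹ := by
  unfold liftKernel
  gcongr

lemma integrable_liftKernel (hd : 2 ≤ d) (hO : IsLipschitzDomain O) {f : Space d → ℂ}
    (hf : Integrable f (surfaceMeasure O)) {x : Space d} (hx : x ∈ O) :
    Integrable (fun y => liftKernel x y • f y) (surfaceMeasure O) := by
  have hδ := hO.infDist_pos hd hx
  refine (hf.norm.const_mul ((infDist x (frontier O) ^ 2) ^ d)⁻¹).mono' ?_ ?_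
  · exact (measurable_liftKernel.comp measurable_prodMk_left).aestronglyMeasurable.smul hf.1
  · filter_upwards [ae_surface_mem (O := O)] with y hy
    rw [norm_smul, Real.norm_of_nonneg (liftKernel_nonneg x y)]
    refine mul_le_mul_of_nonneg_right (liftKernel_le hδ ?_) (norm_nonneg _)
    rw [← dist_eq_norm]
    exact infDist_le_dist_of_mem hy

/-- Potentials of boundary densities are differentiable in the domain. -/
lemma hasFDerivAt_potential (hd : 2 ≤ d) (hO : IsLipschitzDomain O) {f : Space d → ℂ}
    (hf : Integrable f (surfaceMeasure O)) {x : Space d} (hx : x ∈ O) :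
    HasFDerivAt (fun x => ∫ y, liftKernel x y • f y ∂(surfaceMeasure O))
      (∫ y, (liftKernelDeriv x y).smulRight (f y) ∂(surfaceMeasure O)) x := by
  have hδ := hO.infDist_pos hd hx
  set δ := infDist x (frontier O) with hδdef
  -- The kernel is singular only on the diagonal. In a ball of half the distance to the boundary it
  -- and its derivative are bounded uniformly in y, which allows differentiation under the integral.
  have hfar : ∀ x' ∈ ball x (δ / 2), ∀ y ∈ frontier O, δ / 2 ≤ ‖x' - y‖ := by
    intro x' hx' y hy
    have h1 : δ ≤ dist x y := infDist_le_dist_of_mem hy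
    have h2 := dist_triangle_left x y x'
    rw [mem_ball] at hx'
    rw [← dist_eq_norm]
    linarith
  refine hasFDerivAt_integral_of_dominated_of_fderiv_le (s := ball x (δ / 2))
    (F := fun x y => liftKernel x y • f y)
    (F' := fun x y => (liftKernelDeriv x y).smulRight (f y))
    (bound := fun y => 2 * d / (δ / 2) * (((δ / 2) ^ 2) ^ d)⁻¹ * ‖f y‖)
    (ball_mem_nhds x (by positivity)) ?_ (integrable_liftKernel hd hO hf hx) ?_ ?_ ?_ ?_
  · refine Eventually.of_forall fun x' => ?_
    exact (measurable_liftKernel.comp measurable_prodMk_left).aestronglyMeasurable.smul hf.1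
  · have hb := (ContinuousLinearMap.smulRightL ℝ (Space d) ℂ)
    refine (ContinuousLinearMap.smulRightL ℝ (Space d) ℂ).aestronglyMeasurable_comp₂
      (measurable_liftKernelDeriv x).aestronglyMeasurable hf.1
  · filter_upwards [ae_surface_mem (O := O)] with y hy x' hx'
    have h1 := hfar x' hx' y hy
    have hne : x' ≠ y := by
      rintro rfl
      rw [sub_self, norm_zero] at h1
      linarith
    rw [ContinuousLinearMap.norm_smulRight_apply]
    refine mul_le_mul_of_nonneg_right ((norm_liftKernelDeriv_le hne).trans ?_) (norm_nonneg _)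
    refine mul_le_mul ?_ (liftKernel_le (by positivity) h1) (liftKernel_nonneg _ _) (by positivity)
    gcongr
  · exact hf.norm.const_mul _
  · filter_upwards [ae_surface_mem (O := O)] with y hy x' hx'
    have h1 := hfar x' hx' y hy
    have hne : x' ≠ y := by
      rintro rfl
      rw [sub_self, norm_zero] at h1
      linarith
    exact (hasFDerivAt_liftKernel hne).smul_const (f y)

/-- The total mass of the kernel. -/
def liftMass (O : Set (Space d)) (x : Space d) : ℂ := ∫ y, liftKernel x y • (1 : ℂ) ∂(surfaceMeasure O)

/-- The extension of a boundary function to the domain by weighted averages. -/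
def lift (O : Set (Space d)) (g : Space d → ℂ) (x : Space d) : ℂ :=
  (∫ y, liftKernel x y • g y ∂(surfaceMeasure O)) * (liftMass O x)⁻¹

lemma liftMass_eq (O : Set (Space d)) (x : Space d) :
    liftMass O x = ((∫ y, liftKernel x y ∂(surfaceMeasure O) : ℝ) : ℂ) := by
  rw [liftMass, ← integral_complex_ofReal]
  simp

lemma enorm_liftMass (hd : 2 ≤ d) (hO : IsLipschitzDomain O) {x : Space d} (hx : x ∈ O) :
    ‖liftMass O x‖ₑ = ∫⁻ y, ENNReal.ofReal (liftKernel x y) ∂(surfaceMeasure O) := by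
  have hfin := isFiniteMeasure_surface hO
  have hi : Integrable (fun y => liftKernel x y) (surfaceMeasure O) := by
    have := (integrable_liftKernel hd hO (integrable_const (1 : ℂ)) hx).norm
    simpa [norm_smul, abs_of_nonneg (liftKernel_nonneg _ _)] using this
  rw [← ofReal_integral_eq_lintegral_ofReal hi (Eventually.of_forall (liftKernel_nonneg x)),
    liftMass_eq, ← ofReal_norm, Complex.norm_real, Real.norm_of_nonneg
      (integral_nonneg (liftKernel_nonneg x))]

/-- The normalised weights have total mass one and reproduce constants, so only the differences g -
c matter. -/
lemma lift_sub (hd : 2 ≤ d) (hO : IsLipschitzDomain O) {g : Space d → ℂ}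
    (hg : Integrable g (surfaceMeasure O)) {x : Space d} (hx : x ∈ O) (h0 : liftMass O x ≠ 0)
    (c : ℂ) : lift O g x - c =
      (∫ y, liftKernel x y • (g y - c) ∂(surfaceMeasure O)) * (liftMass O x)⁻¹ := by
  have hfin := isFiniteMeasure_surface hO
  have h1 : ∫ y, liftKernel x y • (g y - c) ∂(surfaceMeasure O) =
      (∫ y, liftKernel x y • g y ∂(surfaceMeasure O)) - liftMass O x * c := by
    simp only [smul_sub]
    rw [integral_sub (integrable_liftKernel hd hO hg hx)
      (integrable_liftKernel hd hO (integrable_const c) hx), liftMass, ← integral_mul_const]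
    simp
  rw [h1, sub_mul, lift, mul_right_comm, mul_inv_cancel₀ h0, one_mul]

/-- A density-weighted mean is close to `c` when the density is. -/
lemma enorm_lift_sub_sq_le (hd : 2 ≤ d) (hO : IsLipschitzDomain O) {g : Space d → ℂ}
    (hg : Integrable g (surfaceMeasure O)) {x : Space d} (hx : x ∈ O) (h0 : liftMass O x ≠ 0)
    (c : ℂ) : ‖lift O g x - c‖ₑ ^ 2 ≤ ‖liftMass O x‖ₑ⁻¹ *
      ∫⁻ y, ENNReal.ofReal (liftKernel x y) * ‖g y - c‖ₑ ^ 2 ∂(surfaceMeasure O) := by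
  have hn0 : ‖liftMass O x‖ₑ ≠ 0 := by simpa using h0
  have hnt : ‖liftMass O x‖ₑ ≠ ⊤ := by simp
  have hk : Measurable fun y => ENNReal.ofReal (liftKernel x y) :=
    (measurable_liftKernel.comp measurable_prodMk_left).ennreal_ofReal
  have hgm : AEMeasurable (fun y => ‖g y - c‖ₑ) (surfaceMeasure O) :=
    (hg.1.sub aestronglyMeasurable_const).enorm
  have h1 : ‖∫ y, liftKernel x y • (g y - c) ∂(surfaceMeasure O)‖ₑ ≤
      ∫⁻ y, ENNReal.ofReal (liftKernel x y) * ‖g y - c‖ₑ ∂(surfaceMeasure O) := by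
    refine (enorm_integral_le_lintegral_enorm _).trans (le_of_eq ?_)
    refine lintegral_congr fun y => ?_
    rw [enorm_smul, ← ofReal_norm, Real.norm_of_nonneg (liftKernel_nonneg x y)]
  have h2 := sq_lintegral_mul_le (μ := surfaceMeasure O) hk.aemeasurable hgm
  rw [← enorm_liftMass hd hO hx] at h2
  rw [lift_sub hd hO hg hx h0, enorm_mul, mul_pow, enorm_inv h0]
  refine (mul_le_mul_left ((pow_le_pow_left' h1 2).trans h2) _).trans (le_of_eq ?_)
  rw [sq (‖liftMass O x‖ₑ⁻¹), mul_assoc, mul_left_comm, ← mul_assoc, ← mul_assoc,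
    mul_assoc _ (‖liftMass O x‖ₑ) (‖liftMass O x‖ₑ⁻¹), ENNReal.mul_inv_cancel hn0 hnt, mul_one,
    mul_comm]

/-- The derivative of the extension. -/
lemma lift_fderiv (hd : 2 ≤ d) (hO : IsLipschitzDomain O) {g : Space d → ℂ}
    (hg : Integrable g (surfaceMeasure O)) {x : Space d} (hx : x ∈ O) (h0 : liftMass O x ≠ 0) :
    DifferentiableAt ℝ (lift O g) x ∧ ‖fderiv ℝ (lift O g) x‖ₑ ^ 2 ≤
      ENNReal.ofReal ((2 * d / infDist x (frontier O)) ^ 2) * (‖liftMass O x‖ₑ⁻¹ *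
        ∫⁻ y, ENNReal.ofReal (liftKernel x y) * ‖g y - lift O g x‖ₑ ^ 2 ∂(surfaceMeasure O)) := by
  have hfin := isFiniteMeasure_surface hO
  have hδ := hO.infDist_pos hd hx
  have hm : HasFDerivAt (liftMass O) _ x :=
    hasFDerivAt_potential hd hO (integrable_const (1 : ℂ)) hx
  have hA := hasFDerivAt_potential hd hO hg hx
  have hinv : DifferentiableAt ℝ (fun x => (liftMass O x)⁻¹) x := hm.differentiableAt.inv h0
  refine ⟨hA.differentiableAt.mul hinv, ?_⟩
  -- Subtract the value of the extension at the base point itself. The numerator for g - c vanishes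
  -- at x, so the derivative of the normalising factor drops out of the product rule.
  set c := lift O g x with hc
  have hgc : Integrable (fun y => g y - c) (surfaceMeasure O) := hg.sub (integrable_const c)
  have hB := hasFDerivAt_potential hd hO hgc hx
  have hB0 : ∫ y, liftKernel x y • (g y - c) ∂(surfaceMeasure O) = 0 := by
    have h1 := lift_sub hd hO hg hx h0 c
    rw [← hc, sub_self] at h1
    exact (mul_eq_zero.1 h1.symm).resolve_right (inv_ne_zero h0)
  have heq : lift O g =ᶠ[𝓝 x] fun x =>
      (∫ y, liftKernel x y • (g y - c) ∂(surfaceMeasure O)) * (liftMass O x)⁻¹ + c := by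
    filter_upwards [hO.isOpen.mem_nhds hx, hm.continuousAt.eventually_ne h0] with x' hx' h0'
    rw [← lift_sub hd hO hg hx' h0' c, sub_add_cancel]
  have hD : fderiv ℝ (lift O g) x = (liftMass O x)⁻¹ •
      ∫ y, (liftKernelDeriv x y).smulRight (g y - c) ∂(surfaceMeasure O) := by
    rw [heq.fderiv_eq]
    have h1 : HasFDerivAt (fun x => (∫ y, liftKernel x y • (g y - c) ∂(surfaceMeasure O)) *
      (liftMass O x)⁻¹ + c) _ x := (hB.mul hinv.hasFDerivAt).add_const c
    rw [h1.fderiv, hB0]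
    ext v
    simp only [add_apply, smul_apply, zero_smul, zero_add]
  have hn0 : ‖liftMass O x‖ₑ ≠ 0 := by simpa using h0
  have hnt : ‖liftMass O x‖ₑ ≠ ⊤ := by simp
  have hk : Measurable fun y => ENNReal.ofReal (liftKernel x y) :=
    (measurable_liftKernel.comp measurable_prodMk_left).ennreal_ofReal
  have h2 := sq_lintegral_mul_le (μ := surfaceMeasure O) hk.aemeasurable hgc.1.enorm
  rw [← enorm_liftMass hd hO hx] at h2
  -- Differentiating the kernel costs at most the factor 2d/|x - y|, and |x - y| is at least the
  -- distance to the boundary.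
  have h3 : ‖∫ y, (liftKernelDeriv x y).smulRight (g y - c) ∂(surfaceMeasure O)‖ₑ ≤
      ENNReal.ofReal (2 * d / infDist x (frontier O)) *
        ∫⁻ y, ENNReal.ofReal (liftKernel x y) * ‖g y - c‖ₑ ∂(surfaceMeasure O) := by
    refine (enorm_integral_le_lintegral_enorm _).trans ?_
    rw [← lintegral_const_mul' _ _ ENNReal.ofReal_ne_top]
    refine lintegral_mono_ae ?_
    filter_upwards [ae_surface_mem (O := O)] with y hy
    have h4 : infDist x (frontier O) ≤ ‖x - y‖ := by
      rw [← dist_eq_norm]; exact infDist_le_dist_of_mem hy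
    have hne : x ≠ y := by
      rintro rfl
      rw [sub_self, norm_zero] at h4
      linarith
    rw [← ofReal_norm, ContinuousLinearMap.norm_smulRight_apply,
      ENNReal.ofReal_mul (norm_nonneg _), ofReal_norm, ofReal_norm, ← mul_assoc,
      ← ENNReal.ofReal_mul (by positivity)]
    gcongr
    rw [← ofReal_norm]
    refine ENNReal.ofReal_le_ofReal ((norm_liftKernelDeriv_le hne).trans ?_)
    refine mul_le_mul_of_nonneg_right ?_ (liftKernel_nonneg _ _)
    gcongr
  rw [hD, enorm_smul, mul_pow, enorm_inv h0, ENNReal.ofReal_pow (by positivity)]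
  calc _ ≤ ‖liftMass O x‖ₑ⁻¹ ^ 2 * (ENNReal.ofReal (2 * d / infDist x (frontier O)) ^ 2 *
        (‖liftMass O x‖ₑ * ∫⁻ y, ENNReal.ofReal (liftKernel x y) * ‖g y - c‖ₑ ^ 2
          ∂(surfaceMeasure O))) := by
        gcongr
        refine (pow_le_pow_left' h3 2).trans ?_
        rw [mul_pow]
        gcongr
    _ = _ := by
        rw [sq (‖liftMass O x‖ₑ⁻¹)]
        generalize (∫⁻ y, ENNReal.ofReal (liftKernel x y) * ‖g y - c‖ₑ ^ 2 ∂(surfaceMeasure O)) = J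
        generalize ENNReal.ofReal (2 * d / infDist x (frontier O)) ^ 2 = D
        calc _ = D * (‖liftMass O x‖ₑ⁻¹ * J) * (‖liftMass O x‖ₑ * ‖liftMass O x‖ₑ⁻¹) := by ring
          _ = _ := by rw [ENNReal.mul_inv_cancel hn0 hnt, mul_one]

end Potential

end Acoustic

end


noncomputable section

namespace Acoustic

open Metric
open scoped ENNReal NNReal Topology

variable {d : ℕ}

/-! ### Bounds for the extension operator -/

/-- Classical differentiability in the domain gives weak gradients. -/
lemma hasWeakGrad_of_differentiableOn {O : Set (Space d)} {u : Space d → ℂ}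
    (hu : ∀ x ∈ O, DifferentiableAt ℝ u x) {p : L2 O} {F : L2Vec O}
    (hp : p =ᵐ[volume.restrict O] u) (hF : F =ᵐ[volume.restrict O] grad u) :
    HasWeakGrad O p F := by
  intro φ hφ i
  have hz : ∀ x ∉ O, φ x = 0 := fun x hx => image_eq_zero_of_notMem_tsupport fun h => hx (hφ.supp h)
  have hz' : ∀ x ∉ O, pderiv i φ x = 0 := by
    intro x hx
    have : x ∉ tsupport (fderiv ℝ φ) := fun h => hx (hφ.supp (tsupport_fderiv_subset ℝ h))
    rw [pderiv, image_eq_zero_of_notMem_tsupport this]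
    simp
  have e1 : ∀ᵐ x ∂(volume.restrict O), p x * pderiv i φ x = pderiv i φ x * u x := by
    filter_upwards [hp] with x hx
    rw [hx, mul_comm]
  have e2 : ∀ᵐ x ∂(volume.restrict O), F x i * φ x = φ x * pderiv i u x := by
    filter_upwards [hF] with x hx
    rw [hx, mul_comm]
    rfl
  have i1 : Integrable fun x => pderiv i φ x * u x := by
    refine (integrableOn_iff_integrable_of_support_subset (s := O) fun x hx => ?_).1 ?_
    · by_contra h
      exact hx (by simp [hz' x h])
    · exact ((Lp.memLp p).integrable_mul (hφ.memLp_pderiv i)).congr e1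
  have i2 : Integrable fun x => φ x * pderiv i u x := by
    refine (integrableOn_iff_integrable_of_support_subset (s := O) fun x hx => ?_).1 ?_
    · by_contra h
      exact hx (by simp [hz x h])
    · exact ((F.memLp_apply i).integrable_mul hφ.memLp).congr e2
  have i3 : Integrable fun x => φ x * u x := by
    refine (integrableOn_iff_integrable_of_support_subset (s := O) fun x hx => ?_).1 ?_
    · by_contra h
      exact hx (by simp [hz x h])
    · refine ((Lp.memLp p).integrable_mul hφ.memLp).congr ?_
      filter_upwards [hp] with x hx
      rw [Pi.mul_apply, hx, mul_comm]
  have key := integral_bilinear_hasLineDerivAt_right_eq_neg_left_of_integrable (μ := volume)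
    (B := ContinuousLinearMap.mul ℝ ℂ) (f := φ) (g := u) (v := EuclideanSpace.single i (1 : ℝ))
    i1 i2 i3
    (fun x _ => ((hφ.smooth.differentiable (by simp)) x).hasFDerivAt.hasLineDerivAt _)
    (fun x hx => (hu x (hφ.supp hx)).hasFDerivAt.hasLineDerivAt _)
  rw [integral_congr_ae e1, integral_congr_ae e2,
    setIntegral_eq_integral_of_forall_compl_eq_zero fun x hx => by rw [hz' x hx, zero_mul],
    setIntegral_eq_integral_of_forall_compl_eq_zero fun x hx => by rw [hz x hx, zero_mul]]
  exact neg_eq_iff_eq_neg.1 key.symm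

variable {O : Set (Space d)}

lemma IsLipschitzDomain.exists_radius (hO : IsLipschitzDomain O) :
    ∃ R > 0, closure O ⊆ ball 0 R := by
  obtain ⟨R, hR⟩ := hO.isBounded.closure.subset_ball 0
  exact ⟨max R 1, by positivity, hR.trans (ball_subset_ball (le_max_left _ _))⟩

/-- Let δ be the distance to the boundary. The ball of radius δ about a nearest boundary point has
surface measure at least κδ^{d-1}, and the kernel there is at least (2δ)^{-2d}. The total mass is
thus at least of order δ^{-d-1}. -/
lemma exists_liftMass_inv_le (hd : 2 ≤ d) (hO : IsLipschitzDomain O) : ∃ C > 0, ∀ x ∈ O,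
    liftMass O x ≠ 0 ∧
      ‖liftMass O x‖ₑ⁻¹ ≤ ENNReal.ofReal (C * infDist x (frontier O) ^ (d + 1)) := by
  obtain ⟨R, hR, hOR⟩ := hO.exists_radius
  -- 2R bounds the distance from any point of O to the boundary.
  obtain ⟨κ, hκ, hlow⟩ := exists_surface_lower hO (D := 2 * R) (by positivity)
  refine ⟨(4 ^ d) / κ, by positivity, fun x hx => ?_⟩
  have hδ := hO.infDist_pos hd hx
  obtain ⟨y₀, hy₀, hxy⟩ := isClosed_frontier.exists_infDist_eq_dist (hO.frontier_nonempty hd) x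
  generalize infDist x (frontier O) = δ at *
  have hδR : δ ≤ 2 * R := by
    have h1 := hOR (subset_closure hx)
    have h2 := hOR (frontier_subset_closure hy₀)
    rw [mem_ball] at h1 h2
    have := dist_triangle_right x y₀ 0
    linarith
  have hm : ENNReal.ofReal ((4 ^ d / κ * δ ^ (d + 1))⁻¹) ≤ ‖liftMass O x‖ₑ := by
    rw [enorm_liftMass hd hO hx]
    calc ENNReal.ofReal ((4 ^ d / κ * δ ^ (d + 1))⁻¹)
        = ENNReal.ofReal ((((2 * δ) ^ 2) ^ d)⁻¹) * ENNReal.ofReal (κ * δ ^ (d - 1)) := by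
          rw [← ENNReal.ofReal_mul (by positivity)]
          congr 1
          obtain ⟨k, rfl⟩ : ∃ k, d = k + 1 := ⟨d - 1, by omega⟩
          rw [Nat.add_sub_cancel]
          have : ((2 * δ) ^ 2) ^ (k + 1) = 4 ^ (k + 1) * δ ^ (k + 1 + 1) * δ ^ k := by
            rw [mul_pow, mul_pow, ← pow_mul δ]; ring
          rw [this]
          field_simp
      _ ≤ ENNReal.ofReal ((((2 * δ) ^ 2) ^ d)⁻¹) * surfaceMeasure O (ball y₀ δ) :=
          mul_le_mul_right (hlow y₀ hy₀ δ hδ hδR) _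
      _ = ∫⁻ _ in ball y₀ δ, ENNReal.ofReal ((((2 * δ) ^ 2) ^ d)⁻¹) ∂(surfaceMeasure O) := by
          rw [setLIntegral_const]
      _ ≤ ∫⁻ y in ball y₀ δ, ENNReal.ofReal (liftKernel x y) ∂(surfaceMeasure O) := by
          refine lintegral_mono_ae ?_
          filter_upwards [ae_restrict_mem measurableSet_ball,
            ae_restrict_of_ae (ae_surface_mem (O := O))] with y hy hyO
          refine ENNReal.ofReal_le_ofReal ?_
          have h1 : ‖x - y‖ ≤ 2 * δ := by
            rw [← dist_eq_norm]
            have := dist_triangle_right x y y₀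
            rw [mem_ball] at hy
            linarith
          have h2 : 0 < ‖x - y‖ := by
            refine norm_pos_iff.2 (sub_ne_zero.2 ?_)
            rintro rfl
            rw [hO.isOpen.frontier_eq] at hyO
            exact hyO.2 hx
          unfold liftKernel
          gcongr
      _ ≤ _ := setLIntegral_le_lintegral _ _
  have hpos : 0 < 4 ^ d / κ * δ ^ (d + 1) := by positivity
  refine ⟨fun h => ?_, ?_⟩
  · rw [h, enorm_zero, nonpos_iff_eq_zero, ENNReal.ofReal_eq_zero] at hm
    exact absurd hm (not_le.2 (inv_pos.2 hpos))
  · rw [ENNReal.ofReal_inv_of_pos hpos] at hm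
    exact ENNReal.inv_le_iff_inv_le.1 hm

section Kernels

lemma frontier_dist_pos (hd : 2 ≤ d) (hO : IsLipschitzDomain O) {x y : Space d} (hx : x ∈ O)
    (hy : y ∈ frontier O) : infDist x (frontier O) ≤ ‖x - y‖ ∧ 0 < ‖x - y‖ := by
  have h1 : infDist x (frontier O) ≤ ‖x - y‖ := by
    rw [← dist_eq_norm]; exact infDist_le_dist_of_mem hy
  exact ⟨h1, (hO.infDist_pos hd hx).trans_le h1⟩

/-- `∫ (r + |x - y|)^{-2d} dx = C r^{-d}`. -/
lemma exists_lintegral_kernel (hd : 2 ≤ d) : ∃ C : ℝ≥0, ∀ (y : Space d) (r : ℝ), 0 < r →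
    ∫⁻ x : Space d, ENNReal.ofReal (((r + ‖x - y‖) ^ (2 * d))⁻¹) ≤ C * ENNReal.ofReal (r⁻¹ ^ d) := by
  have hfin : (∫⁻ x : Space d, ENNReal.ofReal (((1 + ‖x‖) ^ (2 * d))⁻¹)) < ⊤ := by
    have h := finite_integral_one_add_norm (E := Space d) (μ := volume) (r := ((2 * d : ℕ) : ℝ))
      (by rw [finrank_euclideanSpace_fin]; exact_mod_cast (by omega))
    refine lt_of_eq_of_lt (lintegral_congr fun x => ?_) h
    rw [Real.rpow_neg (by positivity), Real.rpow_natCast]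
  refine ⟨(∫⁻ x : Space d, ENNReal.ofReal (((1 + ‖x‖) ^ (2 * d))⁻¹)).toNNReal, fun y r hr => ?_⟩
  rw [ENNReal.coe_toNNReal hfin.ne]
  have hm : Measurable fun x : Space d => ENNReal.ofReal (((1 + ‖x‖) ^ (2 * d))⁻¹) := by fun_prop
  rw [lintegral_sub_right_eq_self (fun x : Space d => ENNReal.ofReal (((r + ‖x‖) ^ (2 * d))⁻¹)) y]
  -- Homogeneity: the substitution x = rx' produces r^{-2d} · r^d = r^{-d} times the integral for r
  -- = 1.
  have h1 : ∀ x : Space d, ENNReal.ofReal (((r + ‖x‖) ^ (2 * d))⁻¹) =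
      ENNReal.ofReal ((r ^ (2 * d))⁻¹) * ENNReal.ofReal (((1 + ‖r⁻¹ • x‖) ^ (2 * d))⁻¹) := by
    intro x
    rw [← ENNReal.ofReal_mul (by positivity), ← mul_inv, ← mul_pow, norm_smul,
      Real.norm_of_nonneg (by positivity), mul_add, mul_one, mul_inv_cancel_left₀ hr.ne']
  simp_rw [h1]
  rw [lintegral_const_mul' _ _ ENNReal.ofReal_ne_top]
  have h2 := lintegral_map (μ := (volume : Measure (Space d))) hm
    (measurable_const_smul (r⁻¹ : ℝ) : Measurable fun x : Space d => r⁻¹ • x)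
  rw [← h2, Measure.map_addHaar_smul _ (inv_ne_zero hr.ne'), lintegral_smul_measure,
    finrank_euclideanSpace_fin, smul_eq_mul, ← mul_assoc, ← ENNReal.ofReal_mul (by positivity),
    mul_comm]
  refine mul_le_mul_right (ENNReal.ofReal_le_ofReal (le_of_eq ?_)) _
  rw [abs_of_pos (by positivity), two_mul, pow_add, inv_pow, inv_inv]
  field_simp

/-- The Newtonian kernel `|x - y|^{1-d}` is uniformly integrable in the domain. -/
lemma exists_lintegral_newton (hd : 2 ≤ d) (hO : IsLipschitzDomain O) : ∃ C : ℝ≥0,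
    ∀ y ∈ frontier O, ∫⁻ x in O, ENNReal.ofReal ((‖x - y‖ ^ (d - 1))⁻¹) ≤ C := by
  obtain ⟨R, hR, hOR⟩ := hO.exists_radius
  have hi : IntegrableOn (fun x : Space d => (‖x‖ ^ (d - 1))⁻¹) (ball 0 (2 * R)) := by
    have : Nonempty (Fin d) := ⟨⟨0, by omega⟩⟩
    -- In polar coordinates the Jacobian t^{d-1} cancels the kernel, and the radial integrand is the
    -- constant 1.
    refine (integrableOn_fun_norm_addHaar volume (f := fun t : ℝ => (t ^ (d - 1))⁻¹)).2 ?_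
    rw [finrank_euclideanSpace_fin]
    refine (integrableOn_const (C := (1 : ℝ)) (by rw [Real.volume_Ioo]; exact ENNReal.ofReal_ne_top)
      (by simp)).congr_fun (fun t ht => ?_)
      measurableSet_Ioo
    rw [smul_eq_mul, mul_inv_cancel₀ (pow_ne_zero _ ht.1.ne')]
  have hfin : (∫⁻ x in ball (0 : Space d) (2 * R), ENNReal.ofReal ((‖x‖ ^ (d - 1))⁻¹)) < ⊤ :=
    hi.lintegral_lt_top
  refine ⟨(∫⁻ x in ball (0 : Space d) (2 * R), ENNReal.ofReal ((‖x‖ ^ (d - 1))⁻¹)).toNNReal,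
    fun y hy => ?_⟩
  rw [ENNReal.coe_toNNReal hfin.ne, ← lintegral_indicator hO.isOpen.measurableSet,
    ← lintegral_indicator measurableSet_ball,
    ← lintegral_sub_right_eq_self ((ball (0 : Space d) (2 * R)).indicator _) y]
  refine lintegral_mono fun x => ?_
  by_cases hx : x ∈ O
  · have h1 := hOR (subset_closure hx)
    have h2 := hOR (frontier_subset_closure hy)
    rw [mem_ball] at h1 h2
    have h3 : x - y ∈ ball (0 : Space d) (2 * R) := by
      rw [mem_ball_zero_iff, ← dist_eq_norm]
      have := dist_triangle_right x y 0
      linarith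
    rw [Set.indicator_of_mem hx, Set.indicator_of_mem h3]
  · rw [Set.indicator_of_notMem hx]
    simp

/-- The product kernel of the energy of the extension. -/
lemma mul_liftKernel_le {x y z : Space d} {δ : ℝ} (hδ : 0 < δ) (hy : δ ≤ ‖x - y‖)
    (hz : δ ≤ ‖x - z‖) : δ ^ (2 * d) * (liftKernel x y * liftKernel x z) ≤
      9 ^ d * ((‖y - z‖ + ‖x - y‖) ^ (2 * d))⁻¹ := by
  have ha := hδ.trans_le hy
  have hb := hδ.trans_le hz
  have hr : ‖y - z‖ ≤ ‖x - y‖ + ‖x - z‖ := by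
    have := norm_sub_le (x - z) (x - y)
    rw [sub_sub_sub_cancel_left] at this
    linarith
  have h0 := norm_nonneg (y - z)
  unfold liftKernel
  generalize ‖x - y‖ = a at *
  generalize ‖x - z‖ = b at *
  generalize ‖y - z‖ = r at *
  -- From r ≤ a + b follows r + a ≤ 3 max(a, b), while δ ≤ min(a, b). The power 2d of the constant 3
  -- is 9^d.
  have hab : δ * (r + a) ≤ 3 * (a * b) := by
    rcases le_total a b with h | h <;> nlinarith
  rw [← pow_mul, ← pow_mul, ← mul_inv, ← mul_pow, ← div_eq_mul_inv, ← div_eq_mul_inv,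
    div_le_div_iff₀ (by positivity) (by positivity), ← mul_pow,
    show (9 : ℝ) ^ d = 3 ^ (2 * d) by rw [pow_mul]; norm_num, ← mul_pow]
  gcongr

end Kernels

/-- The normalised weight is at most a multiple of δ^{d+1}|x - y|^{-2d} ≤ |x - y|^{1-d}, where δ is
the distance to the boundary. Cauchy-Schwarz with this weight, Tonelli and uniform integrability of
|x - y|^{1-d} over O give the bound. -/
lemma lintegral_lift_le (hd : 2 ≤ d) (hO : IsLipschitzDomain O) : ∃ C : ℝ≥0,
    ∀ g : Space d → ℂ, Measurable g → Integrable g (surfaceMeasure O) →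
      ∫⁻ x in O, ‖lift O g x‖ₑ ^ 2 ≤ C * ∫⁻ y, ‖g y‖ₑ ^ 2 ∂(surfaceMeasure O) := by
  have hfin := isFiniteMeasure_surface hO
  obtain ⟨A, hA, hmass⟩ := exists_liftMass_inv_le hd hO
  obtain ⟨N, hN⟩ := exists_lintegral_newton hd hO
  refine ⟨A.toNNReal * N, fun g hgm hg => ?_⟩
  have h1 : ∀ x ∈ O, ‖lift O g x‖ₑ ^ 2 ≤ ENNReal.ofReal A *
      ∫⁻ y, ENNReal.ofReal ((‖x - y‖ ^ (d - 1))⁻¹) * ‖g y‖ₑ ^ 2 ∂(surfaceMeasure O) := by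
    intro x hx
    obtain ⟨h0, hm⟩ := hmass x hx
    have hδ := hO.infDist_pos hd hx
    have h2 := enorm_lift_sub_sq_le hd hO hg hx h0 0
    simp only [sub_zero] at h2
    refine (h2.trans (mul_le_mul_left hm _)).trans ?_
    rw [← lintegral_const_mul' _ _ ENNReal.ofReal_ne_top,
      ← lintegral_const_mul' _ _ ENNReal.ofReal_ne_top]
    refine lintegral_mono_ae ?_
    filter_upwards [ae_surface_mem (O := O)] with y hy
    obtain ⟨h3, h4⟩ := frontier_dist_pos hd hO hx hy
    rw [← mul_assoc, ← mul_assoc, ← ENNReal.ofReal_mul (by positivity),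
      ← ENNReal.ofReal_mul (by positivity)]
    refine mul_le_mul_left (ENNReal.ofReal_le_ofReal ?_) _
    rw [mul_assoc]
    refine mul_le_mul_of_nonneg_left ?_ hA.le
    unfold liftKernel
    rw [← div_eq_mul_inv, ← one_div, div_le_div_iff₀ (by positivity) (by positivity), one_mul,
      ← pow_mul]
    calc _ ≤ ‖x - y‖ ^ (d + 1) * ‖x - y‖ ^ (d - 1) := by
          gcongr
      _ = _ := by rw [← pow_add]; congr 1; omega
  calc _ ≤ ∫⁻ x in O, ENNReal.ofReal A *
        ∫⁻ y, ENNReal.ofReal ((‖x - y‖ ^ (d - 1))⁻¹) * ‖g y‖ₑ ^ 2 ∂(surfaceMeasure O) :=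
        setLIntegral_mono' hO.isOpen.measurableSet h1
    _ = ENNReal.ofReal A * ∫⁻ x in O,
        ∫⁻ y, ENNReal.ofReal ((‖x - y‖ ^ (d - 1))⁻¹) * ‖g y‖ₑ ^ 2 ∂(surfaceMeasure O) :=
        lintegral_const_mul' _ _ ENNReal.ofReal_ne_top
    _ = ENNReal.ofReal A * ∫⁻ y, (∫⁻ x in O,
        ENNReal.ofReal ((‖x - y‖ ^ (d - 1))⁻¹) * ‖g y‖ₑ ^ 2) ∂(surfaceMeasure O) := by
        congr 1
        refine lintegral_lintegral_swap (Measurable.aemeasurable ?_)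
        unfold Function.uncurry
        fun_prop
    _ ≤ ENNReal.ofReal A * ∫⁻ y, N * ‖g y‖ₑ ^ 2 ∂(surfaceMeasure O) := by
        refine mul_le_mul_right (lintegral_mono_ae ?_) _
        filter_upwards [ae_surface_mem (O := O)] with y hy
        rw [lintegral_mul_const' _ _ (by simp)]
        exact mul_le_mul_left (hN y hy) _
    _ = _ := by
        rw [lintegral_const_mul' _ _ (by simp), ← mul_assoc, ENNReal.coe_mul]
        rfl

/-- The averaging estimate is used twice: the derivative at x is bounded by 1/δ times the mean over
y of the deviation g(y) - lift g(x), and that deviation by the mean over z of g(z) - g(y). The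
powers of δ combine to δ^{2d}, which `mul_liftKernel_le` absorbs; integrating out x by
`exists_lintegral_kernel` leaves |y - z|^{-d}, the Slobodeckij weight. -/
lemma lintegral_fderiv_lift_le (hd : 2 ≤ d) (hO : IsLipschitzDomain O) : ∃ C : ℝ≥0,
    ∀ g : Space d → ℂ, Measurable g → Integrable g (surfaceMeasure O) →
      ∫⁻ x in O, ‖fderiv ℝ (lift O g) x‖ₑ ^ 2 ≤ C * ∫⁻ y, (∫⁻ z, ‖g y - g z‖ₑ ^ 2 *
        ENNReal.ofReal ((dist y z)⁻¹ ^ d) ∂(surfaceMeasure O)) ∂(surfaceMeasure O) := by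
  have hfin := isFiniteMeasure_surface hO
  obtain ⟨A, hA, hmass⟩ := exists_liftMass_inv_le hd hO
  obtain ⟨N, hN⟩ := exists_lintegral_kernel hd
  -- (2d)² from the derivative of the kernel, A² from the two normalisations, 9^d from the product
  -- of the two kernels.
  let B : ℝ := (2 * d) ^ 2 * A ^ 2 * 9 ^ d
  have hB : 0 ≤ B := by positivity
  refine ⟨B.toNNReal * N, fun g hgm hg => ?_⟩
  have h1 : ∀ x ∈ O, ‖fderiv ℝ (lift O g) x‖ₑ ^ 2 ≤ ENNReal.ofReal B *
      ∫⁻ y, (∫⁻ z, ENNReal.ofReal (((‖y - z‖ + ‖x - y‖) ^ (2 * d))⁻¹) * ‖g y - g z‖ₑ ^ 2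
        ∂(surfaceMeasure O)) ∂(surfaceMeasure O) := by
    intro x hx
    obtain ⟨h0, hm⟩ := hmass x hx
    have hδ := hO.infDist_pos hd hx
    refine (lift_fderiv hd hO hg hx h0).2.trans ?_
    calc _ ≤ ENNReal.ofReal ((2 * d / infDist x (frontier O)) ^ 2) *
          (ENNReal.ofReal (A * infDist x (frontier O) ^ (d + 1)) *
          ∫⁻ y, ENNReal.ofReal (liftKernel x y) *
            (ENNReal.ofReal (A * infDist x (frontier O) ^ (d + 1)) *
            ∫⁻ z, ENNReal.ofReal (liftKernel x z) * ‖g z - g y‖ₑ ^ 2 ∂(surfaceMeasure O))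
            ∂(surfaceMeasure O)) := by
          refine mul_le_mul_right (mul_le_mul' hm (lintegral_mono fun y => ?_)) _
          refine mul_le_mul_right ?_ _
          rw [enorm_sub_rev]
          exact (enorm_lift_sub_sq_le hd hO hg hx h0 (g y)).trans (mul_le_mul_left hm _)
      _ ≤ _ := by
          simp only [← lintegral_const_mul' _ _ ENNReal.ofReal_ne_top]
          refine lintegral_mono_ae ?_
          filter_upwards [ae_surface_mem (O := O)] with y hy
          refine lintegral_mono_ae ?_
          filter_upwards [ae_surface_mem (O := O)] with z hz
          obtain ⟨h3, h4⟩ := frontier_dist_pos hd hO hx hy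
          obtain ⟨h5, h6⟩ := frontier_dist_pos hd hO hx hz
          have h7 := mul_liftKernel_le hδ h3 h5
          rw [enorm_sub_rev (g z) (g y)]
          simp only [← mul_assoc]
          rw [← ENNReal.ofReal_mul (by positivity), ← ENNReal.ofReal_mul (by positivity),
            ← ENNReal.ofReal_mul (by have := liftKernel_nonneg x y; positivity),
            ← ENNReal.ofReal_mul (by have := liftKernel_nonneg x y; positivity),
            ← ENNReal.ofReal_mul (by positivity)]
          refine mul_le_mul_left (ENNReal.ofReal_le_ofReal ?_) _
          calc _ = (2 * d) ^ 2 * A ^ 2 * (infDist x (frontier O) ^ (2 * d) *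
                (liftKernel x y * liftKernel x z)) := by
                rw [div_pow, pow_succ]
                field_simp
                ring
            _ ≤ (2 * d) ^ 2 * A ^ 2 * (9 ^ d * ((‖y - z‖ + ‖x - y‖) ^ (2 * d))⁻¹) := by gcongr
            _ = _ := by simp only [B]; ring
  have hmeas : Measurable fun q : (Space d × Space d) × Space d =>
      ENNReal.ofReal (((‖q.1.2 - q.2‖ + ‖q.1.1 - q.1.2‖) ^ (2 * d))⁻¹) *
        ‖g q.1.2 - g q.2‖ₑ ^ 2 := by fun_prop
  calc _ ≤ ∫⁻ x in O, ENNReal.ofReal B *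
        ∫⁻ y, (∫⁻ z, ENNReal.ofReal (((‖y - z‖ + ‖x - y‖) ^ (2 * d))⁻¹) * ‖g y - g z‖ₑ ^ 2
          ∂(surfaceMeasure O)) ∂(surfaceMeasure O) :=
        setLIntegral_mono' hO.isOpen.measurableSet h1
    _ = ENNReal.ofReal B * ∫⁻ x in O,
        ∫⁻ y, (∫⁻ z, ENNReal.ofReal (((‖y - z‖ + ‖x - y‖) ^ (2 * d))⁻¹) * ‖g y - g z‖ₑ ^ 2
          ∂(surfaceMeasure O)) ∂(surfaceMeasure O) :=
        lintegral_const_mul' _ _ ENNReal.ofReal_ne_top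
    _ = ENNReal.ofReal B * ∫⁻ y, (∫⁻ x in O, (∫⁻ z,
        ENNReal.ofReal (((‖y - z‖ + ‖x - y‖) ^ (2 * d))⁻¹) * ‖g y - g z‖ₑ ^ 2
          ∂(surfaceMeasure O))) ∂(surfaceMeasure O) := by
        congr 1
        exact lintegral_lintegral_swap hmeas.lintegral_prod_right'.aemeasurable
    _ = ENNReal.ofReal B * ∫⁻ y, (∫⁻ z, (∫⁻ x in O,
        ENNReal.ofReal (((‖y - z‖ + ‖x - y‖) ^ (2 * d))⁻¹) * ‖g y - g z‖ₑ ^ 2)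
          ∂(surfaceMeasure O)) ∂(surfaceMeasure O) := by
        congr 1
        refine lintegral_congr fun y => ?_
        refine lintegral_lintegral_swap (Measurable.aemeasurable ?_)
        unfold Function.uncurry
        fun_prop
    _ ≤ ENNReal.ofReal B * ∫⁻ y, (∫⁻ z, N * (‖g y - g z‖ₑ ^ 2 *
        ENNReal.ofReal ((dist y z)⁻¹ ^ d)) ∂(surfaceMeasure O)) ∂(surfaceMeasure O) := by
        refine mul_le_mul_right (lintegral_mono fun y => lintegral_mono fun z => ?_) _
        rcases eq_or_ne y z with rfl | hyz
        · simp
        rw [lintegral_mul_const' _ _ (by simp), mul_left_comm, mul_comm]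
        refine mul_le_mul_right ?_ _
        rw [dist_eq_norm]
        exact (setLIntegral_le_lintegral _ _).trans
          (hN y _ (norm_pos_iff.2 (sub_ne_zero.2 hyz)))
    _ = _ := by
        simp only [lintegral_const_mul' _ _ (ENNReal.coe_ne_top (r := N))]
        rw [← mul_assoc, ENNReal.coe_mul]
        rfl

lemma measurable_lift {g : Space d → ℂ} (hO : IsLipschitzDomain O) (hg : Measurable g) :
    Measurable (lift O g) := by
  have hfin := isFiniteMeasure_surface hO
  have h : ∀ f : Space d → ℂ, Measurable f →
      Measurable fun x => ∫ y, liftKernel x y • f y ∂(surfaceMeasure O) := by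
    intro f hf
    have h1 : Measurable fun z : Space d × Space d => liftKernel z.1 z.2 • f z.2 :=
      measurable_liftKernel.smul (hf.comp measurable_snd)
    exact h1.stronglyMeasurable.integral_prod_right.measurable
  exact (h g hg).mul (h _ measurable_const).inv

lemma measurable_grad (φ : Space d → ℂ) : Measurable (grad φ) := by
  have h : Measurable fun x => fun i => pderiv i φ x :=
    measurable_pi_lambda _ fun i => measurable_fderiv_apply_const ℝ φ _
  exact (PiLp.continuous_toLp 2 _).measurable.comp h

/-- The extension operator from `H^{1/2}(∂O)` to `H¹(O)` is bounded. -/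
lemma exists_lift (hd : 2 ≤ d) (hO : IsLipschitzDomain O) : ∃ C : ℝ, 0 ≤ C ∧ ∀ h : HHalf O,
    ∃ (p : L2 O) (F : L2Vec O), p =ᵐ[volume.restrict O] lift O h.toL2 ∧ HasWeakGrad O p F ∧
      ‖(p, F)‖ ≤ C * ‖h‖ := by
  have hfin := isFiniteMeasure_surface hO
  obtain ⟨A, hA⟩ := lintegral_lift_le hd hO
  obtain ⟨B, hB⟩ := lintegral_fderiv_lift_le hd hO
  obtain ⟨M, hM, hmass⟩ := exists_liftMass_inv_le hd hO
  refine ⟨√A + √(d * B), by positivity, fun h => ?_⟩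
  have hgm : Measurable h.toL2 := (Lp.stronglyMeasurable h.toL2).measurable
  have hg : Integrable h.toL2 (surfaceMeasure O) := (Lp.memLp h.toL2).integrable (by norm_num)
  have h1 : ∫⁻ x in O, ‖lift O h.toL2 x‖ₑ ^ 2 ≤ A * ‖h‖ₑ ^ 2 := by
    refine (hA _ hgm hg).trans (mul_le_mul_right ?_ _)
    rw [← enorm_sq_eq_lintegral, h.norm_sq]
    exact le_self_add
  have h2 : ∫⁻ x in O, ‖grad (lift O h.toL2) x‖ₑ ^ 2 ≤ (d * B) * ‖h‖ₑ ^ 2 := by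
    calc _ ≤ ∫⁻ x in O, d * ‖fderiv ℝ (lift O h.toL2) x‖ₑ ^ 2 := by
          refine lintegral_mono fun x => ?_
          have := norm_grad_sq_le (le_refl ‖fderiv ℝ (lift O h.toL2) x‖)
          rw [← ofReal_norm, ← ofReal_norm, ← ENNReal.ofReal_pow (norm_nonneg _),
            ← ENNReal.ofReal_pow (norm_nonneg _), ← ENNReal.ofReal_natCast,
            ← ENNReal.ofReal_mul (by positivity)]
          exact ENNReal.ofReal_le_ofReal this
      _ = d * ∫⁻ x in O, ‖fderiv ℝ (lift O h.toL2) x‖ₑ ^ 2 :=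
          lintegral_const_mul' _ _ (by simp)
      _ ≤ d * (B * ‖h‖ₑ ^ 2) := by
          refine mul_le_mul_right ((hB _ hgm hg).trans (mul_le_mul_right ?_ _)) _
          rw [← h.enorm_snd_sq, h.norm_sq]
          exact le_add_self
      _ = _ := (mul_assoc _ _ _).symm
  have m1 : MemLp (lift O h.toL2) 2 (volume.restrict O) := by
    refine ⟨(measurable_lift hO hgm).aestronglyMeasurable, ?_⟩
    have := h1.trans_lt (ENNReal.mul_lt_top (by simp) (by simp))
    rw [← eLpNorm_two_sq] at this
    exact (ENNReal.pow_lt_top_iff.1 this).resolve_right (by norm_num)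
  have m2 : MemLp (grad (lift O h.toL2)) 2 (volume.restrict O) := by
    refine ⟨(measurable_grad _).aestronglyMeasurable, ?_⟩
    have := h2.trans_lt (ENNReal.mul_lt_top (ENNReal.mul_lt_top (by simp) (by simp)) (by simp))
    rw [← eLpNorm_two_sq] at this
    exact (ENNReal.pow_lt_top_iff.1 this).resolve_right (by norm_num)
  have sq : ∀ {a b : ℝ} {c : ℝ≥0}, 0 ≤ a → 0 ≤ b → ENNReal.ofReal a ^ 2 ≤ c * ENNReal.ofReal b ^ 2 →
      a ≤ √c * b := by
    intro a b c ha hb hab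
    rw [← ENNReal.ofReal_pow ha, ← ENNReal.ofReal_pow hb, ← ENNReal.ofReal_coe_nnreal,
      ← ENNReal.ofReal_mul c.coe_nonneg, ENNReal.ofReal_le_ofReal_iff (by positivity)] at hab
    refine abs_le_of_sq_le_sq' ?_ (by positivity) |>.2
    rwa [mul_pow, Real.sq_sqrt c.coe_nonneg]
  refine ⟨MemLp.toLp _ m1, MemLp.toLp _ m2, m1.coeFn_toLp,
    hasWeakGrad_of_differentiableOn (fun x hx => (lift_fderiv hd hO hg hx (hmass x hx).1).1)
      m1.coeFn_toLp m2.coeFn_toLp, ?_⟩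
  have n1 : ‖(MemLp.toLp _ m1 : L2 O)‖ ≤ √A * ‖h‖ := by
    refine sq (norm_nonneg _) (norm_nonneg _) ?_
    rw [ofReal_norm, ofReal_norm, Lp.enorm_toLp, eLpNorm_two_sq]
    exact h1
  have n2 : ‖(MemLp.toLp _ m2 : L2Vec O)‖ ≤ √(d * B) * ‖h‖ := by
    have := sq (c := d * B) (norm_nonneg (MemLp.toLp _ m2 : L2Vec O)) (norm_nonneg h) ?_
    · simpa using this
    rw [ofReal_norm, ofReal_norm, Lp.enorm_toLp, eLpNorm_two_sq]
    simpa using h2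
  rw [Prod.norm_def]
  refine max_le (n1.trans ?_) (n2.trans ?_) <;> refine mul_le_mul_of_nonneg_right ?_ (norm_nonneg _)
  · exact le_add_of_nonneg_right (Real.sqrt_nonneg _)
  · exact le_add_of_nonneg_left (Real.sqrt_nonneg _)

end Acoustic

end


noncomputable section

namespace Acoustic

open Metric
open scoped ENNReal NNReal Topology

variable {d : ℕ} {O : Set (Space d)}

/-! ### The trace of the extension -/

lemma lintegral_lintegral_sub_sq_le {α β : Type*} [MeasurableSpace α] [MeasurableSpace β]
    {μ : Measure α} {ν : Measure β} [SFinite ν] {a b : α → β → ℂ} (c : α → β → ℂ)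
    (ha : Measurable (Function.uncurry a)) (hb : Measurable (Function.uncurry b)) :
    ∫⁻ x, (∫⁻ y, ‖a x y - c x y‖ₑ ^ 2 ∂ν) ∂μ ≤
      2 * (∫⁻ x, (∫⁻ y, ‖a x y - b x y‖ₑ ^ 2 ∂ν) ∂μ) +
        2 * ∫⁻ x, (∫⁻ y, ‖b x y - c x y‖ₑ ^ 2 ∂ν) ∂μ := by
  have h1 : Measurable fun q : α × β => ‖a q.1 q.2 - b q.1 q.2‖ₑ ^ 2 :=
    (ha.sub hb).enorm.pow_const 2
  have h2 : ∀ x, Measurable fun y => 2 * ‖a x y - b x y‖ₑ ^ 2 := fun x =>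
    (h1.comp measurable_prodMk_left).const_mul 2
  have h3 : Measurable fun x => 2 * ∫⁻ y, ‖a x y - b x y‖ₑ ^ 2 ∂ν :=
    h1.lintegral_prod_right'.const_mul 2
  calc _ ≤ ∫⁻ x, (∫⁻ y, (2 * ‖a x y - b x y‖ₑ ^ 2 + 2 * ‖b x y - c x y‖ₑ ^ 2) ∂ν) ∂μ :=
        lintegral_mono fun x => lintegral_mono fun y => enorm_sub_sq_le _ _ _
    _ = ∫⁻ x, ((2 * ∫⁻ y, ‖a x y - b x y‖ₑ ^ 2 ∂ν) + 2 * ∫⁻ y, ‖b x y - c x y‖ₑ ^ 2 ∂ν) ∂μ := by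
        refine lintegral_congr fun x => ?_
        rw [lintegral_add_left (h2 x), lintegral_const_mul' _ _ (by simp),
          lintegral_const_mul' _ _ (by simp)]
    _ = _ := by
        rw [lintegral_add_left h3, lintegral_const_mul' _ _ (by simp),
          lintegral_const_mul' _ _ (by simp)]

section Chart

variable {x₀ : Space d}

/-- A boundary point z within cs of y - se would have the form y - s(e + z') with ‖z'‖ < c, and
would thus lie in the open set O. So rays leave the boundary at a linear rate. -/
lemma Chart.layer_point (Γ : Chart O x₀) (hd : 2 ≤ d) (hO : IsLipschitzDomain O) {y : Space d}
    (hy : y ∈ frontier O) (hyB : y ∈ ball x₀ Γ.ρ) {s : ℝ} (hs : s ∈ Set.Ioo 0 Γ.ρ) :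
    y - s • Γ.e ∈ O ∧ Γ.c * s ≤ infDist (y - s • Γ.e) (frontier O) ∧
      infDist (y - s • Γ.e) (frontier O) ≤ s := by
  have hin := Γ.inward y (frontier_subset_closure hy) hyB s hs
  refine ⟨by simpa using hin 0 (by simpa using Γ.c_pos), ?_, ?_⟩
  · refine (le_infDist (hO.frontier_nonempty hd)).2 fun z hz => ?_
    by_contra hlt
    rw [not_le, dist_eq_norm] at hlt
    have h1 := hin (s⁻¹ • (y - s • Γ.e - z)) (by
      rw [norm_smul, Real.norm_of_nonneg (inv_nonneg.2 hs.1.le), inv_mul_lt_iff₀ hs.1, mul_comm]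
      exact hlt)
    rw [smul_add, smul_inv_smul₀ hs.1.ne'] at h1
    have h2 : y - (s • Γ.e + (y - s • Γ.e - z)) = z := by abel
    rw [h2] at h1
    rw [hO.isOpen.frontier_eq] at hz
    exact hz.2 h1
  · refine (infDist_le_dist_of_mem hy).trans (le_of_eq ?_)
    rw [dist_eq_norm, sub_sub_cancel_left, norm_neg, norm_smul, Γ.norm_e, mul_one,
      Real.norm_of_nonneg hs.1.le]

/-- The extension converges to the boundary function at a uniform rate in the mean. -/
lemma Chart.exists_lift_layer_le (Γ : Chart O x₀) (hd : 2 ≤ d) (hO : IsLipschitzDomain O) :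
    ∃ C : ℝ≥0, ∀ g : Space d → ℂ, Measurable g → Integrable g (surfaceMeasure O) →
      ∀ T ∈ Set.Ioo 0 Γ.ρ, ∫⁻ y in ball x₀ Γ.ρ, (∫⁻ s in Set.Ioo 0 T,
        ‖g y - lift O g (y - s • Γ.e)‖ₑ ^ 2) ∂(surfaceMeasure O) ≤
        ENNReal.ofReal (T ^ 2) * (C * ∫⁻ y, (∫⁻ z, ‖g y - g z‖ₑ ^ 2 *
          ENNReal.ofReal ((dist y z)⁻¹ ^ d) ∂(surfaceMeasure O)) ∂(surfaceMeasure O)) := by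
  obtain ⟨A, hA, hmass⟩ := exists_liftMass_inv_le hd hO
  have hc := Γ.c_pos
  let B : ℝ := A * ((1 + Γ.c) / Γ.c ^ 2) ^ d
  have hB : 0 ≤ B := by positivity
  refine ⟨B.toNNReal, fun g hgm hg T hT => ?_⟩
  -- A pointwise bound by T times the inner Slobodeckij integral; integrating over s in (0, T)
  -- supplies the second factor T.
  have h1 : ∀ y ∈ frontier O, y ∈ ball x₀ Γ.ρ → ∀ s ∈ Set.Ioo 0 T,
      ‖g y - lift O g (y - s • Γ.e)‖ₑ ^ 2 ≤ ENNReal.ofReal (B * T) * ∫⁻ z, ‖g y - g z‖ₑ ^ 2 *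
          ENNReal.ofReal ((dist y z)⁻¹ ^ d) ∂(surfaceMeasure O) := by
    intro y hy hyB s hs
    obtain ⟨hx, hlo, hup⟩ := Γ.layer_point hd hO hy hyB ⟨hs.1, hs.2.trans hT.2⟩
    obtain ⟨x, hxdef⟩ : ∃ x, x = y - s • Γ.e := ⟨_, rfl⟩
    rw [← hxdef] at hx hlo hup ⊢
    have hxy : ‖y - x‖ = s := by
      rw [hxdef, sub_sub_cancel, norm_smul, Γ.norm_e, mul_one, Real.norm_of_nonneg hs.1.le]
    obtain ⟨h0, hm⟩ := hmass x hx
    rw [enorm_sub_rev]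
    refine ((enorm_lift_sub_sq_le hd hO hg hx h0 (g y)).trans (mul_le_mul_left hm _)).trans ?_
    rw [← lintegral_const_mul' _ _ ENNReal.ofReal_ne_top,
      ← lintegral_const_mul' _ _ ENNReal.ofReal_ne_top]
    refine lintegral_mono_ae ?_
    filter_upwards [ae_surface_mem (O := O)] with z hz
    obtain ⟨h2, h3⟩ := frontier_dist_pos hd hO hx hz
    have hδ := hO.infDist_pos hd hx
    have hT0 := hT.1
    have h9 : 0 < s := hs.1
    rw [enorm_sub_rev (g z) (g y), mul_comm (‖g y - g z‖ₑ ^ 2), ← mul_assoc, ← mul_assoc,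
      ← ENNReal.ofReal_mul (by positivity), ← ENNReal.ofReal_mul (by positivity)]
    rcases eq_or_ne y z with rfl | hyz
    · simp
    refine mul_le_mul_left (ENNReal.ofReal_le_ofReal ?_) _
    have hr : 0 < dist y z := dist_pos.2 hyz
    have h4 : dist y z ≤ s + ‖x - z‖ := by
      rw [← hxy, ← dist_eq_norm, ← dist_eq_norm]
      exact dist_triangle y x z
    -- The product of cs ≤ |x - z| and c|y - z| ≤ (1 + c)|x - z|. It converts |x - z|^{-2d} into
    -- s^{-d}|y - z|^{-d}, and the normalisation s^{d+1} then leaves a single factor s.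
    have h5 : Γ.c ^ 2 * (s * dist y z) ≤ (1 + Γ.c) * ‖x - z‖ ^ 2 := by
      have h6 : Γ.c * s ≤ ‖x - z‖ := hlo.trans h2
      have h7 : Γ.c * dist y z ≤ (1 + Γ.c) * ‖x - z‖ := by nlinarith
      calc _ = (Γ.c * s) * (Γ.c * dist y z) := by ring
        _ ≤ ‖x - z‖ * ((1 + Γ.c) * ‖x - z‖) := by gcongr
        _ = _ := by ring
    have h8 : liftKernel x z ≤ ((1 + Γ.c) / Γ.c ^ 2) ^ d * (s ^ d)⁻¹ * (dist y z)⁻¹ ^ d := by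
      unfold liftKernel
      rw [← inv_pow (‖x - z‖ ^ 2), ← inv_pow s, ← mul_pow, ← mul_pow]
      refine pow_le_pow_left₀ (by positivity) ?_ d
      rw [div_mul_eq_mul_div, div_mul_eq_mul_div, le_div_iff₀ (by positivity), inv_mul_le_iff₀
        (by positivity)]
      calc Γ.c ^ 2 = Γ.c ^ 2 * (s * dist y z) * (s⁻¹ * (dist y z)⁻¹) := by field_simp
        _ ≤ (1 + Γ.c) * ‖x - z‖ ^ 2 * (s⁻¹ * (dist y z)⁻¹) := by gcongr
        _ = _ := by ring
    calc _ ≤ A * s ^ (d + 1) *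
          (((1 + Γ.c) / Γ.c ^ 2) ^ d * (s ^ d)⁻¹ * (dist y z)⁻¹ ^ d) := by
          have := liftKernel_nonneg x z
          gcongr
      _ = B * s * (dist y z)⁻¹ ^ d := by
          simp only [B]
          rw [pow_succ]
          field_simp
      _ ≤ _ := by
          gcongr
          exact hs.2.le
  calc _ ≤ ∫⁻ y in ball x₀ Γ.ρ, ENNReal.ofReal (T ^ 2) * (B.toNNReal * ∫⁻ z, ‖g y - g z‖ₑ ^ 2 *
          ENNReal.ofReal ((dist y z)⁻¹ ^ d) ∂(surfaceMeasure O)) ∂(surfaceMeasure O) := by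
        refine lintegral_mono_ae ?_
        filter_upwards [ae_restrict_mem measurableSet_ball,
          ae_restrict_of_ae (ae_surface_mem (O := O))] with y hyB hy
        refine (setLIntegral_mono' measurableSet_Ioo (h1 y hy hyB)).trans (le_of_eq ?_)
        rw [setLIntegral_const, Real.volume_Ioo, sub_zero, ← mul_assoc, mul_right_comm,
          ENNReal.ofReal_mul hB, sq, ENNReal.ofReal_mul hT.1.le]
        change _ = _ * (ENNReal.ofReal B) * _
        ring
    _ ≤ _ := by
        rw [lintegral_const_mul' _ _ (by simp), lintegral_const_mul' _ _ (by simp)]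
        exact mul_le_mul_right (mul_le_mul_right (setLIntegral_le_lintegral _ _) _) _

/-- Functions of `H¹(O)` converge to their trace at a uniform rate in the mean. -/
lemma Chart.trace_layer_le (Γ : Chart O x₀) (hO : IsLipschitzDomain O) {p : L2 O} {F : L2Vec O}
    {b : L2Bdry O} (hw : (p, F, b) ∈ (restrictionGraph O).topologicalClosure) {u : Space d → ℂ}
    (hu : Measurable u) (hpu : p =ᵐ[volume.restrict O] u) {T : ℝ} (hT : T ≤ Γ.ρ) :
    ∫⁻ y in ball x₀ Γ.ρ, (∫⁻ s in Set.Ioo 0 T, ‖u (y - s • Γ.e) - b y‖ₑ ^ 2) ∂(surfaceMeasure O) ≤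
      ENNReal.ofReal (T ^ 2) * (64 * Γ.C * ‖F‖ₑ ^ 2) := by
  have hfin := isFiniteMeasure_surface hO
  have hbm : Measurable b := (Lp.stronglyMeasurable b).measurable
  -- The estimate is first proved with an arbitrary smooth comparison function, with error terms for
  -- its distance to p and to b. The right side is continuous in w, so w may tend to (p, F, b),
  -- where both errors vanish.
  have hbound : ∀ w ∈ restrictionGraph O, ∫⁻ y in ball x₀ Γ.ρ, (∫⁻ s in Set.Ioo 0 T,
      ‖u (y - s • Γ.e) - b y‖ₑ ^ 2) ∂(surfaceMeasure O) ≤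
      2 * Γ.C * ‖p - w.1‖ₑ ^ 2 + (ENNReal.ofReal (T ^ 2) * (64 * Γ.C) * ‖w.2.1‖ₑ ^ 2 +
        4 * ENNReal.ofReal T * ‖w.2.2 - b‖ₑ ^ 2) := by
    rintro ⟨p', F', b'⟩ ⟨φ, hφ, h1, h2, h3⟩
    have hφm : Measurable φ := hφ.continuous.measurable
    refine (lintegral_lintegral_sub_sq_le (a := fun y s => u (y - s • Γ.e))
      (b := fun y s => φ (y - s • Γ.e)) (fun y s => b y) (by unfold Function.uncurry; fun_prop)
      (by unfold Function.uncurry; fun_prop)).trans ?_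
    refine add_le_add ?_ ?_
    · rw [mul_assoc]
      refine mul_le_mul_right ?_ _
      have h4 := Γ.sweep 0 (by simpa using Γ.c_pos) (fun x => ‖u x - φ x‖ₑ ^ 2) (by fun_prop)
      simp only [add_zero] at h4
      calc _ ≤ ∫⁻ y in ball x₀ Γ.ρ, (∫⁻ s in Set.Ioo 0 Γ.ρ,
            ‖u (y - s • Γ.e) - φ (y - s • Γ.e)‖ₑ ^ 2) ∂(surfaceMeasure O) :=
            lintegral_mono fun y => lintegral_mono_set (Set.Ioo_subset_Ioo_right hT)
        _ ≤ _ := h4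
        _ = _ := by
            rw [enorm_sq_eq_lintegral]
            congr 1
            refine lintegral_congr_ae ?_
            filter_upwards [hpu, h1, Lp.coeFn_sub p p'] with x e1 e2 e3
            rw [e3, Pi.sub_apply, e1, e2]
    · refine (mul_le_mul_right (lintegral_lintegral_sub_sq_le (a := fun y s => φ (y - s • Γ.e))
        (b := fun y s => φ y) (fun y s => b y) (by unfold Function.uncurry; fun_prop)
        (by unfold Function.uncurry; fun_prop)) _).trans ?_
      rw [mul_add]
      refine add_le_add ?_ ?_
      · have h4 := Γ.layer_variation hφ hT
        simp only [enorm_sub_rev (φ _) (φ (_ - _ • Γ.e))] at h4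
        calc _ ≤ 2 * (2 * (ENNReal.ofReal (T ^ 2) * (16 * Γ.C * ‖F'‖ₑ ^ 2))) := by
              refine mul_le_mul_right (mul_le_mul_right (h4.trans ?_) _) _
              refine mul_le_mul_right (mul_le_mul_right ((layerEnergy_le _ _).trans ?_) _) _
              rw [enorm_sq_eq_lintegral]
              refine le_of_eq (lintegral_congr_ae ?_)
              filter_upwards [h2] with x hx
              rw [← hx]
          _ = _ := by
              rw [show (64 : ℝ≥0∞) = 2 * 2 * 16 by norm_num]
              ring
      · simp only [setLIntegral_const, Real.volume_Ioo, sub_zero]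
        rw [lintegral_mul_const' _ _ ENNReal.ofReal_ne_top, ← mul_assoc,
          show (2 : ℝ≥0∞) * 2 = 4 by norm_num, mul_assoc, mul_comm (ENNReal.ofReal T)]
        refine mul_le_mul_right (mul_le_mul_left ?_ _) _
        refine (setLIntegral_le_lintegral _ _).trans ?_
        rw [enorm_sq_eq_lintegral]
        refine le_of_eq (lintegral_congr_ae ?_)
        filter_upwards [h3, Lp.coeFn_sub b' b] with x e1 e2
        rw [e2, Pi.sub_apply, e1]
  rw [← SetLike.mem_coe, Submodule.topologicalClosure_coe] at hw
  have hcont : Continuous fun w : L2 O × L2Vec O × L2Bdry O =>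
      2 * Γ.C * ‖p - w.1‖ₑ ^ 2 + (ENNReal.ofReal (T ^ 2) * (64 * Γ.C) * ‖w.2.1‖ₑ ^ 2 +
        4 * ENNReal.ofReal T * ‖w.2.2 - b‖ₑ ^ 2) := by
    refine (continuous_const_mul_of_ne_top (by finiteness) ?_).add
      ((continuous_const_mul_of_ne_top (by finiteness) ?_).add
        (continuous_const_mul_of_ne_top (by finiteness) ?_)) <;>
    refine (ENNReal.continuous_pow 2).comp (Continuous.enorm ?_) <;> fun_prop
  have hcl := closure_minimal (t := {w : L2 O × L2Vec O × L2Bdry O |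
    ∫⁻ y in ball x₀ Γ.ρ, (∫⁻ s in Set.Ioo 0 T,
      ‖u (y - s • Γ.e) - b y‖ₑ ^ 2) ∂(surfaceMeasure O) ≤
      2 * Γ.C * ‖p - w.1‖ₑ ^ 2 + (ENNReal.ofReal (T ^ 2) * (64 * Γ.C) * ‖w.2.1‖ₑ ^ 2 +
        4 * ENNReal.ofReal T * ‖w.2.2 - b‖ₑ ^ 2)}) hbound (isClosed_le continuous_const hcont) hw
  rw [Set.mem_ofPred_eq] at hcl
  simpa [mul_assoc] using hcl

end Chart

/-- On a layer of width T the extension differs in mean square by O(T²) both from h, by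
`Chart.exists_lift_layer_le`, and from its own trace b, by `Chart.trace_layer_le`. Hence T∫|h - b|²
= O(T²) in each chart, and T tends to 0. -/
lemma ae_eq_of_trace_lift (hd : 2 ≤ d) (hO : IsLipschitzDomain O) {h : HHalf O} {p : L2 O}
    {F : L2Vec O} {b : L2Bdry O} (hp : p =ᵐ[volume.restrict O] lift O h.toL2)
    (hw : (p, F, b) ∈ (restrictionGraph O).topologicalClosure) : h.toL2 = b := by
  have hfin := isFiniteMeasure_surface hO
  have hgm : Measurable h.toL2 := (Lp.stronglyMeasurable h.toL2).measurable
  have hbm : Measurable b := (Lp.stronglyMeasurable b).measurable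
  have hg : Integrable h.toL2 (surfaceMeasure O) := (Lp.memLp h.toL2).integrable (by norm_num)
  have hum := measurable_lift hO hgm
  obtain ⟨s, Γ, hs⟩ := exists_chart_cover hO (fun _ Γ => Γ.ρ) (fun _ Γ => Γ.ρ_pos)
  have hloc : ∀ x : frontier O, ∫⁻ y in ball (x : Space d) (Γ x).ρ, ‖h.toL2 y - b y‖ₑ ^ 2
      ∂(surfaceMeasure O) = 0 := by
    intro x
    have hρ := (Γ x).ρ_pos
    obtain ⟨C, hC⟩ := (Γ x).exists_lift_layer_le hd hO
    obtain ⟨K, hK⟩ : ∃ K : ℝ≥0, ∀ T ∈ Set.Ioo 0 (Γ x).ρ,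
        ∫⁻ y in ball (x : Space d) (Γ x).ρ, ‖h.toL2 y - b y‖ₑ ^ 2 ∂(surfaceMeasure O) ≤
          K * ENNReal.ofReal T := by
      refine ⟨(2 * (C * ‖h.1.snd‖ₑ ^ 2) + 2 * (64 * (Γ x).C * ‖F‖ₑ ^ 2)).toNNReal, fun T hT => ?_⟩
      have hT0 : ENNReal.ofReal T ≠ 0 := by simpa using hT.1
      rw [ENNReal.coe_toNNReal (by finiteness)]
      have h1 := lintegral_lintegral_sub_sq_le
        (μ := (surfaceMeasure O).restrict (ball (x : Space d) (Γ x).ρ))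
        (ν := volume.restrict (Set.Ioo 0 T)) (a := fun y s => h.toL2 y)
        (b := fun y s => lift O h.toL2 (y - s • (Γ x).e)) (fun y s => b y)
        (by unfold Function.uncurry; fun_prop) (by unfold Function.uncurry; fun_prop)
      have h2 := hC _ hgm hg T hT
      rw [← h.enorm_snd_sq] at h2
      have h3 := (Γ x).trace_layer_le hO hw hum hp hT.2.le
      have h4 := h1.trans (add_le_add (mul_le_mul_right h2 2) (mul_le_mul_right h3 2))
      simp only [setLIntegral_const, Real.volume_Ioo, sub_zero] at h4
      rw [lintegral_mul_const' _ _ ENNReal.ofReal_ne_top, sq T, ENNReal.ofReal_mul hT.1.le] at h4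
      refine (ENNReal.mul_le_mul_iff_left hT0 ENNReal.ofReal_ne_top).1 (h4.trans (le_of_eq ?_))
      ring
    refine le_antisymm (ge_of_tendsto (x := 𝓝[>] (0 : ℝ)) (f := fun T => K * ENNReal.ofReal T)
      ?_ ?_) zero_le
    · have : Tendsto (fun T : ℝ => (K : ℝ≥0∞) * ENNReal.ofReal T) (𝓝 0) (𝓝 (K * ENNReal.ofReal 0)) :=
        (continuous_const_mul_of_ne_top (by simp) ENNReal.continuous_ofReal).tendsto 0
      rw [ENNReal.ofReal_zero, mul_zero] at this
      exact this.mono_left nhdsWithin_le_nhds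
    · filter_upwards [Ioo_mem_nhdsGT hρ] with T hT using hK T hT
  have h0 := lintegral_le_sum_cover s _ (ae_surface_mem.mono fun x hx => hs hx)
    (fun y => ‖h.toL2 y - b y‖ₑ ^ 2)
  rw [Finset.sum_eq_zero fun x _ => hloc x] at h0
  have h1 : ‖h.toL2 - b‖ₑ ^ 2 = 0 := by
    rw [enorm_sq_eq_lintegral]
    refine le_antisymm (le_trans (le_of_eq (lintegral_congr_ae ?_)) h0) zero_le
    filter_upwards [Lp.coeFn_sub h.toL2 b] with x hx
    rw [hx, Pi.sub_apply]
  exact sub_eq_zero.1 (by simpa using h1)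

/-- The trace has a bounded right inverse. -/
theorem exists_extension (hd : 2 ≤ d) (hO : IsLipschitzDomain O) [CompleteSpace (HHalf O)] :
    ∃ C : ℝ, 0 ≤ C ∧ ∀ h : HHalf O, ∃ (p : L2 O) (F : L2Vec O), HasWeakGrad O p F ∧
      IsTrace O p h ∧ ‖(p, F)‖ ≤ C * ‖h‖ := by
  obtain ⟨C, hC0, hC⟩ := exists_lift hd hO
  obtain ⟨K, hK⟩ := exists_trace hd hO
  refine ⟨C, hC0, fun h => ?_⟩
  obtain ⟨p, F, hp, hF, hb⟩ := hC h
  obtain ⟨k, ⟨G, hG, hk⟩, -⟩ := hK p F hF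
  have : h = k := HHalf.toL2_injective (ae_eq_of_trace_lift hd hO hp hk)
  exact ⟨p, F, hF, this ▸ ⟨G, hG, hk⟩, hb⟩

end Acoustic

end


noncomputable section

namespace Acoustic

open Metric
open scoped ENNReal NNReal Topology

variable {d : ℕ} {O : Set (Space d)}

/-! ### Weak derivatives as orthogonality relations -/

lemma pderiv_conj {φ : Space d → ℂ} (hφ : ContDiff ℝ ∞ φ) (i : Fin d) (x : Space d) :
    pderiv i (fun y => starRingEnd ℂ (φ y)) x = starRingEnd ℂ (pderiv i φ x) := by
  have h := (Complex.conjCLE.toContinuousLinearMap.hasFDerivAt (x := φ x)).comp x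
    ((hφ.differentiable (by simp)) x).hasFDerivAt
  have h' : HasFDerivAt (fun y => starRingEnd ℂ (φ y)) _ x := h
  rw [pderiv, h'.fderiv]
  simp [pderiv]

lemma IsTest.conj {φ : Space d → ℂ} (h : IsTest O φ) : IsTest O fun x => starRingEnd ℂ (φ x) where
  smooth := Complex.conjCLE.toContinuousLinearMap.contDiff.comp h.smooth
  compact := h.compact.comp_left (g := starRingEnd ℂ) (map_zero _)
  supp := (tsupport_comp_subset (g := starRingEnd ℂ) (map_zero _) φ).trans h.supp

lemma IsTest.memLp_grad {φ : Space d → ℂ} (h : IsTest O φ) :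
    MemLp (grad φ) 2 (volume.restrict O) := by
  rw [memLp_piLp_iff]
  exact fun i => h.memLp_pderiv i

lemma IsTest.memLp_single {φ : Space d → ℂ} (h : IsTest O φ) (i : Fin d) :
    MemLp (fun x => EuclideanSpace.single i (φ x)) 2 (volume.restrict O) := by
  rw [memLp_piLp_iff]
  intro j
  by_cases hij : j = i
  · subst hij
    simpa using h.memLp
  · simp [hij]

lemma inner_toLp {f : Space d → ℂ} (hf : MemLp f 2 (volume.restrict O)) (p : L2 O) :
    inner ℂ (MemLp.toLp f hf) p = ∫ x in O, p x * starRingEnd ℂ (f x) := by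
  rw [L2.inner_def]
  refine integral_congr_ae ?_
  filter_upwards [hf.coeFn_toLp] with x hx
  rw [hx, RCLike.inner_apply]

lemma inner_toLp_single {φ : Space d → ℂ} (h : IsTest O φ) (i : Fin d) (F : L2Vec O) :
    inner ℂ (MemLp.toLp _ (h.memLp_single i)) F = ∫ x in O, F x i * starRingEnd ℂ (φ x) := by
  rw [L2.inner_def]
  refine integral_congr_ae ?_
  filter_upwards [(h.memLp_single i).coeFn_toLp] with x hx
  rw [hx, EuclideanSpace.inner_single_left, mul_comm]

lemma inner_toLp_grad {φ : Space d → ℂ} (h : IsTest O φ) (v : L2Vec O) :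
    inner ℂ (MemLp.toLp _ h.memLp_grad) v =
      ∑ i, ∫ x in O, v x i * starRingEnd ℂ (pderiv i φ x) := by
  rw [L2.inner_def, ← integral_finsetSum]
  · refine integral_congr_ae ?_
    filter_upwards [h.memLp_grad.coeFn_toLp] with x hx
    rw [hx, PiLp.inner_apply]
    rfl
  · intro i _
    have := (v.memLp_apply i).integrable_mul (h.conj.memLp_pderiv i)
    refine this.congr (Eventually.of_forall fun x => ?_)
    simp only [Pi.mul_apply]
    rw [pderiv_conj h.smooth]

/-- Weak derivatives are defined with a bilinear pairing, the inner product is sesquilinear; test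
functions are stable under conjugation, which reconciles the two. As orthogonality relations, weak
derivatives are visibly closed and fit the computation of adjoints. -/
lemma hasWeakGrad_iff {p : L2 O} {F : L2Vec O} : HasWeakGrad O p F ↔
    ∀ φ (h : IsTest O φ) i, inner ℂ (MemLp.toLp _ (h.memLp_pderiv i)) p =
      -inner ℂ (MemLp.toLp _ (h.memLp_single i)) F := by
  constructor
  · intro H φ h i
    rw [inner_toLp, inner_toLp_single h, ← H _ h.conj i]
    simp only [pderiv_conj h.smooth]
  · intro H φ h i
    have := H _ h.conj i
    rw [inner_toLp, inner_toLp_single h.conj] at this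
    simpa only [pderiv_conj h.smooth, Complex.conj_conj] using this

lemma hasWeakDiv_iff {v : L2Vec O} {q : L2 O} : HasWeakDiv O v q ↔
    ∀ φ (h : IsTest O φ), inner ℂ (MemLp.toLp _ h.memLp_grad) v =
      -inner ℂ (MemLp.toLp _ h.memLp) q := by
  constructor
  · intro H φ h
    rw [inner_toLp, inner_toLp_grad h, ← H _ h.conj]
    simp only [pderiv_conj h.smooth]
  · intro H φ h
    have := H _ h.conj
    rw [inner_toLp, inner_toLp_grad h.conj] at this
    simpa only [pderiv_conj h.smooth, Complex.conj_conj] using this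

lemma isClosed_hasWeakGrad : IsClosed {w : L2 O × L2Vec O | HasWeakGrad O w.1 w.2} := by
  simp only [hasWeakGrad_iff, Set.ofPred_forall]
  refine isClosed_iInter fun φ => isClosed_iInter fun h => isClosed_iInter fun i =>
    isClosed_eq ?_ ?_ <;> fun_prop

lemma IsTest.hasWeakGrad {φ : Space d → ℂ} (h : IsTest O φ) :
    HasWeakGrad O (MemLp.toLp _ h.memLp) (MemLp.toLp _ h.memLp_grad) :=
  hasWeakGrad_of_differentiableOn (fun x _ => (h.smooth.differentiable (by simp)) x)
    h.memLp.coeFn_toLp h.memLp_grad.coeFn_toLp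

lemma IsTest.mem_testGraph {φ : Space d → ℂ} (h : IsTest O φ) :
    ((MemLp.toLp _ h.memLp, MemLp.toLp _ h.memLp_grad) : L2 O × L2Vec O) ∈ testGraph O :=
  ⟨φ, h, h.memLp.coeFn_toLp, h.memLp_grad.coeFn_toLp⟩

lemma IsTest.hasWeakGradZero {φ : Space d → ℂ} (h : IsTest O φ) :
    HasWeakGradZero O (MemLp.toLp _ h.memLp) (MemLp.toLp _ h.memLp_grad) :=
  ⟨h.hasWeakGrad, (testGraph O).le_topologicalClosure h.mem_testGraph⟩

/-- Green's formula without boundary term: for test functions it is the definition of the weak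
divergence, and both sides are continuous along the closure defining H¹₀(O). -/
lemma HasWeakDiv.pairing_eq_zero {v : L2Vec O} {q : L2 O} (hv : HasWeakDiv O v q) {p : L2 O}
    {F : L2Vec O} (h : HasWeakGradZero O p F) : inner ℂ F v + inner ℂ p q = 0 := by
  have hw := h.2
  rw [← SetLike.mem_coe, Submodule.topologicalClosure_coe] at hw
  have hc : Continuous fun w : L2 O × L2Vec O => inner ℂ w.2 v + inner ℂ w.1 q :=
    (continuous_snd.inner continuous_const).add (continuous_fst.inner continuous_const)
  have hsub : ∀ w ∈ testGraph O, inner ℂ w.2 v + inner ℂ w.1 q = 0 := by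
    rintro ⟨p', F'⟩ ⟨φ, hφ, h1, h2⟩
    have e1 : p' = MemLp.toLp _ hφ.memLp := Lp.ext (h1.trans hφ.memLp.coeFn_toLp.symm)
    have e2 : F' = MemLp.toLp _ hφ.memLp_grad := Lp.ext (h2.trans hφ.memLp_grad.coeFn_toLp.symm)
    simp only [e1, e2]
    rw [hasWeakDiv_iff.1 hv φ hφ, neg_add_cancel]
  have key := closure_minimal hsub (isClosed_singleton.preimage hc) hw
  exact key

lemma HasWeakGradZero.isTrace_zero (hO : IsOpen O) {p : L2 O} {F : L2Vec O} (h : HasWeakGradZero O p F) :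
    IsTrace O p 0 := by
  refine ⟨F, h.1, ?_⟩
  have hw := h.2
  rw [← SetLike.mem_coe, Submodule.topologicalClosure_coe] at hw ⊢
  have hc : Continuous fun w : L2 O × L2Vec O => ((w.1, w.2, 0) : L2 O × L2Vec O × L2Bdry O) := by
    fun_prop
  refine map_mem_closure (f := fun w : L2 O × L2Vec O => ((w.1, w.2, 0) : L2 O × L2Vec O × L2Bdry O))
    hc hw ?_
  rintro ⟨p', F'⟩ ⟨φ, hφ, h1, h2⟩
  refine ⟨φ, hφ.smooth, h1, h2, ?_⟩
  have h0 : (0 : L2Bdry O) =ᵐ[surfaceMeasure O] 0 := Lp.coeFn_zero _ _ _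
  filter_upwards [h0, ae_surface_mem (O := O)] with x hx hxO
  rw [hO.frontier_eq] at hxO
  rw [hx, image_eq_zero_of_notMem_tsupport (f := φ) fun hxt => hxO.2 (hφ.supp hxt)]
  rfl

/-! ### The normal trace -/

section NormalTrace

lemma IsTrace.neg {p : L2 O} {h : HHalf O} (hp : IsTrace O p h) : IsTrace O (-p) (-h) := by
  have := hp.smul (-1)
  rwa [neg_one_smul, neg_one_smul] at this

lemma HasWeakGrad.neg {p : L2 O} {F : L2Vec O} (h : HasWeakGrad O p F) :
    HasWeakGrad O (-p) (-F) := by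
  have := h.smul (-1)
  rwa [neg_one_smul, neg_one_smul] at this

/-- The pairing in Green's formula depends on the trace only. -/
lemma HasWeakDiv.pairing_congr (hd : 2 ≤ d) (hO : IsLipschitzDomain O) {v : L2Vec O} {q : L2 O}
    (hv : HasWeakDiv O v q) {p p' : L2 O} {F F' : L2Vec O} {h : HHalf O} (hF : HasWeakGrad O p F)
    (hF' : HasWeakGrad O p' F') (hp : IsTrace O p h) (hp' : IsTrace O p' h) :
    inner ℂ F v + inner ℂ p q = (inner ℂ F' v + inner ℂ p' q : ℂ) := by
  have h1 := hp.add hp'.neg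
  rw [add_neg_cancel] at h1
  have h2 := hv.pairing_eq_zero
    (hasWeakGradZero_of_isTrace_zero hd hO (hF.add hF'.neg) h1)
  rw [inner_add_left, inner_add_left, inner_neg_left, inner_neg_left] at h2
  linear_combination h2

/-- The functional is the left side of Green's formula evaluated on a bounded extension of h. Since
H¹₀(O) is the kernel of the trace, the value does not depend on the chosen extension, and this also
makes the functional antilinear. -/
theorem exists_isNormalTrace (hd : 2 ≤ d) (hO : IsLipschitzDomain O) [CompleteSpace (HHalf O)]
    {v : L2Vec O} {q : L2 O} (hv : HasWeakDiv O v q) :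
    ∃ g : HMinusHalf O, IsNormalTrace O v g := by
  obtain ⟨C, hC, hext⟩ := exists_extension hd hO
  choose P G hG hP hb using hext
  let L : HHalf O →ₛₗ[starRingEnd ℂ] ℂ :=
    { toFun := fun h => inner ℂ (G h) v + inner ℂ (P h) q
      map_add' := fun h k => by
        rw [hv.pairing_congr hd hO (hG (h + k)) ((hG h).add (hG k)) (hP _) ((hP h).add (hP k)),
          inner_add_left, inner_add_left]
        ring
      map_smul' := fun c h => by
        rw [hv.pairing_congr hd hO (hG (c • h)) ((hG h).smul c) (hP _) ((hP h).smul c),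
          inner_smul_left, inner_smul_left, smul_eq_mul]
        ring }
  have hL : ∀ h, ‖L h‖ ≤ (C * (‖v‖ + ‖q‖)) * ‖h‖ := by
    intro h
    have h1 : ‖inner ℂ (G h) v‖ ≤ ‖G h‖ * ‖v‖ := norm_inner_le_norm _ _
    have h2 : ‖inner ℂ (P h) q‖ ≤ ‖P h‖ * ‖q‖ := norm_inner_le_norm _ _
    have h3 : ‖G h‖ ≤ C * ‖h‖ := (norm_snd_le (P h, G h)).trans (hb h)
    have h4 : ‖P h‖ ≤ C * ‖h‖ := (norm_fst_le (P h, G h)).trans (hb h)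
    calc _ ≤ ‖inner ℂ (G h) v‖ + ‖inner ℂ (P h) q‖ := norm_add_le _ _
      _ ≤ (C * ‖h‖) * ‖v‖ + (C * ‖h‖) * ‖q‖ := by
          refine add_le_add (h1.trans ?_) (h2.trans ?_) <;> gcongr
      _ = _ := by ring
  refine ⟨L.mkContinuous _ hL, q, hv, fun p F h hF hp => ?_⟩
  exact hv.pairing_congr hd hO (hG h) hF (hP h) hp

lemma HasWeakDiv.ext (hO : IsOpen O) {v : L2Vec O} {q r : L2 O} (h : HasWeakDiv O v q)
    (k : HasWeakDiv O v r) : q = r := by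
  have h1 := h.add (k.smul (-1))
  rw [neg_one_smul, neg_one_smul, add_neg_cancel, ← sub_eq_add_neg] at h1
  exact sub_eq_zero.1 (HasWeakDiv.unique hO h1)

/-- Every element of H^{1/2}(∂O) is a trace, so Green's formula prescribes all values of the
functional. -/
lemma IsNormalTrace.unique (hd : 2 ≤ d) (hO : IsLipschitzDomain O) [CompleteSpace (HHalf O)]
    {v : L2Vec O} {g k : HMinusHalf O} (hg : IsNormalTrace O v g) (hk : IsNormalTrace O v k) :
    g = k := by
  obtain ⟨C, hC, hext⟩ := exists_extension hd hO
  obtain ⟨q, h1, h2⟩ := hg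
  obtain ⟨r, k1, k2⟩ := hk
  ext h
  obtain ⟨p, F, hF, hp, -⟩ := hext h
  rw [h2 p F h hF hp, k2 p F h hF hp, h1.ext hO.isOpen k1]

/-- Green's formula. -/
lemma IsNormalTrace.green (hO : IsOpen O) {v : L2Vec O} {q : L2 O} {g : HMinusHalf O}
    (hg : IsNormalTrace O v g) (hv : HasWeakDiv O v q) {p : L2 O} {F : L2Vec O} {h : HHalf O}
    (hF : HasWeakGrad O p F) (hp : IsTrace O p h) : g h = inner ℂ F v + inner ℂ p q := by
  obtain ⟨r, h1, h2⟩ := hg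
  rw [h2 p F h hF hp, h1.ext hO hv]

/-- The space `H¹(O)`, as a space of pairs of a function and its weak gradient. -/
def sobolevOne (O : Set (Space d)) : Submodule ℂ (WithLp 2 (L2 O × L2Vec O)) where
  carrier := {w | HasWeakGrad O w.fst w.snd}
  zero_mem' := HasWeakGrad.zero
  add_mem' := HasWeakGrad.add
  smul_mem' := fun c _ => HasWeakGrad.smul c

lemma isClosed_sobolevOne : IsClosed (sobolevOne O : Set (WithLp 2 (L2 O × L2Vec O))) := by
  have hc : Continuous fun w : WithLp 2 (L2 O × L2Vec O) => ((w.fst, w.snd) : L2 O × L2Vec O) := by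
    fun_prop
  exact isClosed_hasWeakGrad.preimage hc

instance : CompleteSpace (sobolevOne O) :=
  (isClosed_sobolevOne (O := O)).completeSpace_coe

/-- The normal trace is onto. -/
theorem exists_normalTrace_eq (hd : 2 ≤ d) (hO : IsLipschitzDomain O) [CompleteSpace (HHalf O)]
    (g : HMinusHalf O) : ∃ (v : L2Vec O) (q : L2 O), HasWeakDiv O v q ∧ IsNormalTrace O v g := by
  obtain ⟨K, hK⟩ := exists_trace hd hO
  choose t ht hb using fun w : sobolevOne O => hK _ _ w.2
  -- Conjugation makes the antilinear g composed with the trace a linear functional on H¹(O), to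
  -- which Riesz representation applies.
  let L : sobolevOne O →ₗ[ℂ] ℂ :=
    { toFun := fun w => starRingEnd ℂ (g (t w))
      map_add' := fun w w' => by
        rw [IsTrace.unique hO (ht (w + w')) ((ht w).add (ht w')), map_add, map_add]
      map_smul' := fun c w => by
        rw [IsTrace.unique hO (ht (c • w)) ((ht w).smul c), map_smulₛₗ, smul_eq_mul, map_mul,
          Complex.conj_conj]
        rfl }
  have hL : ∀ w, ‖L w‖ ≤ (‖g‖ * |K|) * ‖w‖ := by
    intro w
    have h1 : ‖(w.1.fst, w.1.snd)‖ ≤ ‖w‖ := by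
      rw [Prod.norm_def]
      exact max_le (WithLp.norm_fst_le _ w.1) (WithLp.norm_snd_le _ w.1)
    calc ‖L w‖ = ‖g (t w)‖ := RCLike.norm_conj _
      _ ≤ ‖g‖ * ‖t w‖ := g.le_opNorm _
      _ ≤ ‖g‖ * (|K| * ‖w‖) := by
          refine mul_le_mul_of_nonneg_left ((hb w).trans ?_) g.opNorm_nonneg
          exact mul_le_mul (le_abs_self K) h1 (norm_nonneg _) (abs_nonneg _)
      _ = _ := (mul_assoc _ _ _).symm
  -- The representative solves the Neumann problem -Δu + u = 0 with normal derivative g; its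
  -- gradient is the desired field and u is the divergence of that field.
  obtain ⟨u, hu⟩ : ∃ u : sobolevOne O, ∀ w, inner ℂ u w = L w :=
    ⟨(InnerProductSpace.toDual ℂ (sobolevOne O)).symm (L.mkContinuous _ hL), fun w => by
      rw [InnerProductSpace.toDual_symm_apply]; rfl⟩
  have key : ∀ (p : L2 O) (F : L2Vec O) (h : HHalf O), HasWeakGrad O p F → IsTrace O p h →
      g h = inner ℂ F u.1.snd + inner ℂ p u.1.fst := by
    intro p F h hF hp
    let w : sobolevOne O := ⟨WithLp.toLp 2 (p, F), hF⟩
    have h1 : t w = h := IsTrace.unique hO (ht w) hp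
    have h2 : inner ℂ w u = starRingEnd ℂ (starRingEnd ℂ (g (t w))) := by
      change _ = starRingEnd ℂ (L w)
      rw [← hu w]
      exact (inner_conj_symm w u).symm
    rw [Complex.conj_conj, h1] at h2
    rw [← h2, add_comm]
    rfl
  -- For test functions the boundary term is absent, which gives the differential equation.
  have hdiv : HasWeakDiv O u.1.snd u.1.fst := by
    refine hasWeakDiv_iff.2 fun φ hφ => ?_
    have h0 := hφ.hasWeakGradZero
    have := key _ _ _ h0.1 (h0.isTrace_zero hO.isOpen)
    rw [map_zero] at this
    linear_combination -this
  exact ⟨u.1.snd, u.1.fst, hdiv, u.1.fst, hdiv, key⟩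

end NormalTrace

end Acoustic

end


noncomputable section

namespace Acoustic

variable {d : ℕ} {O : Set (Space d)}

/-! ### The material parameters as operators -/

lemma matAct_mul (A B : Matrix (Fin d) (Fin d) ℝ) (ξ : EuclideanSpace ℂ (Fin d)) :
    matAct A (matAct B ξ) = matAct (A * B) ξ := by
  ext i
  simp only [matAct, Matrix.mul_apply, Complex.ofReal_sum, Complex.ofReal_mul, Finset.sum_mul,
    Finset.mul_sum, mul_assoc]
  exact Finset.sum_comm

lemma matAct_one (ξ : EuclideanSpace ℂ (Fin d)) : matAct 1 ξ = ξ := by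
  ext i
  simp only [matAct, Matrix.one_apply]
  rw [Finset.sum_eq_single i] <;> simp +contextual [eq_comm]

lemma isUnit_det_of_pos {A : Matrix (Fin d) (Fin d) ℝ} {a : ℝ} (ha : 0 < a)
    (h : ∀ ξ : Fin d → ℝ, a * (ξ ⬝ᵥ ξ) ≤ ξ ⬝ᵥ A.mulVec ξ) : IsUnit A.det := by
  rw [isUnit_iff_ne_zero]
  intro h0
  obtain ⟨ξ, hξ, h1⟩ := Matrix.exists_mulVec_eq_zero_iff.2 h0
  have h2 := h ξ
  rw [h1, dotProduct_zero] at h2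
  have h3 : 0 < ξ ⬝ᵥ ξ := by
    refine lt_of_le_of_ne ?_ fun h => hξ (dotProduct_self_eq_zero.1 h.symm)
    exact Finset.sum_nonneg fun i _ => mul_self_nonneg _
  nlinarith [mul_pos ha h3]

/-- A bounded coercive operator on a Hilbert space is onto. -/
lemma surjective_of_coercive {H : Type*} [NormedAddCommGroup H] [InnerProductSpace ℂ H]
    [CompleteSpace H] (T : H →ₗ[ℂ] H) {C a : ℝ} (hC : ∀ x, ‖T x‖ ≤ C * ‖x‖) (ha : 0 < a)
    (h : ∀ x, a * ‖x‖ ^ 2 ≤ (inner ℂ x (T x)).re) : Function.Surjective T := by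
  let S : H →L[ℂ] H := T.mkContinuous C hC
  have h1 : ∀ x, a * ‖x‖ ≤ ‖S x‖ := by
    intro x
    rcases eq_or_ne x 0 with rfl | hx
    · simp
    have h2 : (inner ℂ x (T x)).re ≤ ‖x‖ * ‖T x‖ := re_inner_le_norm (𝕜 := ℂ) x _
    have h3 := h x
    have h4 : 0 < ‖x‖ := norm_pos_iff.2 hx
    change a * ‖x‖ ≤ ‖T x‖
    nlinarith
  have h2 : AntilipschitzWith (a⁻¹).toNNReal S := by
    refine AddMonoidHomClass.antilipschitz_of_bound S fun x => ?_
    rw [Real.coe_toNNReal _ (by positivity), ← div_eq_inv_mul, le_div_iff₀ ha, mul_comm]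
    exact h1 x
  have h3 : IsClosed (S.range : Set H) := by
    rw [LinearMap.coe_range]
    exact h2.isClosed_range S.uniformContinuous
  have h4 : S.rangeᗮ = ⊥ := by
    refine (Submodule.eq_bot_iff _).2 fun x hx => ?_
    have h5 := (Submodule.mem_orthogonal' _ _).1 hx (S x) ⟨x, rfl⟩
    have h6 := h x
    change inner ℂ x (T x) = 0 at h5
    rw [h5, Complex.zero_re] at h6
    have h7 : ‖x‖ ^ 2 = 0 := le_antisymm (by nlinarith [sq_nonneg ‖x‖]) (sq_nonneg _)
    simpa using h7
  have h5 : S.range = ⊤ := by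
    rw [← h3.submodule_topologicalClosure_eq]
    exact (Submodule.topologicalClosure_eq_top_iff).2 h4
  intro y
  have : y ∈ S.range := h5 ▸ Submodule.mem_top
  obtain ⟨x, hx⟩ := this
  exact ⟨x, hx⟩

namespace Medium

variable (M : Medium O)

lemma mulα_coe (v : L2Vec O) : M.mulα v =ᵐ[volume.restrict O] fun x => matAct (M.α x) (v x) :=
  (M.memLp_α v).coeFn_toLp

lemma mulβ_coe (p : L2 O) : M.mulβ p =ᵐ[volume.restrict O] fun x => (M.β x : ℂ) * p x :=
  (M.memLp_β p).coeFn_toLp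

lemma mulα_add (v w : L2Vec O) : M.mulα (v + w) = M.mulα v + M.mulα w := by
  refine Lp.ext ?_
  filter_upwards [M.mulα_coe (v + w), M.mulα_coe v, M.mulα_coe w, Lp.coeFn_add v w,
    Lp.coeFn_add (M.mulα v) (M.mulα w)] with x h1 h2 h3 h4 h5
  rw [h1, h5, h4, Pi.add_apply, Pi.add_apply, matAct_add, h2, h3]

lemma mulα_smul (c : ℂ) (v : L2Vec O) : M.mulα (c • v) = c • M.mulα v := by
  refine Lp.ext ?_
  filter_upwards [M.mulα_coe (c • v), M.mulα_coe v, Lp.coeFn_smul c v,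
    Lp.coeFn_smul c (M.mulα v)] with x h1 h2 h3 h4
  rw [h1, h4, h3, Pi.smul_apply, Pi.smul_apply, matAct_smul, h2]

lemma mulβ_add (p q : L2 O) : M.mulβ (p + q) = M.mulβ p + M.mulβ q := by
  refine Lp.ext ?_
  filter_upwards [M.mulβ_coe (p + q), M.mulβ_coe p, M.mulβ_coe q, Lp.coeFn_add p q,
    Lp.coeFn_add (M.mulβ p) (M.mulβ q)] with x h1 h2 h3 h4 h5
  rw [h1, h5, h4, Pi.add_apply, Pi.add_apply, mul_add, h2, h3]

lemma mulβ_smul (c : ℂ) (p : L2 O) : M.mulβ (c • p) = c • M.mulβ p := by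
  refine Lp.ext ?_
  filter_upwards [M.mulβ_coe (c • p), M.mulβ_coe p, Lp.coeFn_smul c p,
    Lp.coeFn_smul c (M.mulβ p)] with x h1 h2 h3 h4
  rw [h1, h4, h3, Pi.smul_apply, Pi.smul_apply, h2, smul_eq_mul, smul_eq_mul, mul_left_comm]

lemma mulα_surjective : Function.Surjective M.mulα := by
  obtain ⟨C, hC⟩ := M.norm_mulα_le
  obtain ⟨a, ha, h⟩ := M.le_inner_α
  exact surjective_of_coercive ⟨⟨M.mulα, M.mulα_add⟩, M.mulα_smul⟩ hC ha h

lemma mulβ_surjective : Function.Surjective M.mulβ := by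
  obtain ⟨C, hC⟩ := M.norm_mulβ_le
  obtain ⟨a, ha, h⟩ := M.le_inner_β
  exact surjective_of_coercive ⟨⟨M.mulβ, M.mulβ_add⟩, M.mulβ_smul⟩ hC ha h

lemma mulα_eq_zero {v : L2Vec O} (hv : M.mulα v = 0) : v = 0 := by
  obtain ⟨a, ha, h⟩ := M.le_inner_α
  have h1 := h v
  rw [hv, inner_zero_right, Complex.zero_re] at h1
  have h7 : ‖v‖ ^ 2 = 0 := le_antisymm (by nlinarith [sq_nonneg ‖v‖]) (sq_nonneg _)
  simpa using h7

lemma mulβ_eq_zero {p : L2 O} (hp : M.mulβ p = 0) : p = 0 := by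
  obtain ⟨a, ha, h⟩ := M.le_inner_β
  have h1 := h p
  rw [hp, inner_zero_right, Complex.zero_re] at h1
  have h7 : ‖p‖ ^ 2 = 0 := le_antisymm (by nlinarith [sq_nonneg ‖p‖]) (sq_nonneg _)
  simpa using h7

/-- Once the pointwise inverse of α is traded for multiplication by α, the inverse matrix need not
appear again. Positivity makes α(x) invertible at almost every x. -/
lemma ae_eq_inv_α {w F : L2Vec O} : (w =ᵐ[volume.restrict O]
    fun x => (1 / Complex.I) • matAct (M.α x)⁻¹ (F x)) ↔ F = Complex.I • M.mulα w := by
  obtain ⟨a, ha, hpos⟩ := M.α_pos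
  constructor
  · intro h
    refine Lp.ext ?_
    filter_upwards [h, hpos, M.mulα_coe w, Lp.coeFn_smul Complex.I (M.mulα w)] with x h1 h2 h3 h4
    rw [h4, Pi.smul_apply, h3, h1, matAct_smul, smul_smul, matAct_mul,
      Matrix.mul_nonsing_inv _ (isUnit_det_of_pos ha h2), matAct_one,
      mul_one_div_cancel Complex.I_ne_zero, one_smul]
  · rintro rfl
    filter_upwards [hpos, M.mulα_coe w, Lp.coeFn_smul Complex.I (M.mulα w)] with x h2 h3 h4
    rw [h4, Pi.smul_apply, h3, matAct_smul, smul_smul, matAct_mul,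
      Matrix.nonsing_inv_mul _ (isUnit_det_of_pos ha h2), matAct_one,
      one_div_mul_cancel Complex.I_ne_zero, one_smul]

lemma ae_eq_inv_β {r q : L2 O} : (r =ᵐ[volume.restrict O]
    fun x => (1 / Complex.I) • (((M.β x)⁻¹ : ℝ) : ℂ) • q x) ↔ q = Complex.I • M.mulβ r := by
  obtain ⟨b, hb, hpos⟩ := M.β_pos
  have key : ∀ x, b ≤ M.β x → (M.β x : ℂ) ≠ 0 := fun x hx =>
    Complex.ofReal_ne_zero.2 (hb.trans_le hx).ne'
  constructor
  · intro h
    refine Lp.ext ?_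
    filter_upwards [h, hpos, M.mulβ_coe r, Lp.coeFn_smul Complex.I (M.mulβ r)] with x h1 h2 h3 h4
    have := key x h2
    rw [h4, Pi.smul_apply, h3, h1]
    simp only [smul_eq_mul, Complex.ofReal_inv]
    field_simp
  · rintro rfl
    filter_upwards [hpos, M.mulβ_coe r, Lp.coeFn_smul Complex.I (M.mulβ r)] with x h2 h3 h4
    have := key x h2
    rw [h4, Pi.smul_apply, h3]
    simp only [smul_eq_mul, Complex.ofReal_inv]
    field_simp

end Medium

/-! ### The acoustic operator and its adjoint -/

lemma mem_acousticGraph {M : Medium O} {X Y : Energy M} : (X, Y) ∈ acousticGraph M ↔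
    HasWeakGradZero O X.prs (Complex.I • M.mulα Y.vel) ∧
    HasWeakDiv O X.vel (Complex.I • M.mulβ Y.prs) ∧ IsNormalTrace O X.vel 0 := by
  constructor
  · rintro ⟨F, q, h1, h2, h3, h4, h5⟩
    rw [M.ae_eq_inv_α] at h4
    rw [M.ae_eq_inv_β] at h5
    subst h4 h5
    exact ⟨h1, h2, h3⟩
  · rintro ⟨h1, h2, h3⟩
    exact ⟨_, _, h1, h2, h3, M.ae_eq_inv_α.2 rfl, M.ae_eq_inv_β.2 rfl⟩

lemma mem_acousticMin_domain (hO : IsOpen O) {M : Medium O} {X : Energy M} :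
    X ∈ (acousticMin M).domain ↔ ∃ Y, (X, Y) ∈ acousticGraph M := by
  rw [LinearPMap.mem_domain_iff, acousticMin_graph hO]

section TestElements

variable {φ : Space d → ℂ}

/-- The field φeᵢ has divergence ∂ᵢφ and no boundary term in Green's formula against any element of
H¹(O). It will serve to test for weak gradients. -/
lemma IsTest.pairing_single (h : IsTest O φ) (i : Fin d) {p : L2 O} {F : L2Vec O}
    (hF : HasWeakGrad O p F) : inner ℂ F (MemLp.toLp _ (h.memLp_single i)) +
      inner ℂ p (MemLp.toLp _ (h.memLp_pderiv i)) = (0 : ℂ) := by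
  have h1 := hasWeakGrad_iff.1 hF φ h i
  rw [← inner_conj_symm, ← inner_conj_symm p, h1, map_neg, add_neg_cancel]

lemma IsTest.hasWeakDiv_single (h : IsTest O φ) (i : Fin d) :
    HasWeakDiv O (MemLp.toLp _ (h.memLp_single i)) (MemLp.toLp _ (h.memLp_pderiv i)) := by
  refine hasWeakDiv_iff.2 fun ψ hψ => ?_
  linear_combination h.pairing_single i hψ.hasWeakGrad

lemma IsTest.isNormalTrace_single (h : IsTest O φ) (i : Fin d) :
    IsNormalTrace O (MemLp.toLp _ (h.memLp_single i)) 0 :=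
  ⟨_, h.hasWeakDiv_single i, fun _ _ _ hF _ => (h.pairing_single i hF).symm⟩

end TestElements

/-- The element `(v, p)` of the energy space. -/
def Energy.mk (M : Medium O) (v : L2Vec O) (p : L2 O) : Energy M := (v, p)

@[simp] lemma Energy.vel_mk (M : Medium O) (v : L2Vec O) (p : L2 O) : (mk M v p).vel = v := rfl

@[simp] lemma Energy.prs_mk (M : Medium O) (v : L2Vec O) (p : L2 O) : (mk M v p).prs = p := rfl

lemma exists_I_smul_eq (M : Medium O) (F : L2Vec O) (q : L2 O) : ∃ Y : Energy M,
    Complex.I • M.mulα Y.vel = F ∧ Complex.I • M.mulβ Y.prs = q := by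
  obtain ⟨v, hv⟩ := M.mulα_surjective (-Complex.I • F)
  obtain ⟨p, hp⟩ := M.mulβ_surjective (-Complex.I • q)
  refine ⟨Energy.mk M v p, ?_, ?_⟩
  · rw [Energy.vel_mk, hv, smul_smul]; simp
  · rw [Energy.prs_mk, hp, smul_smul]; simp

/-- The weights of the energy inner product cancel against α⁻¹ and β⁻¹ in 𝒜, so that Green's formula
for 𝒜 becomes a statement in the unweighted spaces. -/
lemma inner_eq_left {M : Medium O} (Y X : Energy M) : inner ℂ Y X =
    Complex.I * (inner ℂ (Complex.I • M.mulα Y.vel) X.vel +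
      inner ℂ (Complex.I • M.mulβ Y.prs) X.prs) := by
  rw [Energy.inner_def, inner_smul_left, inner_smul_left, ← M.mulα_symm, ← M.mulβ_symm,
    Complex.conj_I]
  linear_combination (inner ℂ (M.mulα Y.vel) X.vel + inner ℂ (M.mulβ Y.prs) X.prs) *
    Complex.I_mul_I

lemma inner_eq_right {M : Medium O} (X Y : Energy M) : inner ℂ X Y =
    -Complex.I * (inner ℂ X.vel (Complex.I • M.mulα Y.vel) +
      inner ℂ X.prs (Complex.I • M.mulβ Y.prs)) := by
  rw [Energy.inner_def, inner_smul_right, inner_smul_right]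
  linear_combination (inner ℂ X.vel (M.mulα Y.vel) + inner ℂ X.prs (M.mulβ Y.prs)) *
    Complex.I_mul_I

/-- Orthogonality in the graph space of the acoustic operator. -/
lemma inner_sub_inner_eq_zero_iff {M : Medium O} {X Y X' Y' : Energy M} :
    inner ℂ Y X' - inner ℂ X Y' = (0 : ℂ) ↔
      inner ℂ (Complex.I • M.mulα Y.vel) X'.vel + inner ℂ (Complex.I • M.mulβ Y.prs) X'.prs +
        (inner ℂ X.vel (Complex.I • M.mulα Y'.vel) +
          inner ℂ X.prs (Complex.I • M.mulβ Y'.prs)) = (0 : ℂ) := by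
  rw [inner_eq_left, inner_eq_right X, neg_mul, sub_neg_eq_add, ← mul_add, mul_eq_zero,
    or_iff_right Complex.I_ne_zero]

/-- The elements {φeᵢ, 0}, and {0, φ} in the next lemma, belong to dom 𝒜. Testing with the former
detects weak gradients, with the latter weak divergences; both the density of dom 𝒜 and the form of
dom 𝒜* rest on them. -/
lemma IsTest.exists_single_mem {φ : Space d → ℂ} (h : IsTest O φ) (i : Fin d) (M : Medium O) :
    ∃ Y : Energy M, (Energy.mk M (MemLp.toLp _ (h.memLp_single i)) 0, Y) ∈ acousticGraph M ∧
      Complex.I • M.mulα Y.vel = 0 ∧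
      Complex.I • M.mulβ Y.prs = MemLp.toLp _ (h.memLp_pderiv i) := by
  obtain ⟨Y, h1, h2⟩ := exists_I_smul_eq M 0 (MemLp.toLp _ (h.memLp_pderiv i))
  refine ⟨Y, mem_acousticGraph.2 ?_, h1, h2⟩
  rw [h1, h2]
  exact ⟨HasWeakGradZero.zero, h.hasWeakDiv_single i, h.isNormalTrace_single i⟩

lemma IsTest.exists_mem {φ : Space d → ℂ} (h : IsTest O φ) (M : Medium O) :
    ∃ Y : Energy M, (Energy.mk M 0 (MemLp.toLp _ h.memLp), Y) ∈ acousticGraph M ∧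
      Complex.I • M.mulα Y.vel = MemLp.toLp _ h.memLp_grad ∧
      Complex.I • M.mulβ Y.prs = 0 := by
  obtain ⟨Y, h1, h2⟩ := exists_I_smul_eq M (MemLp.toLp _ h.memLp_grad) 0
  refine ⟨Y, mem_acousticGraph.2 ?_, h1, h2⟩
  rw [h1, h2]
  exact ⟨h.hasWeakGradZero, HasWeakDiv.zero, IsNormalTrace.zero⟩

/-- The acoustic operator is densely defined. -/
lemma dense_acousticMin_domain (hO : IsOpen O) (M : Medium O) :
    Dense ((acousticMin M).domain : Set (Energy M)) := by
  rw [Submodule.dense_iff_topologicalClosure_eq_top, Submodule.topologicalClosure_eq_top_iff,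
    Submodule.eq_bot_iff]
  intro Z hZ
  rw [Submodule.mem_orthogonal] at hZ
  -- Orthogonality to all {φeᵢ, 0} says that α times the velocity of Z is a weak gradient of 0,
  -- hence is 0.
  have h1 : HasWeakGrad O 0 (M.mulα Z.vel) := by
    refine hasWeakGrad_iff.2 fun φ hφ i => ?_
    obtain ⟨Y, hY, -⟩ := hφ.exists_single_mem i M
    have := hZ _ ((mem_acousticMin_domain hO).2 ⟨Y, hY⟩)
    rw [Energy.inner_def, Energy.vel_mk, Energy.prs_mk, inner_zero_left, add_zero] at this
    rw [this, inner_zero_right, neg_zero]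
  have h2 : HasWeakDiv O 0 (M.mulβ Z.prs) := by
    refine hasWeakDiv_iff.2 fun φ hφ => ?_
    obtain ⟨Y, hY, -⟩ := hφ.exists_mem M
    have := hZ _ ((mem_acousticMin_domain hO).2 ⟨Y, hY⟩)
    rw [Energy.inner_def, Energy.vel_mk, Energy.prs_mk, inner_zero_left, zero_add] at this
    rw [this, inner_zero_right, neg_zero]
  exact Prod.ext (M.mulα_eq_zero (HasWeakGrad.unique hO h1))
    (M.mulβ_eq_zero (HasWeakDiv.unique hO h2))

/-- The adjoint of the acoustic operator: `dom 𝒜* = H(div, O) × H¹(O)`. -/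
theorem mem_adjoint_graph (hd : 2 ≤ d) (hO : IsLipschitzDomain O) [CompleteSpace (HHalf O)]
    {M : Medium O} {X Y : Energy M} : (X, Y) ∈ (acousticMin M).adjoint.graph ↔
      HasWeakGrad O X.prs (Complex.I • M.mulα Y.vel) ∧
      HasWeakDiv O X.vel (Complex.I • M.mulβ Y.prs) := by
  rw [LinearPMap.adjoint_graph_eq_graph_adjoint (dense_acousticMin_domain hO.isOpen M),
    acousticMin_graph hO.isOpen, Submodule.mem_adjoint_iff]
  simp only [inner_sub_inner_eq_zero_iff]
  constructor
  · intro h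
    refine ⟨hasWeakGrad_iff.2 fun φ hφ i => ?_, hasWeakDiv_iff.2 fun φ hφ => ?_⟩
    · obtain ⟨Z, hZ, e1, e2⟩ := hφ.exists_single_mem i M
      have := h _ _ hZ
      rw [e1, e2, Energy.vel_mk, Energy.prs_mk, inner_zero_left, inner_zero_left] at this
      linear_combination this
    · obtain ⟨Z, hZ, e1, e2⟩ := hφ.exists_mem M
      have := h _ _ hZ
      rw [e1, e2, Energy.vel_mk, Energy.prs_mk, inner_zero_left, inner_zero_left] at this
      linear_combination this
  · rintro ⟨h1, h2⟩ Z W hZ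
    obtain ⟨k1, k2, k3⟩ := mem_acousticGraph.1 hZ
    obtain ⟨K, hK⟩ := exists_trace hd hO
    obtain ⟨h, hh, -⟩ := hK _ _ h1
    -- Both boundary terms vanish: one because the pressure of Z is in H¹₀(O), the other because its
    -- velocity has zero normal trace.
    have e1 := h2.pairing_eq_zero k1
    have e2 := congrArg (starRingEnd ℂ) (k3.green hO.isOpen k2 h1 hh)
    rw [zero_apply, map_zero, map_add, inner_conj_symm, inner_conj_symm] at e2
    linear_combination e1 - e2

/-! ### The boundary triple -/

/-- The acoustic operator is symmetric. -/
lemma acousticMin_le_adjoint (hd : 2 ≤ d) (hO : IsLipschitzDomain O) [CompleteSpace (HHalf O)]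
    (M : Medium O) : acousticMin M ≤ (acousticMin M).adjoint := by
  refine LinearPMap.le_of_le_graph ?_
  rw [acousticMin_graph hO.isOpen]
  rintro ⟨X, Y⟩ h
  obtain ⟨h1, h2, -⟩ := mem_acousticGraph.1 h
  exact (mem_adjoint_graph hd hO).2 ⟨h1.1, h2⟩

lemma exists_traces (hd : 2 ≤ d) (hO : IsLipschitzDomain O) [CompleteSpace (HHalf O)]
    {M : Medium O} (X : (acousticMin M).adjoint.domain) :
    ∃ (h : HHalf O) (g : HMinusHalf O), IsTrace O (X : Energy M).prs h ∧
      IsNormalTrace O (X : Energy M).vel g := by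
  obtain ⟨h1, h2⟩ := (mem_adjoint_graph hd hO).1 ((acousticMin M).adjoint.mem_graph X)
  obtain ⟨K, hK⟩ := exists_trace hd hO
  obtain ⟨h, hh, -⟩ := hK _ _ h1
  obtain ⟨g, hg⟩ := exists_isNormalTrace hd hO h2
  exact ⟨h, g, hh, hg⟩

/-- The traces as linear maps on the domain of the adjoint. -/
lemma exists_trace_maps (hd : 2 ≤ d) (hO : IsLipschitzDomain O) [CompleteSpace (HHalf O)]
    (M : Medium O) : ∃ (t : (acousticMin M).adjoint.domain →ₗ[ℂ] HHalf O)
      (n : (acousticMin M).adjoint.domain →ₗ[ℂ] HMinusHalf O),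
      ∀ X : (acousticMin M).adjoint.domain, IsTrace O (X : Energy M).prs (t X) ∧ IsNormalTrace O (X : Energy M).vel (n X) := by
  -- Uniqueness of the traces makes these arbitrary choices linear.
  choose t n ht hn using exists_traces hd hO (M := M)
  refine ⟨⟨⟨t, fun X Y => ?_⟩, fun c X => ?_⟩, ⟨⟨n, fun X Y => ?_⟩, fun c X => ?_⟩,
    fun X => ⟨ht X, hn X⟩⟩
  · exact IsTrace.unique hO (ht (X + Y)) ((ht X).add (ht Y))
  · exact IsTrace.unique hO (ht (c • X)) ((ht X).smul c)
  · exact IsNormalTrace.unique hd hO (hn (X + Y)) ((hn X).add (hn Y))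
  · exact IsNormalTrace.unique hd hO (hn (c • X)) ((hn X).smul c)

/-- Green's formula for the adjoint of the acoustic operator. -/
lemma adjoint_green (hd : 2 ≤ d) (hO : IsLipschitzDomain O) [CompleteSpace (HHalf O)]
    {M : Medium O} (X Y : (acousticMin M).adjoint.domain) {h k : HHalf O} {g l : HMinusHalf O}
    (hX : IsTrace O (X : Energy M).prs h) (hX' : IsNormalTrace O (X : Energy M).vel g)
    (hY : IsTrace O (Y : Energy M).prs k) (hY' : IsNormalTrace O (Y : Energy M).vel l) :
    inner ℂ ((acousticMin M).adjoint X) (Y : Energy M) -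
      inner ℂ (X : Energy M) ((acousticMin M).adjoint Y) =
      Complex.I * (l h + starRingEnd ℂ (g k)) := by
  obtain ⟨x1, x2⟩ := (mem_adjoint_graph hd hO).1 ((acousticMin M).adjoint.mem_graph X)
  obtain ⟨y1, y2⟩ := (mem_adjoint_graph hd hO).1 ((acousticMin M).adjoint.mem_graph Y)
  rw [hY'.green hO.isOpen y2 x1 hX, hX'.green hO.isOpen x2 y1 hY, map_add, inner_conj_symm,
    inner_conj_symm, inner_eq_left, inner_eq_right (X : Energy M)]
  ring

/-- The boundary data realising the acoustic boundary conditions. -/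
theorem exists_boundaryTriple (hd : 2 ≤ d) (hO : IsLipschitzDomain O) [CompleteSpace (HHalf O)]
    (M : Medium O) (V : L2Bdry O ≃L[ℂ] HHalf O) (Vn : HMinusHalf O ≃L[ℂ] L2Bdry O)
    (hV : IsNaturalAdjoint (V : L2Bdry O →L[ℂ] HHalf O) (Vn : HMinusHalf O →L[ℂ] L2Bdry O)) :
    ∃ Γ : BoundaryTriple (acousticMin M) (L2Bdry O), ∀ (X : (acousticMin M).adjoint.domain)
      (h : HHalf O) (g : HMinusHalf O), IsTrace O (X : Energy M).prs h →
      IsNormalTrace O (X : Energy M).vel g → Γ.a X = V.symm h + Vn g ∧ Γ.b X = Vn g - V.symm h := by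
  obtain ⟨t, n, htn⟩ := exists_trace_maps hd hO M
  obtain ⟨f, hfX⟩ : ∃ f : (acousticMin M).adjoint.domain →ₗ[ℂ] L2Bdry O,
      ∀ X, f X = V.symm (t X) := ⟨V.symm.toLinearEquiv.toLinearMap ∘ₗ t, fun _ => rfl⟩
  obtain ⟨γ, hγX⟩ : ∃ γ : (acousticMin M).adjoint.domain →ₗ[ℂ] L2Bdry O,
      ∀ X, γ X = Vn (n X) := ⟨Vn.toLinearEquiv.toLinearMap ∘ₗ n, fun _ => rfl⟩
  have hf : ∀ X, t X = V (f X) := fun X => by rw [hfX, V.apply_symm_apply]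
  have hVn : ∀ (u : L2Bdry O) (g : HMinusHalf O), g (V u) = inner ℂ u (Vn g) := hV
  have huniq : ∀ (X : (acousticMin M).adjoint.domain) (h : HHalf O) (g : HMinusHalf O),
      IsTrace O (X : Energy M).prs h → IsNormalTrace O (X : Energy M).vel g →
      f X = V.symm h ∧ γ X = Vn g := by
    intro X h g hh hg
    constructor
    · rw [hfX, IsTrace.unique hO (htn X).1 hh]
    · rw [hγX, IsNormalTrace.unique hd hO (htn X).2 hg]
  have hfin : ∀ (X : (acousticMin M).adjoint.domain) (h : HHalf O) (g : HMinusHalf O),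
      IsTrace O (X : Energy M).prs h → IsNormalTrace O (X : Energy M).vel g →
      (f + γ) X = V.symm h + Vn g ∧ (γ - f) X = Vn g - V.symm h := by
    intro X h g hh hg
    rw [LinearMap.add_apply, LinearMap.sub_apply, (huniq X h g hh hg).1, (huniq X h g hh hg).2]
    exact ⟨rfl, rfl⟩
  -- The polarisation that diagonalises the boundary form; it dictates a = f + γ and b = γ - f.
  have hsq : ∀ u v u' v' : L2Bdry O, Complex.I * (inner ℂ u v' + inner ℂ v u') = Complex.I / 2 *
      (inner ℂ (u + v) (u' + v') - inner ℂ (v - u) (v' - u')) := by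
    intro u v u' v'
    rw [inner_add_left, inner_add_right, inner_add_right, inner_sub_left, inner_sub_right,
      inner_sub_right]
    ring
  refine ⟨⟨dense_acousticMin_domain hO.isOpen M, acousticMin_le_adjoint hd hO M, f + γ, γ - f,
    fun X hX => ?_, fun u v => ?_, fun X Y => ?_⟩, hfin⟩
  · obtain ⟨Y, hY⟩ := (mem_acousticMin_domain hO.isOpen).1 hX
    obtain ⟨h1, h2, h3⟩ := mem_acousticGraph.1 hY
    obtain ⟨e1, e2⟩ := huniq X _ _ (h1.isTrace_zero hO.isOpen) h3
    rw [map_zero] at e1 e2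
    simp [e1, e2]
  -- Boundary data (u, v) require f = (u - v)/2 and γ = (u + v)/2. Pressure and velocity are
  -- independent, so surjectivity of each trace realises them separately.
  · obtain ⟨C, -, hC⟩ := exists_extension hd hO
    obtain ⟨p, F, hF, hp, -⟩ := hC (V ((2 : ℂ)⁻¹ • (u - v)))
    obtain ⟨w, q, hw, hg⟩ := exists_normalTrace_eq hd hO (Vn.symm ((2 : ℂ)⁻¹ • (u + v)))
    obtain ⟨Y, rfl, rfl⟩ := exists_I_smul_eq M F q
    have hX : Energy.mk M w p ∈ (acousticMin M).adjoint.domain :=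
      LinearPMap.mem_domain_iff.2 ⟨Y, (mem_adjoint_graph hd hO).2 ⟨hF, hw⟩⟩
    obtain ⟨e1, e2⟩ := huniq ⟨_, hX⟩ _ _ hp hg
    rw [V.symm_apply_apply] at e1
    rw [Vn.apply_symm_apply] at e2
    refine ⟨⟨_, hX⟩, ?_, ?_⟩
    · rw [LinearMap.add_apply, e1, e2]
      module
    · rw [LinearMap.sub_apply, e1, e2]
      module
  · rw [adjoint_green hd hO X Y (htn X).1 (htn X).2 (htn Y).1 (htn Y).2, hf X, hf Y, hVn, hVn, ← hγX, ← hγX,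
      inner_conj_symm]
    rw [LinearMap.add_apply, LinearMap.add_apply, LinearMap.sub_apply, LinearMap.sub_apply]
    exact hsq (f X) (γ X) (f Y) (γ Y)

/-- Regrouping (K + 1)f + (K - 1)γ = 0 gives γ - f = K(f + γ), which is b = Ka for the boundary
triple above. -/
lemma mem_acousticOp_domain {M : Medium O} {V : L2Bdry O ≃L[ℂ] HHalf O}
    {Vn : HMinusHalf O ≃L[ℂ] L2Bdry O} {K : L2Bdry O →L[ℂ] L2Bdry O}
    (X : (acousticMin M).adjoint.domain) : (X : Energy M) ∈ (acousticOp M V Vn K).domain ↔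
      ∃ (h : HHalf O) (g : HMinusHalf O), IsTrace O (X : Energy M).prs h ∧
        IsNormalTrace O (X : Energy M).vel g ∧ Vn g - V.symm h = K (V.symm h + Vn g) := by
  have key : ∀ f γ : L2Bdry O, (K + 1) f + (K - 1) γ = 0 ↔ γ - f = K (f + γ) := by
    intro f γ
    change K f + f + (K γ - γ) = 0 ↔ _
    rw [map_add, ← sub_eq_zero (a := γ - f), ← neg_eq_zero]
    exact Eq.congr_left (by abel)
  constructor
  · rintro ⟨⟨h, g, h1, h2, h3⟩, -⟩
    exact ⟨h, g, h1, h2, (key _ _).1 h3⟩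
  · rintro ⟨h, g, h1, h2, h3⟩
    exact ⟨⟨h, g, h1, h2, (key _ _).2 h3⟩, X.2⟩

end Acoustic

end

/-! ### The main theorem -/

open Acoustic
theorem theorem2p1 {d : ℕ} (hd : 2 ≤ d) (O : Set (Space d)) (hO : IsLipschitzDomain O)
    (M : Medium O) (V : L2Bdry O ≃L[ℂ] HHalf O) (Vn : HMinusHalf O ≃L[ℂ] L2Bdry O)
    (hV : IsNaturalAdjoint (V : L2Bdry O →L[ℂ] HHalf O) (Vn : HMinusHalf O →L[ℂ] L2Bdry O)) :
    (∀ T : Energy M →ₗ.[ℂ] Energy M,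
      (acousticMin M ≤ T ∧ IsMDissipative T) ↔
        ∃ K : L2Bdry O →L[ℂ] L2Bdry O, ‖K‖ ≤ 1 ∧ T = acousticOp M V Vn K) ∧
    Set.BijOn (acousticOp M V Vn) {K | ‖K‖ ≤ 1}
      {T | acousticMin M ≤ T ∧ IsMDissipative T} ∧
    ∀ K : L2Bdry O →L[ℂ] L2Bdry O, ‖K‖ ≤ 1 →
      ((acousticOp M V Vn K).adjoint = acousticOp M V Vn K ↔
        K ∈ unitary (L2Bdry O →L[ℂ] L2Bdry O)) := by
  -- Completeness of H^{1/2}(∂O) is transported from L²(∂O) by the homeomorphism V.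
  have hcomplete : CompleteSpace (HHalf O) :=
    (completeSpace_congr (e := V.toEquiv) V.isUniformEmbedding).1 inferInstance
  obtain ⟨Γ, hΓ⟩ := exists_boundaryTriple hd hO M V Vn hV
  refine Γ.mDissipative_extensions (fun K => LinearPMap.domRestrict_le) fun K X => ?_
  rw [mem_acousticOp_domain]
  constructor
  · rintro ⟨h, g, h1, h2, h3⟩
    rw [(hΓ X h g h1 h2).1, (hΓ X h g h1 h2).2, h3]
  · intro h3
    obtain ⟨h, g, h1, h2⟩ := exists_traces hd hO X
    rw [(hΓ X h g h1 h2).1, (hΓ X h g h1 h2).2] at h3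
    exact ⟨h, g, h1, h2, h3⟩
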